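/- Variables take values in $\{0,1\}$. A WCNF $\varphi$ is a finite set of clauses (a clause is a finite set of literals) with a weight function $w\colon\varphi\to\mathbb N\cup\{\infty\}$. MaxSAT asks, given a WCNF $\varphi$, for an assignment $\beta$ minimizing the total weight $\mathrm{cost}(\beta)=\sum_{c\in\varphi,\ \beta\not\models c}w(c)$ of the falsified clauses; Max2SAT is the restriction of MaxSAT to formulas in which every clause has at most two literals. QUBO asks, given a Hamiltonian $H(x)=\sum_i w_ix_i+\sum_{i<j}w_{ij}x_ix_j$ with integer weights (listed by its terms of nonzero weight), for $x$ minimizing $H(x)$. The primal graph of an instance has the occurring variables as vertices, two being adjacent if they occur together in a clause (in a term); the incidence graph has the occurring variables and the clauses (terms) as vertices, a variable being adjacent to the clauses (terms) that contain it. The treewidths of these graphs are the primal treewidth $\mathrm{tw}$ and the incidence treewidth $\mathrm{itw}$ of the instance. (The width of a decomposition with only empty bags is taken to be $0$.) A linear-time reduction from a problem $P$ to a problem $Q$ is an algorithm which maps every instance $I$ of $P$ to an instance $J$ of $Q$ (the variables of $I$ keep their names, auxiliary variables may be added) and two integers $\theta,h$ such that the optimum value of $I$ is finite if and only if the optimum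 value of $J$ is less than $h$, in that case $\mathrm{opt}(J)=\mathrm{opt}(I)+\theta$, and every optimal solution of $J$, restricted to the variables of $I$, is an optimal solution of $I$. It runs in time $O(n+1)$, where $n$ is the number of machine words of the input (one word per number, literal or vertex), on a random access machine with addition, subtraction, comparison and indirect addressing at unit cost, using words of $O(\log (n+M+2))$ bits, where $M$ is the largest absolute value of an input word. **Theorem.** Let $P$ and $Q$ be two different problems among MaxSAT, Max2SAT and QUBO. 1. There is a linear-time reduction from $P$ to $Q$, whose input is the instance $I$ alone, such that the output instance $J$ always satisfies $\mathrm{tw}(J)\le \mathrm{tw}(I)+2$. 2. There is a linear-time reduction from $P$ to $Q$, whose input is an instance $I$ together with a tree decomposition of the incidence graph of $I$ (as a rooted tree whose nodes are listed parents before children), such that $\mathrm{itw}(J)\le 3k$ where $k$ is the width of the given decomposition; in particular $\mathrm{itw}(J)\le 3\,\mathrm{itw}(I)$ if the given decomposition is optimal. -/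

import Mathlib

/-! ## Graphs, tree decompositions, treewidth -/

/-- A rooted tree decomposition of `G`.  The tree has the nodes `0, …, last`; the root is `0`, and
nodes are listed parents first, so every other node has a smaller parent.  (Every finite rooted
tree can be listed in this way.)  Bags are finite sets, given as lists without repetition. -/
structure TreeDecomposition {V : Type} (G : SimpleGraph V) where
  last : ℕ
  parent : Fin (last + 1) → Fin (last + 1)
  parent_root : parent 0 = 0
  parent_lt : ∀ t, t ≠ 0 → parent t < t
  bag : Fin (last + 1) → List V
  bag_nodup : ∀ t, (bag t).Nodup
  /-- the nodes whose bags contain `v` induce a nonempty subtree -/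
  connected : ∀ v : V,
    ((SimpleGraph.fromRel fun s t => parent s = t).induce {t | v ∈ bag t}).Connected
  covering : ∀ u v : V, G.Adj u v → ∃ t, u ∈ bag t ∧ v ∈ bag t

/-- The width, i.e. the size of a largest bag minus one (and `0` if all bags are empty). -/
def TreeDecomposition.width {V : Type} {G : SimpleGraph V} (D : TreeDecomposition G) : ℕ :=
  (Finset.univ.sup fun t => (D.bag t).length) - 1

/-- The treewidth of a (finite) graph: the minimum width of a tree decomposition.  It is `0` for
the graph without vertices. -/
noncomputable def treewidth {V : Type} (G : SimpleGraph V) : ℕ :=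
  sInf {w | ∃ D : TreeDecomposition G, D.width = w}

/-- The tree decomposition as a sequence of machine words: the number of nodes and then, for every
node, its parent, the size of its bag and the vertices in its bag. -/
def TreeDecomposition.words {V : Type} {G : SimpleGraph V} (D : TreeDecomposition G)
    (code : V → ℤ) : List ℤ :=
  ((D.last + 1 : ℕ) : ℤ) :: (List.finRange (D.last + 1)).flatMap fun t =>
    ((D.parent t : ℕ) : ℤ) :: ((D.bag t).length : ℤ) :: (D.bag t).map code

/-- The variables that occur in a list of scopes (a scope is the set of variables of one clause or
of one term). -/
abbrev OccVar (S : List (Finset ℕ)) : Type := {x : ℕ // ∃ s ∈ S, x ∈ s}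

/-- The primal graph: variables, adjacent if they occur together in a scope. -/
def primalGraph (S : List (Finset ℕ)) : SimpleGraph (OccVar S) :=
  SimpleGraph.fromRel fun x y => ∃ s ∈ S, x.1 ∈ s ∧ y.1 ∈ s

/-- The incidence graph: variables and scopes (the latter by their position in the list), a
variable being adjacent to the scopes that contain it. -/
def incidenceGraph (S : List (Finset ℕ)) : SimpleGraph (OccVar S ⊕ Fin S.length) :=
  SimpleGraph.fromRel fun a b => ∃ x j, a = Sum.inl x ∧ b = Sum.inr j ∧ x.1 ∈ S.get j

/-- Machine words for the vertices of the incidence graph: the variable `x` is the word `x`, the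
scope at position `j` is the word `-(j + 1)`. -/
def incidenceCode (S : List (Finset ℕ)) : OccVar S ⊕ Fin S.length → ℤ
  | Sum.inl x => (x.1 : ℤ)
  | Sum.inr j => -((j.1 : ℤ) + 1)

/-! ## The three optimization problems -/

/-- A minimization problem over `0/1`-assignments of variables (variables are natural numbers).
Only the variables that occur in the scopes of an instance matter for its value. -/
structure OptProblem where
  Inst : Type
  /-- an instance as a sequence of machine words -/
  words : Inst → List ℤ
  /-- the quantity to be minimized -/
  value : Inst → (ℕ → Bool) → WithTop ℤ
  /-- the variable sets of the clauses, or terms, of an instance -/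
  scopes : Inst → List (Finset ℕ)

/-- A literal: a variable together with the truth value that satisfies the literal. -/
abbrev Literal : Type := ℕ × Bool

/-- A weighted CNF as it is written down: clauses are sets of literals, the formula is a set of
clauses (no clause is repeated, whatever the order of its literals), and every clause carries a
weight from `ℕ ∪ {∞}`. -/
structure WCNF where
  clauses : List (List Literal × ℕ∞)
  literals_nodup : ∀ c ∈ clauses, c.1.Nodup
  clauses_distinct : clauses.Pairwise fun c d => c.1.toFinset ≠ d.1.toFinset

/-- The total weight of the clauses that are falsified by `β`. -/
noncomputable def WCNF.cost (φ : WCNF) (β : ℕ → Bool) : ℕ∞ :=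
  (φ.clauses.map fun c => if ∀ l ∈ c.1, β l.1 ≠ l.2 then c.2 else 0).sum

def WCNF.scopes (φ : WCNF) : List (Finset ℕ) :=
  φ.clauses.map fun c => (c.1.map Prod.fst).toFinset

/-- The literals `x` and `¬ x` are the words `x + 1` and `-(x + 1)`. -/
def literalWord (l : Literal) : ℤ :=
  if l.2 then (l.1 : ℤ) + 1 else -((l.1 : ℤ) + 1)

/-- A finite weight is its own word, the weight `∞` is the word `-1`. -/
def weightWord : ℕ∞ → ℤ
  | ⊤ => -1
  | (n : ℕ) => (n : ℤ)

/-- The number of clauses and then, for every clause, its size, its weight and its literals. -/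
def WCNF.words (φ : WCNF) : List ℤ :=
  (φ.clauses.length : ℤ) :: φ.clauses.flatMap fun c =>
    (c.1.length : ℤ) :: weightWord c.2 :: c.1.map literalWord

/-- A quadratic unconstrained binary optimization problem
`H = ∑ i, w i * x i + ∑ i < j, w i j * x i * x j` with integer weights, given by its nonzero
terms: `(i, i, w)` is the term `w * x i` and `(i, j, w)`, with `i < j`, the term `w * x i * x j`. -/
structure QUBO where
  terms : List (ℕ × ℕ × ℤ)
  upper : ∀ t ∈ terms, t.1 ≤ t.2.1
  nonzero : ∀ t ∈ terms, t.2.2 ≠ 0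
  terms_distinct : terms.Pairwise fun s t => (s.1, s.2.1) ≠ (t.1, t.2.1)

/-- The value `H(x)` of the Hamiltonian. -/
def QUBO.energy (H : QUBO) (x : ℕ → Bool) : ℤ :=
  (H.terms.map fun t => if x t.1 ∧ x t.2.1 then t.2.2 else 0).sum

def QUBO.scopes (H : QUBO) : List (Finset ℕ) :=
  H.terms.map fun t => {t.1, t.2.1}

def QUBO.words (H : QUBO) : List ℤ :=
  (H.terms.length : ℤ) :: H.terms.flatMap fun t => [(t.1 : ℤ), (t.2.1 : ℤ), t.2.2]

noncomputable def maxSAT : OptProblem where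
  Inst := WCNF
  words := WCNF.words
  value φ β := ENat.map (fun n : ℕ => (n : ℤ)) (φ.cost β)
  scopes := WCNF.scopes

/-- `MaxSAT` restricted to formulas all of whose clauses have at most two literals. -/
noncomputable def max2SAT : OptProblem where
  Inst := {φ : WCNF // ∀ c ∈ φ.clauses, c.1.length ≤ 2}
  words φ := φ.1.words
  value φ := maxSAT.value φ.1
  scopes φ := φ.1.scopes

def qubo : OptProblem where
  Inst := QUBO
  words := QUBO.words
  value H x := ((H.energy x : ℤ) : WithTop ℤ)
  scopes := QUBO.scopes

/-- The primal treewidth of an instance. -/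
noncomputable def OptProblem.tw (P : OptProblem) (I : P.Inst) : ℕ :=
  treewidth (primalGraph (P.scopes I))

/-- The incidence treewidth of an instance. -/
noncomputable def OptProblem.itw (P : OptProblem) (I : P.Inst) : ℕ :=
  treewidth (incidenceGraph (P.scopes I))

/-- `β` is an optimal solution of the instance `I`. -/
def OptProblem.Optimal (P : OptProblem) (I : P.Inst) (β : ℕ → Bool) : Prop :=
  ∀ γ : ℕ → Bool, P.value I β ≤ P.value I γ

/-! ## The machine model

A random access machine over the integers: finitely many registers and finitely many arrays are
mentioned by a program, the operations are addition, subtraction, comparison and indirect access,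
and programs are structured.  Executing an assignment or evaluating a test is one step; a program
being a fixed finite object, an expression in it stands for a bounded number of elementary
operations.  Words have bounded length: a run in which a written word exceeds the bound is not
valid. -/

inductive Expr : Type
  | const (z : ℤ)
  | reg (r : ℕ)
  | load (a : ℕ) (index : Expr)
  | add (e f : Expr)
  | sub (e f : Expr)
  /-- `1` if `e ≤ f`, and `0` otherwise -/
  | le (e f : Expr)
  /-- `1` if `e = f`, and `0` otherwise -/
  | eq (e f : Expr)

inductive Program : Type
  | skip
  | assign (r : ℕ) (e : Expr)
  | store (a : ℕ) (index e : Expr)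
  | seq (p q : Program)
  /-- execute `p` if the test is nonzero, and `q` otherwise -/
  | branch (test : Expr) (p q : Program)
  /-- execute `p` as long as the test is nonzero -/
  | loop (test : Expr) (p : Program)

structure MachineState where
  reg : ℕ → ℤ
  mem : ℕ → ℤ → ℤ

def Expr.eval (s : MachineState) : Expr → ℤ
  | .const z => z
  | .reg r => s.reg r
  | .load a i => s.mem a (i.eval s)
  | .add e f => e.eval s + f.eval s
  | .sub e f => e.eval s - f.eval s
  | .le e f => if e.eval s ≤ f.eval s then 1 else 0
  | .eq e f => if e.eval s = f.eval s then 1 else 0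

def MachineState.setReg (s : MachineState) (r : ℕ) (v : ℤ) : MachineState where
  reg := Function.update s.reg r v
  mem := s.mem

def MachineState.setMem (s : MachineState) (a : ℕ) (i v : ℤ) : MachineState where
  reg := s.reg
  mem := Function.update s.mem a (Function.update (s.mem a) i v)

/-- `Exec B p s t s'`: started in state `s`, the program `p` halts after `t` steps in state `s'`,
and it never writes a word of absolute value above `B`. -/
inductive Exec (B : ℤ) : Program → MachineState → ℕ → MachineState → Prop
  | skip (s : MachineState) : Exec B .skip s 1 s
  | assign (r : ℕ) (e : Expr) (s : MachineState) (bound : |e.eval s| ≤ B) :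
      Exec B (.assign r e) s 1 (s.setReg r (e.eval s))
  | store (a : ℕ) (i e : Expr) (s : MachineState) (index_bound : |i.eval s| ≤ B)
      (bound : |e.eval s| ≤ B) :
      Exec B (.store a i e) s 1 (s.setMem a (i.eval s) (e.eval s))
  | seq {p q : Program} {s s' s'' : MachineState} {t t' : ℕ}
      (first : Exec B p s t s') (second : Exec B q s' t' s'') :
      Exec B (.seq p q) s (t + t') s''
  | branch_then {e : Expr} {p q : Program} {s s' : MachineState} {t : ℕ}
      (test : e.eval s ≠ 0) (run : Exec B p s t s') : Exec B (.branch e p q) s (t + 1) s'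
  | branch_else {e : Expr} {p q : Program} {s s' : MachineState} {t : ℕ}
      (test : e.eval s = 0) (run : Exec B q s t s') : Exec B (.branch e p q) s (t + 1) s'
  | loop_step {e : Expr} {p : Program} {s s' s'' : MachineState} {t t' : ℕ}
      (test : e.eval s ≠ 0) (body : Exec B p s t s') (rest : Exec B (.loop e p) s' t' s'') :
      Exec B (.loop e p) s (t + t' + 1) s''
  | loop_exit {e : Expr} {p : Program} {s : MachineState}
      (test : e.eval s = 0) : Exec B (.loop e p) s 1 s

/-- The input words are in array `0`, starting at index `0`, their number is in register `0`, and
everything else is `0`. -/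
def initialState (input : List ℤ) : MachineState where
  reg r := if r = 0 then (input.length : ℤ) else 0
  mem a i := if a = 0 ∧ 0 ≤ i then input.getD i.toNat 0 else 0

/-- The output words are in array `1`, starting at index `0`, and their number is in
register `1`. -/
def MachineState.HasOutput (s : MachineState) (output : List ℤ) : Prop :=
  s.reg 1 = (output.length : ℤ) ∧
    ∀ (i : ℕ) (h : i < output.length), s.mem 1 (i : ℤ) = output[i]

/-- The largest absolute value of a word of the list. -/
def maxAbs (l : List ℤ) : ℕ :=
  (l.map Int.natAbs).foldr max 0

/-- With constant `K`, the program maps `input` to `output` in linear time, namely in at most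
`K * (n + 1)` steps where `n` is the number of input words, using words of at most
`K * log (n + M + 2)` bits where `M` is the largest absolute value of an input word. -/
def RunsLinear (p : Program) (K : ℕ) (input output : List ℤ) : Prop :=
  ∃ (t : ℕ) (s : MachineState),
    Exec (((input.length + maxAbs input + 2) ^ K : ℕ) : ℤ) p (initialState input) t s ∧
      t ≤ K * (input.length + 1) ∧ s.HasOutput output

/-! ## Reductions -/

/-- The instance `J` of `Q`, together with the offset `θ` and the top value `h`, represents the
instance `I` of `P`.  The optimum `a` of `I` is finite if and only if the optimum `b` of `J` is
below `h`, and then `b = a + θ`; every optimal solution of `J` is, on the variables of `I`, an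
optimal solution of `I`. -/
structure Represents (P Q : OptProblem) (I : P.Inst) (J : Q.Inst) (θ h : ℤ) : Prop where
  optimum : ∃ a b : WithTop ℤ, IsLeast (Set.range (P.value I)) a ∧
    IsLeast (Set.range (Q.value J)) b ∧ (a ≠ ⊤ ↔ b < (h : WithTop ℤ)) ∧
    (a ≠ ⊤ → b = a + (θ : WithTop ℤ))
  solution : ∀ β : ℕ → Bool, Q.Optimal J β → P.Optimal I β

/-- `P` reduces to `Q` in linear time such that an instance of primal treewidth `k` is mapped to
an instance of primal treewidth at most `g k`; the machine reads nothing but the instance, and it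
writes the offset, the top value and the new instance. -/
def LinReducesTw (g : ℕ → ℕ) (P Q : OptProblem) : Prop :=
  ∃ (p : Program) (K : ℕ), ∀ I : P.Inst, ∃ (J : Q.Inst) (θ h : ℤ),
    RunsLinear p K (P.words I) (θ :: h :: Q.words J) ∧
      Represents P Q I J θ h ∧ Q.tw J ≤ g (P.tw I)

/-- `P` reduces to `Q` in linear time such that an instance given together with a tree
decomposition of width `k` of its incidence graph is mapped to an instance of incidence treewidth
at most `g k`. -/
def LinReducesItw (g : ℕ → ℕ) (P Q : OptProblem) : Prop :=
  ∃ (p : Program) (K : ℕ), ∀ (I : P.Inst) (D : TreeDecomposition (incidenceGraph (P.scopes I))),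
    ∃ (J : Q.Inst) (θ h : ℤ),
      RunsLinear p K (P.words I ++ D.words (incidenceCode (P.scopes I)))
          (θ :: h :: Q.words J) ∧
        Represents P Q I J θ h ∧ Q.itw J ≤ g D.width

def LinEquivTw (g : ℕ → ℕ) (P Q : OptProblem) : Prop :=
  LinReducesTw g P Q ∧ LinReducesTw g Q P

def LinEquivItw (g : ℕ → ℕ) (P Q : OptProblem) : Prop :=
  LinReducesItw g P Q ∧ LinReducesItw g Q P

/-! The heart of the matter is a quadratic function that prices a clause of weight `g`. A unit of
flow starts at a root variable and passes along binary variables; at every branching an end `y` is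
replaced by two fresh ends `n`, `n'`, with the penalty `g * (y - n - n') ^ 2` for a violation of
conservation. A branch may lead into a literal of the clause, where the unit is absorbed free of
charge if the literal is true and at the price `g` if it is false; a unit that stops at an open end
also pays `g`. The minimum is therefore `0` for a satisfied clause and `g` for a falsified one, up
to the constant `-3 * g`. All penalties have two variables, and the network may have any tree shape,
which leaves the freedom to keep the treewidth small. `FlowHist.lower_bound` and
`FlowHist.exists_flow` are the two inequalities, collected in `simulates_gadgets`. The weight `∞` is
replaced by `W`, one more than the sum of the finite weights, so that the finite optima are exactly
those below `W`.

For the primal treewidth the network of a clause is a caterpillar, attached to a bag that contains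
all variables of the clause. Such a bag exists because the clause is a clique, and only the current
open end and its successor are added to it (`complete_of_primal`). Width `0` leaves no room for this
and is treated separately (`complete_of_edgeless`).

For the incidence treewidth the network of a clause follows the subtree of the nodes whose bags
contain the clause: each such node owns an open end, obtained by a branching from the end of its
parent. A literal is attached at the first node that contains both its variable and its clause. When
a node is processed, the ends of all clauses shared with the parent branch simultaneously. If this
is done one clause after the other, the intermediate bags have at most `max (2 * k + 2) (k + 3)`
elements (`Built.prism`, `NodesInv.step`), which is at most `3 * k + 1` since `k ≥ 1` as soon as a
nonempty clause occurs.

Conversely a quadratic term is a small set of weighted clauses with at most two literals: one clause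
for a positive weight, and for a negative product three clauses with one auxiliary variable
(`satClauses`), which costs only a bag of three elements. Hence a quadratic function can be written
as a `QUBO` or as a `Max2SAT` instance; `Target` and `Emitter` abstract from the format. A `QUBO`
given with a decomposition of its incidence graph has its terms contracted into their variables
(`exists_built_contract`).

Finally the algorithms are explicit programs. Loop-free pieces are verified by weakest
preconditions, loops by one rule for reading blocks of words (`halts_readBlocks`), and all words are
bounded by a polynomial in the length and the largest word of the input. -/

/-! ### Tree decompositions grown leaf by leaf -/

/-- `Built w L`: the bags in `L` can be arranged as a rooted tree decomposition of width at most
`w`, by adding leaves one after the other, starting from an empty bag. -/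
inductive Built {α : Type} (w : ℕ) : List (Finset α) → Prop
  | nil : Built w [∅]
  | cons {L : List (Finset α)} {A B : Finset α} (built : Built w L) (mem : A ∈ L)
      (card_le : B.card ≤ w + 1) (old_or_new : ∀ v ∈ B, v ∈ A ∨ ∀ C ∈ L, v ∉ C) :
      Built w (B :: L)

theorem Built.card_le {α : Type} {w : ℕ} {L : List (Finset α)} (h : Built w L) :
    ∀ B ∈ L, B.card ≤ w + 1 := by
  induction h with
  | nil => simp
  | cons _ _ hB _ ih => simpa using ⟨hB, ih⟩

theorem Built.mono {α : Type} {w w' : ℕ} (hw : w ≤ w') {L : List (Finset α)} (h : Built w L) :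
    Built w' L := by
  induction h with
  | nil => exact .nil
  | cons _ hA hB hv ih => exact .cons ih hA (by omega) hv

theorem Built.empty_mem {α : Type} {w : ℕ} {L : List (Finset α)} (h : Built w L) : ∅ ∈ L := by
  induction h with
  | nil => simp
  | cons _ _ _ _ ih => simp [ih]

/-- Numbering the bags in the order in which they are added lists parents before children. Equal
bags may occur several times; any index with the bag `A` serves as the parent of the new leaf. -/
theorem Built.exists_tree {α : Type} {w : ℕ} {L : List (Finset α)} (h : Built w L) :
    ∃ (n : ℕ) (bag : ℕ → Finset α) (par : ℕ → ℕ), par 0 = 0 ∧ (∀ i, 0 < i → par i < i) ∧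
      (∀ B, B ∈ L ↔ ∃ i ≤ n, bag i = B) ∧
      ∀ i ≤ n, 0 < i → ∀ v ∈ bag i, v ∈ bag (par i) ∨ ∀ k < i, v ∉ bag k := by
  induction h with
  | nil =>
    refine ⟨0, fun _ => ∅, fun _ => 0, rfl, fun i hi => hi, fun B => ?_, fun i hi h0 => by omega⟩
    simp [eq_comm]
  | @cons L A B _ hA hB hv ih =>
    obtain ⟨n, bag, par, h0, hlt, hmem, hpar⟩ := ih
    obtain ⟨a, ha, rfl⟩ := (hmem A).1 hA
    refine ⟨n + 1, Function.update bag (n + 1) B, Function.update par (n + 1) a, ?_, ?_, ?_, ?_⟩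
    · rw [Function.update_of_ne (by omega), h0]
    · intro i hi
      by_cases h : i = n + 1
      · subst h; simp; omega
      · rw [Function.update_of_ne h]; exact hlt i hi
    · intro C
      rw [List.mem_cons, hmem]
      constructor
      · rintro (rfl | ⟨i, hi, rfl⟩)
        · exact ⟨n + 1, le_rfl, by simp⟩
        · exact ⟨i, by omega, by rw [Function.update_of_ne (by omega)]⟩
      · rintro ⟨i, hi, rfl⟩
        by_cases h : i = n + 1
        · subst h; simp
        · rw [Function.update_of_ne h]; exact Or.inr ⟨i, by omega, rfl⟩
    · intro i hi hi0 v hvi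
      by_cases h : i = n + 1
      · subst h
        rw [Function.update_self] at hvi ⊢
        rw [Function.update_of_ne (by omega : a ≠ n + 1)]
        refine (hv v hvi).imp id fun h k hk => ?_
        rw [Function.update_of_ne (by omega)]
        exact h _ ((hmem _).2 ⟨k, by omega, rfl⟩)
      · rw [Function.update_of_ne h] at hvi ⊢
        have := hlt i hi0
        rw [Function.update_of_ne (by omega)]
        refine (hpar i (by omega) hi0 v hvi).imp id fun h k hk => ?_
        rw [Function.update_of_ne (by omega)]
        exact h k hk

/-- A vertex that is not in its first bag also lies in the parent bag, since it is not new there.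
Climbing thus leads from every occurrence of the vertex to the first one without leaving the
vertex's nodes, which gives connectedness. Bags may contain labels that are not vertices of `G`; the
preimage under `e` drops them. -/
theorem Built.treewidth_le {α V : Type} {w : ℕ} {L : List (Finset α)} (h : Built w L)
    (G : SimpleGraph V) (e : V → α) (he : Function.Injective e)
    (hvert : ∀ v, ∃ B ∈ L, e v ∈ B)
    (hedge : ∀ u v, G.Adj u v → ∃ B ∈ L, e u ∈ B ∧ e v ∈ B) : treewidth G ≤ w := by
  classical
  obtain ⟨n, bag, par, h0, hlt, hmem, hpar⟩ := h.exists_tree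
  have hle : ∀ i : Fin (n + 1), par i ≤ i := fun i => by
    rcases Nat.eq_zero_or_pos i with hi | hi
    · rw [hi, h0]
    · exact (hlt _ hi).le
  let parent : Fin (n + 1) → Fin (n + 1) := fun i => ⟨par i, by have := hle i; omega⟩
  let bag' : Fin (n + 1) → List V := fun i => ((bag i).preimage e he.injOn).toList
  have hbag' : ∀ i v, v ∈ bag' i ↔ e v ∈ bag i := fun i v => by simp [bag']
  let D : TreeDecomposition G :=
    { last := n
      parent := parent
      parent_root := by ext; simp [parent, h0]
      parent_lt := fun t ht => by
        rw [Fin.lt_def]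
        exact hlt t (Nat.pos_of_ne_zero fun h => ht (Fin.ext h))
      bag := bag'
      bag_nodup := fun t => Finset.nodup_toList _
      connected := fun v => by
        obtain ⟨B, hB, hvB⟩ := hvert v
        obtain ⟨i0, hi0, rfl⟩ := (hmem B).1 hB
        have hex : ∃ i, i ≤ n ∧ e v ∈ bag i := ⟨i0, hi0, hvB⟩
        obtain ⟨htn, htv⟩ := Nat.find_spec hex
        have hmin := fun m => Nat.find_min' hex (m := m)
        set top := Nat.find hex
        have key : ∀ i (hi : i ≤ n) (hv : e v ∈ bag i),
            ((SimpleGraph.fromRel fun s t => parent s = t).induce {t | v ∈ bag' t}).Reachable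
              ⟨⟨i, by omega⟩, (hbag' _ _).2 hv⟩ ⟨⟨top, by omega⟩, (hbag' _ _).2 htv⟩ := by
          intro i
          induction i using Nat.strong_induction_on with
          | _ i ih =>
            intro hi hv
            by_cases hit : i = top
            · subst hit; exact SimpleGraph.Reachable.refl _
            · have hti : top < i := lt_of_le_of_ne (hmin _ ⟨hi, hv⟩) (Ne.symm hit)
              have hpi := hlt i (by omega)
              have hvp : e v ∈ bag (par i) :=
                (hpar i hi (by omega) _ hv).resolve_right fun h => h top hti htv
              refine SimpleGraph.Reachable.trans (SimpleGraph.Adj.reachable ?_)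
                (ih (par i) hpi (by omega) hvp)
              simp only [SimpleGraph.comap_adj, Function.Embedding.subtype_apply,
                SimpleGraph.fromRel_adj]
              refine ⟨fun h => ?_, Or.inl rfl⟩
              have := congrArg Fin.val h
              simp at this
              omega
        have : Nonempty {t | v ∈ bag' t} := ⟨⟨⟨top, by omega⟩, (hbag' _ _).2 htv⟩⟩
        refine SimpleGraph.Connected.mk fun a b => ?_
        obtain ⟨⟨a, ha⟩, hva⟩ := a
        obtain ⟨⟨b, hb⟩, hvb⟩ := b
        exact (key a (by omega) ((hbag' _ _).1 hva)).trans
          (key b (by omega) ((hbag' _ _).1 hvb)).symm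
      covering := fun u v huv => by
        obtain ⟨B, hB, hu, hv⟩ := hedge u v huv
        obtain ⟨i, hi, rfl⟩ := (hmem B).1 hB
        exact ⟨⟨i, by omega⟩, (hbag' _ _).2 hu, (hbag' _ _).2 hv⟩ }
  have hD : D.width ≤ w := by
    unfold TreeDecomposition.width
    rw [Nat.sub_le_iff_le_add]
    refine Finset.sup_le fun t _ => ?_
    have h1 : (bag t).card ≤ w + 1 :=
      h.card_le _ ((hmem _).2 ⟨t, Nat.lt_succ_iff.1 t.2, rfl⟩)
    refine le_trans ?_ h1
    change (bag' t).length ≤ _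
    simp only [bag', Finset.length_toList]
    exact Finset.card_le_card_of_injOn e (fun v hv => by simpa using hv) he.injOn
  have hmem' : D.width ∈ {w | ∃ D : TreeDecomposition G, D.width = w} := ⟨D, rfl⟩
  exact (Nat.sInf_le hmem').trans hD

/-- The parent matters only for a bag that shares a vertex with an earlier bag. All other bags can
be hung on the initial empty bag, so the roots need no special treatment. -/
theorem Built.of_parent {α : Type} {w : ℕ} (n : ℕ) (bag : ℕ → Finset α) (par : ℕ → ℕ)
    (hcard : ∀ i < n, (bag i).card ≤ w + 1)
    (hpar : ∀ i < n, ∀ v ∈ bag i, (∃ k < i, v ∈ bag k) → par i < i ∧ v ∈ bag (par i)) :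
    ∃ L, Built w L ∧ (∀ i < n, bag i ∈ L) ∧ ∀ B ∈ L, ∀ v ∈ B, ∃ i < n, v ∈ bag i := by
  classical
  induction n with
  | zero => exact ⟨_, .nil, by simp, by simp⟩
  | succ n ih =>
    obtain ⟨L, hL, hmem, hcov⟩ := ih (fun i hi => hcard i (by omega))
      (fun i hi => hpar i (by omega))
    have hfin : ∃ A ∈ L, ∀ v ∈ bag n, v ∈ A ∨ ∀ C ∈ L, v ∉ C := by
      by_cases hp : par n < n
      · refine ⟨_, hmem _ hp, fun v hv => ?_⟩
        by_cases hk : ∃ k < n, v ∈ bag k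
        · exact Or.inl (hpar n (by omega) v hv hk).2
        · exact Or.inr fun C hC hvC => hk (hcov C hC v hvC)
      -- Without a smaller parent index no vertex of the bag has occurred before.
      · refine ⟨_, hL.empty_mem, fun v hv => Or.inr fun C hC hvC => ?_⟩
        exact hp (hpar n (by omega) v hv (hcov C hC v hvC)).1
    obtain ⟨A, hA, hv⟩ := hfin
    refine ⟨_, .cons hL hA (hcard n (by omega)) hv, ?_, ?_⟩
    · intro i hi
      by_cases h : i = n
      · subst h; simp
      · exact List.mem_cons_of_mem _ (hmem i (by omega))
    · intro B hB v hvB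
      rcases List.mem_cons.1 hB with rfl | hB
      · exact ⟨n, by omega, hvB⟩
      · obtain ⟨i, hi, h⟩ := hcov B hB v hvB
        exact ⟨i, by omega, h⟩

/-! ### Given tree decompositions and their relabellings -/

/-- In a tree with parents listed first, a connected set of nodes contains the parent of each of
its nodes that is not its first one. -/
theorem parent_mem_of_connected {n : ℕ} {parent : Fin (n + 1) → Fin (n + 1)}
    (hroot : parent 0 = 0) (hlt : ∀ t, t ≠ 0 → parent t < t) {S : Set (Fin (n + 1))}
    (hS : ((SimpleGraph.fromRel fun s t => parent s = t).induce S).Preconnected)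
    {t t' : Fin (n + 1)} (ht : t ∈ S) (ht' : t' ∈ S) (h : t' < t) : parent t ∈ S := by
  by_contra hp
  have hle : ∀ u, parent u ≤ u := fun u => by
    by_cases hu : u = 0
    · rw [hu, hroot]
    · exact (hlt u hu).le
  have hit : ∀ k u, parent^[k] u ≤ u := by
    intro k
    induction k with
    | zero => simp
    | succ k ih => intro u; rw [Function.iterate_succ_apply]; exact (ih _).trans (hle u)
  -- A walk inside `S` that starts at `t` stays among the descendants of `t`: the only edge leaving
  -- them goes from `t` to its parent, which is not in `S`. So `t'` would be a descendant of `t`,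
  -- although taking parents never increases the index.
  have key : ∀ a b : S, ((SimpleGraph.fromRel fun s t => parent s = t).induce S).Reachable a b →
      (∃ k, parent^[k] a.1 = t) → ∃ k, parent^[k] b.1 = t := by
    rintro a b ⟨p⟩
    induction p with
    | nil => exact id
    | @cons a b c hab p ih =>
      rintro ⟨k, hk⟩
      apply ih
      simp only [SimpleGraph.comap_adj, Function.Embedding.subtype_apply,
        SimpleGraph.fromRel_adj] at hab
      rcases hab.2 with h1 | h1
      · cases k with
        | zero =>
          simp only [Function.iterate_zero, id] at hk
          rw [hk] at h1
          exact absurd b.2 (h1 ▸ hp)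
        | succ k => exact ⟨k, by rw [← hk, Function.iterate_succ_apply, h1]⟩
      · exact ⟨k + 1, by rw [Function.iterate_succ_apply, h1, hk]⟩
  obtain ⟨k, hk⟩ := key ⟨t, ht⟩ ⟨t', ht'⟩ (hS _ _) ⟨0, rfl⟩
  have := hit k t'
  rw [hk] at this
  exact absurd h (not_lt.2 this)

/-- Relabelling the vertices of a tree decomposition. -/
theorem TreeDecomposition.built_image {V α : Type} [DecidableEq α] {G : SimpleGraph V}
    (D : TreeDecomposition G) (f : V → α)
    (hf : ∀ a, ((SimpleGraph.fromRel fun s t => D.parent s = t).induce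
      {t | ∃ v ∈ D.bag t, f v = a}).Preconnected) :
    ∃ L, Built D.width L ∧ (∀ t, ∃ B ∈ L, ∀ v ∈ D.bag t, f v ∈ B) ∧
      ∀ B ∈ L, ∀ a ∈ B, ∃ v, f v = a := by
  let bag : ℕ → Finset α := fun i =>
    if h : i < D.last + 1 then ((D.bag ⟨i, h⟩).map f).toFinset else ∅
  have hmem : ∀ i (h : i < D.last + 1) a, a ∈ bag i ↔ ∃ v ∈ D.bag ⟨i, h⟩, f v = a := by
    intro i h a; simp only [bag, dif_pos h, List.mem_toFinset, List.mem_map]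
  obtain ⟨L, hL, h1, h2⟩ := Built.of_parent (w := D.width) (D.last + 1) bag
    (fun i => if h : i < D.last + 1 then D.parent ⟨i, h⟩ else 0) (by
      intro i hi
      simp only [bag, hi, dite_true]
      refine (List.toFinset_card_le _).trans ?_
      rw [List.length_map]
      have : (D.bag ⟨i, hi⟩).length ≤ Finset.univ.sup fun t => (D.bag t).length :=
        Finset.le_sup (f := fun t => (D.bag t).length) (Finset.mem_univ _)
      unfold TreeDecomposition.width
      omega) (by
      rintro i hi a ha ⟨k, hk, hak⟩
      simp only [hi, dite_true]
      have hk' : k < D.last + 1 := by omega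
      rw [hmem i hi] at ha
      rw [hmem k hk'] at hak
      have hpar := parent_mem_of_connected D.parent_root D.parent_lt (hf a)
        (t := ⟨i, hi⟩) (t' := ⟨k, hk'⟩) ha hak hk
      refine ⟨?_, (hmem _ (D.parent ⟨i, hi⟩).2 a).2 hpar⟩
      exact D.parent_lt ⟨i, hi⟩ fun h => by
        have := congrArg Fin.val h
        simp at this
        omega)
  refine ⟨L, hL, fun t => ⟨_, h1 t t.2, fun v hv => (hmem _ t.2 _).2 ⟨v, hv, rfl⟩⟩, ?_⟩
  intro B hB a ha
  obtain ⟨i, hi, hai⟩ := h2 B hB a ha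
  obtain ⟨v, _, hv⟩ := (hmem i hi a).1 hai
  exact ⟨v, hv⟩

theorem TreeDecomposition.preconnected_of_injective {V α : Type} {G : SimpleGraph V}
    (D : TreeDecomposition G) {f : V → α} (hf : Function.Injective f) (a : α) :
    ((SimpleGraph.fromRel fun s t => D.parent s = t).induce
      {t | ∃ v ∈ D.bag t, f v = a}).Preconnected := by
  by_cases ha : ∃ v, f v = a
  · obtain ⟨v, rfl⟩ := ha
    have : {t | ∃ u ∈ D.bag t, f u = f v} = {t | v ∈ D.bag t} := by
      ext t
      constructor
      · rintro ⟨u, hu, h⟩; exact hf h ▸ hu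
      · exact fun h => ⟨v, h, rfl⟩
    rw [this]
    exact (D.connected v).preconnected
  · rintro ⟨_, v, _, hv⟩
    exact absurd ⟨v, hv⟩ ha

instance occVarFinite (S : List (Finset ℕ)) : Finite (OccVar S) := by
  have : {x : ℕ | ∃ s ∈ S, x ∈ s} = ⋃ s ∈ S.toFinset, (s : Set ℕ) := by ext; simp
  have hf : {x : ℕ | ∃ s ∈ S, x ∈ s}.Finite := by
    rw [this]
    exact Set.Finite.biUnion (Finset.finite_toSet _) fun s _ => Finset.finite_toSet s
  exact hf

/-- A single bag with all vertices shows that the infimum is taken over a nonempty set of natural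
numbers, so it is attained. -/
theorem exists_width_eq_treewidth {V : Type} [Finite V] (G : SimpleGraph V) :
    ∃ D : TreeDecomposition G, D.width = treewidth G := by
  classical
  cases nonempty_fintype V
  have : Set.Nonempty {w | ∃ D : TreeDecomposition G, D.width = w} :=
    ⟨_, { last := 0
          parent := fun _ => 0
          parent_root := rfl
          parent_lt := fun t ht => absurd (Fin.ext (by omega)) ht
          bag := fun _ => Finset.univ.toList
          bag_nodup := fun _ => Finset.nodup_toList _
          connected := fun v => by
            have : Nonempty {t : Fin (0 + 1) | v ∈ (Finset.univ : Finset V).toList} :=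
              ⟨⟨0, by simp⟩⟩
            refine SimpleGraph.Connected.mk fun a b => ?_
            rw [Subtype.ext (Fin.ext (by omega) : a.1 = b.1)]
          covering := fun u v _ => ⟨0, by simp, by simp⟩ }, rfl⟩
  exact Nat.sInf_mem this

theorem Built.map {α β : Type} {w : ℕ} {L : List (Finset α)} (h : Built w L) (f : α ↪ β) :
    Built w (L.map (Finset.map f)) := by
  induction h with
  | nil => exact .nil
  | @cons L A B _ hA hB hv ih =>
    refine .cons ih (List.mem_map_of_mem hA) (by simpa using hB) ?_
    intro v hvB
    obtain ⟨u, hu, rfl⟩ := Finset.mem_map.1 hvB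
    refine (hv u hu).imp (fun h => Finset.mem_map_of_mem f h) fun h C hC huC => ?_
    obtain ⟨C', hC', rfl⟩ := List.mem_map.1 hC
    exact h C' hC' ((Finset.mem_map' f).1 huC)

/-! ### Scopes inside bags -/

theorem treewidth_primalGraph_le {w : ℕ} {L : List (Finset ℕ)} (h : Built w L)
    {S : List (Finset ℕ)} (hS : ∀ s ∈ S, ∃ B ∈ L, s ⊆ B) : treewidth (primalGraph S) ≤ w := by
  refine h.treewidth_le _ Subtype.val Subtype.val_injective ?_ ?_
  · rintro ⟨x, s, hs, hx⟩
    obtain ⟨B, hB, h⟩ := hS s hs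
    exact ⟨B, hB, h hx⟩
  · rintro u v huv
    have : ∃ s ∈ S, u.1 ∈ s ∧ v.1 ∈ s := by
      rcases ((SimpleGraph.fromRel_adj _ _ _).1 huv).2 with h | ⟨s, hs, h1, h2⟩
      exacts [h, ⟨s, hs, h2, h1⟩]
    obtain ⟨s, hs, h1, h2⟩ := this
    obtain ⟨B, hB, h⟩ := hS s hs
    exact ⟨B, hB, h h1, h h2⟩

/-- Below a bag that contains the scope `s`, a leaf with `s` and the vertex of the scope itself is
added. It has at most `w + 1` elements. Scope vertices live in the right summand of `ℕ ⊕ ℕ`, where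
they are new. -/
theorem treewidth_incidenceGraph_le {w : ℕ} {L : List (Finset ℕ)} (h : Built w L)
    {S : List (Finset ℕ)} (hcard : ∀ s ∈ S, s.card ≤ w) (hS : ∀ s ∈ S, ∃ B ∈ L, s ⊆ B) :
    treewidth (incidenceGraph S) ≤ w := by
  classical
  let f : ℕ ↪ ℕ ⊕ ℕ := ⟨Sum.inl, Sum.inl_injective⟩
  have key : ∀ n ≤ S.length, ∃ L' : List (Finset (ℕ ⊕ ℕ)), Built w L' ∧
      (∀ B ∈ L, B.map f ∈ L') ∧ (∀ B ∈ L', ∀ j, Sum.inr j ∈ B → j < n) ∧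
      ∀ j (hj : j < S.length), j < n → ∃ B ∈ L', Sum.inr j ∈ B ∧ (S[j]).map f ⊆ B := by
    intro n
    induction n with
    | zero =>
      intro _
      refine ⟨_, h.map f, fun B hB => List.mem_map_of_mem hB, ?_, by simp⟩
      intro B hB j hj
      obtain ⟨C, _, rfl⟩ := List.mem_map.1 hB
      obtain ⟨x, _, hx⟩ := Finset.mem_map.1 hj
      cases hx
    | succ n ih =>
      intro hn
      obtain ⟨L', hL', h1, h2, h3⟩ := ih (by omega)
      have hmem : S[n] ∈ S := List.getElem_mem _
      obtain ⟨A, hA, hsA⟩ := hS _ hmem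
      refine ⟨insert (Sum.inr n) ((S[n]).map f) :: L', .cons hL' (h1 A hA) ?_ ?_, ?_, ?_, ?_⟩
      · refine (Finset.card_insert_le _ _).trans ?_
        have := hcard _ hmem
        simpa using this
      · intro v hv
        rcases Finset.mem_insert.1 hv with rfl | hv
        · exact Or.inr fun C hC hnC => absurd (h2 C hC n hnC) (lt_irrefl _)
        · exact Or.inl (Finset.map_subset_map.2 hsA hv)
      · exact fun B hB => List.mem_cons_of_mem _ (h1 B hB)
      · intro B hB j hj
        rcases List.mem_cons.1 hB with rfl | hB
        · rcases Finset.mem_insert.1 hj with hj | hj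
          · rw [Sum.inr.inj hj]; omega
          · obtain ⟨x, _, hx⟩ := Finset.mem_map.1 hj
            cases hx
        · exact (h2 B hB j hj).trans (by omega)
      · intro j hj hjn
        by_cases hjn' : j = n
        · subst hjn'
          exact ⟨_, List.mem_cons_self, Finset.mem_insert_self _ _, Finset.subset_insert _ _⟩
        · obtain ⟨B, hB, h⟩ := h3 j hj (by omega)
          exact ⟨B, List.mem_cons_of_mem _ hB, h⟩
  obtain ⟨L', hL', h1, -, h3⟩ := key S.length le_rfl
  have hedge : ∀ (x : OccVar S) (j : Fin S.length), x.1 ∈ S.get j →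
      ∃ B ∈ L', Sum.inl x.1 ∈ B ∧ Sum.inr j.1 ∈ B := by
    intro x j hx
    obtain ⟨B, hB, h, h'⟩ := h3 j j.2 j.2
    exact ⟨B, hB, h' (Finset.mem_map_of_mem f hx), h⟩
  refine hL'.treewidth_le _ (Sum.map Subtype.val Fin.val)
    (Sum.map_injective.2 ⟨Subtype.val_injective, Fin.val_injective⟩) ?_ ?_
  · rintro (⟨x, s, hs, hx⟩ | j)
    · obtain ⟨j, hj, rfl⟩ := List.getElem_of_mem hs
      obtain ⟨B, hB, h, -⟩ := hedge ⟨x, _, hs, hx⟩ ⟨j, hj⟩ hx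
      exact ⟨B, hB, h⟩
    · obtain ⟨B, hB, h, -⟩ := h3 j j.2 j.2
      exact ⟨B, hB, h⟩
  · intro u v huv
    rcases ((SimpleGraph.fromRel_adj _ _ _).1 huv).2 with ⟨x, j, rfl, rfl, hx⟩ | ⟨x, j, rfl, rfl, hx⟩
    · exact hedge x j hx
    · obtain ⟨B, hB, h, h'⟩ := hedge x j hx
      exact ⟨B, hB, h', h⟩

/-- A clique is contained in a bag. -/
theorem Built.exists_bag_of_clique {α : Type} {w : ℕ} {L : List (Finset α)} (h : Built w L)
    (s : Finset α) (hs : ∀ u ∈ s, ∀ v ∈ s, ∃ B ∈ L, u ∈ B ∧ v ∈ B) : ∃ B ∈ L, s ⊆ B := by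
  induction h with
  | nil =>
    refine ⟨∅, by simp, fun u hu => ?_⟩
    obtain ⟨B, hB, h, -⟩ := hs u hu u hu
    rw [List.mem_singleton.1 hB] at h
    exact h
  | @cons L A B _ hA _ hv ih =>
    by_cases hsB : s ⊆ B
    · exact ⟨B, List.mem_cons_self, hsB⟩
    obtain ⟨u, hu, huB⟩ := Finset.not_subset.1 hsB
    -- The vertex `u` of the clique is missing in the last bag. A vertex of the clique in `B` meets
    -- `u` in an older bag, so it is not new and lies in `A`; hence `A` can take the place of `B`.
    have hold : ∀ v ∈ s, v ∈ B → v ∈ A := by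
      intro v hvs hvB
      refine (hv v hvB).resolve_right fun hnew => ?_
      obtain ⟨C, hC, hvC, huC⟩ := hs v hvs u hu
      rcases List.mem_cons.1 hC with rfl | hC
      · exact huB huC
      · exact hnew C hC hvC
    obtain ⟨C, hC, hsC⟩ := ih fun x hx y hy => by
      obtain ⟨C, hC, hxC, hyC⟩ := hs x hx y hy
      rcases List.mem_cons.1 hC with rfl | hC
      · exact ⟨A, hA, hold x hx hxC, hold y hy hyC⟩
      · exact ⟨C, hC, hxC, hyC⟩
    exact ⟨C, List.mem_cons_of_mem _ hC, hsC⟩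

theorem exists_built_primal (S : List (Finset ℕ)) :
    ∃ L, Built (treewidth (primalGraph S)) L ∧ (∀ s ∈ S, ∃ B ∈ L, s ⊆ B) ∧
      ∀ B ∈ L, ∀ x ∈ B, ∃ s ∈ S, x ∈ s := by
  obtain ⟨D, hD⟩ := exists_width_eq_treewidth (primalGraph S)
  obtain ⟨L, hL, h1, h2⟩ := D.built_image Subtype.val
    (D.preconnected_of_injective Subtype.val_injective)
  rw [hD] at hL
  refine ⟨L, hL, fun s hs => hL.exists_bag_of_clique s fun u hu v hv => ?_, ?_⟩
  · let u' : OccVar S := ⟨u, s, hs, hu⟩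
    let v' : OccVar S := ⟨v, s, hs, hv⟩
    have : ∃ t, u' ∈ D.bag t ∧ v' ∈ D.bag t := by
      by_cases huv : u' = v'
      · rw [← huv]
        obtain ⟨⟨t, ht⟩⟩ := (D.connected u').nonempty
        exact ⟨t, ht, ht⟩
      · exact D.covering u' v' ((SimpleGraph.fromRel_adj _ _ _).2
          ⟨huv, Or.inl ⟨s, hs, hu, hv⟩⟩)
    obtain ⟨t, h3, h4⟩ := this
    obtain ⟨B, hB, h⟩ := h1 t
    exact ⟨B, hB, h _ h3, h _ h4⟩
  · intro B hB x hx
    obtain ⟨v, rfl⟩ := h2 B hB x hx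
    exact v.2

/-- Contracting every scope into one of its variables. -/
theorem exists_built_contract {S : List (Finset ℕ)} (hne : ∀ s ∈ S, s.Nonempty)
    (hcard : ∀ s ∈ S, s.card ≤ 2) (D : TreeDecomposition (incidenceGraph S)) :
    ∃ L, Built D.width L ∧ (∀ s ∈ S, ∃ B ∈ L, s ⊆ B) ∧ ∀ B ∈ L, ∀ x ∈ B, ∃ s ∈ S, x ∈ s := by
  classical
  choose a ha using fun j : Fin S.length => hne (S.get j) (List.get_mem _ _)
  let a' : Fin S.length → OccVar S := fun j => ⟨a j, _, List.get_mem _ _, ha j⟩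
  have hadj : ∀ (x : OccVar S) j, x.1 ∈ S.get j →
      (incidenceGraph S).Adj (Sum.inl x) (Sum.inr j) := fun x j hx =>
    (SimpleGraph.fromRel_adj _ _ _).2 ⟨by simp, Or.inl ⟨x, j, rfl, rfl, hx⟩⟩
  -- The fibre over a variable consists of its own subtree and of the subtrees of the scopes
  -- contracted into it. Each of the latter meets the former in a bag that covers an incidence edge,
  -- so the union is connected.
  obtain ⟨L, hL, h1, h2⟩ := D.built_image (Sum.elim id a') (by
    intro x
    have hset : ∀ t, (∃ v ∈ D.bag t, Sum.elim id a' v = x) ↔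
        Sum.inl x ∈ D.bag t ∨ ∃ j, a' j = x ∧ Sum.inr j ∈ D.bag t := by
      intro t
      constructor
      · rintro ⟨v | j, hv, h⟩
        · exact Or.inl (by simpa [← h] using hv)
        · exact Or.inr ⟨j, h, hv⟩
      · rintro (h | ⟨j, h, h'⟩)
        exacts [⟨_, h, rfl⟩, ⟨_, h', h⟩]
    obtain ⟨⟨t0, ht0⟩⟩ := (D.connected (Sum.inl x)).nonempty
    refine (SimpleGraph.induce_connected_of_patches t0 ((hset t0).2 (Or.inl ht0)) ?_).preconnected
    intro t ht
    rcases (hset t).1 ht with h | ⟨j, hj, h⟩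
    · exact ⟨{t | Sum.inl x ∈ D.bag t}, fun t ht => (hset t).2 (Or.inl ht), ht0, h,
        (D.connected (Sum.inl x)).preconnected _ _⟩
    · obtain ⟨t1, h3, h4⟩ := D.covering _ _ (hadj (a' j) j (ha j))
      rw [hj] at h3
      refine ⟨{t | Sum.inl x ∈ D.bag t} ∪ {t | Sum.inr j ∈ D.bag t}, ?_, Or.inl ht0, Or.inr h,
        (SimpleGraph.induce_union_connected (D.connected (Sum.inl x)).preconnected
          (D.connected (Sum.inr j)).preconnected ⟨t1, h3, h4⟩).preconnected _ _⟩
      rintro t (ht | ht)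
      · exact (hset t).2 (Or.inl ht)
      · exact (hset t).2 (Or.inr ⟨j, hj, ht⟩))
  let f : OccVar S ↪ ℕ := ⟨Subtype.val, Subtype.val_injective⟩
  refine ⟨_, hL.map f, fun s hs => ?_, ?_⟩
  · obtain ⟨j, rfl⟩ := List.get_of_mem hs
    -- A bag that covers the edge between `v` and the scope contains `a j` after the contraction.
    -- For a scope with two elements this puts the scope into one bag.
    have hpair : ∀ v ∈ S.get j, ∃ B ∈ L.map (Finset.map f), a j ∈ B ∧ v ∈ B := by
      intro v hv
      obtain ⟨t, h3, h4⟩ := D.covering _ _ (hadj ⟨v, _, hs, hv⟩ j hv)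
      obtain ⟨B, hB, h⟩ := h1 t
      exact ⟨_, List.mem_map_of_mem hB, Finset.mem_map_of_mem f (h _ h4),
        Finset.mem_map_of_mem f (h _ h3)⟩
    have h2 := hcard _ hs
    by_cases hx : ∃ b ∈ S.get j, b ≠ a j
    · obtain ⟨b, hb, hba⟩ := hx
      obtain ⟨B, hB, h3, h4⟩ := hpair b hb
      refine ⟨B, hB, fun v hv => ?_⟩
      by_contra hvB
      have h5 : ({a j, b, v} : Finset ℕ) ⊆ S.get j := by
        intro u hu
        simp only [Finset.mem_insert, Finset.mem_singleton] at hu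
        rcases hu with rfl | rfl | rfl
        exacts [ha j, hb, hv]
      have h6 := Finset.card_le_card h5
      rw [Finset.card_eq_three.2 ⟨a j, b, v, hba.symm, fun h => hvB (h ▸ h3),
        fun h => hvB (h ▸ h4), rfl⟩] at h6
      omega
    · push Not at hx
      obtain ⟨B, hB, h3, -⟩ := hpair (a j) (ha j)
      exact ⟨B, hB, fun v hv => hx v hv ▸ h3⟩
  · intro B hB x hx
    obtain ⟨C, _, rfl⟩ := List.mem_map.1 hB
    obtain ⟨v, _, rfl⟩ := Finset.mem_map.1 hx
    exact v.2

/-! ### Branching all shared ends of a bag -/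

/-- Three cliques with a perfect matching of triangles between them: the vertices of `T` are
replaced, one after the other, by pairs of fresh vertices, the even ones of which go to `Q` and the
odd ones of which go to `P`. -/
theorem Built.prism {w : ℕ} {L : List (Finset ℕ)} (T : List ℕ) (P Q A : Finset ℕ) (b : ℕ)
    (h : Built w L) (hA : A ∈ L) (hPA : P ⊆ A) (hQA : Q ⊆ A) (hTA : ∀ v ∈ T, v ∈ A)
    (hb : ∀ B ∈ L, ∀ v ∈ B, v < b)
    (hc1 : T = [] ∨ (P ∪ Q).card + 2 * T.length ≤ w + 1)
    (hc2 : T = [] ∨ Q.card + T.length + 2 ≤ w + 1) :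
    ∃ L', Built w L' ∧ (∀ B ∈ L, B ∈ L') ∧
      (∀ i (hi : i < T.length), ∃ B ∈ L', T[i] ∈ B ∧ b + 2 * i ∈ B ∧ b + 2 * i + 1 ∈ B) ∧
      (∃ B ∈ L', P ⊆ B ∧ ∀ i < T.length, b + 2 * i + 1 ∈ B) ∧
      (∃ B ∈ L', Q ⊆ B ∧ ∀ i < T.length, b + 2 * i ∈ B) ∧
      ∀ B ∈ L', ∀ v ∈ B, (∃ C ∈ L, v ∈ C) ∨ (b ≤ v ∧ v < b + 2 * T.length) := by
  induction T generalizing L P Q A b with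
  | nil =>
    exact ⟨L, h, fun _ => id, by simp, ⟨A, hA, hPA, by simp⟩, ⟨A, hA, hQA, by simp⟩,
      fun B hB v hv => Or.inl ⟨B, hB, hv⟩⟩
  | cons o T ih =>
    simp only [List.length_cons, reduceCtorEq, false_or] at hc1 hc2
    have hoA : o ∈ A := hTA o (by simp)
    have hfresh : ∀ v, b ≤ v → ∀ C ∈ L, v ∉ C := fun v hv C hC h => by
      have := hb C hC v h; omega
    have hPQ : P ∪ Q ⊆ A := Finset.union_subset hPA hQA
    -- The last vertex needs two bags: a single one with `P`, `Q` and three further elements would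
    -- exceed the bound. Here `P` is finished before the last fresh vertex of `Q` appears.
    rcases T with _ | ⟨o', T⟩
    · have hB1 : Built w ((P ∪ Q ∪ {o, b + 1}) :: L) := by
        refine .cons h hA ?_ ?_
        · refine (Finset.card_union_le _ _).trans ?_
          have := Finset.card_le_two (a := o) (b := b + 1)
          simp at hc1
          omega
        · intro v hv
          simp only [Finset.mem_union, Finset.mem_insert, Finset.mem_singleton] at hv
          rcases hv with (hv | hv) | rfl | rfl
          exacts [Or.inl (hPA hv), Or.inl (hQA hv), Or.inl hoA, Or.inr (hfresh _ (by omega))]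
      have hB2 : Built w ((Q ∪ {o, b + 1, b}) :: (P ∪ Q ∪ {o, b + 1}) :: L) := by
        refine .cons hB1 List.mem_cons_self ?_ ?_
        · refine (Finset.card_union_le _ _).trans ?_
          have := Finset.card_le_three (a := o) (b := b + 1) (c := b)
          simp at hc2
          omega
        · intro v hv
          simp only [Finset.mem_union, Finset.mem_insert, Finset.mem_singleton] at hv
          rcases hv with hv | rfl | rfl | rfl
          · exact Or.inl (by simp [hv])
          · exact Or.inl (by simp)
          · exact Or.inl (by simp)
          · refine Or.inr fun C hC hvC => ?_
            rcases List.mem_cons.1 hC with rfl | hC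
            · simp only [Finset.mem_union, Finset.mem_insert, Finset.mem_singleton] at hvC
              rcases hvC with (hv | hv) | rfl | hv
              · exact hfresh _ le_rfl A hA (hPA hv)
              · exact hfresh _ le_rfl A hA (hQA hv)
              · exact hfresh _ le_rfl A hA hoA
              · omega
            · exact hfresh _ le_rfl C hC hvC
      refine ⟨_, hB2, fun B hB => by simp [hB], ?_, ?_, ?_, ?_⟩
      · intro i hi
        have : i = 0 := by simpa using hi
        subst this
        exact ⟨_, List.mem_cons_self, by simp, by simp, by simp⟩
      · refine ⟨P ∪ Q ∪ {o, b + 1}, by simp, fun v hv => by simp [hv], fun i hi => ?_⟩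
        have : i = 0 := by simpa using hi
        subst this; simp
      · refine ⟨Q ∪ {o, b + 1, b}, by simp, fun v hv => by simp [hv], fun i hi => ?_⟩
        have : i = 0 := by simpa using hi
        subst this; simp
      · intro B hB v hv
        simp only [List.mem_cons] at hB
        rcases hB with rfl | rfl | hB
        · simp only [Finset.mem_union, Finset.mem_insert, Finset.mem_singleton] at hv
          rcases hv with hv | rfl | rfl | rfl
          · exact Or.inl ⟨A, hA, hQA hv⟩
          · exact Or.inl ⟨A, hA, hoA⟩
          · right; simp
          · right; simp
        · simp only [Finset.mem_union, Finset.mem_insert, Finset.mem_singleton] at hv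
          rcases hv with (hv | hv) | rfl | rfl
          · exact Or.inl ⟨A, hA, hPA hv⟩
          · exact Or.inl ⟨A, hA, hQA hv⟩
          · exact Or.inl ⟨A, hA, hoA⟩
          · right; simp
        · exact Or.inl ⟨B, hB, hv⟩
    · set U := o' :: T with hU
      have hUlen : 1 ≤ U.length := by simp [hU]
      -- The vertex `o` gives way to `b + 1` in `P` and to `b` in `Q`. The size is at most `(P ∪
      -- Q).card + 2` plus the number of vertices still to be replaced. As at least two of them are
      -- left, this is at most `(P ∪ Q).card` plus twice their number. Both cardinality bounds are
      -- unchanged for the next step.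
      set B0 := P ∪ Q ∪ insert o U.toFinset ∪ {b, b + 1} with hB0
      have hB0' : Built w (B0 :: L) := by
        refine .cons h hA ?_ ?_
        · have h1 : B0.card ≤ (P ∪ Q).card + (insert o U.toFinset).card + 2 := by
            refine (Finset.card_union_le _ _).trans (add_le_add (Finset.card_union_le _ _) ?_)
            exact Finset.card_le_two
          have h2 := Finset.card_insert_le o U.toFinset
          have h3 := List.toFinset_card_le U
          omega
        · intro v hv
          simp only [hB0, Finset.mem_union, Finset.mem_insert, Finset.mem_singleton,
            List.mem_toFinset] at hv
          rcases hv with ((hv | hv) | rfl | hv) | rfl | rfl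
          exacts [Or.inl (hPA hv), Or.inl (hQA hv), Or.inl hoA,
            Or.inl (hTA v (List.mem_cons_of_mem _ hv)), Or.inr (hfresh _ le_rfl),
            Or.inr (hfresh _ (by omega))]
      obtain ⟨L', hL', g1, g2, g3, g4, g5⟩ := ih (L := B0 :: L) (insert (b + 1) P) (insert b Q) B0
        (b + 2) hB0' List.mem_cons_self
        (by intro v hv; rcases Finset.mem_insert.1 hv with rfl | hv <;> simp [*])
        (by intro v hv; rcases Finset.mem_insert.1 hv with rfl | hv <;> simp [*])
        (by intro v hv; simp [hB0, hv])
        (by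
          intro B hB v hv
          rcases List.mem_cons.1 hB with rfl | hB
          · simp only [hB0, Finset.mem_union, Finset.mem_insert, Finset.mem_singleton,
              List.mem_toFinset] at hv
            rcases hv with ((hv | hv) | rfl | hv) | rfl | rfl
            · have := hb A hA v (hPA hv); omega
            · have := hb A hA v (hQA hv); omega
            · have := hb A hA v hoA; omega
            · have := hb A hA v (hTA v (List.mem_cons_of_mem _ hv)); omega
            · omega
            · omega
          · have := hb B hB v hv; omega)
        (by
          right
          have : insert (b + 1) P ∪ insert b Q = (P ∪ Q) ∪ {b, b + 1} := by
            ext v; simp only [Finset.mem_union, Finset.mem_insert, Finset.mem_singleton]; tauto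
          rw [this]
          have h1 := Finset.card_union_le (P ∪ Q) {b, b + 1}
          have h2 := Finset.card_le_two (a := b) (b := b + 1)
          omega)
        (by right; have := Finset.card_insert_le b Q; omega)
      refine ⟨L', hL', fun B hB => g1 B (List.mem_cons_of_mem _ hB), ?_, ?_, ?_, ?_⟩
      · intro i hi
        rcases i with _ | i
        · exact ⟨B0, g1 _ List.mem_cons_self, by simp [hB0], by simp [hB0], by simp [hB0]⟩
        · obtain ⟨B, hB, h1, h2, h3⟩ := g2 i (by simpa using hi)
          exact ⟨B, hB, by simpa using h1, by convert h2 using 1; ring, by convert h3 using 1; ring⟩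
      · obtain ⟨B, hB, h1, h2⟩ := g3
        refine ⟨B, hB, fun v hv => h1 (Finset.mem_insert_of_mem hv), fun i hi => ?_⟩
        rcases i with _ | i
        · exact h1 (Finset.mem_insert_self _ _)
        · convert h2 i (by simpa using hi) using 1; ring
      · obtain ⟨B, hB, h1, h2⟩ := g4
        refine ⟨B, hB, fun v hv => h1 (Finset.mem_insert_of_mem hv), fun i hi => ?_⟩
        rcases i with _ | i
        · exact h1 (Finset.mem_insert_self _ _)
        · convert h2 i (by simpa using hi) using 1; ring
      · intro B hB v hv
        rcases g5 B hB v hv with ⟨C, hC, hvC⟩ | ⟨h1, h2⟩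
        · rcases List.mem_cons.1 hC with rfl | hC
          · simp only [hB0, Finset.mem_union, Finset.mem_insert, Finset.mem_singleton,
              List.mem_toFinset] at hvC
            rcases hvC with ((hv | hv) | rfl | hv) | rfl | rfl
            · exact Or.inl ⟨A, hA, hPA hv⟩
            · exact Or.inl ⟨A, hA, hQA hv⟩
            · exact Or.inl ⟨A, hA, hoA⟩
            · exact Or.inl ⟨A, hA, hTA v (List.mem_cons_of_mem _ hv)⟩
            · right; simp
            · right; simp only [List.length_cons]; omega
          · exact Or.inl ⟨C, hC, hvC⟩
        · right; simp only [List.length_cons]; omega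

/-! ### Unit flow networks and their energy -/

abbrev Term : Type := ℕ × ℕ × ℤ

def energyOf (ts : List Term) (x : ℕ → Bool) : ℤ :=
  (ts.map fun t => if x t.1 ∧ x t.2.1 then t.2.2 else 0).sum

@[simp] theorem energyOf_append (ts us : List Term) (x : ℕ → Bool) :
    energyOf (ts ++ us) x = energyOf ts x + energyOf us x := by
  simp [energyOf]

theorem energyOf_congr {ts : List Term} {x y : ℕ → Bool}
    (h : ∀ t ∈ ts, x t.1 = y t.1 ∧ x t.2.1 = y t.2.1) : energyOf ts x = energyOf ts y := by
  unfold energyOf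
  congr 1
  refine List.map_congr_left fun t ht => ?_
  rw [(h t ht).1, (h t ht).2]

/-- The penalty `w * (y - n - (n + 1)) ^ 2` with the linear coefficient of `y` removed, that of the
fresh variable `n` changed to `c`, and that of the fresh variable `n + 1` changed to `2 * w`. -/
def triangle (y n : ℕ) (c w : ℤ) : List Term :=
  [(n, n, c), (n + 1, n + 1, 2 * w), (y, n, -(2 * w)), (y, n + 1, -(2 * w)), (n, n + 1, 2 * w)]

/-- Each fresh variable has the coefficient `2 * g`. One `g` belongs to the square in which it is
created. The other is the price of a unit that stops there, as long as the end is open; once the end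
branches further, it is the linear coefficient that `triangle` leaves out for its apex. -/
def joinTerms (y n : ℕ) (g : ℤ) : List Term := triangle y n (2 * g) g

/-- The variable `n` carries the flow into the literal and `n + 1` is the new open end. Flow into a
false literal costs `g * n * (1 - x)` for the literal `x` and `g * n * x` for its negation, which
explains the two coefficients of `n` and the sign of the product. -/
def literalTerms (y n : ℕ) (g : ℤ) (l : Literal) : List Term :=
  triangle y n (if l.2 then 2 * g else g) g ++ [(l.1, n, if l.2 then -g else g)]

/-- The unit flow networks of several clauses, as they are built.  `R` are the clauses that have a
root, `A` are the literals (with their clauses) that have been attached, `live` are the open ends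
(with their clauses), `n` is the next fresh variable and `ts` are the terms. -/
inductive FlowHist (N : ℕ) (g : ℕ → ℕ) : Finset ℕ → Finset (ℕ × Literal) → Finset (ℕ × ℕ) → ℕ →
    List Term → Prop
  | init : FlowHist N g ∅ ∅ ∅ N []
  | root {R A live n ts} (j : ℕ) (h : FlowHist N g R A live n ts) (hj : j ∉ R) (hg : 0 < g j) :
      FlowHist N g (insert j R) A (insert (j, n) live) (n + 1) (ts ++ [(n, n, -(2 * g j : ℤ))])
  | join {R A live n ts} (j y : ℕ) (h : FlowHist N g R A live n ts) (hy : (j, y) ∈ live) :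
      FlowHist N g R A (insert (j, n) (insert (j, n + 1) (live.erase (j, y)))) (n + 2)
        (ts ++ joinTerms y n (g j))
  | literal {R A live n ts} (j y : ℕ) (l : Literal) (h : FlowHist N g R A live n ts)
      (hy : (j, y) ∈ live) (hl : l.1 < N) :
      FlowHist N g R (insert (j, l) A) (insert (j, n + 1) (live.erase (j, y))) (n + 2)
        (ts ++ literalTerms y n (g j) l)

namespace FlowHist

variable {N : ℕ} {g : ℕ → ℕ} {R : Finset ℕ} {A : Finset (ℕ × Literal)} {live : Finset (ℕ × ℕ)}
  {n : ℕ} {ts : List Term}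

theorem le_next (h : FlowHist N g R A live n ts) : N ≤ n := by
  induction h <;> omega

theorem live_bounds (h : FlowHist N g R A live n ts) :
    ∀ p ∈ live, N ≤ p.2 ∧ p.2 < n ∧ p.1 ∈ R := by
  induction h with
  | init => simp
  | root j h hj hg ih =>
    have := h.le_next
    intro p hp
    rcases Finset.mem_insert.1 hp with rfl | hp
    · simp [this]
    · obtain ⟨h1, h2, h3⟩ := ih p hp
      exact ⟨h1, by omega, Finset.mem_insert_of_mem h3⟩
  | join j y h hy ih =>
    have := h.le_next
    intro p hp
    simp only [Finset.mem_insert, Finset.mem_erase] at hp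
    rcases hp with rfl | rfl | ⟨-, hp⟩
    · exact ⟨this, by simp, (ih _ hy).2.2⟩
    · exact ⟨by simp; omega, by simp, (ih _ hy).2.2⟩
    · obtain ⟨h1, h2, h3⟩ := ih p hp
      exact ⟨h1, by omega, h3⟩
  | literal j y l h hy hl ih =>
    have := h.le_next
    intro p hp
    simp only [Finset.mem_insert, Finset.mem_erase] at hp
    rcases hp with rfl | ⟨-, hp⟩
    · exact ⟨by simp; omega, by simp, (ih _ hy).2.2⟩
    · obtain ⟨h1, h2, h3⟩ := ih p hp
      exact ⟨h1, by omega, h3⟩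

theorem weight_pos (h : FlowHist N g R A live n ts) : ∀ j ∈ R, 0 < g j := by
  induction h with
  | init => simp
  | root j h hj hg ih =>
    intro i hi
    rcases Finset.mem_insert.1 hi with rfl | hi
    exacts [hg, ih i hi]
  | join j y h hy ih => exact ih
  | literal j y l h hy hl ih => exact ih

/-- A branching always leaves at least one open end of the same clause. This is where the flow of a
falsified clause can stop. -/
theorem exists_live (h : FlowHist N g R A live n ts) : ∀ j ∈ R, ∃ y, (j, y) ∈ live := by
  induction h with
  | init => simp
  | root j h hj hg ih =>
    intro i hi
    rcases Finset.mem_insert.1 hi with rfl | hi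
    · exact ⟨_, Finset.mem_insert_self _ _⟩
    · obtain ⟨y, hy⟩ := ih i hi
      exact ⟨y, Finset.mem_insert_of_mem hy⟩
  | @join R A live n ts j y h hy ih =>
    intro i hi
    obtain ⟨z, hz⟩ := ih i hi
    by_cases hij : i = j
    · subst hij; exact ⟨n, by simp⟩
    · exact ⟨z, by simp [hz, hij]⟩
  | @literal R A live n ts j y l h hy hl ih =>
    intro i hi
    obtain ⟨z, hz⟩ := ih i hi
    by_cases hij : i = j
    · subst hij; exact ⟨n + 1, by simp⟩
    · exact ⟨z, by simp [hz, hij]⟩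

theorem terms_lt (h : FlowHist N g R A live n ts) : ∀ t ∈ ts, t.1 ≤ t.2.1 ∧ t.2.1 < n := by
  induction h with
  | init => simp
  | root j h hj hg ih =>
    intro t ht
    rcases List.mem_append.1 ht with ht | ht
    · have := ih t ht; omega
    · rw [List.mem_singleton.1 ht]; simp
  | join j y h hy ih =>
    intro t ht
    have hb := h.live_bounds _ hy
    simp only at hb
    rcases List.mem_append.1 ht with ht | ht
    · have := ih t ht; omega
    · simp only [joinTerms, triangle, List.mem_cons, List.not_mem_nil, or_false] at ht
      rcases ht with rfl | rfl | rfl | rfl | rfl <;> simp <;> omega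
  | literal j y l h hy hl ih =>
    intro t ht
    have hb := h.live_bounds _ hy
    simp only at hb
    rcases List.mem_append.1 ht with ht | ht
    · have := ih t ht; omega
    · simp only [literalTerms, triangle, List.mem_cons, List.not_mem_nil, or_false,
        List.cons_append, List.nil_append] at ht
      rcases ht with rfl | rfl | rfl | rfl | rfl | rfl <;> simp <;> omega

theorem terms_ne_zero (h : FlowHist N g R A live n ts) : ∀ t ∈ ts, t.2.2 ≠ 0 := by
  induction h with
  | init => simp
  | root j h hj hg ih =>
    intro t ht
    rcases List.mem_append.1 ht with ht | ht
    · exact ih t ht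
    · rw [List.mem_singleton.1 ht]; simp; omega
  | join j y h hy ih =>
    intro t ht
    have hg := h.weight_pos _ (h.live_bounds _ hy).2.2
    simp only at hg
    rcases List.mem_append.1 ht with ht | ht
    · exact ih t ht
    · simp only [joinTerms, triangle, List.mem_cons, List.not_mem_nil, or_false] at ht
      rcases ht with rfl | rfl | rfl | rfl | rfl <;> simp <;> omega
  | literal j y l h hy hl ih =>
    intro t ht
    have hg := h.weight_pos _ (h.live_bounds _ hy).2.2
    simp only at hg
    rcases List.mem_append.1 ht with ht | ht
    · exact ih t ht
    · simp only [literalTerms, triangle, List.mem_cons, List.not_mem_nil, or_false,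
        List.cons_append, List.nil_append] at ht
      rcases ht with rfl | rfl | rfl | rfl | rfl | rfl <;> simp <;> (try split_ifs) <;> omega

/-- The second index of every new term is one of the fresh variables, so it is at least `n`, whereas
the older terms have second indices below `n`. The terms with second index `n` differ in their first
index, since a literal has its variable below `N` and open ends are at least `N`. -/
theorem terms_distinct (h : FlowHist N g R A live n ts) :
    ts.Pairwise fun s t => (s.1, s.2.1) ≠ (t.1, t.2.1) := by
  induction h with
  | init => simp
  | root j h hj hg ih =>
    rw [List.pairwise_append]
    refine ⟨ih, by simp, fun s hs t ht => ?_⟩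
    have := h.terms_lt s hs
    rw [List.mem_singleton.1 ht]
    simp only [ne_eq, Prod.mk.injEq]; omega
  | join j y h hy ih =>
    have hb := h.live_bounds _ hy
    simp only at hb
    rw [List.pairwise_append]
    refine ⟨ih, ?_, fun s hs t ht => ?_⟩
    · simp [joinTerms, triangle]; omega
    · have := h.terms_lt s hs
      simp only [joinTerms, triangle, List.mem_cons, List.not_mem_nil, or_false] at ht
      rcases ht with rfl | rfl | rfl | rfl | rfl <;> simp only [ne_eq, Prod.mk.injEq] <;> omega
  | literal j y l h hy hl ih =>
    have hb := h.live_bounds _ hy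
    simp only at hb
    rw [List.pairwise_append]
    refine ⟨ih, ?_, fun s hs t ht => ?_⟩
    · simp [literalTerms, triangle]; omega
    · have := h.terms_lt s hs
      simp only [literalTerms, triangle, List.mem_cons, List.not_mem_nil, or_false,
        List.cons_append, List.nil_append] at ht
      rcases ht with rfl | rfl | rfl | rfl | rfl | rfl <;> simp only [ne_eq, Prod.mk.injEq] <;>
        omega

def bitValue (b : Bool) : ℤ := if b then 1 else 0

theorem energyOf_joinTerms (y n : ℕ) (g : ℤ) (β : ℕ → Bool) :
    energyOf (joinTerms y n g) β =
      g * ((bitValue (β y) - bitValue (β n) - bitValue (β (n + 1))) ^ 2 +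
        (bitValue (β n) + bitValue (β (n + 1)) - bitValue (β y))) := by
  unfold energyOf joinTerms triangle bitValue
  rcases h1 : β y <;> rcases h2 : β n <;> rcases h3 : β (n + 1) <;> simp [h1, h2, h3] <;> ring

theorem energyOf_literalTerms (y n : ℕ) (g : ℤ) (l : Literal) (β : ℕ → Bool) :
    energyOf (literalTerms y n g l) β =
      g * ((bitValue (β y) - bitValue (β n) - bitValue (β (n + 1))) ^ 2 +
        (bitValue (β (n + 1)) - bitValue (β y)) + if β l.1 = l.2 then 0 else bitValue (β n)) := by
  obtain ⟨x, b⟩ := l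
  unfold energyOf literalTerms triangle bitValue
  rcases h1 : β y <;> rcases h2 : β n <;> rcases h3 : β (n + 1) <;> rcases b <;>
    rcases h4 : β x <;> simp [h1, h2, h3, h4] <;> ring

/-- Let `d` be the outflow minus the inflow at a branching. For a clause in `F`, where every
attached literal is false, a branching contributes `g * (d ^ 2 + d)`, which is nonnegative for an
integer `d`, and the root contributes `3 * g - 2 * g * r ≥ g`, where `r` is the bit of the root. For
other clauses the root term is `3 * g * (1 - r) + g * r`: a penalty, and the price of the open end.
At a branching the change of the prices of the open ends is accounted for by the left side, and the
square and the price of the literal remain, which are nonnegative. -/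
theorem lower_bound (h : FlowHist N g R A live n ts) (β : ℕ → Bool) (F : ℕ → Prop)
    [DecidablePred F] (hF : ∀ p ∈ A, F p.1 → β p.2.1 ≠ p.2.2) :
    (∑ j ∈ R, if F j then (g j : ℤ) else 0) +
        ∑ p ∈ live, (if F p.1 then 0 else (g p.1 : ℤ) * bitValue (β p.2)) ≤
      energyOf ts β + 3 * ∑ j ∈ R, (g j : ℤ) := by
  induction h with
  | init => simp [energyOf]
  | @root R A live n ts j h hj hg ih =>
    have hn : (j, n) ∉ live := fun hm => by have := h.live_bounds _ hm; simp at this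
    have := ih hF
    rw [Finset.sum_insert hj, Finset.sum_insert hn, Finset.sum_insert hj, energyOf_append]
    have h2 : energyOf [(n, n, -(2 * g j : ℤ))] β = -(2 * g j * bitValue (β n)) := by
      unfold energyOf bitValue; rcases hb : β n <;> simp [hb]
    rw [h2]
    have h3 : (0 : ℤ) < g j := by exact_mod_cast hg
    generalize (∑ p ∈ live, _ : ℤ) = s at *
    unfold bitValue at *
    rcases hb : β n <;> by_cases hFj : F j <;> simp [hFj] <;> linarith
  | @join R A live n ts j y h hy ih =>
    have hb := fun p hp => (h.live_bounds p hp).2.1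
    have h1 : (j, n + 1) ∉ live.erase (j, y) := fun hm => by
      have := hb _ (Finset.mem_of_mem_erase hm); simp at this
    have h2 : (j, n) ∉ insert (j, n + 1) (live.erase (j, y)) := fun hm => by
      rcases Finset.mem_insert.1 hm with hm | hm
      · simp at hm
      · have := hb _ (Finset.mem_of_mem_erase hm); simp at this
    have := ih hF
    rw [← Finset.add_sum_erase _ _ hy] at this
    rw [Finset.sum_insert h2, Finset.sum_insert h1, energyOf_append, energyOf_joinTerms]
    have h3 : (0 : ℤ) ≤ g j := Int.natCast_nonneg _
    generalize (∑ p ∈ live.erase (j, y), _ : ℤ) = s at *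
    unfold bitValue at *
    by_cases hFj : F j <;> rcases hb1 : β n <;> rcases hb2 : β (n + 1) <;> rcases hb3 : β y <;>
      simp [hFj, hb3] at this ⊢ <;> linarith
  | @literal R A live n ts j y l h hy hl ih =>
    have hb := fun p hp => (h.live_bounds p hp).2.1
    have h1 : (j, n + 1) ∉ live.erase (j, y) := fun hm => by
      have := hb _ (Finset.mem_of_mem_erase hm); simp at this
    have := ih fun p hp => hF p (Finset.mem_insert_of_mem hp)
    have hFl := hF (j, l) (Finset.mem_insert_self _ _)
    simp only at hFl
    rw [← Finset.add_sum_erase _ _ hy] at this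
    rw [Finset.sum_insert h1, energyOf_append, energyOf_literalTerms]
    have h3 : (0 : ℤ) ≤ g j := Int.natCast_nonneg _
    generalize (∑ p ∈ live.erase (j, y), _ : ℤ) = s at *
    unfold bitValue at *
    by_cases hFj : F j
    · have hl' := hFl hFj
      rcases hb1 : β n <;> rcases hb2 : β (n + 1) <;> rcases hb3 : β y <;>
        simp [hFj, hl', hb3] at this ⊢ <;> linarith
    · by_cases hl' : β l.1 = l.2 <;> rcases hb1 : β n <;> rcases hb2 : β (n + 1) <;>
        rcases hb3 : β y <;> simp [hFj, hl', hb3] at this ⊢ <;> linarith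

/-- Every choice of one open end, or of one satisfied literal, for each clause is realized by a
flow: `τ j = none` means that the flow of clause `j` ends in a satisfied literal. -/
theorem exists_flow (h : FlowHist N g R A live n ts) (β₀ : ℕ → Bool) (τ : ℕ → Option ℕ)
    (hτ : ∀ j ∈ R, (τ j = none ∧ ∃ l, (j, l) ∈ A ∧ β₀ l.1 = l.2) ∨
      ∃ y, τ j = some y ∧ (j, y) ∈ live) :
    ∃ β : ℕ → Bool, (∀ x < N, β x = β₀ x) ∧ (∀ p ∈ live, β p.2 = decide (τ p.1 = some p.2)) ∧
      energyOf ts β + 3 * ∑ j ∈ R, (g j : ℤ) =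
        ∑ j ∈ R, if τ j = none then 0 else (g j : ℤ) := by
  have hcongr : ∀ {R A live n ts}, FlowHist N g R A live n ts → ∀ {β β' : ℕ → Bool},
      (∀ x < n, β' x = β x) → energyOf ts β' = energyOf ts β := by
    intro R A live n ts h β β' hβ
    refine energyOf_congr fun t ht => ?_
    have := h.terms_lt t ht
    exact ⟨hβ _ (by omega), hβ _ (by omega)⟩
  induction h generalizing τ with
  | init => exact ⟨β₀, fun _ _ => rfl, by simp, by simp [energyOf]⟩
  | @root R A live n ts j h hj hg ih =>
    have hN := h.le_next
    obtain ⟨β, hβ, hlive, hE⟩ := ih τ fun i hi => by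
      refine (hτ i (Finset.mem_insert_of_mem hi)).imp id fun ⟨y, h1, h2⟩ => ⟨y, h1, ?_⟩
      rcases Finset.mem_insert.1 h2 with h2 | h2
      · exact absurd ((Prod.mk.inj h2).1 ▸ hi) hj
      · exact h2
    refine ⟨Function.update β n (decide (τ j = some n)), fun x hx => ?_, fun p hp => ?_, ?_⟩
    · rw [Function.update_of_ne (by omega), hβ x hx]
    · rcases Finset.mem_insert.1 hp with rfl | hp
      · simp
      · have := (h.live_bounds p hp).2.1
        rw [Function.update_of_ne (by omega), hlive p hp]
    · rw [Finset.sum_insert hj, Finset.sum_insert hj, energyOf_append,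
        hcongr h (fun x hx => Function.update_of_ne (by omega) _ _), mul_add]
      have h2 : energyOf [(n, n, -(2 * g j : ℤ))] (Function.update β n (decide (τ j = some n))) =
          if τ j = some n then -(2 * g j : ℤ) else 0 := by
        unfold energyOf; simp
      rw [h2]
      -- A clause that has just received its root has no attached literal yet, so its flow can only
      -- end at the root.
      have h3 : τ j = some n := by
        rcases hτ j (Finset.mem_insert_self _ _) with ⟨_, l, hl, _⟩ | ⟨y, h1, h2⟩
        · exfalso
          have hAR : ∀ {R A live n ts}, FlowHist N g R A live n ts → ∀ p ∈ A, p.1 ∈ R := by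
            intro R A live n ts h
            induction h with
            | init => simp
            | root j h hj hg ih => exact fun p hp => Finset.mem_insert_of_mem (ih p hp)
            | join j y h hy ih => exact ih
            | literal j y l h hy hl ih =>
              intro p hp
              rcases Finset.mem_insert.1 hp with rfl | hp
              exacts [(h.live_bounds _ hy).2.2, ih p hp]
          exact hj (hAR h _ hl)
        · rcases Finset.mem_insert.1 h2 with h2 | h2
          · rw [h1, (Prod.mk.inj h2).2]
          · exact absurd (h.live_bounds _ h2).2.2 hj
      simp only [h3, if_true, reduceCtorEq, if_false]
      linarith
  | @join R A live n ts j y h hy ih =>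
    have hN := h.le_next
    have hb := fun p hp => (h.live_bounds p hp).2.1
    have hyn := hb _ hy
    simp only at hyn
    have hjR := (h.live_bounds _ hy).2.2
    -- A flow that ends at one of the two new ends is, in the older network, one that ends at `y`.
    -- In the other case no unit passes `y`, and both new variables are `0`.
    by_cases hτj : τ j = some n ∨ τ j = some (n + 1)
    · obtain ⟨β, hβ, hlive, hE⟩ := ih (Function.update τ j (some y)) fun i hi => by
        by_cases hij : i = j
        · subst hij; exact Or.inr ⟨y, by simp, hy⟩
        · rw [Function.update_of_ne hij]
          refine (hτ i hi).imp id fun ⟨z, h1, h2⟩ => ⟨z, h1, ?_⟩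
          simpa [hij] using h2
      have hyβ : β y = true := by rw [hlive _ hy]; simp
      refine ⟨Function.update (Function.update β n (decide (τ j = some n))) (n + 1)
        (decide (τ j = some (n + 1))), fun x hx => ?_, fun p hp => ?_, ?_⟩
      · rw [Function.update_of_ne (by omega), Function.update_of_ne (by omega), hβ x hx]
      · simp only [Finset.mem_insert, Finset.mem_erase] at hp
        rcases hp with rfl | rfl | ⟨hne, hp⟩
        · simp
        · simp
        · have := hb _ hp
          rw [Function.update_of_ne (by omega), Function.update_of_ne (by omega), hlive p hp]
          by_cases hpj : p.1 = j
          · have : p.2 ≠ y := fun h => hne (Prod.ext hpj h)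
            rw [hpj, Function.update_self, decide_eq_decide]
            rcases hτj with h | h <;> rw [h] <;> simp [Ne.symm this] <;> omega
          · rw [Function.update_of_ne hpj]
      · rw [energyOf_append, energyOf_joinTerms,
          hcongr h (fun x hx => by
            rw [Function.update_of_ne (by omega), Function.update_of_ne (by omega)])]
        have hs : (∑ i ∈ R, if Function.update τ j (some y) i = none then 0 else (g i : ℤ)) =
            ∑ i ∈ R, if τ i = none then 0 else (g i : ℤ) := by
          refine Finset.sum_congr rfl fun i _ => ?_
          by_cases hij : i = j
          · subst hij; rcases hτj with h | h <;> simp [h]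
          · rw [Function.update_of_ne hij]
        rw [hs] at hE
        rw [← hE, Function.update_self, Function.update_of_ne (by omega : n ≠ n + 1),
          Function.update_self, Function.update_of_ne (by omega : y ≠ n + 1),
          Function.update_of_ne (by omega : y ≠ n), hyβ]
        rcases hτj with h | h <;> simp [h, bitValue]
    · push Not at hτj
      obtain ⟨β, hβ, hlive, hE⟩ := ih τ fun i hi => by
        refine (hτ i hi).imp id fun ⟨z, h1, h2⟩ => ⟨z, h1, ?_⟩
        simp only [Finset.mem_insert, Finset.mem_erase, Prod.mk.injEq] at h2
        rcases h2 with ⟨rfl, rfl⟩ | ⟨rfl, rfl⟩ | ⟨-, h2⟩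
        · exact absurd h1 hτj.1
        · exact absurd h1 hτj.2
        · exact h2
      have hyβ : β y = false := by
        rw [hlive _ hy]
        rcases hτ j hjR with ⟨h1, -⟩ | ⟨z, h1, h2⟩
        · simp [h1]
        · simp only [Finset.mem_insert, Finset.mem_erase, Prod.mk.injEq] at h2
          simp only [h1, Option.some.injEq, decide_eq_false_iff_not]
          rintro rfl
          simp at h2
          omega
      refine ⟨Function.update (Function.update β n false) (n + 1) false,
        fun x hx => ?_, fun p hp => ?_, ?_⟩
      · rw [Function.update_of_ne (by omega), Function.update_of_ne (by omega), hβ x hx]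
      · simp only [Finset.mem_insert, Finset.mem_erase] at hp
        rcases hp with rfl | rfl | ⟨hne, hp⟩
        · simp [hτj.1]
        · simp [hτj.2]
        · have := hb _ hp
          rw [Function.update_of_ne (by omega), Function.update_of_ne (by omega), hlive p hp]
      · rw [energyOf_append, energyOf_joinTerms,
          hcongr h (fun x hx => by
            rw [Function.update_of_ne (by omega), Function.update_of_ne (by omega)])]
        rw [← hE, Function.update_self, Function.update_of_ne (by omega : n ≠ n + 1),
          Function.update_self, Function.update_of_ne (by omega : y ≠ n + 1),
          Function.update_of_ne (by omega : y ≠ n), hyβ]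
        simp [bitValue]
  | @literal R A live n ts j y l h hy hl ih =>
    have hN := h.le_next
    have hb := fun p hp => (h.live_bounds p hp).2.1
    have hyn := hb _ hy
    simp only at hyn
    have hjR := (h.live_bounds _ hy).2.2
    have hother : ∀ i ∈ R, i ≠ j → (τ i = none ∧ ∃ l, (i, l) ∈ A ∧ β₀ l.1 = l.2) ∨
        ∃ y, τ i = some y ∧ (i, y) ∈ live := by
      intro i hi hij
      rcases hτ i hi with ⟨h1, l', h2, h3⟩ | ⟨z, h1, h2⟩
      · exact Or.inl ⟨h1, l', by simpa [hij] using h2, h3⟩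
      · exact Or.inr ⟨z, h1, by simpa [hij] using h2⟩
    -- A unit that continues to the new end or into the true literal `l` stopped at `y` in the older
    -- network. Entering the literal saves the price `g j` paid there, which is the last summand of
    -- `hs`.
    by_cases hcase : τ j = some (n + 1) ∨ (τ j = none ∧ β₀ l.1 = l.2)
    · obtain ⟨β, hβ, hlive, hE⟩ := ih (Function.update τ j (some y)) fun i hi => by
        by_cases hij : i = j
        · subst hij; exact Or.inr ⟨y, by simp, hy⟩
        · rw [Function.update_of_ne hij]; exact hother i hi hij
      have hyβ : β y = true := by rw [hlive _ hy]; simp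
      have hs : (∑ i ∈ R, if Function.update τ j (some y) i = none then 0 else (g i : ℤ)) =
          (∑ i ∈ R, if τ i = none then 0 else (g i : ℤ)) + if τ j = none then (g j : ℤ) else 0 := by
        rw [← Finset.add_sum_erase _ _ hjR, ← Finset.add_sum_erase _ _ hjR,
          Function.update_self]
        have : (∑ i ∈ R.erase j, if Function.update τ j (some y) i = none then 0 else (g i : ℤ)) =
            ∑ i ∈ R.erase j, if τ i = none then 0 else (g i : ℤ) :=
          Finset.sum_congr rfl fun i hi => by
            rw [Function.update_of_ne (Finset.ne_of_mem_erase hi)]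
        rw [this]
        split_ifs <;> simp_all <;> ring
      rw [hs] at hE
      refine ⟨Function.update (Function.update β n (decide (τ j = none))) (n + 1)
        (decide (τ j = some (n + 1))), fun x hx => ?_, fun p hp => ?_, ?_⟩
      · rw [Function.update_of_ne (by omega), Function.update_of_ne (by omega), hβ x hx]
      · simp only [Finset.mem_insert, Finset.mem_erase] at hp
        rcases hp with rfl | ⟨hne, hp⟩
        · simp
        · have := hb _ hp
          rw [Function.update_of_ne (by omega), Function.update_of_ne (by omega), hlive p hp]
          by_cases hpj : p.1 = j
          · have : p.2 ≠ y := fun h => hne (Prod.ext hpj h)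
            rw [hpj, Function.update_self, decide_eq_decide]
            rcases hcase with h | ⟨h, -⟩ <;> rw [h] <;> simp [Ne.symm this] <;> omega
          · rw [Function.update_of_ne hpj]
      · rw [energyOf_append, energyOf_literalTerms,
          hcongr h (fun x hx => by
            rw [Function.update_of_ne (by omega), Function.update_of_ne (by omega)])]
        rw [Function.update_self, Function.update_of_ne (by omega : n ≠ n + 1),
          Function.update_self, Function.update_of_ne (by omega : y ≠ n + 1),
          Function.update_of_ne (by omega : y ≠ n), hyβ,
          Function.update_of_ne (by omega : l.1 ≠ n + 1),
          Function.update_of_ne (by omega : l.1 ≠ n), hβ _ hl]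
        rcases hcase with h | ⟨h, h'⟩
        · simp [h, bitValue] at hE ⊢; linarith
        · simp [h, h', bitValue] at hE ⊢; linarith
    · push Not at hcase
      obtain ⟨β, hβ, hlive, hE⟩ := ih τ fun i hi => by
        by_cases hij : i = j
        · subst hij
          rcases hτ i hi with ⟨h1, l', h2, h3⟩ | ⟨z, h1, h2⟩
          · refine Or.inl ⟨h1, l', ?_, h3⟩
            rcases Finset.mem_insert.1 h2 with h2 | h2
            · rw [(Prod.mk.inj h2).2] at h3
              exact absurd h3 (hcase.2 h1)
            · exact h2
          · refine Or.inr ⟨z, h1, ?_⟩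
            simp only [Finset.mem_insert, Finset.mem_erase, Prod.mk.injEq] at h2
            rcases h2 with ⟨-, rfl⟩ | ⟨-, h2⟩
            · exact absurd h1 hcase.1
            · exact h2
        · exact hother i hi hij
      have hyβ : β y = false := by
        rw [hlive _ hy]
        rcases hτ j hjR with ⟨h1, -⟩ | ⟨z, h1, h2⟩
        · simp [h1]
        · simp only [Finset.mem_insert, Finset.mem_erase, Prod.mk.injEq] at h2
          simp only [h1, Option.some.injEq, decide_eq_false_iff_not]
          rintro rfl
          simp at h2
          omega
      refine ⟨Function.update (Function.update β n false) (n + 1) false,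
        fun x hx => ?_, fun p hp => ?_, ?_⟩
      · rw [Function.update_of_ne (by omega), Function.update_of_ne (by omega), hβ x hx]
      · simp only [Finset.mem_insert, Finset.mem_erase] at hp
        rcases hp with rfl | ⟨hne, hp⟩
        · simp [hcase.1]
        · have := hb _ hp
          rw [Function.update_of_ne (by omega), Function.update_of_ne (by omega), hlive p hp]
      · rw [energyOf_append, energyOf_literalTerms,
          hcongr h (fun x hx => by
            rw [Function.update_of_ne (by omega), Function.update_of_ne (by omega)])]
        rw [← hE, Function.update_self, Function.update_of_ne (by omega : n ≠ n + 1),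
          Function.update_self, Function.update_of_ne (by omega : y ≠ n + 1),
          Function.update_of_ne (by omega : y ≠ n), hyβ]
        simp [bitValue]

end FlowHist

/-! ### Shifted objective functions -/

/-- The values of `f'` are those of `f` shifted by `θ`, up to larger ones. -/
def Simulates (f f' : (ℕ → Bool) → ℤ) (θ : ℤ) : Prop :=
  (∀ β, f β + θ ≤ f' β) ∧ ∀ β, ∃ β', f' β' = f β + θ

theorem Simulates.refl (f : (ℕ → Bool) → ℤ) : Simulates f f 0 :=
  ⟨fun β => by simp, fun β => ⟨β, by simp⟩⟩

theorem Simulates.trans {f f' f'' : (ℕ → Bool) → ℤ} {θ θ' : ℤ} (h : Simulates f f' θ)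
    (h' : Simulates f' f'' θ') : Simulates f f'' (θ + θ') := by
  refine ⟨fun β => ?_, fun β => ?_⟩
  · have h1 := h.1 β
    have h2 := h'.1 β
    linarith
  · obtain ⟨β', h1⟩ := h.2 β
    obtain ⟨β'', h2⟩ := h'.2 β'
    exact ⟨β'', by rw [h2, h1]; ring⟩

/-- The integer function `f` stands in for the value of `I`: it agrees with it where that is finite
and is so large elsewhere that `f + θ` reaches `h`. Being integral and bounded below, it attains its
minimum. The first half of `Simulates` compares `f` and `f'` at the same assignment, so a minimizer
of `f'` is itself a minimizer of `f`. If the value of `I` is infinite everywhere, every assignment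
is optimal. -/
theorem represents_of_simulates {P Q : OptProblem} {I : P.Inst} {J : Q.Inst}
    {f f' : (ℕ → Bool) → ℤ} {θ h : ℤ} (hsim : Simulates f f' θ)
    (hval : ∀ β, P.value I β ≠ ⊤ → P.value I β = (f β : WithTop ℤ))
    (htop : ∀ β, P.value I β = ⊤ → h ≤ f β + θ)
    (hfin : (∃ β, P.value I β ≠ ⊤) → ∃ β, f β + θ < h)
    (hval' : ∀ β, Q.value J β = (f' β : WithTop ℤ)) (hbdd : ∃ c, ∀ β, c ≤ f β) :
    Represents P Q I J θ h := by
  obtain ⟨c, hc⟩ := hbdd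
  obtain ⟨m, ⟨β₁, hβ₁⟩, hmin⟩ := Int.exists_least_of_bdd (P := fun z => ∃ β, f β = z)
    ⟨c, by rintro z ⟨β, rfl⟩; exact hc β⟩ ⟨_, fun _ => false, rfl⟩
  have hmin' : ∀ β, f β₁ ≤ f β := fun β => hβ₁ ▸ hmin _ ⟨β, rfl⟩
  have hkey : (∃ β, P.value I β ≠ ⊤) → ∀ β, (∀ γ, f β ≤ f γ) → P.value I β = (f β : WithTop ℤ) ∧
      f β + θ < h := by
    intro hex β hβ
    obtain ⟨γ, hγ⟩ := hfin hex
    have h1 : f β + θ < h := by have := hβ γ; omega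
    exact ⟨hval β fun h => by have := htop β h; omega, h1⟩
  have hle : (∃ β, P.value I β ≠ ⊤) → ∀ β, (∀ γ, f β ≤ f γ) → ∀ γ, P.value I β ≤ P.value I γ := by
    intro hex β hβ γ
    by_cases hγ : P.value I γ = ⊤
    · rw [hγ]; exact le_top
    · rw [hval γ hγ, (hkey hex β hβ).1]
      exact_mod_cast hβ γ
  constructor
  · obtain ⟨β', hβ'⟩ := hsim.2 β₁
    refine ⟨P.value I β₁, Q.value J β', ⟨⟨β₁, rfl⟩, ?_⟩, ⟨⟨β', rfl⟩, ?_⟩, ?_, ?_⟩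
    · rintro _ ⟨γ, rfl⟩
      by_cases hex : ∃ β, P.value I β ≠ ⊤
      · exact hle hex β₁ hmin' γ
      · push Not at hex
        rw [hex γ]; exact le_top
    · rintro _ ⟨γ, rfl⟩
      rw [hval', hval', hβ']
      have := hsim.1 γ
      have := hmin' γ
      exact_mod_cast (by omega : f β₁ + θ ≤ f' γ)
    · rw [hval', hβ']
      constructor
      · intro hne
        exact_mod_cast (hkey ⟨_, hne⟩ β₁ hmin').2
      · intro hlt htop'
        have h1 := htop _ htop'
        have h2 : f β₁ + θ < h := by exact_mod_cast hlt
        omega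
    · intro hne
      rw [hval', hβ', hval _ hne]
      push_cast
      rfl
  · intro β hβ γ
    by_cases hex : ∃ β, P.value I β ≠ ⊤
    · refine hle hex β (fun γ => ?_) γ
      obtain ⟨γ', hγ'⟩ := hsim.2 γ
      have h1 := hβ γ'
      rw [hval', hval', hγ'] at h1
      have h2 : f' β ≤ f γ + θ := by exact_mod_cast h1
      have := hsim.1 β
      omega
    · push Not at hex
      rw [hex γ]; exact le_top

/-! ### The terms of a quadratic function as weighted clauses -/

def intCost (cs : List (List Literal × ℕ)) (β : ℕ → Bool) : ℤ :=
  (cs.map fun c => if ∀ l ∈ c.1, β l.1 ≠ l.2 then (c.2 : ℤ) else 0).sum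

@[simp] theorem intCost_append (cs ds : List (List Literal × ℕ)) (β : ℕ → Bool) :
    intCost (cs ++ ds) β = intCost cs β + intCost ds β := by
  simp [intCost]

/-- Weighted clauses for a term, where `z` is a fresh variable. -/
def satClauses (z : ℕ) (t : Term) : List (List Literal × ℕ) :=
  if 0 < t.2.2 then
    if t.1 = t.2.1 then [([(t.1, false)], t.2.2.natAbs)]
    else [([(t.1, false), (t.2.1, false)], t.2.2.natAbs)]
  else
    if t.1 = t.2.1 then [([(t.1, true)], t.2.2.natAbs)]
    else [([(z, true)], t.2.2.natAbs), ([(z, false), (t.1, true)], t.2.2.natAbs),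
      ([(z, false), (t.2.1, true)], t.2.2.natAbs)]

def satOffset (t : Term) : ℤ := if 0 < t.2.2 then 0 else -t.2.2

/-- For a positive weight the clause with both literals negated is falsified exactly when the
product is `1`. For a negative product of two different variables the clause `z` costs `|w|` if `z`
is false, and otherwise one of the other two clauses is falsified unless both variables are true.
The cheapest choice is `z = u * v`, with cost `|w| * (1 - u * v) = w * u * v + |w|`; this is the
origin of the offset. -/
theorem le_intCost_satClauses (z : ℕ) (t : Term) (β : ℕ → Bool) :
    energyOf [t] β + satOffset t ≤ intCost (satClauses z t) β := by
  obtain ⟨u, v, w⟩ := t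
  unfold satClauses satOffset intCost energyOf
  have hw1 : 0 < w → |w| = w := abs_of_pos
  have hw2 : ¬ 0 < w → |w| = -w := fun h => abs_of_nonpos (not_lt.1 h)
  by_cases hw : 0 < w <;> by_cases huv : u = v
  · subst huv; rcases h1 : β u <;> simp [h1, hw] <;> omega
  · rcases h1 : β u <;> rcases h2 : β v <;> simp [h1, h2, hw, huv] <;> omega
  · subst huv; rcases h1 : β u <;> simp [h1, hw] <;> omega
  · rcases h1 : β u <;> rcases h2 : β v <;> rcases h3 : β z <;>
      simp [h1, h2, h3, hw, huv] <;> omega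

theorem intCost_satClauses (z : ℕ) (t : Term) (β : ℕ → Bool) (hz : β z = (β t.1 && β t.2.1)) :
    intCost (satClauses z t) β = energyOf [t] β + satOffset t := by
  obtain ⟨u, v, w⟩ := t
  unfold satClauses satOffset intCost energyOf
  simp only at hz
  have hw1 : 0 < w → |w| = w := abs_of_pos
  have hw2 : ¬ 0 < w → |w| = -w := fun h => abs_of_nonpos (not_lt.1 h)
  by_cases hw : 0 < w <;> by_cases huv : u = v
  · subst huv; rcases h1 : β u <;> simp [h1, hw] <;> omega
  · rcases h1 : β u <;> rcases h2 : β v <;> simp [h1, h2, hw, huv] <;> omega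
  · subst huv; rcases h1 : β u <;> simp [h1, hw] <;> omega
  · rcases h1 : β u <;> rcases h2 : β v <;> simp [h1, h2, hz, hw, huv] <;> omega

def satFormula (Z : ℕ) (ts : List Term) : List (List Literal × ℕ) :=
  ts.zipIdx.flatMap fun p => satClauses (Z + p.2) p.1

def satOffsets (ts : List Term) : ℤ := (ts.map satOffset).sum

theorem satFormula_append_singleton (Z : ℕ) (ts : List Term) (t : Term) :
    satFormula Z (ts ++ [t]) = satFormula Z ts ++ satClauses (Z + ts.length) t := by
  simp [satFormula, List.zipIdx_append]

theorem satOffsets_append_singleton (ts : List Term) (t : Term) :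
    satOffsets (ts ++ [t]) = satOffsets ts + satOffset t := by
  simp [satOffsets]

theorem mem_satFormula {Z : ℕ} {ts : List Term} {c : List Literal × ℕ}
    (hc : c ∈ satFormula Z ts) : ∃ (i : ℕ) (hi : i < ts.length), c ∈ satClauses (Z + i) ts[i] := by
  obtain ⟨⟨t, i⟩, hp, hc⟩ := List.mem_flatMap.1 hc
  obtain ⟨hi, rfl⟩ := List.getElem?_eq_some_iff.1 (List.mk_mem_zipIdx_iff_getElem?.1 hp)
  exact ⟨i, hi, hc⟩

/-- The properties of the terms of a Hamiltonian with variables below `Z`. -/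
structure ValidTerms (Z : ℕ) (ts : List Term) : Prop where
  upper : ∀ t ∈ ts, t.1 ≤ t.2.1
  lt : ∀ t ∈ ts, t.2.1 < Z
  nonzero : ∀ t ∈ ts, t.2.2 ≠ 0
  distinct : ts.Pairwise fun s t => (s.1, s.2.1) ≠ (t.1, t.2.1)

theorem satFormula_congr {Z : ℕ} {ts : List Term} (h : ∀ t ∈ ts, t.1 < Z ∧ t.2.1 < Z)
    {β β' : ℕ → Bool} (hβ : ∀ x < Z + ts.length, β x = β' x) :
    intCost (satFormula Z ts) β = intCost (satFormula Z ts) β' := by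
  unfold intCost
  congr 1
  refine List.map_congr_left fun c hc => ?_
  have : (∀ l ∈ c.1, β l.1 ≠ l.2) ↔ ∀ l ∈ c.1, β' l.1 ≠ l.2 := by
    refine forall₂_congr fun l hl => ?_
    rw [hβ]
    obtain ⟨i, hi, hc⟩ := mem_satFormula hc
    have h1 := h _ (List.getElem_mem hi)
    unfold satClauses at hc
    split_ifs at hc <;> simp only [List.mem_cons, List.not_mem_nil, or_false] at hc
    · subst hc; rw [List.mem_singleton.1 hl]; simp only; omega
    · subst hc
      simp only [List.mem_cons, List.not_mem_nil, or_false] at hl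
      rcases hl with rfl | rfl <;> simp only <;> omega
    · subst hc; rw [List.mem_singleton.1 hl]; simp only; omega
    · rcases hc with rfl | rfl | rfl <;>
        simp only [List.mem_cons, List.not_mem_nil, or_false] at hl
      · subst hl; simp only; omega
      · rcases hl with rfl | rfl <;> simp only <;> omega
      · rcases hl with rfl | rfl <;> simp only <;> omega
  simp only [this]

theorem simulates_satFormula {Z : ℕ} {ts : List Term} (h : ∀ t ∈ ts, t.1 < Z ∧ t.2.1 < Z) :
    Simulates (energyOf ts) (intCost (satFormula Z ts)) (satOffsets ts) := by
  constructor
  · intro β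
    induction ts using List.reverseRecOn with
    | nil => simp [energyOf, satOffsets, satFormula, intCost]
    | append_singleton ts t ih =>
      have h1 := ih fun t ht => h t (by simp [ht])
      have h2 := le_intCost_satClauses (Z + ts.length) t β
      rw [satFormula_append_singleton, satOffsets_append_singleton, energyOf_append,
        intCost_append]
      linarith
  · intro β
    suffices ∃ β' : ℕ → Bool, (∀ x < Z, β' x = β x) ∧
        intCost (satFormula Z ts) β' = energyOf ts β + satOffsets ts by
      obtain ⟨β', -, h'⟩ := this
      exact ⟨β', h'⟩
    induction ts using List.reverseRecOn with
    | nil => exact ⟨β, fun _ _ => rfl, by simp [energyOf, satOffsets, satFormula, intCost]⟩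
    | append_singleton ts t ih =>
      have hts : ∀ t ∈ ts, t.1 < Z ∧ t.2.1 < Z := fun t ht => h t (by simp [ht])
      obtain ⟨β', hβ', hE⟩ := ih hts
      have ht := h t (by simp)
      refine ⟨Function.update β' (Z + ts.length) (β t.1 && β t.2.1), fun x hx => ?_, ?_⟩
      · rw [Function.update_of_ne (by omega), hβ' x hx]
      · rw [satFormula_append_singleton, satOffsets_append_singleton, energyOf_append,
          intCost_append, satFormula_congr (β' := β') hts fun x hx => by
            rw [Function.update_of_ne (by omega)], hE, intCost_satClauses]
        · rw [energyOf_congr (x := Function.update β' _ _) (y := β) fun s hs => ?_]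
          · ring
          · rw [List.mem_singleton.1 hs, Function.update_of_ne (by omega),
              Function.update_of_ne (by omega), hβ' _ ht.1, hβ' _ ht.2]
            exact ⟨rfl, rfl⟩
        · rw [Function.update_self, Function.update_of_ne (by omega),
            Function.update_of_ne (by omega), hβ' _ ht.1, hβ' _ ht.2]

def clauseScope (c : List Literal × ℕ) : Finset ℕ := (c.1.map Prod.fst).toFinset

theorem scope_satClauses {z : ℕ} {t : Term} {c : List Literal × ℕ} (hc : c ∈ satClauses z t) :
    clauseScope c = {t.1, t.2.1} ∨ (t.1 ≠ t.2.1 ∧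
      (clauseScope c = {z} ∨ clauseScope c = {z, t.1} ∨ clauseScope c = {z, t.2.1})) := by
  unfold satClauses at hc
  split_ifs at hc with h1 h2 h2 <;> simp only [List.mem_cons, List.not_mem_nil, or_false] at hc
  · subst hc; left; simp [clauseScope, h2]
  · subst hc; left; simp [clauseScope]
  · subst hc; left; simp [clauseScope, h2]
  · rcases hc with rfl | rfl | rfl <;> right <;> simp [clauseScope, h2]

theorem length_satClauses {z : ℕ} {t : Term} : ∀ c ∈ satClauses z t, c.1.length ≤ 2 := by
  intro c hc
  unfold satClauses at hc
  split_ifs at hc with h1 h2 h2 <;> simp only [List.mem_cons, List.not_mem_nil, or_false] at hc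
  · subst hc; simp
  · subst hc; simp
  · subst hc; simp
  · rcases hc with rfl | rfl | rfl <;> simp

theorem pair_eq_of_le {a b c d : ℕ} (h1 : a ≤ b) (h2 : c ≤ d)
    (h : ({a, b} : Finset ℕ) = {c, d}) : a = c ∧ b = d := by
  have ha : a ∈ ({c, d} : Finset ℕ) := h ▸ by simp
  have hb : b ∈ ({c, d} : Finset ℕ) := h ▸ by simp
  have hc : c ∈ ({a, b} : Finset ℕ) := h ▸ by simp
  have hd : d ∈ ({a, b} : Finset ℕ) := h ▸ by simp
  simp only [Finset.mem_insert, Finset.mem_singleton] at ha hb hc hd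
  omega

theorem clauseScope_congr {c d : List Literal × ℕ} (h : c.1.toFinset = d.1.toFinset) :
    clauseScope c = clauseScope d := by
  have : ∀ c : List Literal × ℕ, clauseScope c = c.1.toFinset.image Prod.fst := by
    intro c; ext x; simp [clauseScope]
  rw [this, this, h]

/-- It suffices to compare the variable sets. A clause of the `i`-th term either contains `Z + i`,
which occurs in no clause of another term, or has exactly the variables of the term, and these pairs
are distinct by hypothesis. -/
theorem satFormula_distinct {Z : ℕ} {ts : List Term} (h : ValidTerms Z ts) :
    (satFormula Z ts).Pairwise fun c d => c.1.toFinset ≠ d.1.toFinset := by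
  unfold satFormula
  rw [List.pairwise_flatMap]
  constructor
  · rintro ⟨t, i⟩ hp
    obtain ⟨hi, rfl⟩ := List.getElem?_eq_some_iff.1 (List.mk_mem_zipIdx_iff_getElem?.1 hp)
    have hm := List.getElem_mem hi
    have h1 := h.lt _ hm
    have h2 := h.upper _ hm
    suffices (satClauses (Z + i) ts[i]).Pairwise fun c d => clauseScope c ≠ clauseScope d from
      this.imp fun hne he => hne (clauseScope_congr he)
    unfold satClauses
    split_ifs with h3 h4 h4
    · simp
    · simp
    · simp
    · simp only [List.pairwise_cons, List.mem_cons, List.not_mem_nil, or_false, forall_eq_or_imp,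
        forall_eq, clauseScope, List.map_cons, List.map_nil, List.toFinset_cons,
        List.toFinset_nil, IsEmpty.forall_iff, implies_true, List.Pairwise.nil, and_true,
        insert_empty_eq]
      refine ⟨⟨fun he => ?_, fun he => ?_⟩, fun he => ?_⟩
      · have : ts[i].1 ∈ ({Z + i} : Finset ℕ) := he ▸ by simp
        simp at this; omega
      · have : ts[i].2.1 ∈ ({Z + i} : Finset ℕ) := he ▸ by simp
        simp at this; omega
      · have : ts[i].1 ∈ ({Z + i, ts[i].2.1} : Finset ℕ) := he ▸ by simp
        simp at this; omega
  · rw [List.pairwise_iff_getElem]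
    intro i j hi hj hij c hc d hd he
    replace he := clauseScope_congr he
    simp only [List.length_zipIdx] at hi hj
    simp only [List.getElem_zipIdx, Nat.zero_add] at hc hd
    have mi := List.getElem_mem hi
    have mj := List.getElem_mem hj
    have li := h.lt _ mi
    have lj := h.lt _ mj
    have ui := h.upper _ mi
    have uj := h.upper _ mj
    have hzi : ∀ x ∈ clauseScope c, x < Z ∨ x = Z + i := by
      intro x hx
      rcases scope_satClauses hc with h1 | ⟨-, h1 | h1 | h1⟩ <;> rw [h1] at hx <;>
        simp only [Finset.mem_insert, Finset.mem_singleton] at hx <;> omega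
    have hzj : ∀ x ∈ clauseScope d, x < Z ∨ x = Z + j := by
      intro x hx
      rcases scope_satClauses hd with h1 | ⟨-, h1 | h1 | h1⟩ <;> rw [h1] at hx <;>
        simp only [Finset.mem_insert, Finset.mem_singleton] at hx <;> omega
    have hni : Z + i ∉ clauseScope c := fun hm => by have := hzj _ (he ▸ hm); omega
    have hnj : Z + j ∉ clauseScope d := fun hm => by have := hzi _ (he.symm ▸ hm); omega
    rcases scope_satClauses hc with h1 | ⟨-, h1 | h1 | h1⟩
    · rcases scope_satClauses hd with h2 | ⟨-, h2 | h2 | h2⟩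
      · rw [h1, h2] at he
        have := pair_eq_of_le ui uj he
        exact (List.pairwise_iff_getElem.1 h.distinct i j hi hj hij) (Prod.ext this.1 this.2)
      all_goals exact hnj (by rw [h2]; simp)
    all_goals exact hni (by rw [h1]; simp)

theorem satFormula_nodup {Z : ℕ} {ts : List Term} (h : ValidTerms Z ts) :
    ∀ c ∈ satFormula Z ts, c.1.Nodup := by
  intro c hc
  obtain ⟨i, hi, hc⟩ := mem_satFormula hc
  have hm := List.getElem_mem hi
  have h1 := h.lt _ hm
  have h2 := h.upper _ hm
  unfold satClauses at hc
  split_ifs at hc with h3 h4 h4 <;> simp only [List.mem_cons, List.not_mem_nil, or_false] at hc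
  · subst hc; simp
  · subst hc; simp [h4]
  · subst hc; simp
  · rcases hc with rfl | rfl | rfl <;> simp

/-- The auxiliary variable of a term enters in a leaf with the two variables of the term. Such a
leaf has at most three elements, so width `2` suffices. -/
theorem exists_built_satFormula {Z w : ℕ} {ts : List Term} (h : ValidTerms Z ts) (hw : 2 ≤ w)
    {L : List (Finset ℕ)} (hL : Built w L) (hlt : ∀ B ∈ L, ∀ x ∈ B, x < Z)
    (hcov : ∀ t ∈ ts, ∃ B ∈ L, t.1 ∈ B ∧ t.2.1 ∈ B) :
    ∃ L', Built w L' ∧ ∀ c ∈ satFormula Z ts, ∃ B ∈ L', clauseScope c ⊆ B := by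
  suffices ∃ L', Built w L' ∧ (∀ B ∈ L, B ∈ L') ∧ (∀ B ∈ L', ∀ x ∈ B, x < Z + ts.length) ∧
      ∀ c ∈ satFormula Z ts, ∃ B ∈ L', clauseScope c ⊆ B by
    obtain ⟨L', h1, -, -, h2⟩ := this
    exact ⟨L', h1, h2⟩
  have hlt' : ∀ t ∈ ts, t.1 < Z ∧ t.2.1 < Z := fun t ht =>
    ⟨(h.upper t ht).trans_lt (h.lt t ht), h.lt t ht⟩
  clear h
  induction ts using List.reverseRecOn with
  | nil => exact ⟨L, hL, fun _ => id, by simpa using hlt, by simp [satFormula]⟩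
  | append_singleton ts t ih =>
    obtain ⟨L', h1, h2, h3, h4⟩ := ih (fun t ht => hcov t (by simp [ht]))
      fun t ht => hlt' t (by simp [ht])
    obtain ⟨A, hA, ha, hb⟩ := hcov t (by simp)
    refine ⟨{t.1, t.2.1, Z + ts.length} :: L', .cons h1 (h2 A hA) ?_ ?_, ?_, ?_, ?_⟩
    · exact Finset.card_le_three.trans (by omega)
    · intro v hv
      simp only [Finset.mem_insert, Finset.mem_singleton] at hv
      rcases hv with rfl | rfl | rfl
      · exact Or.inl ha
      · exact Or.inl hb
      · exact Or.inr fun C hC hm => by have := h3 C hC _ hm; omega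
    · exact fun B hB => List.mem_cons_of_mem _ (h2 B hB)
    · have := hlt' t (by simp)
      intro B hB x hx
      simp only [List.length_append, List.length_singleton]
      rcases List.mem_cons.1 hB with rfl | hB
      · simp only [Finset.mem_insert, Finset.mem_singleton] at hx
        omega
      · have := h3 B hB x hx; omega
    · intro c hc
      rw [satFormula_append_singleton] at hc
      rcases List.mem_append.1 hc with hc | hc
      · obtain ⟨B, hB, h⟩ := h4 c hc
        exact ⟨B, List.mem_cons_of_mem _ hB, h⟩
      · refine ⟨_, List.mem_cons_self, fun x hx => ?_⟩
        rcases scope_satClauses hc with h1 | ⟨-, h1 | h1 | h1⟩ <;> rw [h1] at hx <;>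
          simp only [Finset.mem_insert, Finset.mem_singleton] at hx ⊢ <;> tauto

/-! ### Writing down a quadratic function as an instance of a problem -/

/-- How terms are written down as an instance of `Q`: the words (without their number in front),
the number in front, and the offset; `Z` bounds the variables of the terms. -/
structure Target (Q : OptProblem) where
  enc : ℕ → List Term → List ℤ
  count : ℕ → List Term → ℕ
  offset : List Term → ℤ
  exists_inst : ∀ Z ts, ValidTerms Z ts → ∃ J : Q.Inst,
    Q.words J = (count Z ts : ℤ) :: enc Z ts ∧
    (∃ f', (∀ β, Q.value J β = ((f' β : ℤ) : WithTop ℤ)) ∧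
      Simulates (energyOf ts) f' (offset ts)) ∧
    (∀ w, 2 ≤ w → ∀ L, Built w L → (∀ B ∈ L, ∀ x ∈ B, x < Z) →
      (∀ t ∈ ts, ∃ B ∈ L, t.1 ∈ B ∧ t.2.1 ∈ B) → Q.tw J ≤ w ∧ Q.itw J ≤ w) ∧
    (ts = [] → Q.itw J = 0)

theorem itw_nil {Q : OptProblem} {J : Q.Inst} (h : Q.scopes J = []) : Q.itw J = 0 := by
  unfold OptProblem.itw
  rw [h]
  exact Nat.le_zero.1 (treewidth_incidenceGraph_le (w := 0) .nil (by simp) (by simp))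

def quboTarget : Target qubo where
  enc _ ts := ts.flatMap fun t => [(t.1 : ℤ), (t.2.1 : ℤ), t.2.2]
  count _ ts := ts.length
  offset _ := 0
  exists_inst Z ts h := by
    refine ⟨(⟨ts, h.upper, h.nonzero, h.distinct⟩ : QUBO), rfl,
      ⟨energyOf ts, fun β => rfl, Simulates.refl _⟩, ?_, ?_⟩
    · intro w hw L hL hlt hcov
      have hS : ∀ s ∈ qubo.scopes (⟨ts, h.upper, h.nonzero, h.distinct⟩ : QUBO),
          ∃ B ∈ L, s ⊆ B := by
        intro s hs
        obtain ⟨t, ht, rfl⟩ := List.mem_map.1 hs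
        obtain ⟨B, hB, h1, h2⟩ := hcov t ht
        exact ⟨B, hB, by simp [Finset.insert_subset_iff, h1, h2]⟩
      refine ⟨treewidth_primalGraph_le hL hS, treewidth_incidenceGraph_le hL ?_ hS⟩
      intro s hs
      obtain ⟨t, ht, rfl⟩ := List.mem_map.1 hs
      exact Finset.card_le_two.trans hw
    · rintro rfl
      exact itw_nil rfl

def clauseWords (c : List Literal × ℕ) : List ℤ :=
  (c.1.length : ℤ) :: (c.2 : ℤ) :: c.1.map literalWord

theorem value_of_finite (cs : List (List Literal × ℕ)) (β : ℕ → Bool) :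
    ENat.map (fun n : ℕ => (n : ℤ)) ((cs.map fun c => (c.1, (c.2 : ℕ∞))).map fun c =>
      if ∀ l ∈ c.1, β l.1 ≠ l.2 then c.2 else 0).sum = (intCost cs β : WithTop ℤ) := by
  have : ((cs.map fun c => (c.1, (c.2 : ℕ∞))).map fun c =>
      if ∀ l ∈ c.1, β l.1 ≠ l.2 then c.2 else 0).sum =
      (((cs.map fun c => if ∀ l ∈ c.1, β l.1 ≠ l.2 then c.2 else 0).sum : ℕ) : ℕ∞) := by
    induction cs with
    | nil => simp
    | cons c cs ih =>
      simp only [List.map_cons, List.sum_cons, ih]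
      push_cast
      split_ifs <;> simp
  rw [this, ENat.map_natCast]
  congr 1
  clear this
  unfold intCost
  rw [Nat.cast_list_sum, List.map_map]
  congr 1
  refine List.map_congr_left fun c _ => ?_
  simp only [Function.comp]
  split_ifs <;> simp

def max2SATTarget : Target max2SAT where
  enc Z ts := (satFormula Z ts).flatMap clauseWords
  count Z ts := (satFormula Z ts).length
  offset := satOffsets
  exists_inst Z ts h := by
    let φ : WCNF :=
      { clauses := (satFormula Z ts).map fun c => (c.1, (c.2 : ℕ∞))
        literals_nodup := by
          intro c hc
          obtain ⟨d, hd, rfl⟩ := List.mem_map.1 hc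
          exact satFormula_nodup h d hd
        clauses_distinct := by
          rw [List.pairwise_map]
          exact satFormula_distinct h }
    have hlen : ∀ c ∈ φ.clauses, c.1.length ≤ 2 := by
      intro c hc
      obtain ⟨d, hd, rfl⟩ := List.mem_map.1 hc
      obtain ⟨p, _, hd⟩ := List.mem_flatMap.1 hd
      exact length_satClauses d hd
    have hscopes : φ.scopes = (satFormula Z ts).map clauseScope := by
      simp [WCNF.scopes, φ, clauseScope]
    have hlt : ∀ t ∈ ts, t.1 < Z ∧ t.2.1 < Z := fun t ht =>
      ⟨(h.upper t ht).trans_lt (h.lt t ht), h.lt t ht⟩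
    refine ⟨(⟨φ, hlen⟩ : {φ : WCNF // ∀ c ∈ φ.clauses, c.1.length ≤ 2}), ?_,
      ⟨_, fun β => value_of_finite _ β, simulates_satFormula hlt⟩, ?_, ?_⟩
    · change φ.words = _
      simp [WCNF.words, φ, List.flatMap_map, weightWord]
      rfl
    · intro w hw L hL hlt hcov
      obtain ⟨L', hL', hB⟩ := exists_built_satFormula h hw hL hlt hcov
      have hS : ∀ s ∈ φ.scopes, ∃ B ∈ L', s ⊆ B := by
        intro s hs
        rw [hscopes] at hs
        obtain ⟨t, ht, rfl⟩ := List.mem_map.1 hs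
        exact hB t ht
      refine ⟨treewidth_primalGraph_le hL' hS, treewidth_incidenceGraph_le hL' ?_ hS⟩
      intro s hs
      obtain ⟨c, hc, rfl⟩ := List.mem_map.1 hs
      refine (List.toFinset_card_le _).trans ?_
      rw [List.length_map]
      exact (hlen c hc).trans hw
    · rintro rfl
      exact itw_nil (by change φ.scopes = []; rw [hscopes]; rfl)

/-! ### The construction of the Hamiltonian -/

/-- The state of the construction: the next fresh variable, the open ends (by slot), for every
variable and every clause the slots of the first node that contains it, and the terms. -/
structure BuildState where
  next : ℕ
  cur : ℕ → ℕ
  topVar : ℕ → ℕ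
  topClause : ℕ → ℕ
  terms : List Term

namespace BuildState

def init (N : ℕ) : BuildState := ⟨N, fun _ => 0, fun _ => 0, fun _ => 0, []⟩

/-- The slot `j` itself, with base `0`, holds the root until a node with the clause is met. Clauses
of weight `0` are skipped throughout, as terms must be nonzero. -/
def rootStep (g : ℕ → ℕ) (σ : BuildState) (j : ℕ) : BuildState :=
  if g j = 0 then σ else
    { σ with
      next := σ.next + 1
      cur := Function.update σ.cur j σ.next
      terms := σ.terms ++ [(σ.next, σ.next, -(2 * g j : ℤ))] }

/-- The end of the parent branches: one part is handed down to the new node, the other stays with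
the parent for its own literals and its further children. -/
def joinStep (g : ℕ → ℕ) (b pb j : ℕ) (σ : BuildState) : BuildState :=
  { σ with
    next := σ.next + 2
    cur := Function.update (Function.update σ.cur (b + j) σ.next) (pb + j) (σ.next + 1)
    terms := σ.terms ++ joinTerms (σ.cur (pb + j)) σ.next (g j) }

def moveStep (b j : ℕ) (σ : BuildState) : BuildState :=
  { σ with
    topClause := Function.update σ.topClause j b
    cur := Function.update σ.cur (b + j) (σ.cur j) }

/-- Process an element of a bag; `b` and `pb` are the first slots of the node and of its
parent. -/
def bagStep (g : ℕ → ℕ) (b pb : ℕ) (σ : BuildState) (v : ℤ) : BuildState :=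
  if 0 ≤ v then
    if σ.topVar v.toNat = 0 then { σ with topVar := Function.update σ.topVar v.toNat b } else σ
  else if g (-1 - v).toNat = 0 then σ
  else if σ.topClause (-1 - v).toNat = 0 then σ.moveStep b (-1 - v).toNat
  else σ.joinStep g b pb (-1 - v).toNat

/-- The nodes with the variable and the nodes with the clause form two subtrees that intersect. The
top node of the intersection is the later one of the two top nodes, and bases increase with the
index of the node. If no nodes are given, both bases are `0` and the slot is `j`. -/
def literalSlot (σ : BuildState) (j : ℕ) (l : Literal) : ℕ :=
  max (σ.topVar l.1) (σ.topClause j) + j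

def literalStep (g : ℕ → ℕ) (j : ℕ) (σ : BuildState) (l : Literal) : BuildState :=
  if g j = 0 then σ else
    { σ with
      next := σ.next + 2
      cur := Function.update σ.cur (σ.literalSlot j l) (σ.next + 1)
      terms := σ.terms ++ literalTerms (σ.cur (σ.literalSlot j l)) σ.next (g j) l }

def roots (g : ℕ → ℕ) (σ : BuildState) (m : ℕ) : BuildState :=
  (List.range m).foldl (rootStep g) σ

def node (g : ℕ → ℕ) (m : ℕ) (σ : BuildState) (p : (ℕ × List ℤ) × ℕ) : BuildState :=
  p.1.2.foldl (bagStep g (m * (p.2 + 1)) (m * (p.1.1 + 1))) σ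

def nodes (g : ℕ → ℕ) (m : ℕ) (σ : BuildState) (ns : List (ℕ × List ℤ)) : BuildState :=
  ns.zipIdx.foldl (node g m) σ

def clause (g : ℕ → ℕ) (σ : BuildState) (p : List Literal × ℕ) : BuildState :=
  p.1.foldl (literalStep g p.2) σ

def clauses (g : ℕ → ℕ) (σ : BuildState) (cs : List (List Literal)) : BuildState :=
  cs.zipIdx.foldl (clause g) σ

/-- Bounds on all numbers in the state. -/
structure Small (G T : ℕ) (σ : BuildState) : Prop where
  weight_le : ∀ t ∈ σ.terms, |t.2.2| ≤ 2 * G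
  lt_next : ∀ t ∈ σ.terms, t.1 < σ.next ∧ t.2.1 < σ.next
  cur_le : ∀ s, σ.cur s ≤ σ.next
  topVar_le : ∀ x, σ.topVar x ≤ T
  topClause_le : ∀ x, σ.topClause x ≤ T

/-- The number `k` counts elementary steps. Attaching a literal is the most expensive one, with two
variables and six terms. -/
structure Grows (k : ℕ) (σ σ' : BuildState) : Prop where
  le_next : σ.next ≤ σ'.next
  next_le : σ'.next ≤ σ.next + 2 * k
  length_le : σ'.terms.length ≤ σ.terms.length + 6 * k

theorem Grows.refl (σ : BuildState) : Grows 0 σ σ := ⟨le_rfl, by simp, by simp⟩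

theorem Grows.mono {k k' : ℕ} (hk : k ≤ k') {σ σ' : BuildState} (h : Grows k σ σ') :
    Grows k' σ σ' :=
  ⟨h.1, h.2.trans (by omega), h.3.trans (by omega)⟩

theorem Grows.trans {k k' : ℕ} {σ σ' σ'' : BuildState} (h : Grows k σ σ') (h' : Grows k' σ' σ'') :
    Grows (k + k') σ σ'' :=
  ⟨h.1.trans h'.1, by have := h.2; have := h'.2; omega, by have := h.3; have := h'.3; omega⟩

theorem small_init (G T N : ℕ) : Small G T (init N) :=
  ⟨by simp [init], by simp [init], by simp [init], by simp [init], by simp [init]⟩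

theorem grows_foldl {α : Type} (f : BuildState → α → BuildState) (k : α → ℕ)
    (hf : ∀ σ a, Grows (k a) σ (f σ a)) (l : List α) (σ : BuildState) :
    Grows (l.map k).sum σ (l.foldl f σ) := by
  induction l generalizing σ with
  | nil => exact Grows.refl σ
  | cons a l ih => exact (hf σ a).trans (ih _)

theorem grows_rootStep (g : ℕ → ℕ) (σ : BuildState) (j : ℕ) : Grows 1 σ (rootStep g σ j) := by
  unfold rootStep
  split_ifs
  · exact (Grows.refl σ).mono (by omega)
  · exact ⟨by simp, by simp, by simp⟩

theorem grows_bagStep (g : ℕ → ℕ) (b pb : ℕ) (σ : BuildState) (v : ℤ) :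
    Grows 1 σ (bagStep g b pb σ v) := by
  unfold bagStep
  split_ifs
  · exact ⟨by simp, by simp, by simp⟩
  · exact (Grows.refl σ).mono (by omega)
  · exact (Grows.refl σ).mono (by omega)
  · exact ⟨by simp [moveStep], by simp [moveStep], by simp [moveStep]⟩
  · exact ⟨by simp [joinStep], by simp [joinStep], by simp [joinStep, joinTerms, triangle]⟩

theorem grows_literalStep (g : ℕ → ℕ) (j : ℕ) (σ : BuildState) (l : Literal) :
    Grows 1 σ (literalStep g j σ l) := by
  unfold literalStep
  split_ifs
  · exact (Grows.refl σ).mono (by omega)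
  · exact ⟨by simp, by simp, by simp [literalTerms, triangle]⟩

theorem grows_roots (g : ℕ → ℕ) (σ : BuildState) (m : ℕ) : Grows m σ (roots g σ m) := by
  simpa [roots] using grows_foldl (rootStep g) (fun _ => 1) (grows_rootStep g) (List.range m) σ

theorem grows_bag (g : ℕ → ℕ) (b pb : ℕ) (l : List ℤ) (σ : BuildState) :
    Grows l.length σ (l.foldl (bagStep g b pb) σ) := by
  simpa using grows_foldl (bagStep g b pb) (fun _ => 1) (grows_bagStep g b pb) l σ

theorem grows_nodes (g : ℕ → ℕ) (m : ℕ) (σ : BuildState) (ns : List (ℕ × List ℤ)) :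
    Grows (ns.map fun n => n.2.length).sum σ (nodes g m σ ns) := by
  have := grows_foldl (node g m) (fun p => p.1.2.length) (fun σ p => grows_bag _ _ _ _ _)
    ns.zipIdx σ
  have h : ns.zipIdx.map (fun p => p.1.2.length) =
      (ns.zipIdx.map Prod.fst).map fun n => n.2.length := by rw [List.map_map]; rfl
  rwa [h, List.zipIdx_map_fst] at this

theorem grows_literals (g : ℕ → ℕ) (j : ℕ) (l : List Literal) (σ : BuildState) :
    Grows l.length σ (l.foldl (literalStep g j) σ) := by
  simpa using grows_foldl (literalStep g j) (fun _ => 1) (grows_literalStep g j) l σ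

theorem grows_clauses (g : ℕ → ℕ) (σ : BuildState) (cs : List (List Literal)) :
    Grows (cs.map List.length).sum σ (clauses g σ cs) := by
  have := grows_foldl (clause g) (fun p => p.1.length) (fun σ p => grows_literals _ _ _ _)
    cs.zipIdx σ
  have h : cs.zipIdx.map (fun p => p.1.length) = (cs.zipIdx.map Prod.fst).map List.length := by
    rw [List.map_map]; rfl
  rwa [h, List.zipIdx_map_fst] at this

variable {g : ℕ → ℕ} {G T : ℕ} {σ : BuildState}

theorem Small.rootStep (hg : ∀ j, g j ≤ G) (h : Small G T σ) (j : ℕ) :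
    Small G T (rootStep g σ j) := by
  unfold BuildState.rootStep
  split_ifs
  · exact h
  have hgj : (g j : ℤ) ≤ G := by exact_mod_cast hg j
  refine ⟨?_, ?_, ?_, h.4, h.5⟩
  · intro t ht
    rcases List.mem_append.1 ht with ht | ht
    · exact h.1 t ht
    · rw [List.mem_singleton.1 ht, abs_neg, abs_of_nonneg (by positivity)]
      linarith
  · intro t ht
    rcases List.mem_append.1 ht with ht | ht
    · have := h.2 t ht; simp only; omega
    · rw [List.mem_singleton.1 ht]; simp
  · intro s
    by_cases hs : s = j
    · subst hs; simp
    · simp only [Function.update_of_ne hs]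
      have := h.3 s; omega

theorem Small.moveStep (h : Small G T σ) {b : ℕ} (hb : b ≤ T) (j : ℕ) :
    Small G T (σ.moveStep b j) := by
  refine ⟨h.1, h.2, fun s => ?_, h.4, fun x => ?_⟩
  · unfold BuildState.moveStep
    simp only [Function.update_apply]
    split_ifs
    exacts [h.3 _, h.3 _]
  · unfold BuildState.moveStep
    simp only [Function.update_apply]
    split_ifs
    exacts [hb, h.5 _]

theorem Small.joinStep (hg : ∀ j, g j ≤ G) (h : Small G T σ) (b pb j : ℕ) :
    Small G T (σ.joinStep g b pb j) := by
  have hgj : (g j : ℤ) ≤ G := by exact_mod_cast hg j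
  have h0 : (0 : ℤ) ≤ g j := Int.natCast_nonneg _
  refine ⟨?_, ?_, ?_, h.4, h.5⟩
  · intro t ht
    rcases List.mem_append.1 ht with ht | ht
    · exact h.1 t ht
    · simp only [joinTerms, triangle, List.mem_cons, List.not_mem_nil, or_false] at ht
      rcases ht with rfl | rfl | rfl | rfl | rfl <;> simp only [abs_le] <;> constructor <;> linarith
  · intro t ht
    have hc := h.3 (pb + j)
    rcases List.mem_append.1 ht with ht | ht
    · have := h.2 t ht; simp only [BuildState.joinStep]; omega
    · simp only [joinTerms, triangle, List.mem_cons, List.not_mem_nil, or_false] at ht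
      rcases ht with rfl | rfl | rfl | rfl | rfl <;> simp only [BuildState.joinStep] <;> omega
  · intro s
    have hc := h.3 s
    simp only [BuildState.joinStep, Function.update_apply]
    split_ifs <;> omega

theorem Small.bagStep (hg : ∀ j, g j ≤ G) (h : Small G T σ) {b : ℕ} (hb : b ≤ T) (pb : ℕ)
    (v : ℤ) : Small G T (bagStep g b pb σ v) := by
  unfold BuildState.bagStep
  split_ifs
  · refine ⟨h.1, h.2, h.3, fun x => ?_, h.5⟩
    simp only [Function.update_apply]
    split_ifs
    exacts [hb, h.4 _]
  · exact h
  · exact h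
  · exact h.moveStep hb _
  · exact h.joinStep hg _ _ _

theorem Small.literalStep (hg : ∀ j, g j ≤ G) (h : Small G T σ) (j : ℕ) {l : Literal}
    (hl : l.1 ≤ σ.next) : Small G T (literalStep g j σ l) := by
  unfold BuildState.literalStep
  split_ifs
  · exact h
  have hgj : (g j : ℤ) ≤ G := by exact_mod_cast hg j
  have h0 : (0 : ℤ) ≤ g j := Int.natCast_nonneg _
  refine ⟨?_, ?_, ?_, h.4, h.5⟩
  · intro t ht
    rcases List.mem_append.1 ht with ht | ht
    · exact h.1 t ht
    · simp only [literalTerms, triangle, List.mem_cons, List.not_mem_nil, or_false,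
        List.cons_append, List.nil_append] at ht
      rcases ht with rfl | rfl | rfl | rfl | rfl | rfl <;> simp only [abs_le] <;>
        (try split_ifs) <;> constructor <;> linarith
  · intro t ht
    have hc := h.3 (σ.literalSlot j l)
    rcases List.mem_append.1 ht with ht | ht
    · have := h.2 t ht; simp only; omega
    · simp only [literalTerms, triangle, List.mem_cons, List.not_mem_nil, or_false,
        List.cons_append, List.nil_append] at ht
      rcases ht with rfl | rfl | rfl | rfl | rfl | rfl <;> simp only <;> omega
  · intro s
    have hc := h.3 s
    simp only [Function.update_apply]
    split_ifs <;> omega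

/-! ### The construction builds unit flow networks -/

/-- The open ends in the slots `V` of the state belong to a family of flow networks. -/
structure Tracks (N : ℕ) (g : ℕ → ℕ) (m : ℕ) (σ : BuildState) (V : Set (ℕ × ℕ)) (R : Finset ℕ)
    (A : Finset (ℕ × Literal)) : Prop where
  hist : ∃ live, FlowHist N g R A live σ.next σ.terms ∧
    ∀ p ∈ V, (p.2, σ.cur (p.1 + p.2)) ∈ live
  slot : ∀ p ∈ V, p.2 < m ∧ m ∣ p.1
  inj : ∀ p ∈ V, ∀ q ∈ V, σ.cur (p.1 + p.2) = σ.cur (q.1 + q.2) → p = q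

/-- A slot is a number in base `m`: the clause is its last digit, the node determines the rest. -/
theorem slot_inj {m b j b' j' : ℕ} (hb : m ∣ b) (hj : j < m) (hb' : m ∣ b') (hj' : j' < m)
    (h : b + j = b' + j') : (b, j) = (b', j') := by
  obtain ⟨c, rfl⟩ := hb
  obtain ⟨c', rfl⟩ := hb'
  have h1 : (m * c + j) % m = (m * c' + j') % m := by rw [h]
  rw [Nat.mul_add_mod, Nat.mul_add_mod, Nat.mod_eq_of_lt hj, Nat.mod_eq_of_lt hj'] at h1
  subst h1
  rw [Nat.add_right_cancel h]

variable {N m : ℕ} {V : Set (ℕ × ℕ)} {R : Finset ℕ} {A : Finset (ℕ × Literal)}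

theorem Tracks.cur_lt (h : Tracks N g m σ V R A) {p : ℕ × ℕ} (hp : p ∈ V) :
    N ≤ σ.cur (p.1 + p.2) ∧ σ.cur (p.1 + p.2) < σ.next ∧ p.2 ∈ R := by
  obtain ⟨live, h1, h2⟩ := h.hist
  have := h1.live_bounds _ (h2 p hp)
  exact this

theorem Tracks.le_next (h : Tracks N g m σ V R A) : N ≤ σ.next := by
  obtain ⟨live, h1, h2⟩ := h.hist
  exact h1.le_next

theorem Tracks.mono {V' : Set (ℕ × ℕ)} (h : Tracks N g m σ V R A) (hV : V' ⊆ V) :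
    Tracks N g m σ V' R A := by
  obtain ⟨live, h1, h2⟩ := h.hist
  exact ⟨⟨live, h1, fun p hp => h2 p (hV hp)⟩, fun p hp => h.slot p (hV hp),
    fun p hp q hq => h.inj p (hV hp) q (hV hq)⟩

/-- Changing one slot. -/
theorem Tracks.cur_update (h : Tracks N g m σ V R A) {b j v : ℕ} (hb : m ∣ b) (hj : j < m)
    {p : ℕ × ℕ} (hp : p ∈ V) (hne : p ≠ (b, j)) :
    Function.update σ.cur (b + j) v (p.1 + p.2) = σ.cur (p.1 + p.2) := by
  refine Function.update_of_ne (fun he => hne ?_) _ _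
  exact slot_inj (h.slot p hp).2 (h.slot p hp).1 hb hj he

theorem Tracks.rootStep (h : Tracks N g m σ V R A) {j : ℕ} (hj : j < m) (hjR : j ∉ R)
    (hg : 0 < g j) : Tracks N g m (rootStep g σ j) (insert (0, j) V) (insert j R) A := by
  obtain ⟨live, h1, h2⟩ := h.hist
  have hV : ∀ p ∈ V, p ≠ (0, j) := fun p hp he => hjR (by
    have := (h.cur_lt hp).2.2; rwa [he] at this)
  have hup := fun p (hp : p ∈ V) => h.cur_update (v := σ.next) (dvd_zero m) hj hp (hV p hp)
  rw [Nat.zero_add] at hup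
  unfold BuildState.rootStep
  rw [if_neg hg.ne']
  refine ⟨⟨_, h1.root j hjR hg, ?_⟩, ?_, ?_⟩
  · rintro p (rfl | hp)
    · simp
    · simp only [hup p hp]
      exact Finset.mem_insert_of_mem (h2 p hp)
  · rintro p (rfl | hp)
    exacts [⟨hj, dvd_zero m⟩, h.slot p hp]
  · rintro p (rfl | hp) q (rfl | hq)
    · simp
    · simp only [hup q hq, Nat.zero_add, Function.update_self]
      intro he
      have := (h.cur_lt hq).2.1
      omega
    · simp only [hup p hp, Nat.zero_add, Function.update_self]
      intro he
      have := (h.cur_lt hp).2.1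
      omega
    · simp only [hup p hp, hup q hq]
      exact h.inj p hp q hq

theorem Tracks.moveStep (h : Tracks N g m σ V R A) {b j : ℕ} (hb : m ∣ b) (h0 : (0, j) ∈ V)
    (hbV : (b, j) ∉ V) : Tracks N g m (σ.moveStep b j) (insert (b, j) (V \ {(0, j)})) R A := by
  obtain ⟨live, h1, h2⟩ := h.hist
  have hj := (h.slot _ h0).1
  have hup := fun p (hp : p ∈ V) => h.cur_update (v := σ.cur j) hb hj hp
    (fun he => hbV (he ▸ hp))
  unfold BuildState.moveStep
  refine ⟨⟨live, h1, ?_⟩, ?_, ?_⟩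
  · rintro p (rfl | hp)
    · simpa using h2 _ h0
    · simp only [hup p hp.1]
      exact h2 p hp.1
  · rintro p (rfl | hp)
    exacts [⟨hj, hb⟩, h.slot p hp.1]
  · rintro p (rfl | hp) q (rfl | hq)
    · simp
    · simp only [hup q hq.1, Function.update_self]
      intro he
      exact absurd (h.inj (0, j) h0 q hq.1 (by simpa using he)).symm hq.2
    · simp only [hup p hp.1, Function.update_self]
      intro he
      exact absurd (h.inj p hp.1 (0, j) h0 (by simpa using he)) hp.2
    · simp only [hup p hp.1, hup q hq.1]
      exact h.inj p hp.1 q hq.1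

theorem Tracks.joinStep (h : Tracks N g m σ V R A) {b pb j : ℕ} (hb : m ∣ b) (hp : (pb, j) ∈ V)
    (hbV : (b, j) ∉ V) : Tracks N g m (σ.joinStep g b pb j) (insert (b, j) V) R A := by
  obtain ⟨live, h1, h2⟩ := h.hist
  obtain ⟨hj, hpb⟩ := h.slot _ hp
  simp only at hj hpb
  have hbp : b ≠ pb := fun he => hbV (he ▸ hp)
  have hval : ∀ q ∈ insert (b, j) V, (σ.joinStep g b pb j).cur (q.1 + q.2) =
      if q = (b, j) then σ.next else if q = (pb, j) then σ.next + 1 else σ.cur (q.1 + q.2) := by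
    intro q hq
    unfold BuildState.joinStep
    have hs : q.2 < m ∧ m ∣ q.1 := by
      rcases hq with rfl | hq
      exacts [⟨hj, hb⟩, h.slot q hq]
    simp only [Function.update_apply]
    have e1 : q.1 + q.2 = b + j ↔ q = (b, j) :=
      ⟨slot_inj hs.2 hs.1 hb hj, fun he => by rw [he]⟩
    have e2 : q.1 + q.2 = pb + j ↔ q = (pb, j) :=
      ⟨slot_inj hs.2 hs.1 hpb hj, fun he => by rw [he]⟩
    simp only [e1, e2]
    by_cases h3 : q = (b, j)
    · subst h3; simp [hbp]
    · simp [h3]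
  refine ⟨⟨_, h1.join j _ (h2 _ hp), ?_⟩, ?_, ?_⟩
  · intro q hq
    rw [hval q hq]
    split_ifs with h3 h4
    · rw [h3]; simp
    · rw [h4]; simp
    · have hq' : q ∈ V := hq.resolve_left h3
      refine Finset.mem_insert_of_mem (Finset.mem_insert_of_mem
        (Finset.mem_erase.2 ⟨fun he => h4 ?_, h2 q hq'⟩))
      exact h.inj q hq' _ hp (Prod.mk.inj he).2
  · rintro q (rfl | hq)
    exacts [⟨hj, hb⟩, h.slot q hq]
  · intro p' hp' q hq
    rw [hval p' hp', hval q hq]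
    have hlt : ∀ q ∈ insert (b, j) V, q ≠ (b, j) → σ.cur (q.1 + q.2) < σ.next :=
      fun q hq hne => (h.cur_lt (hq.resolve_left hne)).2.1
    have l1 := hlt p' hp'
    have l2 := hlt q hq
    split_ifs with c1 c2 c3 c4 c5 c6 c7 c8
    · intro _; rw [c1, c2]
    · intro he; omega
    · intro he; have := l2 c2; omega
    · intro he; omega
    · intro _; rw [c4, c6]
    · intro he; have := l2 c5; omega
    · intro he; have := l1 c1; omega
    · intro he; have := l1 c1; omega
    · exact h.inj p' (hp'.resolve_left c1) q (hq.resolve_left c7)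

theorem Tracks.literalStep (h : Tracks N g m σ V R A) {b j : ℕ} {l : Literal} (hb : (b, j) ∈ V)
    (hs : σ.literalSlot j l = b + j) (hl : l.1 < N) :
    Tracks N g m (literalStep g j σ l) V R (insert (j, l) A) := by
  obtain ⟨live, h1, h2⟩ := h.hist
  obtain ⟨hj, hmb⟩ := h.slot _ hb
  simp only at hj hmb
  have hg := h1.weight_pos _ (h.cur_lt hb).2.2
  unfold BuildState.literalStep
  rw [if_neg hg.ne', hs]
  refine ⟨⟨_, h1.literal j _ l (h2 _ hb) hl, ?_⟩, h.slot, ?_⟩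
  · intro q hq
    by_cases hqb : q = (b, j)
    · rw [hqb]; simp
    · simp only [h.cur_update hmb hj hq hqb]
      refine Finset.mem_insert_of_mem (Finset.mem_erase.2 ⟨fun he => hqb ?_, h2 q hq⟩)
      exact h.inj q hq _ hb (Prod.mk.inj he).2
  · intro p hp q hq
    simp only
    by_cases hpb : p = (b, j) <;> by_cases hqb : q = (b, j)
    · intro _; rw [hpb, hqb]
    · rw [h.cur_update hmb hj hq hqb, hpb, Function.update_self]
      intro he
      have := (h.cur_lt hq).2.1
      omega
    · rw [h.cur_update hmb hj hp hpb, hqb, Function.update_self]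
      intro he
      have := (h.cur_lt hp).2.1
      omega
    · rw [h.cur_update hmb hj hp hpb, h.cur_update hmb hj hq hqb]
      exact h.inj p hp q hq

end BuildState

/-! ### Processing the bag of one node -/

def clauseCode (j : ℕ) : ℤ := -((j : ℤ) + 1)

theorem clauseCode_inj {i j : ℕ} (h : clauseCode i = clauseCode j) : i = j := by
  unfold clauseCode at h; omega

theorem clauseCode_neg (j : ℕ) : clauseCode j < 0 := by unfold clauseCode; omega

theorem decode_clauseCode (j : ℕ) : (-1 - clauseCode j).toNat = j := by
  unfold clauseCode; omega

theorem natCast_ne_clauseCode (x j : ℕ) : (x : ℤ) ≠ clauseCode j := by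
  have := clauseCode_neg j; omega

namespace BuildState

variable {g : ℕ → ℕ} {m N : ℕ} {R : Finset ℕ}

theorem slot_ne {b j b' j' : ℕ} (hb : m ∣ b) (hj : j < m) (hb' : m ∣ b') (hj' : j' < m)
    (h : b ≠ b') : b + j ≠ b' + j' := fun he => h (Prod.mk.inj (slot_inj hb hj hb' hj' he)).1

/-- The slots after the elements `pre` of the bag of a node with first slot `b`. -/
def bagSlots (g : ℕ → ℕ) (b : ℕ) (V₀ : Set (ℕ × ℕ)) (pre : List ℤ) : Set (ℕ × ℕ) :=
  {p | p ∈ V₀ ∧ ¬ (p.1 = 0 ∧ clauseCode p.2 ∈ pre)} ∪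
    {p | p.1 = b ∧ g p.2 ≠ 0 ∧ clauseCode p.2 ∈ pre}

/-- The state `σ` after the elements `pre` of the bag of a node, processed from the state `σ₀`;
the clauses `js` are those shared with the parent node. -/
structure BagInv (N : ℕ) (g : ℕ → ℕ) (m : ℕ) (R : Finset ℕ) (b pb : ℕ) (V₀ : Set (ℕ × ℕ))
    (σ₀ : BuildState) (pre : List ℤ) (σ : BuildState) (js : List ℕ) : Prop where
  nodup : js.Nodup
  mem : ∀ j, j ∈ js ↔ g j ≠ 0 ∧ σ₀.topClause j ≠ 0 ∧ clauseCode j ∈ pre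
  next : σ.next = σ₀.next + 2 * js.length
  child : ∀ q (h : q < js.length), σ.cur (b + js[q]) = σ₀.next + 2 * q
  rest : ∀ q (h : q < js.length), σ.cur (pb + js[q]) = σ₀.next + 2 * q + 1
  moved : ∀ j, g j ≠ 0 → σ₀.topClause j = 0 → clauseCode j ∈ pre → σ.cur (b + j) = σ₀.cur j
  other : ∀ s, (∀ j, clauseCode j ∈ pre → s ≠ b + j) → (∀ j ∈ js, s ≠ pb + j) →
    σ.cur s = σ₀.cur s
  terms : ∀ t ∈ σ.terms, t ∈ σ₀.terms ∨ ∃ (q : ℕ) (h : q < js.length),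
    t ∈ joinTerms (σ₀.cur (pb + js[q])) (σ₀.next + 2 * q) (g js[q])
  topVar : ∀ x : ℕ, σ.topVar x = if (x : ℤ) ∈ pre ∧ σ₀.topVar x = 0 then b else σ₀.topVar x
  topClause : ∀ j, g j ≠ 0 → σ.topClause j =
    if clauseCode j ∈ pre ∧ σ₀.topClause j = 0 then b else σ₀.topClause j
  tracks : Tracks N g m σ (bagSlots g b V₀ pre) R ∅

theorem BagInv.nil {b pb : ℕ} {V₀ : Set (ℕ × ℕ)} {σ₀ : BuildState}
    (h : Tracks N g m σ₀ V₀ R ∅) : BagInv N g m R b pb V₀ σ₀ [] σ₀ [] where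
  nodup := List.nodup_nil
  mem := by simp
  next := by simp
  child := by simp
  rest := by simp
  moved := by simp
  other := by simp
  terms := fun t ht => Or.inl ht
  topVar := by simp
  topClause := by simp
  tracks := h.mono (by simp [bagSlots])

/-- The earlier elements of the bag concern other clauses, so the slots of the current one still
have their contents from `σ₀`. A variable changes at most its top node; a clause met for the first
time moves its root here; a clause shared with the parent branches. The `q`-th shared clause thereby
receives the variables `σ₀.next + 2 * q` for the child and `σ₀.next + 2 * q + 1` for the parent,
which is the numbering used by `Built.prism`. -/
theorem BagInv.step {b pb : ℕ} {V₀ : Set (ℕ × ℕ)} {σ₀ σ : BuildState} {pre : List ℤ} {js : List ℕ}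
    (h : BagInv N g m R b pb V₀ σ₀ pre σ js) (hb : m ∣ b) (hb0 : b ≠ 0) (hpb : m ∣ pb)
    (hpb0 : pb ≠ 0) {v : ℤ} (hvpre : v ∉ pre) (hv : 0 ≤ v ∨ ∃ j < m, v = clauseCode j)
    (hbV : ∀ p ∈ V₀, p.1 ≠ b)
    (hpre : ∀ j, clauseCode j ∈ pre → j < m)
    (hnew : ∀ j, clauseCode j = v → g j ≠ 0 → σ₀.topClause j = 0 → (0, j) ∈ V₀)
    (hshared : ∀ j, (clauseCode j = v ∨ clauseCode j ∈ pre) → g j ≠ 0 → σ₀.topClause j ≠ 0 →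
      (pb, j) ∈ V₀ ∧ (0, j) ∉ V₀) :
    ∃ js', BagInv N g m R b pb V₀ σ₀ (pre ++ [v]) (bagStep g b pb σ v) js' := by
  have hjs : ∀ j ∈ js, j < m := fun j hj => hpre j ((h.mem j).1 hj).2.2
  have hpbb : ∀ j ∈ js, pb ≠ b := fun j hj =>
    hbV _ (hshared j (Or.inr ((h.mem j).1 hj).2.2) ((h.mem j).1 hj).1 ((h.mem j).1 hj).2.1).1
  rcases hv with hv | ⟨j, hj, rfl⟩
  · obtain ⟨x, rfl⟩ := Int.eq_ofNat_of_zero_le hv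
    have hcode : ∀ j, clauseCode j ∈ pre ++ [(x : ℤ)] ↔ clauseCode j ∈ pre := by
      intro j
      have := natCast_ne_clauseCode x j
      simp [this.symm]
    have hslots : bagSlots g b V₀ (pre ++ [(x : ℤ)]) = bagSlots g b V₀ pre := by
      unfold bagSlots; simp only [hcode]
    have hx := h.topVar x
    simp only [hvpre, false_and, if_false] at hx
    unfold bagStep
    rw [if_pos hv, Int.toNat_natCast, hx]
    by_cases hx0 : σ₀.topVar x = 0
    · rw [if_pos hx0]
      obtain ⟨⟨live, h1, h2⟩, h3, h4⟩ := h.tracks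
      refine ⟨js, ⟨h.nodup, fun j => by rw [h.mem j, hcode], h.next, h.child, h.rest,
        fun j h1 h2 h3 => h.moved j h1 h2 ((hcode j).1 h3),
        fun s h1 h2 => h.other s (fun j hj => h1 j ((hcode j).2 hj)) h2, h.terms, ?_, ?_, ?_⟩⟩
      · intro y
        simp only [Function.update_apply]
        by_cases hyx : y = x
        · subst hyx; simp [hx0]
        · rw [if_neg hyx, h.topVar y]
          simp [hyx]
      · intro j hj; simp only [h.topClause j hj, hcode]
      · rw [hslots]; exact ⟨⟨live, h1, h2⟩, h3, h4⟩
    · rw [if_neg hx0]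
      refine ⟨js, ⟨h.nodup, fun j => by rw [h.mem j, hcode], h.next, h.child, h.rest,
        fun j h1 h2 h3 => h.moved j h1 h2 ((hcode j).1 h3),
        fun s h1 h2 => h.other s (fun j hj => h1 j ((hcode j).2 hj)) h2, h.terms, ?_, ?_, ?_⟩⟩
      · intro y
        rw [h.topVar y]
        by_cases hyx : y = x
        · subst hyx; simp [hx0]
        · simp [hyx]
      · intro j hj; simp only [h.topClause j hj, hcode]
      · rw [hslots]; exact h.tracks
  · have hcode : ∀ i, clauseCode i ∈ pre ++ [clauseCode j] ↔ clauseCode i ∈ pre ∨ i = j := by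
      intro i
      simp only [List.mem_append, List.mem_singleton]
      exact or_congr Iff.rfl ⟨clauseCode_inj, fun h => by rw [h]⟩
    have hjpre : j ∉ js := fun hm => hvpre ((h.mem j).1 hm).2.2
    have hvar : ∀ x : ℕ, (x : ℤ) ∈ pre ++ [clauseCode j] ↔ (x : ℤ) ∈ pre := by
      intro x
      have := natCast_ne_clauseCode x j
      simp [this]
    unfold bagStep
    rw [if_neg (not_le.2 (clauseCode_neg j)), decode_clauseCode]
    by_cases hg : g j = 0
    · rw [if_pos hg]
      have hne : ∀ i, g i ≠ 0 → i ≠ j := fun i hi he => hi (he ▸ hg)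
      have hcode' : ∀ i, g i ≠ 0 → (clauseCode i ∈ pre ++ [clauseCode j] ↔ clauseCode i ∈ pre) :=
        fun i hi => by rw [hcode]; simp [hne i hi]
      refine ⟨js, ⟨h.nodup, fun i => ?_, h.next, h.child, h.rest,
        fun i h1 h2 h3 => h.moved i h1 h2 ((hcode' i h1).1 h3),
        fun s h1 h2 => h.other s (fun i hi => h1 i ((hcode i).2 (Or.inl hi))) h2, h.terms,
        fun x => by simp only [h.topVar x, hvar], fun i hi => by simp only [h.topClause i hi, hcode' i hi],
        h.tracks.mono ?_⟩⟩
      · rw [h.mem i]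
        exact and_congr_right fun hi => by rw [hcode' i hi]
      · rintro p (⟨h1, h2⟩ | ⟨h1, h2, h3⟩)
        · exact Or.inl ⟨h1, fun h3 => h2 ⟨h3.1, (hcode _).2 (Or.inl h3.2)⟩⟩
        · exact Or.inr ⟨h1, h2, (hcode' _ h2).1 h3⟩
    rw [if_neg hg]
    have htop := h.topClause j hg
    simp only [hvpre, false_and, if_false] at htop
    rw [htop]
    have hbj : (b, j) ∉ bagSlots g b V₀ pre := by
      rintro (⟨h1, -⟩ | ⟨-, -, h3⟩)
      exacts [hbV _ h1 rfl, hvpre h3]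
    by_cases ht0 : σ₀.topClause j = 0
    · rw [if_pos ht0]
      have h0V := hnew j rfl hg ht0
      have hjsj : ∀ i ∈ js, i ≠ j := fun i hi he => ((h.mem i).1 hi).2.1 (he ▸ ht0)
      have hcurj : σ.cur j = σ₀.cur j := by
        refine h.other j (fun i hi => ?_) fun i hi => ?_
        · have := slot_ne (dvd_zero m) hj hb (hpre i hi) hb0.symm
          simpa using this
        · have := slot_ne (dvd_zero m) hj hpb (hjs i hi) hpb0.symm
          simpa using this
      have hcur : ∀ s, (σ.moveStep b j).cur s = if s = b + j then σ₀.cur j else σ.cur s := by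
        intro s; simp only [moveStep, Function.update_apply, hcurj]
      refine ⟨js, ⟨h.nodup, fun i => ?_, h.next, fun q hq => ?_, fun q hq => ?_, fun i h1 h2 h3 => ?_,
        fun s h1 h2 => ?_, h.terms, fun x => ?_, fun i hi => ?_, ?_⟩⟩
      · rw [h.mem i]
        refine and_congr_right fun hi => and_congr_right fun hi' => ?_
        rw [hcode]
        exact ⟨Or.inl, fun ho => ho.resolve_right fun he => hi' (he ▸ ht0)⟩
      · rw [hcur, if_neg, h.child q hq]
        have := hjsj _ (List.getElem_mem hq); omega
      · rw [hcur, if_neg, h.rest q hq]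
        have hm := List.getElem_mem hq
        exact slot_ne hpb (hjs _ hm) hb hj (hpbb _ hm)
      · rw [hcur]
        by_cases hij : i = j
        · subst hij; rw [if_pos rfl]
        · rw [if_neg (by omega)]
          exact h.moved i h1 h2 (((hcode i).1 h3).resolve_right hij)
      · rw [hcur, if_neg (h1 j ((hcode j).2 (Or.inr rfl)))]
        exact h.other s (fun i hi => h1 i ((hcode i).2 (Or.inl hi))) h2
      · change σ.topVar x = _
        simp only [h.topVar x, hvar]
      · simp only [moveStep, Function.update_apply]
        by_cases hij : i = j
        · subst hij; simp [ht0]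
        · rw [if_neg hij, h.topClause i hi]
          simp [hcode, hij, -List.mem_append]
      · have h0 : (0, j) ∈ bagSlots g b V₀ pre := Or.inl ⟨h0V, fun h3 => hvpre h3.2⟩
        refine (h.tracks.moveStep hb h0 hbj).mono ?_
        rintro p (⟨h1, h2⟩ | ⟨h1, h2, h3⟩)
        · refine Or.inr ⟨Or.inl ⟨h1, fun h3 => h2 ⟨h3.1, (hcode _).2 (Or.inl h3.2)⟩⟩, ?_⟩
          rintro rfl
          exact h2 ⟨rfl, (hcode _).2 (Or.inr rfl)⟩
        · rcases (hcode _).1 h3 with h3 | h3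
          · refine Or.inr ⟨Or.inr ⟨h1, h2, h3⟩, ?_⟩
            rintro rfl
            exact hb0 h1.symm
          · exact Or.inl (Prod.ext h1 h3)
    · rw [if_neg ht0]
      obtain ⟨hpV, h0V⟩ := hshared j (Or.inl rfl) hg ht0
      have hpbne : pb ≠ b := hbV _ hpV
      have hold : σ.cur (pb + j) = σ₀.cur (pb + j) := by
        refine h.other _ (fun i hi => slot_ne hpb hj hb (hpre i hi) hpbne) fun i hi he => ?_
        exact hjpre ((Nat.add_left_cancel he) ▸ hi)
      have hcur : ∀ s, (σ.joinStep g b pb j).cur s = if s = pb + j then σ.next + 1 else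
          if s = b + j then σ.next else σ.cur s := by
        intro s; simp only [joinStep, Function.update_apply]
      have hbpj := slot_ne hb hj hpb hj hpbne.symm
      refine ⟨js ++ [j], ⟨?_, fun i => ?_, ?_, fun q hq => ?_, fun q hq => ?_, fun i h1 h2 h3 => ?_,
        fun s h1 h2 => ?_, fun t ht => ?_, fun x => ?_, fun i hi => ?_, ?_⟩⟩
      · rw [List.nodup_append]
        refine ⟨h.nodup, List.nodup_singleton _, fun a ha c hc he => ?_⟩
        rw [List.mem_singleton.1 hc] at he
        exact hjpre (he ▸ ha)
      · rw [List.mem_append, h.mem i, hcode, List.mem_singleton]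
        constructor
        · rintro (⟨h1, h2, h3⟩ | rfl)
          exacts [⟨h1, h2, Or.inl h3⟩, ⟨hg, ht0, Or.inr rfl⟩]
        · rintro ⟨h1, h2, h3 | h3⟩
          exacts [Or.inl ⟨h1, h2, h3⟩, Or.inr h3]
      · simp only [joinStep, h.next, List.length_append, List.length_singleton]; ring
      · rw [hcur]
        by_cases hql : q < js.length
        · rw [List.getElem_append_left hql]
          have hm := List.getElem_mem hql
          rw [if_neg (slot_ne hb (hjs _ hm) hpb hj hpbne.symm), if_neg, h.child q hql]
          intro he
          exact hjpre ((Nat.add_left_cancel he) ▸ hm)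
        · have hqe : q = js.length := by simp at hq; omega
          subst hqe
          rw [List.getElem_concat_length rfl, if_neg hbpj, if_pos rfl, h.next]
      · rw [hcur]
        by_cases hql : q < js.length
        · rw [List.getElem_append_left hql]
          have hm := List.getElem_mem hql
          rw [if_neg, if_neg (slot_ne hpb (hjs _ hm) hb hj hpbne), h.rest q hql]
          intro he
          exact hjpre ((Nat.add_left_cancel he) ▸ hm)
        · have hqe : q = js.length := by simp at hq; omega
          subst hqe
          rw [List.getElem_concat_length rfl, if_pos rfl, h.next]
      · have hij : i ≠ j := fun he => ht0 (he ▸ h2)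
        have hm := ((hcode i).1 h3).resolve_right hij
        rw [hcur, if_neg (slot_ne hb (hpre i hm) hpb hj hpbne.symm), if_neg (by omega)]
        exact h.moved i h1 h2 hm
      · rw [hcur, if_neg (h2 j (by simp)), if_neg (h1 j ((hcode j).2 (Or.inr rfl)))]
        exact h.other s (fun i hi => h1 i ((hcode i).2 (Or.inl hi)))
          fun i hi => h2 i (by simp [hi])
      · rcases List.mem_append.1 ht with ht | ht
        · rcases h.terms t ht with ht | ⟨q, hq, ht⟩
          · exact Or.inl ht
          · refine Or.inr ⟨q, by simp; omega, ?_⟩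
            rw [List.getElem_append_left hq]
            exact ht
        · refine Or.inr ⟨js.length, by simp, ?_⟩
          rw [List.getElem_concat_length rfl, ← hold, ← h.next]
          exact ht
      · change σ.topVar x = _
        simp only [h.topVar x, hvar]
      · change σ.topClause i = _
        simp only [h.topClause i hi, hcode]
        by_cases hij : i = j
        · subst hij; simp [ht0]
        · simp [hij]
      · have hp : (pb, j) ∈ bagSlots g b V₀ pre := Or.inl ⟨hpV, fun h3 => hpb0 h3.1⟩
        refine (h.tracks.joinStep hb hp hbj).mono ?_
        rintro p (⟨h1, h2⟩ | ⟨h1, h2, h3⟩)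
        · exact Or.inr (Or.inl ⟨h1, fun h3 => h2 ⟨h3.1, (hcode _).2 (Or.inl h3.2)⟩⟩)
        · rcases (hcode _).1 h3 with h3 | h3
          · exact Or.inr (Or.inr ⟨h1, h2, h3⟩)
          · exact Or.inl (Prod.ext h1 h3)

theorem BagInv.foldl {b pb : ℕ} {V₀ : Set (ℕ × ℕ)} {σ₀ : BuildState} {bag : List ℤ}
    (h : Tracks N g m σ₀ V₀ R ∅) (hb : m ∣ b) (hb0 : b ≠ 0) (hpb : m ∣ pb) (hpb0 : pb ≠ 0)
    (hnodup : bag.Nodup) (hbag : ∀ v ∈ bag, 0 ≤ v ∨ ∃ j < m, v = clauseCode j)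
    (hbV : ∀ p ∈ V₀, p.1 ≠ b)
    (hnew : ∀ j, clauseCode j ∈ bag → g j ≠ 0 → σ₀.topClause j = 0 → (0, j) ∈ V₀)
    (hshared : ∀ j, clauseCode j ∈ bag → g j ≠ 0 → σ₀.topClause j ≠ 0 →
      (pb, j) ∈ V₀ ∧ (0, j) ∉ V₀) :
    ∃ js, BagInv N g m R b pb V₀ σ₀ bag (bag.foldl (bagStep g b pb) σ₀) js := by
  suffices ∀ pre suf, bag = pre ++ suf → ∃ js,
      BagInv N g m R b pb V₀ σ₀ pre (pre.foldl (bagStep g b pb) σ₀) js from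
    this bag [] (by simp)
  intro pre
  induction pre using List.reverseRecOn with
  | nil => exact fun _ _ => ⟨[], BagInv.nil h⟩
  | append_singleton pre v ih =>
    intro suf hsuf
    obtain ⟨js, hjs⟩ := ih (v :: suf) (by simpa using hsuf)
    have hvb : v ∈ bag := by rw [hsuf]; simp
    have hpb' : ∀ w ∈ pre, w ∈ bag := fun w hw => by rw [hsuf]; simp [hw]
    have hvpre : v ∉ pre := by
      rw [hsuf, List.append_assoc, List.nodup_append] at hnodup
      exact fun hm => hnodup.2.2 v hm v (by simp) rfl
    rw [List.foldl_append]
    refine hjs.step hb hb0 hpb hpb0 hvpre (hbag v hvb) hbV ?_ ?_ ?_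
    · intro j hj
      rcases hbag _ (hpb' _ hj) with h0 | ⟨i, hi, he⟩
      · have := clauseCode_neg j; omega
      · exact (clauseCode_inj he) ▸ hi
    · rintro j rfl; exact hnew j hvb
    · rintro j (rfl | hj)
      exacts [hshared j hvb, hshared j (hpb' _ hj)]

end BuildState

/-! ### Following a decomposition of the incidence graph -/

def bagVars (B : List ℤ) : Finset ℕ := (B.toFinset.filter (0 ≤ ·)).image Int.toNat

def bagClauses (g : ℕ → ℕ) (B : List ℤ) : Finset ℕ :=
  ((B.toFinset.filter (¬ 0 ≤ ·)).image fun v => (-1 - v).toNat).filter (g · ≠ 0)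

@[simp] theorem mem_bagVars {B : List ℤ} {x : ℕ} : x ∈ bagVars B ↔ (x : ℤ) ∈ B := by
  simp only [bagVars, Finset.mem_image, Finset.mem_filter, List.mem_toFinset]
  constructor
  · rintro ⟨v, ⟨h1, h2⟩, rfl⟩
    rwa [Int.toNat_of_nonneg h2]
  · exact fun h => ⟨x, ⟨h, by simp⟩, by simp⟩

@[simp] theorem mem_bagClauses {g : ℕ → ℕ} {B : List ℤ} {j : ℕ} :
    j ∈ bagClauses g B ↔ clauseCode j ∈ B ∧ g j ≠ 0 := by
  simp only [bagClauses, Finset.mem_image, Finset.mem_filter, List.mem_toFinset]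
  refine and_congr_left fun _ => ?_
  constructor
  · rintro ⟨v, ⟨h1, h2⟩, rfl⟩
    convert h1 using 1
    unfold clauseCode; omega
  · exact fun h => ⟨_, ⟨h, by have := clauseCode_neg j; omega⟩, decode_clauseCode j⟩

theorem card_bagVars_add_card_bagClauses (g : ℕ → ℕ) (B : List ℤ) :
    (bagVars B).card + (bagClauses g B).card ≤ B.length := by
  have h1 : (bagVars B).card ≤ (B.toFinset.filter (0 ≤ ·)).card := Finset.card_image_le
  have h2 : (bagClauses g B).card ≤ (B.toFinset.filter (¬ 0 ≤ ·)).card :=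
    (Finset.card_filter_le _ _).trans Finset.card_image_le
  have h3 := B.toFinset.card_filter_add_card_filter_not (0 ≤ ·)
  have := B.toFinset_card_le
  omega

/-- The variables of a bag, and the open ends of its clauses. -/
def nodeBag (g : ℕ → ℕ) (cur : ℕ → ℕ) (b : ℕ) (B : List ℤ) : Finset ℕ :=
  bagVars B ∪ (bagClauses g B).image fun j => cur (b + j)

theorem card_nodeBag_le (g cur : ℕ → ℕ) (b : ℕ) (B : List ℤ) :
    (nodeBag g cur b B).card ≤ B.length := by
  refine (Finset.card_union_le _ _).trans ?_
  have := card_bagVars_add_card_bagClauses g B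
  have : ((bagClauses g B).image fun j => cur (b + j)).card ≤ _ := Finset.card_image_le
  omega

/-- The nodes of a tree decomposition of width at most `k`, parents first. -/
structure ValidNodes (m N k len : ℕ) (bag : ℕ → List ℤ) (par : ℕ → ℕ) : Prop where
  nodup : ∀ t < len, (bag t).Nodup
  code : ∀ t < len, ∀ v ∈ bag t, (0 ≤ v ∧ v < N) ∨ ∃ j < m, v = clauseCode j
  parent : ∀ t < len, ∀ v ∈ bag t, ∀ s < t, v ∈ bag s → par t < t ∧ v ∈ bag (par t)
  length_le : ∀ t < len, (bag t).length ≤ k + 1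

namespace BuildState

variable {g : ℕ → ℕ} {m N k : ℕ} {R : Finset ℕ} {bag : ℕ → List ℤ} {par : ℕ → ℕ}

/-- The slots in use after `i` nodes. -/
def nodeSlots (g : ℕ → ℕ) (m : ℕ) (bag : ℕ → List ℤ) (i : ℕ) : Set (ℕ × ℕ) :=
  {p | p.1 = 0 ∧ g p.2 ≠ 0 ∧ p.2 < m ∧ ∀ t < i, clauseCode p.2 ∉ bag t} ∪
    {p | ∃ t < i, p.1 = m * (t + 1) ∧ g p.2 ≠ 0 ∧ clauseCode p.2 ∈ bag t}

/-- `c` is the first slot of the first of the nodes before `i` that contains `v`. -/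
def IsTop (m : ℕ) (bag : ℕ → List ℤ) (i : ℕ) (v : ℤ) (c : ℕ) : Prop :=
  (c = 0 ∧ ∀ t < i, v ∉ bag t) ∨ ∃ t < i, c = m * (t + 1) ∧ v ∈ bag t ∧ ∀ s < t, v ∉ bag s

/-- Node `t` has the base `m * (t + 1)`, which is never `0`. So `0` can mark a vertex that has not
been seen, and the base `0` remains free for the roots. -/
theorem IsTop.eq_zero_iff {i : ℕ} {v : ℤ} {c : ℕ} (h : IsTop m bag i v c) (hm : 0 < m) :
    c = 0 ↔ ∀ t < i, v ∉ bag t := by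
  rcases h with ⟨rfl, h⟩ | ⟨t, ht, rfl, hv, -⟩
  · simpa using h
  · simp only [Nat.mul_eq_zero, hm.ne', Nat.succ_ne_zero, or_self, false_iff, not_forall]
    exact ⟨t, ht, fun h => h hv⟩

theorem IsTop.step {i : ℕ} {v : ℤ} {c : ℕ} (h : IsTop m bag i v c) (hm : 0 < m) :
    IsTop m bag (i + 1) v (if v ∈ bag i ∧ c = 0 then m * (i + 1) else c) := by
  have h0 := h.eq_zero_iff hm
  split_ifs with hc
  · exact Or.inr ⟨i, by omega, rfl, hc.1, h0.1 hc.2⟩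
  · rcases h with ⟨hc0, h⟩ | ⟨t, ht, hct, hv, h⟩
    · refine Or.inl ⟨hc0, fun t ht => ?_⟩
      rcases Nat.lt_succ_iff_lt_or_eq.1 ht with ht | rfl
      exacts [h t ht, fun hv => hc ⟨hv, hc0⟩]
    · exact Or.inr ⟨t, by omega, hct, hv, h⟩

/-- The root of a clause that has not been seen must be in no bag, so that it is new when the first
node with the clause is reached. Until then its linear term is not covered, and it is the only term
of which this is allowed. -/
structure NodesInv (N : ℕ) (g : ℕ → ℕ) (m k : ℕ) (R : Finset ℕ) (bag : ℕ → List ℤ) (i : ℕ)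
    (σ : BuildState) : Prop where
  tracks : Tracks N g m σ (nodeSlots g m bag i) R ∅
  topVar : ∀ x : ℕ, IsTop m bag i x (σ.topVar x)
  topClause : ∀ j, g j ≠ 0 → IsTop m bag i (clauseCode j) (σ.topClause j)
  built : ∃ L, Built (3 * k) L ∧ (∀ B ∈ L, ∀ v ∈ B, v < σ.next) ∧
    (∀ B ∈ L, ∀ x ∈ B, x < N → ∃ t < i, (x : ℤ) ∈ bag t) ∧
    (∀ j, (0, j) ∈ nodeSlots g m bag i → ∀ B ∈ L, σ.cur j ∉ B) ∧
    (∀ t < i, ∃ B ∈ L, nodeBag g σ.cur (m * (t + 1)) (bag t) ⊆ B) ∧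
    ∀ t ∈ σ.terms, (∃ B ∈ L, t.1 ∈ B ∧ t.2.1 ∈ B) ∨
      ∃ j, (0, j) ∈ nodeSlots g m bag i ∧ t.1 = σ.cur j ∧ t.2.1 = σ.cur j

/-- Let `js` be the clauses shared with the parent, `T` their ends at the parent, `P` the rest of
the parent's bag and `Q` the variables shared with earlier nodes, all of which are in the parent's
bag. `Built.prism` leads from the parent's bag to a bag with `P` and the ends kept by the parent,
and to a bag with `Q` and the ends for the child. The latter carries the bag of the new node, whose
remaining elements, variables and roots seen for the first time, are new. -/
theorem NodesInv.step {i len : ℕ} {σ₀ : BuildState} (h : NodesInv N g m k R bag i σ₀) (hm : 0 < m)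
    (hk : 1 ≤ k) (hi : i < len) (hv : ValidNodes m N k len bag par) :
    NodesInv N g m k R bag (i + 1)
      ((bag i).foldl (bagStep g (m * (i + 1)) (m * (par i + 1))) σ₀) := by
  set b := m * (i + 1) with hbdef
  set pb := m * (par i + 1) with hpbdef
  have hb : m ∣ b := Dvd.intro _ rfl
  have hpb : m ∣ pb := Dvd.intro _ rfl
  have hb0 : b ≠ 0 := by positivity
  have hpb0 : pb ≠ 0 := by positivity
  have hslot : ∀ s t : ℕ, m * (s + 1) = m * (t + 1) → s = t := fun s t he => by
    have := Nat.eq_of_mul_eq_mul_left hm he; omega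
  have hzero : ∀ t : ℕ, m * (t + 1) ≠ 0 := fun t => by positivity
  have hbV : ∀ p ∈ nodeSlots g m bag i, p.1 ≠ b := by
    rintro p (⟨h1, -⟩ | ⟨t, ht, h1, -⟩) he
    · exact hb0 (he.symm.trans h1)
    · have := hslot _ _ (he.symm.trans h1); omega
  have hseen : ∀ j, clauseCode j ∈ bag i → j < m := by
    intro j hj
    rcases hv.code i hi _ hj with h0 | ⟨j', hj', he⟩
    · have := clauseCode_neg j; omega
    · exact (clauseCode_inj he) ▸ hj'
  have hnew : ∀ j, clauseCode j ∈ bag i → g j ≠ 0 → σ₀.topClause j = 0 →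
      (0, j) ∈ nodeSlots g m bag i := fun j hj hg h0 =>
    Or.inl ⟨rfl, hg, hseen j hj, ((h.topClause j hg).eq_zero_iff hm).1 h0⟩
  have hpar : ∀ j, clauseCode j ∈ bag i → g j ≠ 0 → σ₀.topClause j ≠ 0 →
      par i < i ∧ clauseCode j ∈ bag (par i) := by
    intro j hj hg h0
    rw [Ne, (h.topClause j hg).eq_zero_iff hm] at h0
    push Not at h0
    obtain ⟨t, ht, hjt⟩ := h0
    exact hv.parent i hi _ hj t ht hjt
  have hzmem : ∀ j, (0, j) ∈ nodeSlots g m bag i ↔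
      g j ≠ 0 ∧ j < m ∧ ∀ t < i, clauseCode j ∉ bag t := by
    intro j
    constructor
    · rintro (⟨-, h2⟩ | ⟨t, -, h1, -⟩)
      exacts [h2, absurd h1.symm (hzero t)]
    · exact fun h => Or.inl ⟨rfl, h⟩
  have hzmem' : ∀ j, (0, j) ∈ nodeSlots g m bag (i + 1) ↔
      (0, j) ∈ nodeSlots g m bag i ∧ clauseCode j ∉ bag i := by
    intro j
    rw [hzmem]
    constructor
    · rintro (⟨-, h2, h3, h4⟩ | ⟨t, -, h1, -⟩)
      exacts [⟨⟨h2, h3, fun t ht => h4 t (by omega)⟩, h4 i (by omega)⟩, absurd h1.symm (hzero t)]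
    · rintro ⟨⟨h1, h2, h3⟩, h4⟩
      refine Or.inl ⟨rfl, h1, h2, fun t ht => ?_⟩
      rcases Nat.lt_succ_iff_lt_or_eq.1 ht with ht | rfl
      exacts [h3 t ht, h4]
  obtain ⟨js, hinv⟩ := BagInv.foldl (b := b) (pb := pb) h.tracks hb hb0 hpb hpb0 (hv.nodup i hi)
    (fun v hvb => (hv.code i hi v hvb).imp And.left id) hbV
    hnew
    (fun j hj hg h0 => ⟨Or.inr ⟨par i, (hpar j hj hg h0).1, rfl, hg, (hpar j hj hg h0).2⟩,
      fun h1 => ((hzmem j).1 h1).2.2 _ (hpar j hj hg h0).1 (hpar j hj hg h0).2⟩)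
  generalize (bag i).foldl (bagStep g b pb) σ₀ = σ at hinv
  have hslots : nodeSlots g m bag (i + 1) ⊆ bagSlots g b (nodeSlots g m bag i) (bag i) := by
    rintro ⟨c, j⟩ hp
    by_cases hc : c = 0
    · subst hc
      have := (hzmem' j).1 hp
      exact Or.inl ⟨this.1, fun h => this.2 h.2⟩
    · rcases hp with ⟨h1, -⟩ | ⟨t, ht, h1, h2, h3⟩
      · exact absurd h1 hc
      · simp only at h1 h2 h3
        rcases Nat.lt_succ_iff_lt_or_eq.1 ht with ht | rfl
        · exact Or.inl ⟨Or.inr ⟨t, ht, h1, h2, h3⟩, fun h => hc h.1⟩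
        · exact Or.inr ⟨h1, h2, h3⟩
  have htr := hinv.tracks.mono hslots
  refine ⟨htr, fun x => ?_, fun j hj => ?_, ?_⟩
  · rw [hinv.topVar x]; exact (h.topVar x).step hm
  · rw [hinv.topClause j hj]; exact (h.topClause j hj).step hm
  obtain ⟨L, hL, hlt, hold, hroot, hnode, hterm⟩ := h.built
  have hNn := h.tracks.le_next
  have hjs : ∀ j ∈ js, par i < i ∧ clauseCode j ∈ bag (par i) ∧ g j ≠ 0 ∧ clauseCode j ∈ bag i ∧
      σ₀.topClause j ≠ 0 := by
    intro j hj
    obtain ⟨h1, h2, h3⟩ := (hinv.mem j).1 hj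
    exact ⟨(hpar j h3 h1 h2).1, (hpar j h3 h1 h2).2, h1, h3, h2⟩
  have hcur0 : ∀ j < m, σ.cur j = σ₀.cur j := by
    intro j hj
    refine hinv.other j (fun j' hj' => ?_) fun j' hj' => ?_
    · simpa using slot_ne (dvd_zero m) hj hb (hseen j' hj') hb0.symm
    · simpa using slot_ne (dvd_zero m) hj hpb (hseen j' (hjs j' hj').2.2.2.1) hpb0.symm
  have hcurold : ∀ t < i, ∀ j ∈ bagClauses g (bag t), (t = par i → j ∉ js) →
      σ.cur (m * (t + 1) + j) = σ₀.cur (m * (t + 1) + j) := by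
    intro t ht j hj htj
    have hjt := mem_bagClauses.1 hj
    have hjm : j < m := (h.tracks.slot (m * (t + 1), j) (Or.inr ⟨t, ht, rfl, hjt.2, hjt.1⟩)).1
    refine hinv.other _ (fun j' hj' he => ?_) fun j' hj' he => ?_
    · have := hslot _ _ (Prod.mk.inj
        (slot_inj (Dvd.intro _ rfl) hjm hb (hseen j' hj') he)).1
      omega
    · have := Prod.mk.inj (slot_inj (Dvd.intro _ rfl) hjm hpb (hseen j' (hjs j' hj').2.2.2.1) he)
      exact htj (hslot _ _ this.1) (this.2 ▸ hj')
  set Q := (bagVars (bag i)).filter fun x : ℕ => ∃ s < i, (x : ℤ) ∈ bag s with hQdef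
  set T := js.map fun j => σ₀.cur (pb + j) with hTdef
  have hTlen : T.length = js.length := List.length_map _
  -- If the parent's index is not smaller, the node shares nothing with earlier ones and the empty
  -- bag takes the role of the parent's bag.
  obtain ⟨A, hA, P, hPA, hQA, hTA, hQP, hPc, hP⟩ : ∃ A ∈ L, ∃ P : Finset ℕ, P ⊆ A ∧ Q ⊆ A ∧
      (∀ v ∈ T, v ∈ A) ∧ Q ⊆ P ∧ P.card + js.length ≤ k + 1 ∧ (par i < i →
        bagVars (bag (par i)) ⊆ P ∧
        ∀ j ∈ bagClauses g (bag (par i)), j ∉ js → σ₀.cur (pb + j) ∈ P) := by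
    by_cases hp : par i < i
    · obtain ⟨A, hA, hnA⟩ := hnode _ hp
      have hQP : Q ⊆ bagVars (bag (par i)) := by
        intro x hx
        obtain ⟨h1, s, hs, h2⟩ := Finset.mem_filter.1 hx
        exact mem_bagVars.2 (hv.parent i hi _ (mem_bagVars.1 h1) s hs h2).2
      have hPs : bagVars (bag (par i)) ∪
          (bagClauses g (bag (par i)) \ js.toFinset).image (fun j => σ₀.cur (pb + j)) ⊆
          nodeBag g σ₀.cur pb (bag (par i)) :=
        Finset.union_subset_union_right (Finset.image_subset_image Finset.sdiff_subset)
      refine ⟨A, hA, _, hPs.trans hnA,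
        (hQP.trans Finset.subset_union_left).trans (hPs.trans hnA), ?_,
        hQP.trans Finset.subset_union_left, ?_, fun _ => ⟨Finset.subset_union_left, ?_⟩⟩
      · intro v hvT
        obtain ⟨j, hj, rfl⟩ := List.mem_map.1 hvT
        refine hnA (Finset.mem_union_right _ (Finset.mem_image_of_mem _ ?_))
        exact mem_bagClauses.2 ⟨(hjs j hj).2.1, (hjs j hj).2.2.1⟩
      · have h1 := card_bagVars_add_card_bagClauses g (bag (par i))
        have h2 := hv.length_le (par i) (hp.trans hi)
        have hsub : js.toFinset ⊆ bagClauses g (bag (par i)) := by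
          intro j hj
          rw [List.mem_toFinset] at hj
          exact mem_bagClauses.2 ⟨(hjs j hj).2.1, (hjs j hj).2.2.1⟩
        have h3 := Finset.card_sdiff_add_card_eq_card hsub
        rw [List.toFinset_card_of_nodup hinv.nodup] at h3
        refine (Nat.add_le_add_right ((Finset.card_union_le _ _).trans
          (Nat.add_le_add_left Finset.card_image_le _)) _).trans ?_
        omega
      · intro j hj hjn
        refine Finset.mem_union_right _ (Finset.mem_image_of_mem (fun j => σ₀.cur (pb + j)) ?_)
        exact Finset.mem_sdiff.2 ⟨hj, fun hm => hjn (List.mem_toFinset.1 hm)⟩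
    · have hjs0 : js = [] := List.eq_nil_iff_forall_not_mem.2 fun j hj => hp (hjs j hj).1
      have hQ0 : Q = ∅ := by
        refine Finset.eq_empty_of_forall_notMem fun x hx => hp ?_
        obtain ⟨h1, s, hs, h2⟩ := Finset.mem_filter.1 hx
        exact (hv.parent i hi _ (mem_bagVars.1 h1) s hs h2).1
      refine ⟨∅, hL.empty_mem, ∅, le_rfl, hQ0.le, ?_, hQ0.le, ?_, fun h => absurd h hp⟩
      · simp [hTdef, hjs0]
      · simp [hjs0]
  have hQcard : Q.card + js.length ≤ k + 1 :=
    (Nat.add_le_add_right (Finset.card_le_card hQP) _).trans hPc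
  -- From `P.card + js.length ≤ k + 1` and `Q ⊆ P` the two size conditions follow: `P.card + 2 *
  -- js.length ≤ 2 * k + 2` and `Q.card + js.length + 2 ≤ k + 3`. Both bounds are at most `3 * k +
  -- 1` because `k ≥ 1`.
  obtain ⟨L', hL', hLL', hTbag, ⟨BP, hBP, hPBP, hBP'⟩, ⟨BQ, hBQ, hQBQ, hBQ'⟩, hvert⟩ :=
    hL.prism T P Q A σ₀.next hA hPA hQA hTA hlt
      (by rw [hTlen, Finset.union_eq_left.2 hQP]; right; omega)
      (by rw [hTlen]; right; omega)
  rw [hTlen] at hBP' hBQ' hvert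
  have hvarN : ∀ x ∈ bagVars (bag i), x < N := by
    intro x hx
    rcases hv.code i hi _ (mem_bagVars.1 hx) with h0 | ⟨j, -, he⟩
    · exact_mod_cast h0.2
    · exact absurd he (natCast_ne_clauseCode x j)
  have hmemi : ∀ j ∈ bagClauses g (bag i), (b, j) ∈ nodeSlots g m bag (i + 1) := by
    intro j hj
    have := mem_bagClauses.1 hj
    exact Or.inr ⟨i, by omega, rfl, this.2, this.1⟩
  have hvN : ∀ B ∈ L', ∀ v ∈ B, v < σ.next := by
    intro B hB v hvB
    have hn := hinv.next
    rcases hvert B hB v hvB with ⟨C, hC, hvC⟩ | h1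
    · have := hlt C hC v hvC; omega
    · omega
  have hF : Built (3 * k) (nodeBag g σ.cur b (bag i) :: L') := by
    refine .cons hL' hBQ ?_ ?_
    · have := card_nodeBag_le g σ.cur b (bag i)
      have := hv.length_le i hi
      omega
    · intro v hvF
      rcases Finset.mem_union.1 hvF with hvF | hvF
      · by_cases hs : ∃ s < i, (v : ℤ) ∈ bag s
        · exact Or.inl (hQBQ (Finset.mem_filter.2 ⟨hvF, hs⟩))
        · refine Or.inr fun C hC hvC => ?_
          have hvN := hvarN v hvF
          rcases hvert C hC v hvC with ⟨C', hC', hvC'⟩ | h1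
          · exact hs (hold C' hC' v hvC' hvN)
          · omega
      · obtain ⟨j, hj, rfl⟩ := Finset.mem_image.1 hvF
        obtain ⟨hjb, hg⟩ := mem_bagClauses.1 hj
        by_cases hjjs : j ∈ js
        · obtain ⟨q, hq, rfl⟩ := List.getElem_of_mem hjjs
          refine Or.inl ?_
          simp only [hinv.child q hq]
          exact hBQ' q hq
        · have ht0 : σ₀.topClause j = 0 := by
            by_contra h0
            exact hjjs ((hinv.mem j).2 ⟨hg, h0, hjb⟩)
          have hz := hnew j hjb hg ht0
          refine Or.inr fun C hC hvC => ?_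
          simp only [hinv.moved j hg ht0 hjb] at hvC
          rcases hvert C hC _ hvC with ⟨C', hC', hvC'⟩ | h1
          · exact hroot j hz C' hC' hvC'
          · have := (h.tracks.cur_lt hz).2.1
            simp only [Nat.zero_add] at this
            omega
  refine ⟨_, hF, ?_, ?_, ?_, ?_, ?_⟩
  · intro B hB v hvB
    rcases List.mem_cons.1 hB with rfl | hB
    · rcases Finset.mem_union.1 hvB with hvF | hvF
      · have := hvarN v hvF
        have := htr.le_next
        omega
      · obtain ⟨j, hj, rfl⟩ := Finset.mem_image.1 hvF
        exact (htr.cur_lt (hmemi j hj)).2.1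
    · exact hvN B hB v hvB
  · intro B hB x hx hxN
    rcases List.mem_cons.1 hB with rfl | hB
    · rcases Finset.mem_union.1 hx with hvF | hvF
      · exact ⟨i, by omega, mem_bagVars.1 hvF⟩
      · obtain ⟨j, hj, rfl⟩ := Finset.mem_image.1 hvF
        have := (htr.cur_lt (hmemi j hj)).1
        simp only at this
        omega
    · rcases hvert B hB x hx with ⟨C, hC, hxC⟩ | h1
      · obtain ⟨t, ht, h2⟩ := hold C hC x hxC hxN
        exact ⟨t, by omega, h2⟩
      · omega
  · intro j hj B hB hjB
    obtain ⟨hz, hjb⟩ := (hzmem' j).1 hj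
    have hjm := (h.tracks.slot _ hz).1
    rcases List.mem_cons.1 hB with rfl | hB
    · rcases Finset.mem_union.1 hjB with hvF | hvF
      · have := hvarN _ hvF
        have := (htr.cur_lt hj).1
        simp only [Nat.zero_add] at this
        omega
      · obtain ⟨j', hj', he⟩ := Finset.mem_image.1 hvF
        have := htr.inj _ (hmemi j' hj') _ hj (by simpa using he)
        exact hb0 (Prod.mk.inj this).1
    · rw [hcur0 j hjm] at hjB
      rcases hvert B hB _ hjB with ⟨C, hC, hxC⟩ | h1
      · exact hroot j hz C hC hxC
      · have := (h.tracks.cur_lt hz).2.1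
        simp only [Nat.zero_add] at this
        omega
  · intro t ht
    rcases Nat.lt_succ_iff_lt_or_eq.1 ht with ht | rfl
    -- Among the earlier nodes only the parent has changed open ends; all others keep their bags.
    · by_cases htp : t = par i
      · refine ⟨BP, by simp [hBP], fun v hvB => ?_⟩
        have hp : par i < i := htp ▸ ht
        obtain ⟨hP1, hP2⟩ := hP hp
        rcases Finset.mem_union.1 hvB with hvF | hvF
        · exact hPBP (hP1 (htp ▸ hvF))
        · obtain ⟨j, hj, rfl⟩ := Finset.mem_image.1 hvF
          by_cases hjjs : j ∈ js
          · obtain ⟨q, hq, rfl⟩ := List.getElem_of_mem hjjs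
            have := hinv.rest q hq
            rw [htp, ← hpbdef, this]
            exact hBP' q hq
          · simp only [hcurold t ht j hj fun _ => hjjs]
            refine hPBP ?_
            rw [htp]
            exact hP2 j (htp ▸ hj) hjjs
      · obtain ⟨B, hB, hnB⟩ := hnode t ht
        refine ⟨B, by simp [hLL' B hB], fun v hvB => hnB ?_⟩
        rcases Finset.mem_union.1 hvB with hvF | hvF
        · exact Finset.mem_union_left _ hvF
        · obtain ⟨j, hj, rfl⟩ := Finset.mem_image.1 hvF
          simp only [hcurold t ht j hj fun h => absurd h htp]
          exact Finset.mem_union_right _ (Finset.mem_image_of_mem _ hj)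
    · exact ⟨_, List.mem_cons_self, le_rfl⟩
  · intro t ht
    rcases hinv.terms t ht with ht | ⟨q, hq, ht⟩
    · rcases hterm t ht with ⟨B, hB, h1, h2⟩ | ⟨j, hj, h1, h2⟩
      · exact Or.inl ⟨B, by simp [hLL' B hB], h1, h2⟩
      · have hjm := (h.tracks.slot _ hj).1
        by_cases hjb : clauseCode j ∈ bag i
        · have hg := ((hzmem j).1 hj).1
          have ht0 := ((h.topClause j hg).eq_zero_iff hm).2 ((hzmem j).1 hj).2.2
          have hmem : σ₀.cur j ∈ nodeBag g σ.cur b (bag i) := by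
            rw [← hinv.moved j hg ht0 hjb]
            exact Finset.mem_union_right _ (Finset.mem_image_of_mem (fun j => σ.cur (b + j))
              (mem_bagClauses.2 ⟨hjb, hg⟩))
          exact Or.inl ⟨_, List.mem_cons_self, h1 ▸ hmem, h2 ▸ hmem⟩
        · exact Or.inr ⟨j, (hzmem' j).2 ⟨hj, hjb⟩, by rw [hcur0 j hjm]; exact h1,
            by rw [hcur0 j hjm]; exact h2⟩
    · obtain ⟨B, hB, h1, h2, h3⟩ := hTbag q (hTlen.symm ▸ hq)
      refine Or.inl ⟨B, by simp [hB], ?_⟩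
      rw [List.getElem_map] at h1
      simp only [joinTerms, triangle, List.mem_cons, List.not_mem_nil, or_false] at ht
      rcases ht with rfl | rfl | rfl | rfl | rfl <;> simp [h1, h2, h3]

theorem NodesInv.nodes {σ₀ : BuildState} (ns : List (ℕ × List ℤ))
    (h : NodesInv N g m k R (fun t => (ns.getD t (0, [])).2) 0 σ₀) (hm : 0 < m) (hk : 1 ≤ k)
    (hv : ValidNodes m N k ns.length (fun t => (ns.getD t (0, [])).2)
      fun t => (ns.getD t (0, [])).1) :
    NodesInv N g m k R (fun t => (ns.getD t (0, [])).2) ns.length (nodes g m σ₀ ns) := by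
  suffices ∀ pre suf, ns = pre ++ suf → NodesInv N g m k R (fun t => (ns.getD t (0, [])).2)
      pre.length (BuildState.nodes g m σ₀ pre) from this ns [] (by simp)
  intro pre
  induction pre using List.reverseRecOn with
  | nil => exact fun _ _ => h
  | append_singleton pre n ih =>
    intro suf hsuf
    have hpre := ih (n :: suf) (by simpa using hsuf)
    have hget : ns.getD pre.length (0, []) = n := by
      rw [hsuf]; simp
    have := hpre.step hm hk (by rw [hsuf]; simp) hv
    simp only [hget] at this
    simpa [BuildState.nodes, List.zipIdx_append, node] using this

end BuildState

/-! ### Roots and the attachment of literals -/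

namespace BuildState

variable {g : ℕ → ℕ} {m N k w : ℕ} {R : Finset ℕ}

def activeSlots (g : ℕ → ℕ) (i : ℕ) : Set (ℕ × ℕ) := {p | p.1 = 0 ∧ p.2 < i ∧ g p.2 ≠ 0}

def activeClauses (g : ℕ → ℕ) (i : ℕ) : Finset ℕ := (Finset.range i).filter (g · ≠ 0)

theorem roots_spec (g : ℕ → ℕ) (m N i : ℕ) (hi : i ≤ m) :
    Tracks N g m (roots g (init N) i) (activeSlots g i) (activeClauses g i) ∅ ∧
      (∀ x, (roots g (init N) i).topVar x = 0) ∧ (∀ x, (roots g (init N) i).topClause x = 0) ∧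
      ∀ t ∈ (roots g (init N) i).terms, ∃ j < i, g j ≠ 0 ∧ t.1 = (roots g (init N) i).cur j ∧
        t.2.1 = (roots g (init N) i).cur j := by
  induction i with
  | zero =>
    refine ⟨⟨⟨∅, .init, ?_⟩, ?_, ?_⟩, fun x => rfl, fun x => rfl, ?_⟩
    · rintro p ⟨-, h, -⟩; omega
    · rintro p ⟨-, h, -⟩; omega
    · rintro p ⟨-, h, -⟩; omega
    · simp [roots, init]
  | succ i ih =>
    obtain ⟨h1, h2, h3, h4⟩ := ih (by omega)
    have hsucc : roots g (init N) (i + 1) = rootStep g (roots g (init N) i) i := by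
      simp [roots, List.range_succ]
    rw [hsucc]
    generalize roots g (init N) i = σ at *
    by_cases hg : g i = 0
    · have hσ : rootStep g σ i = σ := by simp [rootStep, hg]
      rw [hσ]
      have hR : activeClauses g (i + 1) = activeClauses g i := by
        simp [activeClauses, Finset.range_add_one, Finset.filter_insert, hg]
      rw [hR]
      refine ⟨h1.mono ?_, h2, h3, fun t ht => ?_⟩
      · rintro p ⟨e1, e2, e3⟩
        refine ⟨e1, ?_, e3⟩
        rcases Nat.lt_succ_iff_lt_or_eq.1 e2 with e2 | e2
        exacts [e2, absurd (e2 ▸ hg) e3]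
      · obtain ⟨j, hj, h⟩ := h4 t ht
        exact ⟨j, by omega, h⟩
    · have hR : activeClauses g (i + 1) = insert i (activeClauses g i) := by
        simp [activeClauses, Finset.range_add_one, Finset.filter_insert, hg]
      have hi' : i ∉ activeClauses g i := by simp [activeClauses]
      refine ⟨?_, ?_, ?_, ?_⟩
      · rw [hR]
        refine (h1.rootStep (by omega) hi' (Nat.pos_of_ne_zero hg)).mono ?_
        rintro ⟨b, j⟩ ⟨e1, e2, e3⟩
        simp only at e1 e2 e3
        subst e1
        rcases Nat.lt_succ_iff_lt_or_eq.1 e2 with e2 | rfl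
        exacts [Or.inr ⟨rfl, e2, e3⟩, Or.inl rfl]
      · simpa [rootStep, hg] using h2
      · simpa [rootStep, hg] using h3
      · intro t ht
        simp only [rootStep, hg, if_false, List.mem_append, List.mem_singleton] at ht ⊢
        rcases ht with ht | rfl
        · obtain ⟨j, hj, h5, h6, h7⟩ := h4 t ht
          refine ⟨j, by omega, h5, ?_, ?_⟩ <;> rw [Function.update_of_ne (by omega)] <;> assumption
        · exact ⟨i, by omega, hg, by simp, by simp⟩

theorem mem_activeClauses {i j : ℕ} : j ∈ activeClauses g i ↔ j < i ∧ g j ≠ 0 := by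
  simp [activeClauses]

theorem nodesInv_roots (g : ℕ → ℕ) (m N k : ℕ) (bag : ℕ → List ℤ) :
    NodesInv N g m k (activeClauses g m) bag 0 (roots g (init N) m) := by
  obtain ⟨h1, h2, h3, h4⟩ := roots_spec g m N m le_rfl
  have hslots : nodeSlots g m bag 0 = activeSlots g m := by
    ext p
    simp only [nodeSlots, activeSlots, Nat.not_lt_zero, false_and, exists_false, Set.ofPred_false,
      Set.union_empty, Set.mem_ofPred_eq, false_imp_iff, implies_true, and_true]
    tauto
  refine ⟨hslots ▸ h1, fun x => Or.inl ⟨h2 x, by simp⟩, fun j _ => Or.inl ⟨h3 j, by simp⟩,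
    [∅], .nil, by simp, by simp, by simp, by simp, fun t ht => Or.inr ?_⟩
  obtain ⟨j, hj, hg, h5, h6⟩ := h4 t ht
  exact ⟨j, hslots ▸ ⟨rfl, hj, hg⟩, h5, h6⟩

/-- The literals of a list of clauses, with the positions of their clauses. -/
def positions (cs : List (List Literal)) : List (ℕ × Literal) :=
  cs.zipIdx.flatMap fun p => p.1.map fun l => (p.2, l)

theorem clauses_eq_foldl (g : ℕ → ℕ) (σ : BuildState) (cs : List (List Literal)) :
    clauses g σ cs = (positions cs).foldl (fun σ q => literalStep g q.1 σ q.2) σ := by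
  unfold clauses positions
  rw [List.foldl_flatMap]
  congr 1
  funext σ p
  rw [List.foldl_map]
  rfl

theorem mem_positions {cs : List (List Literal)} {q : ℕ × Literal} :
    q ∈ positions cs ↔ ∃ c, cs[q.1]? = some c ∧ q.2 ∈ c := by
  obtain ⟨j, l⟩ := q
  simp only [positions, List.mem_flatMap, List.mem_map, Prod.mk.injEq, Prod.exists]
  constructor
  · rintro ⟨c, i, hc, x, b, hl, rfl, rfl⟩
    exact ⟨c, List.mem_zipIdx_iff_getElem?.1 hc, hl⟩
  · rintro ⟨c, hc, hl⟩
    exact ⟨c, j, List.mem_zipIdx_iff_getElem?.2 hc, l.1, l.2, hl, rfl, rfl⟩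

/-- The terms of `σ` are covered by bags that form a tree decomposition of width at most `w`. -/
def Covered (w : ℕ) (σ : BuildState) : Prop :=
  ∃ L, Built w L ∧ (∀ B ∈ L, ∀ v ∈ B, v < σ.next) ∧ ∀ t ∈ σ.terms, ∃ B ∈ L, t.1 ∈ B ∧ t.2.1 ∈ B

/-- Some bags contain the variables and the open ends of the groups into which the clauses and
their slots have been divided. -/
structure GroupInv (N : ℕ) (g : ℕ → ℕ) (m w : ℕ) (R : Finset ℕ) {τ : Type} (X : τ → Finset ℕ)
    (S : τ → Finset (ℕ × ℕ)) (V : Set (ℕ × ℕ)) (A : Finset (ℕ × Literal)) (σ : BuildState) :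
    Prop where
  tracks : Tracks N g m σ V R A
  built : ∃ L, Built w L ∧ (∀ B ∈ L, ∀ v ∈ B, v < σ.next) ∧
    (∀ t ∈ σ.terms, ∃ B ∈ L, t.1 ∈ B ∧ t.2.1 ∈ B) ∧
    ∀ i, (S i).Nonempty → ∃ B ∈ L, X i ⊆ B ∧ ∀ p ∈ S i, σ.cur (p.1 + p.2) ∈ B

/-- Two leaves are added. The first contains the variables and the ends of the group together with
the new end `n + 1`, and becomes the bag of the group. Below it hangs `{y, n, n + 1, l.1}`, which
covers the new terms and is the reason for `3 ≤ w`. By disjointness no other group notices the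
change of the slot. -/
theorem GroupInv.step {τ : Type} {X : τ → Finset ℕ} {S : τ → Finset (ℕ × ℕ)} {V : Set (ℕ × ℕ)}
    {A : Finset (ℕ × Literal)} {σ : BuildState} (h : GroupInv N g m w R X S V A σ)
    (hSV : ∀ i, ∀ p ∈ S i, p ∈ V) (hdisj : ∀ i i', ∀ p ∈ S i, p ∈ S i' → i = i')
    (hcard : ∀ i, (X i).card + (S i).card ≤ w) (hw : 3 ≤ w) {j : ℕ} {l : Literal} {b : ℕ} {i : τ}
    (hbS : (b, j) ∈ S i) (hlX : l.1 ∈ X i) (hslot : σ.literalSlot j l = b + j) (hlN : l.1 < N) :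
    GroupInv N g m w R X S V (insert (j, l) A) (literalStep g j σ l) := by
  have hb := hSV i _ hbS
  refine ⟨h.tracks.literalStep hb hslot hlN, ?_⟩
  obtain ⟨L, hL, hlt, hcov, hgrp⟩ := h.built
  have hNn := h.tracks.le_next
  have hg : g j ≠ 0 := by
    obtain ⟨live, h1, h2⟩ := h.tracks.hist
    exact (h1.weight_pos _ (h.tracks.cur_lt hb).2.2).ne'
  obtain ⟨hjm, hmb⟩ := h.tracks.slot _ hb
  simp only at hjm hmb
  have hup := fun p (hp : p ∈ V) (hne : p ≠ (b, j)) =>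
    h.tracks.cur_update (v := σ.next + 1) hmb hjm hp hne
  have hylt := (h.tracks.cur_lt hb).2.1
  simp only at hylt
  unfold literalStep
  rw [if_neg hg, hslot]
  simp only
  obtain ⟨B, hB, hXB, hSB⟩ := hgrp i ⟨_, hbS⟩
  have hyB := hSB _ hbS
  simp only at hyB
  set y := σ.cur (b + j)
  set n := σ.next
  set F := insert (n + 1) (X i ∪ (S i).image fun p => σ.cur (p.1 + p.2)) with hF
  have hFsub : X i ∪ ((S i).image fun p => σ.cur (p.1 + p.2)) ⊆ B := by
    refine Finset.union_subset hXB fun v hv => ?_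
    obtain ⟨p, hp, rfl⟩ := Finset.mem_image.1 hv
    exact hSB p hp
  have hyF : y ∈ F :=
    Finset.mem_insert_of_mem (Finset.mem_union_right _ (Finset.mem_image.2 ⟨(b, j), hbS, rfl⟩))
  have hlF : l.1 ∈ F := Finset.mem_insert_of_mem (Finset.mem_union_left _ hlX)
  have hFlt : ∀ v ∈ F, v = n + 1 ∨ v < n := by
    intro v hv
    rcases Finset.mem_insert.1 hv with rfl | hv
    exacts [Or.inl rfl, Or.inr (hlt B hB v (hFsub hv))]
  have h1 : Built w (F :: L) := by
    refine .cons hL hB ?_ ?_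
    · refine (Finset.card_insert_le _ _).trans (Nat.succ_le_succ ?_)
      refine (Finset.card_union_le _ _).trans (le_trans ?_ (hcard i))
      exact Nat.add_le_add_left Finset.card_image_le _
    · intro v hv
      rcases Finset.mem_insert.1 hv with rfl | hv
      · refine Or.inr fun C hC hm => ?_
        have := hlt C hC _ hm; omega
      · exact Or.inl (hFsub hv)
  have h2 : Built w (({y, n, n + 1, l.1} : Finset ℕ) :: F :: L) := by
    refine .cons h1 List.mem_cons_self ?_ ?_
    · exact Finset.card_le_four.trans (by omega)
    · intro v hv
      simp only [Finset.mem_insert, Finset.mem_singleton] at hv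
      rcases hv with rfl | rfl | rfl | rfl
      · exact Or.inl hyF
      · refine Or.inr fun C hC hm => ?_
        rcases List.mem_cons.1 hC with rfl | hC
        · have := hFlt _ hm; omega
        · have := hlt C hC _ hm; omega
      · exact Or.inl (by simp [hF])
      · exact Or.inl hlF
  refine ⟨_, h2, ?_, ?_, ?_⟩
  · intro C hC v hv
    simp only [List.mem_cons] at hC
    rcases hC with rfl | rfl | hC
    · simp only [Finset.mem_insert, Finset.mem_singleton] at hv
      omega
    · have := hFlt v hv; omega
    · have := hlt C hC v hv; omega
  · intro t ht
    rcases List.mem_append.1 ht with ht | ht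
    · obtain ⟨C, hC, h⟩ := hcov t ht
      exact ⟨C, by simp [hC], h⟩
    · refine ⟨_, List.mem_cons_self, ?_⟩
      simp only [literalTerms, triangle, List.mem_cons, List.not_mem_nil, or_false,
        List.cons_append, List.nil_append] at ht
      rcases ht with rfl | rfl | rfl | rfl | rfl | rfl <;> simp
  · intro i' hi'
    by_cases hii : i' = i
    · subst hii
      refine ⟨F, by simp, fun v hv => by simp [hF, hv], fun p hp => ?_⟩
      by_cases hpb : p = (b, j)
      · subst hpb; simp [hF]
      · rw [hup p (hSV _ _ hp) hpb]
        exact Finset.mem_insert_of_mem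
          (Finset.mem_union_right _ (Finset.mem_image.2 ⟨p, hp, rfl⟩))
    · obtain ⟨C, hC, h3, h4⟩ := hgrp i' hi'
      refine ⟨C, by simp [hC], h3, fun p hp => ?_⟩
      rw [hup p (hSV _ _ hp) fun hpb => hii (hdisj _ _ p hp (hpb ▸ hbS))]
      exact h4 p hp

theorem literalStep_of_eq_zero {σ : BuildState} {j : ℕ} (hg : g j = 0) (l : Literal) :
    literalStep g j σ l = σ := by
  simp [literalStep, hg]

theorem literalStep_top (g : ℕ → ℕ) (j : ℕ) (σ : BuildState) (l : Literal) :
    (literalStep g j σ l).topVar = σ.topVar ∧ (literalStep g j σ l).topClause = σ.topClause := by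
  unfold literalStep
  split_ifs <;> simp

theorem GroupInv.foldl {τ : Type} {X : τ → Finset ℕ} {S : τ → Finset (ℕ × ℕ)} {V : Set (ℕ × ℕ)}
    {σ : BuildState} (h : GroupInv N g m w R X S V ∅ σ)
    (hSV : ∀ i, ∀ p ∈ S i, p ∈ V) (hdisj : ∀ i i', ∀ p ∈ S i, p ∈ S i' → i = i')
    (hcard : ∀ i, (X i).card + (S i).card ≤ w) (hw : 3 ≤ w) (qs : List (ℕ × Literal))
    (hqs : ∀ q ∈ qs, g q.1 ≠ 0 → q.2.1 < N ∧ ∃ i b, (b, q.1) ∈ S i ∧ q.2.1 ∈ X i ∧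
      σ.literalSlot q.1 q.2 = b + q.1) :
    GroupInv N g m w R X S V (qs.filter (g ·.1 ≠ 0)).toFinset
      (qs.foldl (fun σ q => literalStep g q.1 σ q.2) σ) := by
  suffices (qs.foldl (fun σ q => literalStep g q.1 σ q.2) σ).topVar = σ.topVar ∧
      (qs.foldl (fun σ q => literalStep g q.1 σ q.2) σ).topClause = σ.topClause ∧
      GroupInv N g m w R X S V (qs.filter (g ·.1 ≠ 0)).toFinset
      (qs.foldl (fun σ q => literalStep g q.1 σ q.2) σ) from this.2.2
  induction qs using List.reverseRecOn with
  | nil => exact ⟨rfl, rfl, by simpa using h⟩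
  | append_singleton qs q ih =>
    obtain ⟨h1, h2, h3⟩ := ih fun q hq => hqs q (by simp [hq])
    rw [List.foldl_append]
    simp only [List.foldl_cons, List.foldl_nil]
    generalize qs.foldl (fun σ q => literalStep g q.1 σ q.2) σ = σ' at *
    obtain ⟨h4, h5⟩ := literalStep_top g q.1 σ' q.2
    refine ⟨h4.trans h1, h5.trans h2, ?_⟩
    by_cases hg : g q.1 = 0
    · rw [literalStep_of_eq_zero hg]
      simpa [hg] using h3
    · obtain ⟨hN, i, b, hb, hX, hs⟩ := hqs q (by simp) hg
      have := h3.step hSV hdisj hcard hw hb hX (by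
        rw [← hs]; unfold literalSlot; rw [h1, h2]) hN
      convert this using 1
      ext x
      simp [hg]

theorem mem_active_positions {cs : List (List Literal)} {q : ℕ × Literal} :
    q ∈ ((positions cs).filter (g ·.1 ≠ 0)).toFinset ↔
      g q.1 ≠ 0 ∧ ∃ c, cs[q.1]? = some c ∧ q.2 ∈ c := by
  simp [mem_positions, and_comm]

/-- The result of the construction. -/
structure Complete (N : ℕ) (g : ℕ → ℕ) (cs : List (List Literal)) (σ : BuildState) : Prop where
  hist : ∃ live, FlowHist N g (activeClauses g cs.length)
    ((positions cs).filter (g ·.1 ≠ 0)).toFinset live σ.next σ.terms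

theorem GroupInv.complete {τ : Type} {X : τ → Finset ℕ} {S : τ → Finset (ℕ × ℕ)} {V : Set (ℕ × ℕ)}
    {cs : List (List Literal)} {σ : BuildState}
    (h : GroupInv N g m w (activeClauses g cs.length) X S V
      ((positions cs).filter (g ·.1 ≠ 0)).toFinset σ) : Complete N g cs σ ∧ Covered w σ := by
  obtain ⟨live, h1, h2⟩ := h.tracks.hist
  obtain ⟨L, h3, h4, h5, -⟩ := h.built
  exact ⟨⟨live, h1⟩, L, h3, h4, h5⟩

/-- The construction along a tree decomposition of the incidence graph. -/
theorem complete_of_nodes {cs : List (List Literal)} {ns : List (ℕ × List ℤ)}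
    (hm : 0 < cs.length) (hk : 1 ≤ k)
    (hv : ValidNodes cs.length N k ns.length (fun t => (ns.getD t (0, [])).2)
      fun t => (ns.getD t (0, [])).1)
    (hcov : ∀ q ∈ positions cs, ∃ t < ns.length, (q.2.1 : ℤ) ∈ (ns.getD t (0, [])).2 ∧
      clauseCode q.1 ∈ (ns.getD t (0, [])).2)
    (hactive : ∀ j < cs.length, g j ≠ 0 → ∃ l, (j, l) ∈ positions cs) :
    Complete N g cs (clauses g (nodes g cs.length (roots g (init N) cs.length) ns) cs) ∧
      Covered (3 * k) (clauses g (nodes g cs.length (roots g (init N) cs.length) ns) cs) := by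
  have h := (nodesInv_roots g cs.length N k _).nodes ns hm hk hv
  rw [clauses_eq_foldl]
  generalize nodes g cs.length (roots g (init N) cs.length) ns = σ at *
  set m := cs.length
  set bag := fun t => (ns.getD t (0, [])).2
  set len := ns.length
  have hinj : ∀ s t : ℕ, m * (s + 1) = m * (t + 1) → s = t := fun s t he => by
    have := Nat.eq_of_mul_eq_mul_left hm he; omega
  -- A clause of nonzero weight has a literal, hence lies in some bag, and its root has moved to a
  -- node. Thus all terms are covered.
  have hnoroot : ∀ j, (0, j) ∉ nodeSlots g m bag len := by
    rintro j (⟨-, hg, hj, hn⟩ | ⟨t, -, h0, -⟩)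
    · obtain ⟨l, hl⟩ := hactive j hj hg
      obtain ⟨t, ht, -, hjt⟩ := hcov _ hl
      exact hn t ht hjt
    · simp only at h0
      have : m * (t + 1) ≠ 0 := by positivity
      exact this h0.symm
  have hSmem : ∀ t p, p ∈ (if t < len then (bagClauses g (bag t)).image fun j => (m * (t + 1), j)
      else ∅ : Finset (ℕ × ℕ)) ↔ t < len ∧ p.1 = m * (t + 1) ∧ p.2 ∈ bagClauses g (bag t) := by
    intro t p
    obtain ⟨b, j⟩ := p
    split_ifs with ht
    · simp [ht]
      constructor
      · rintro ⟨h, rfl⟩; exact ⟨rfl, h⟩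
      · rintro ⟨rfl, h⟩; exact ⟨h, rfl⟩
    · simp [ht]
  -- The groups are the nodes. A group has at most `k + 1` elements, and `k + 1 ≤ 3 * k` as well as
  -- `3 ≤ 3 * k` hold since `k ≥ 1`.
  refine (GroupInv.foldl (τ := ℕ) (X := fun t => if t < len then bagVars (bag t) else ∅)
    (S := fun t => if t < len then (bagClauses g (bag t)).image fun j => (m * (t + 1), j) else ∅)
    (V := nodeSlots g m bag len) (w := 3 * k) ⟨h.tracks, ?_⟩ ?_ ?_ ?_ (by omega) _ ?_).complete
  · obtain ⟨L, h1, h2, -, -, h5, h6⟩ := h.built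
    refine ⟨L, h1, h2, fun t ht => (h6 t ht).resolve_right ?_, fun t ⟨p, hp⟩ => ?_⟩
    · rintro ⟨j, hj, -⟩; exact hnoroot j hj
    · have ht := ((hSmem t p).1 hp).1
      obtain ⟨B, hB, hsub⟩ := h5 t ht
      refine ⟨B, hB, ?_, fun p hp => hsub ?_⟩
      · rw [if_pos ht]; exact Finset.subset_union_left.trans hsub
      · obtain ⟨-, h7, h8⟩ := (hSmem t p).1 hp
        rw [h7]
        exact Finset.mem_union_right _ (Finset.mem_image_of_mem (fun j => σ.cur (m * (t + 1) + j)) h8)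
  · intro t p hp
    obtain ⟨h6, h7, h8⟩ := (hSmem t p).1 hp
    exact Or.inr ⟨t, h6, h7, (mem_bagClauses.1 h8).2, (mem_bagClauses.1 h8).1⟩
  · intro t t' p hp hp'
    exact hinj _ _ (((hSmem t p).1 hp).2.1.symm.trans ((hSmem t' p).1 hp').2.1)
  · intro t
    split_ifs with ht
    · have h1 := card_bagVars_add_card_bagClauses g (bag t)
      have h2 := hv.length_le t ht
      have h3 : ((bagClauses g (bag t)).image fun j => (m * (t + 1), j)).card ≤ _ :=
        Finset.card_image_le
      change (bag t).length ≤ k + 1 at h2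
      omega
    · simp
  · rintro ⟨j, l⟩ hq hg
    obtain ⟨t₀, ht₀, hlt₀, hjt₀⟩ := hcov _ hq
    simp only at hg hlt₀ hjt₀ ⊢
    change (l.1 : ℤ) ∈ bag t₀ at hlt₀
    change clauseCode j ∈ bag t₀ at hjt₀
    have hlN : l.1 < N := by
      rcases hv.code t₀ ht₀ _ hlt₀ with h0 | ⟨i, -, he⟩
      · exact_mod_cast h0.2
      · exact absurd he (natCast_ne_clauseCode _ _)
    refine ⟨hlN, ?_⟩
    -- the first node that contains both vertices
    have hex : ∃ t, t < len ∧ (l.1 : ℤ) ∈ bag t ∧ clauseCode j ∈ bag t := ⟨t₀, ht₀, hlt₀, hjt₀⟩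
    classical
    obtain ⟨ht, hlt, hjt⟩ := Nat.find_spec hex
    have hmin := fun s (hs : s < Nat.find hex) => Nat.find_min hex hs
    generalize Nat.find hex = t at *
    have hl : ∃ s ≤ t, σ.topVar l.1 = m * (s + 1) ∧ (l.1 : ℤ) ∈ bag s ∧
        ∀ r < s, (l.1 : ℤ) ∉ bag r := by
      rcases h.topVar l.1 with ⟨-, hn⟩ | ⟨s, hs, h1, h2, h3⟩
      · exact absurd hlt (hn t ht)
      · exact ⟨s, by by_contra hc; exact h3 t (by omega) hlt, h1, h2, h3⟩
    have hj : ∃ s ≤ t, σ.topClause j = m * (s + 1) ∧ clauseCode j ∈ bag s ∧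
        ∀ r < s, clauseCode j ∉ bag r := by
      rcases h.topClause j hg with ⟨-, hn⟩ | ⟨s, hs, h1, h2, h3⟩
      · exact absurd hjt (hn t ht)
      · exact ⟨s, by by_contra hc; exact h3 t (by omega) hjt, h1, h2, h3⟩
    -- If the variable and the clause both occurred before node `t`, then the parent of `t` would
    -- contain both, contrary to the minimality of `t`. So one of the two has its top node at `t`.
    have hmax : max (σ.topVar l.1) (σ.topClause j) = m * (t + 1) := by
      obtain ⟨s, hs, e1, h2, -⟩ := hl
      obtain ⟨s', hs', e2, h3, -⟩ := hj
      have hor : s = t ∨ s' = t := by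
        by_contra hne
        push Not at hne
        have p1 := hv.parent t ht _ hlt s (by omega) h2
        have p2 := hv.parent t ht _ hjt s' (by omega) h3
        exact hmin _ p1.1 ⟨p1.1.trans ht, p1.2, p2.2⟩
      rw [e1, e2]
      rcases hor with rfl | rfl
      · exact max_eq_left (Nat.mul_le_mul_left _ (by omega))
      · exact max_eq_right (Nat.mul_le_mul_left _ (by omega))
    refine ⟨t, m * (t + 1), (hSmem _ _).2 ⟨ht, rfl, mem_bagClauses.2 ⟨hjt, hg⟩⟩, ?_, ?_⟩
    · rw [if_pos ht]; exact mem_bagVars.2 hlt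
    · unfold literalSlot; rw [hmax]

end BuildState

def literalScope (c : List Literal) : Finset ℕ := (c.map Prod.fst).toFinset

theorem mem_literalScope {c : List Literal} {l : Literal} (h : l ∈ c) : l.1 ∈ literalScope c :=
  List.mem_toFinset.2 (List.mem_map_of_mem h)

/-! ### Following a decomposition of the primal graph -/

namespace BuildState

variable {g : ℕ → ℕ} {m N k w : ℕ} {R : Finset ℕ}

/-- Every clause receives a leaf with its variables and its root. This adds one element to a subset
of an old bag, whence the width `k + 1`. The roots are new because they are at least `N` and
pairwise different. -/
theorem Tracks.exists_placed {σ : BuildState} {L₀ : List (Finset ℕ)} {X : ℕ → Finset ℕ}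
    (h : Tracks N g m σ (activeSlots g m) R ∅) (h₀ : Built k L₀)
    (hlt : ∀ B ∈ L₀, ∀ x ∈ B, x < N) (hX : ∀ j < m, ∃ B ∈ L₀, X j ⊆ B) (J : Finset ℕ)
    (hJ : J ⊆ activeClauses g m) :
    ∃ L, Built (k + 1) L ∧ (∀ B ∈ L₀, B ∈ L) ∧ (∀ j ∈ J, ∃ B ∈ L, insert (σ.cur j) (X j) ⊆ B) ∧
      (∀ B ∈ L, ∀ v ∈ B, v < N ∨ ∃ j ∈ J, v = σ.cur j) := by
  induction J using Finset.induction_on with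
  | empty => exact ⟨L₀, h₀.mono (by omega), fun _ => id, by simp, fun B hB v hv => Or.inl (hlt B hB v hv)⟩
  | insert j J hj ih =>
    obtain ⟨L, hL, h1, h2, h3⟩ := ih fun x hx => hJ (Finset.mem_insert_of_mem hx)
    have hjm := mem_activeClauses.1 (hJ (Finset.mem_insert_self j J))
    obtain ⟨B, hB, hXB⟩ := hX j hjm.1
    have hc := (h.cur_lt (p := (0, j)) ⟨rfl, hjm⟩).1
    simp only [Nat.zero_add] at hc
    refine ⟨_, .cons (B := insert (σ.cur j) (X j)) hL (h1 B hB) ?_ ?_, ?_, ?_, ?_⟩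
    · have := Finset.card_insert_le (σ.cur j) (X j)
      have := Finset.card_le_card hXB
      have := h₀.card_le B hB
      omega
    · intro v hv
      rcases Finset.mem_insert.1 hv with rfl | hv
      · refine Or.inr fun C hC hm => ?_
        rcases h3 C hC _ hm with h4 | ⟨i, hi, he⟩
        · omega
        · have him := mem_activeClauses.1 (hJ (Finset.mem_insert_of_mem hi))
          have := h.inj (0, j) ⟨rfl, hjm⟩ (0, i) ⟨rfl, him⟩ (by simpa using he)
          exact hj ((Prod.mk.inj this).2 ▸ hi)
      · exact Or.inl (hXB hv)
    · exact fun C hC => List.mem_cons_of_mem _ (h1 C hC)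
    · intro i hi
      rcases Finset.mem_insert.1 hi with rfl | hi
      · exact ⟨_, List.mem_cons_self, le_rfl⟩
      · obtain ⟨C, hC, h4⟩ := h2 i hi
        exact ⟨C, List.mem_cons_of_mem _ hC, h4⟩
    · intro C hC v hv
      rcases List.mem_cons.1 hC with rfl | hC
      · rcases Finset.mem_insert.1 hv with rfl | hv
        · exact Or.inr ⟨j, Finset.mem_insert_self _ _, rfl⟩
        · exact Or.inl (hlt B hB v (hXB hv))
      · rcases h3 C hC v hv with h4 | ⟨i, hi, he⟩
        exacts [Or.inl h4, Or.inr ⟨i, Finset.mem_insert_of_mem hi, he⟩]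

theorem literalSlot_roots {σ : BuildState} (h1 : ∀ x, σ.topVar x = 0) (h2 : ∀ x, σ.topClause x = 0)
    (j : ℕ) (l : Literal) : σ.literalSlot j l = 0 + j := by
  simp [literalSlot, h1, h2]

/-- The construction from a tree decomposition of the primal graph. -/
theorem complete_of_primal (g : ℕ → ℕ) {cs : List (List Literal)} {L₀ : List (Finset ℕ)}
    (hk : 1 ≤ k) (h₀ : Built k L₀) (hlt : ∀ B ∈ L₀, ∀ x ∈ B, x < N)
    (hscope : ∀ c ∈ cs, ∃ B ∈ L₀, literalScope c ⊆ B) :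
    Complete N g cs (clauses g (roots g (init N) cs.length) cs) ∧
      Covered (k + 2) (clauses g (roots g (init N) cs.length) cs) := by
  obtain ⟨h, h1, h2, h3⟩ := roots_spec g cs.length N cs.length le_rfl
  rw [clauses_eq_foldl]
  generalize roots g (init N) cs.length = σ at *
  set m := cs.length
  have hX : ∀ j < m, ∃ B ∈ L₀, literalScope (cs.getD j []) ⊆ B := by
    intro j hj
    rw [List.getD_eq_getElem _ _ hj]
    exact hscope _ (List.getElem_mem _)
  obtain ⟨L, hL, -, h5, h6⟩ := h.exists_placed h₀ hlt hX (activeClauses g m) le_rfl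
  have hNn := h.le_next
  have hSmem : ∀ j p, p ∈ (if j < m ∧ g j ≠ 0 then {(0, j)} else ∅ : Finset (ℕ × ℕ)) ↔
      j < m ∧ g j ≠ 0 ∧ p = (0, j) := by
    intro j p
    split_ifs with hj
    · simp [hj]
    · simp only [Finset.notMem_empty, false_iff]; tauto
  -- Every clause is a group of its own, with the single slot `j` and at most `k + 1` variables. The
  -- condition `3 ≤ k + 2` is where `k ≥ 1` is needed.
  refine (GroupInv.foldl (τ := ℕ)
    (X := fun j => if j < m ∧ g j ≠ 0 then literalScope (cs.getD j []) else ∅)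
    (S := fun j => if j < m ∧ g j ≠ 0 then {(0, j)} else ∅)
    (V := activeSlots g m) (w := k + 2) ⟨h, ?_⟩ ?_ ?_ ?_ (by omega) _ ?_).complete
  · refine ⟨L, hL.mono (by omega), ?_, ?_, ?_⟩
    · intro B hB v hv
      rcases h6 B hB v hv with h7 | ⟨j, hj, rfl⟩
      · omega
      · have := (h.cur_lt (p := (0, j)) ⟨rfl, mem_activeClauses.1 hj⟩).2.1
        simpa using this
    · intro t ht
      obtain ⟨j, hj, hg, e1, e2⟩ := h3 t ht
      obtain ⟨B, hB, hsub⟩ := h5 j (mem_activeClauses.2 ⟨hj, hg⟩)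
      have := hsub (Finset.mem_insert_self _ _)
      exact ⟨B, hB, e1 ▸ this, e2 ▸ this⟩
    · rintro j ⟨p, hp⟩
      obtain ⟨hj, hg, -⟩ := (hSmem j p).1 hp
      obtain ⟨B, hB, hsub⟩ := h5 j (mem_activeClauses.2 ⟨hj, hg⟩)
      refine ⟨B, hB, ?_, fun p hp => ?_⟩
      · rw [if_pos ⟨hj, hg⟩]
        exact (Finset.subset_insert _ _).trans hsub
      · rw [((hSmem j p).1 hp).2.2]
        simpa using hsub (Finset.mem_insert_self _ _)
  · intro j p hp
    obtain ⟨hj, hg, rfl⟩ := (hSmem j p).1 hp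
    exact ⟨rfl, hj, hg⟩
  · intro i i' p hp hp'
    exact (Prod.mk.inj (((hSmem i p).1 hp).2.2.symm.trans ((hSmem i' p).1 hp').2.2)).2
  · intro j
    split_ifs with hj
    · obtain ⟨B, hB, hsub⟩ := hX j hj.1
      have := Finset.card_le_card hsub
      have := h₀.card_le B hB
      rw [Finset.card_singleton]; omega
    · simp
  · rintro ⟨j, l⟩ hq hg
    obtain ⟨c, hc, hl⟩ := mem_positions.1 hq
    simp only at hc hl hg ⊢
    obtain ⟨hj, rfl⟩ := List.getElem?_eq_some_iff.1 hc
    have hXe : literalScope cs[j] = literalScope (cs.getD j []) := by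
      rw [List.getD_eq_getElem _ _ hj]
    obtain ⟨B, hB, hsub⟩ := hX j hj
    refine ⟨hlt B hB _ (hsub (hXe ▸ mem_literalScope hl)), j, 0, (hSmem _ _).2 ⟨hj, hg, rfl⟩, ?_,
      literalSlot_roots h1 h2 j l⟩
    rw [if_pos ⟨hj, hg⟩, ← hXe]
    exact mem_literalScope hl

/-- The state after some literals of clauses with a single variable. -/
structure SingleInv (N : ℕ) (g : ℕ → ℕ) (m : ℕ) (L₀ : List (Finset ℕ)) (xv : ℕ → ℕ)
    (qs : List (ℕ × Literal)) (σ : BuildState) : Prop where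
  tracks : Tracks N g m σ (activeSlots g m) (activeClauses g m)
    (qs.filter (g ·.1 ≠ 0)).toFinset
  top : (∀ x, σ.topVar x = 0) ∧ ∀ x, σ.topClause x = 0
  built : ∃ L, Built 2 L ∧ (∀ B ∈ L₀, B ∈ L) ∧ (∀ B ∈ L, ∀ v ∈ B, v < σ.next) ∧
    (∀ t ∈ σ.terms, (∃ B ∈ L, t.1 ∈ B ∧ t.2.1 ∈ B) ∨ ∃ j ∈ activeClauses g m,
      (qs.map Prod.fst).count j = 0 ∧ t.1 = σ.cur j ∧ t.2.1 = σ.cur j) ∧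
    (∀ j ∈ activeClauses g m, (qs.map Prod.fst).count j = 0 → ∀ B ∈ L, σ.cur j ∉ B) ∧
    ∀ j ∈ activeClauses g m, (qs.map Prod.fst).count j = 1 → ∃ B ∈ L, xv j ∈ B ∧ σ.cur j ∈ B

/-- Only three elements fit into a bag, but a clause has one variable `x` and at most two literals.
For the first literal, `{x, n, n + 1}` and then `{n, n + 1, y}` are added, where the root `y` has
been in no bag so far. For the second one `x` and the end `y` share a bag, and `{x, y, n}` and then
`{y, n, n + 1}` are added; the last end need not meet `x` any more. -/
theorem SingleInv.step {L₀ : List (Finset ℕ)} {xv : ℕ → ℕ} {qs : List (ℕ × Literal)}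
    {σ : BuildState} (h : SingleInv N g m L₀ xv qs σ) {j : ℕ} {l : Literal} (hj : j < m)
    (hlN : l.1 < N) (hl : l.1 = xv j) (hB₀ : ∃ B ∈ L₀, l.1 ∈ B)
    (hcount : (qs.map Prod.fst).count j ≤ 1) :
    SingleInv N g m L₀ xv (qs ++ [(j, l)]) (literalStep g j σ l) := by
  by_cases hg : g j = 0
  · rw [literalStep_of_eq_zero hg]
    have hc : ∀ i ∈ activeClauses g m,
        ((qs ++ [(j, l)]).map Prod.fst).count i = (qs.map Prod.fst).count i := by
      intro i hi
      have : j ≠ i := fun he => (mem_activeClauses.1 hi).2 (he ▸ hg)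
      simp [this]
    obtain ⟨L, h1, h2, h3, h4, h5, h6⟩ := h.built
    refine ⟨by simpa [hg] using h.tracks, h.top, L, h1, h2, h3, fun t ht => ?_, fun i hi hi' => ?_,
      fun i hi hi' => ?_⟩
    · refine (h4 t ht).imp id fun ⟨i, hi, h7, h8⟩ => ⟨i, hi, by rw [hc i hi]; exact h7, h8⟩
    · exact h5 i hi (hc i hi ▸ hi')
    · exact h6 i hi (hc i hi ▸ hi')
  have hjR : j ∈ activeClauses g m := mem_activeClauses.2 ⟨hj, hg⟩
  have hjV : (0, j) ∈ activeSlots g m := ⟨rfl, hj, hg⟩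
  have hslot := literalSlot_roots h.top.1 h.top.2 j l
  have htr := h.tracks.literalStep hjV hslot hlN
  have hNn := h.tracks.le_next
  have hy := h.tracks.cur_lt hjV
  simp only [Nat.zero_add] at hy
  have hiV : ∀ i ∈ activeClauses g m, (0, i) ∈ activeSlots g m :=
    fun i hi => ⟨rfl, mem_activeClauses.1 hi⟩
  have hlts : ∀ i ∈ activeClauses g m, σ.cur i < σ.next := fun i hi => by
    simpa using (h.tracks.cur_lt (hiV i hi)).2.1
  have hinj : ∀ i ∈ activeClauses g m, σ.cur i = σ.cur j → i = j := fun i hi he =>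
    (Prod.mk.inj (h.tracks.inj _ (hiV i hi) _ hjV (by simpa using he))).2
  obtain ⟨L, h1, h2, h3, h4, h5, h6⟩ := h.built
  have hge : ∀ i ∈ activeClauses g m, N ≤ σ.cur i := fun i hi => by
    simpa using (h.tracks.cur_lt (hiV i hi)).1
  have hfilter : ((qs ++ [(j, l)]).filter (g ·.1 ≠ 0)).toFinset =
      insert (j, l) (qs.filter (g ·.1 ≠ 0)).toFinset := by
    ext x; simp [hg]
  have hc : ∀ i, ((qs ++ [(j, l)]).map Prod.fst).count i =
      (qs.map Prod.fst).count i + if i = j then 1 else 0 := by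
    intro i
    rw [List.map_append, List.count_append]
    by_cases hij : i = j
    · simp [hij]
    · simp [hij, Ne.symm hij]
  have htop := literalStep_top g j σ l
  refine ⟨hfilter ▸ htr, ⟨fun x => by rw [htop.1, h.top.1], fun x => by rw [htop.2, h.top.2]⟩, ?_⟩
  simp only [hc]
  have hcur : ∀ i, (literalStep g j σ l).cur i = if i = j then σ.next + 1 else σ.cur i := by
    intro i
    simp only [literalStep, hg, if_false, hslot, Nat.zero_add, Function.update_apply]
  have hterms : (literalStep g j σ l).terms = σ.terms ++ literalTerms (σ.cur j) σ.next (g j) l := by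
    simp only [literalStep, hg, if_false, hslot, Nat.zero_add]
  have hnext : (literalStep g j σ l).next = σ.next + 2 := by
    simp only [literalStep, hg, if_false]
  simp only [hcur, hterms, hnext]
  set y := σ.cur j
  set n := σ.next
  have hold : ∀ v, v ≤ n + 1 → (v = y → (qs.map Prod.fst).count j = 0) → (n ≤ v ∨ v = y) →
      ∀ C ∈ L, v ∉ C := by
    intro v hv hvy hor C hC hm
    have := h3 C hC v hm
    rcases hor with hor | hor
    · omega
    · rw [hor] at hm
      exact h5 j hjR (hvy hor) C hC hm
  -- the new bags
  obtain ⟨L', hL', hLL', hvert, ⟨B1, hB1, b1, b2⟩, ⟨B2, hB2, b3, b4, b5⟩, hB3⟩ :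
      ∃ L', Built 2 L' ∧ (∀ C ∈ L, C ∈ L') ∧
        (∀ C ∈ L', ∀ v ∈ C, (∃ C ∈ L, v ∈ C) ∨ v = y ∨ v = n ∨ v = n + 1) ∧
        (∃ C ∈ L', l.1 ∈ C ∧ n ∈ C) ∧ (∃ C ∈ L', y ∈ C ∧ n ∈ C ∧ n + 1 ∈ C) ∧
        ((qs.map Prod.fst).count j = 0 → ∃ C ∈ L', l.1 ∈ C ∧ n + 1 ∈ C) := by
    by_cases h0 : (qs.map Prod.fst).count j = 0
    · obtain ⟨B, hB, hlB⟩ := hB₀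
      have s1 : Built 2 (({l.1, n, n + 1} : Finset ℕ) :: L) := by
        refine .cons h1 (h2 B hB) Finset.card_le_three fun v hv => ?_
        simp only [Finset.mem_insert, Finset.mem_singleton] at hv
        rcases hv with rfl | rfl | rfl
        · exact Or.inl hlB
        · exact Or.inr (hold _ (by omega) (fun _ => h0) (by omega))
        · exact Or.inr (hold _ (by omega) (fun _ => h0) (by omega))
      have s2 : Built 2 (({n, n + 1, y} : Finset ℕ) :: ({l.1, n, n + 1} : Finset ℕ) :: L) := by
        refine .cons s1 List.mem_cons_self Finset.card_le_three fun v hv => ?_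
        simp only [Finset.mem_insert, Finset.mem_singleton] at hv
        rcases hv with rfl | rfl | rfl
        · exact Or.inl (by simp)
        · exact Or.inl (by simp)
        · refine Or.inr fun C hC hm => ?_
          rcases List.mem_cons.1 hC with rfl | hC
          · simp only [Finset.mem_insert, Finset.mem_singleton] at hm
            omega
          · exact hold y (by omega) (fun _ => h0) (Or.inr rfl) C hC hm
      refine ⟨_, s2, fun C hC => by simp [hC], ?_, ⟨{l.1, n, n + 1}, by simp, by simp, by simp⟩,
        ⟨_, List.mem_cons_self, by simp, by simp, by simp⟩,
        fun _ => ⟨{l.1, n, n + 1}, by simp, by simp, by simp⟩⟩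
      intro C hC v hv
      simp only [List.mem_cons] at hC
      rcases hC with rfl | rfl | hC
      · simp only [Finset.mem_insert, Finset.mem_singleton] at hv
        omega
      · simp only [Finset.mem_insert, Finset.mem_singleton] at hv
        rcases hv with rfl | hv
        · exact Or.inl ⟨B, h2 B hB, hlB⟩
        · omega
      · exact Or.inl ⟨C, hC, hv⟩
    · obtain ⟨B, hB, hxB, hyB⟩ := h6 j hjR (by omega)
      rw [← hl] at hxB
      have s1 : Built 2 (({l.1, y, n} : Finset ℕ) :: L) := by
        refine .cons h1 hB Finset.card_le_three fun v hv => ?_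
        simp only [Finset.mem_insert, Finset.mem_singleton] at hv
        rcases hv with rfl | rfl | rfl
        · exact Or.inl hxB
        · exact Or.inl hyB
        · exact Or.inr (hold _ (by omega) (fun _ => by omega) (by omega))
      have s2 : Built 2 (({y, n, n + 1} : Finset ℕ) :: ({l.1, y, n} : Finset ℕ) :: L) := by
        refine .cons s1 List.mem_cons_self Finset.card_le_three fun v hv => ?_
        simp only [Finset.mem_insert, Finset.mem_singleton] at hv
        rcases hv with rfl | rfl | rfl
        · exact Or.inl (by simp)
        · exact Or.inl (by simp)
        · refine Or.inr fun C hC hm => ?_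
          rcases List.mem_cons.1 hC with rfl | hC
          · simp only [Finset.mem_insert, Finset.mem_singleton] at hm
            omega
          · have := h3 C hC _ hm; omega
      refine ⟨_, s2, fun C hC => by simp [hC], ?_, ⟨{l.1, y, n}, by simp, by simp, by simp⟩,
        ⟨_, List.mem_cons_self, by simp, by simp, by simp⟩, fun h => absurd h h0⟩
      intro C hC v hv
      simp only [List.mem_cons] at hC
      rcases hC with rfl | rfl | hC
      · simp only [Finset.mem_insert, Finset.mem_singleton] at hv
        omega
      · simp only [Finset.mem_insert, Finset.mem_singleton] at hv
        rcases hv with rfl | hv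
        · exact Or.inl ⟨B, hB, hxB⟩
        · omega
      · exact Or.inl ⟨C, hC, hv⟩
  refine ⟨L', hL', fun C hC => hLL' C (h2 C hC), ?_, ?_, ?_, ?_⟩
  · intro C hC v hv
    rcases hvert C hC v hv with ⟨C', hC', hm⟩ | h7
    · have := h3 C' hC' v hm; omega
    · omega
  · intro t ht
    rcases List.mem_append.1 ht with ht | ht
    · rcases h4 t ht with ⟨B, hB, h7⟩ | ⟨i, hi, h7, h8, h9⟩
      · exact Or.inl ⟨B, hLL' B hB, h7⟩
      · by_cases hij : i = j
        · subst hij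
          exact Or.inl ⟨B2, hB2, h8 ▸ b3, h9 ▸ b3⟩
        · exact Or.inr ⟨i, hi, by simp [hij, h7], by simp [hij, h8], by simp [hij, h9]⟩
    · simp only [literalTerms, triangle, List.mem_cons, List.not_mem_nil, or_false,
        List.cons_append, List.nil_append] at ht
      rcases ht with rfl | rfl | rfl | rfl | rfl | rfl
      · exact Or.inl ⟨B2, hB2, b4, b4⟩
      · exact Or.inl ⟨B2, hB2, b5, b5⟩
      · exact Or.inl ⟨B2, hB2, b3, b4⟩
      · exact Or.inl ⟨B2, hB2, b3, b5⟩
      · exact Or.inl ⟨B2, hB2, b4, b5⟩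
      · exact Or.inl ⟨B1, hB1, b1, b2⟩
  · intro i hi h0 C hC hm
    by_cases hij : i = j
    · simp [hij] at h0
    · simp only [hij, if_false, Nat.add_zero] at h0 hm
      rcases hvert C hC _ hm with ⟨C', hC', hm'⟩ | h7 | h7
      · exact h5 i hi h0 C' hC' hm'
      · exact hij (hinj i hi h7)
      · have := hlts i hi; omega
  · intro i hi h0
    by_cases hij : i = j
    · subst hij
      simp only [if_true, Nat.add_eq_right] at h0 ⊢
      obtain ⟨C, hC, h7, h8⟩ := hB3 h0
      exact ⟨C, hC, hl ▸ h7, h8⟩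
    · simp only [hij, if_false, Nat.add_zero] at h0 ⊢
      obtain ⟨C, hC, h7⟩ := h6 i hi h0
      exact ⟨C, hLL' C hC, h7⟩

theorem count_positions_le (cs : List (List Literal)) (hcs : ∀ c ∈ cs, c.length ≤ 2) (j : ℕ) :
    ((positions cs).map Prod.fst).count j ≤ 2 := by
  have hmap : (positions cs).map Prod.fst = cs.zipIdx.flatMap fun p => List.replicate p.1.length p.2 := by
    simp [positions, List.map_flatMap, List.map_map, Function.comp_def]
  rw [hmap]
  clear hmap
  suffices ∀ i, ((cs.zipIdx i).flatMap fun p => List.replicate p.1.length p.2).count j ≤ 2 ∧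
      (j < i → ((cs.zipIdx i).flatMap fun p => List.replicate p.1.length p.2).count j = 0) from
    (this 0).1
  induction cs with
  | nil => simp
  | cons c cs ih =>
    intro i
    have h1 := hcs c (by simp)
    obtain ⟨h2, h3⟩ := ih (fun d hd => hcs d (by simp [hd])) (i + 1)
    simp only [List.zipIdx_cons, List.flatMap_cons, List.count_append, List.count_replicate]
    by_cases hij : i = j
    · subst hij
      rw [h3 (by omega)]
      simp; exact h1
    · simp only [beq_iff_eq, hij, if_false, Nat.zero_add]
      exact ⟨h2, fun h => h3 (by omega)⟩

/-- The construction for formulas in which no clause has two different variables. -/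
theorem complete_of_edgeless (g : ℕ → ℕ) {cs : List (List Literal)} {L₀ : List (Finset ℕ)}
    (h₀ : Built 0 L₀) (hlt : ∀ B ∈ L₀, ∀ x ∈ B, x < N)
    (hscope : ∀ c ∈ cs, ∃ B ∈ L₀, literalScope c ⊆ B) (hnodup : ∀ c ∈ cs, c.Nodup)
    (hactive : ∀ q ∈ activeClauses g cs.length, cs.getD q [] ≠ []) :
    Complete N g cs (clauses g (roots g (init N) cs.length) cs) ∧
      Covered 2 (clauses g (roots g (init N) cs.length) cs) := by
  obtain ⟨h, h1, h2, h3⟩ := roots_spec g cs.length N cs.length le_rfl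
  rw [clauses_eq_foldl]
  generalize roots g (init N) cs.length = σ at *
  set m := cs.length
  set xv : ℕ → ℕ := fun j => ((cs.getD j []).headD (0, true)).1
  -- Bags of width `0` have at most one element, so a clause has at most one variable. Its literals
  -- then differ in their signs, and there are at most two of them.
  have hsame : ∀ c ∈ cs, ∀ l ∈ c, ∀ l' ∈ c, l.1 = l'.1 := by
    intro c hc l hl l' hl'
    obtain ⟨B, hB, hsub⟩ := hscope c hc
    exact Finset.card_le_one.1 (h₀.card_le B hB) _ (hsub (mem_literalScope hl)) _
      (hsub (mem_literalScope hl'))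
  have hlen : ∀ c ∈ cs, c.length ≤ 2 := by
    intro c hc
    have hn : (c.map Prod.snd).Nodup := (List.nodup_map_iff_inj_on (hnodup c hc)).2
      fun l hl l' hl' he => Prod.ext (hsame c hc l hl l' hl') he
    have := hn.length_le_card
    simpa using this
  have key : ∀ pre suf, positions cs = pre ++ suf → SingleInv N g m L₀ xv pre
      (pre.foldl (fun σ q => literalStep g q.1 σ q.2) σ) := by
    intro pre
    induction pre using List.reverseRecOn with
    | nil =>
      intro suf _
      refine ⟨by simpa using h, ⟨h1, h2⟩, L₀, h₀.mono (by omega), fun _ => id, ?_, ?_, ?_, by simp⟩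
      · intro B hB v hv
        have := hlt B hB v hv
        have := h.le_next
        simp only [List.foldl_nil]; omega
      · intro t ht
        obtain ⟨j, hj, hg, h5⟩ := h3 t ht
        exact Or.inr ⟨j, mem_activeClauses.2 ⟨hj, hg⟩, by simp, h5⟩
      · intro j hj _ B hB hm
        have := hlt B hB _ hm
        have := (h.cur_lt (p := (0, j)) ⟨rfl, mem_activeClauses.1 hj⟩).1
        simp only [Nat.zero_add, List.foldl_nil] at *
        omega
    | append_singleton pre q ih =>
      intro suf hsuf
      obtain ⟨j, l⟩ := q
      have hq : (j, l) ∈ positions cs := by rw [hsuf]; simp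
      obtain ⟨c, hc, hl⟩ := mem_positions.1 hq
      simp only at hc hl
      obtain ⟨hj, rfl⟩ := List.getElem?_eq_some_iff.1 hc
      have hcm : cs[j] ∈ cs := List.getElem_mem _
      obtain ⟨B, hB, hsub⟩ := hscope _ hcm
      have hlB := hsub (mem_literalScope hl)
      rw [List.foldl_append]
      refine (ih ((j, l) :: suf) (by simpa using hsuf)).step hj (hlt B hB _ hlB) ?_ ⟨B, hB, hlB⟩ ?_
      · simp only [xv, List.getD_eq_getElem _ _ hj]
        refine hsame _ hcm _ hl _ ?_
        rcases hcj : cs[j] with _ | ⟨a, c⟩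
        · rw [hcj] at hl; simp at hl
        · simp
      · have := count_positions_le cs hlen j
        rw [hsuf] at this
        simp only [List.map_append, List.count_append, List.map_cons, List.map_nil,
          List.count_singleton_self] at this
        omega
  have hfin := key (positions cs) [] (by simp)
  generalize (positions cs).foldl (fun σ q => literalStep g q.1 σ q.2) σ = σ' at *
  obtain ⟨live, h4, h5⟩ := hfin.tracks.hist
  obtain ⟨L, h6, -, h7, h8, -⟩ := hfin.built
  refine ⟨⟨live, h4⟩, L, h6, h7, fun t ht => (h8 t ht).resolve_right ?_⟩
  rintro ⟨j, hj, h0, -⟩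
  have hne := hactive j hj
  have hjm := (mem_activeClauses.1 hj).1
  rw [List.getD_eq_getElem _ _ hjm] at hne
  obtain ⟨l, hl⟩ := List.exists_mem_of_ne_nil _ hne
  have : (j, l) ∈ positions cs := mem_positions.2 ⟨_, List.getElem?_eq_getElem hjm, hl⟩
  exact List.count_eq_zero.1 h0 (List.mem_map_of_mem this)

/-- Without active clauses no term is constructed. -/
theorem terms_of_inactive (hg : ∀ j, g j = 0) (m N : ℕ) (ns : List (ℕ × List ℤ))
    (cs : List (List Literal)) :
    (clauses g (nodes g m (roots g (init N) m) ns) cs).terms = [] ∧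
      (clauses g (nodes g m (roots g (init N) m) ns) cs).next = N := by
  have h1 : roots g (init N) m = init N := by
    unfold roots
    induction m with
    | zero => rfl
    | succ m ih => rw [List.range_succ, List.foldl_append, ih]; simp [rootStep, hg]
  have h2 : ∀ σ : BuildState, clauses g σ cs = σ := by
    intro σ
    rw [clauses_eq_foldl]
    induction positions cs generalizing σ with
    | nil => rfl
    | cons q qs ih => rw [List.foldl_cons, literalStep_of_eq_zero (hg _), ih]
  have h3 : ∀ (b pb : ℕ) (l : List ℤ) (σ : BuildState), (l.foldl (bagStep g b pb) σ).terms = σ.terms ∧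
      (l.foldl (bagStep g b pb) σ).next = σ.next := by
    intro b pb l
    induction l with
    | nil => simp
    | cons v l ih =>
      intro σ
      rw [List.foldl_cons, (ih _).1, (ih _).2]
      unfold bagStep
      simp only [hg, if_true]
      split_ifs <;> simp
  rw [h2, h1]
  unfold nodes
  suffices ∀ (l : List ((ℕ × List ℤ) × ℕ)) (σ : BuildState),
      (l.foldl (node g m) σ).terms = σ.terms ∧ (l.foldl (node g m) σ).next = σ.next by
    simpa [init] using this ns.zipIdx (init N)
  intro l
  induction l with
  | nil => simp
  | cons p l ih =>
    intro σ
    rw [List.foldl_cons, (ih _).1, (ih _).2]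
    exact h3 _ _ _ _

end BuildState

/-! ### From weights to networks -/

def finiteSum (cs : List (List Literal × ℕ∞)) : ℕ :=
  (cs.map fun c => if c.2 = ⊤ then 0 else c.2.toNat).sum

/-- The weight `∞` is replaced by the finite weight `W`. -/
def finiteWeight (W : ℕ) (a : ℕ∞) : ℕ := if a = ⊤ then W else a.toNat

/-- The empty clause has no literal and is falsified by every assignment. It gets no network; its
weight is a constant and goes into the offset. -/
def gadgetWeight (W : ℕ) (cs : List (List Literal × ℕ∞)) (j : ℕ) : ℕ :=
  match cs[j]? with
  | some c => if c.1 = [] then 0 else finiteWeight W c.2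
  | none => 0

/-- The energy of a network omits the constant `3 * w` of the root. For the empty clause the offset
cancels the weight that is always paid. -/
def clauseOffset (W : ℕ) (c : List Literal × ℕ∞) : ℤ :=
  if c.1 = [] then -(finiteWeight W c.2 : ℤ) else -(3 * (finiteWeight W c.2 : ℤ))

def gadgetOffset (W : ℕ) (cs : List (List Literal × ℕ∞)) : ℤ := (cs.map (clauseOffset W)).sum

def Falsified (β : ℕ → Bool) (c : List Literal) : Prop := ∀ l ∈ c, β l.1 ≠ l.2

instance (β : ℕ → Bool) (c : List Literal) : Decidable (Falsified β c) :=
  inferInstanceAs (Decidable (∀ l ∈ c, β l.1 ≠ l.2))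

/-- The cost with the weight `∞` replaced by `W`. -/
def finiteCost (W : ℕ) (cs : List (List Literal × ℕ∞)) (β : ℕ → Bool) : ℤ :=
  (cs.map fun c => if Falsified β c.1 then (finiteWeight W c.2 : ℤ) else 0).sum

theorem sum_range_getElem? {α : Type} (cs : List α) (f : Option α → ℤ) :
    ∑ j ∈ Finset.range cs.length, f cs[j]? = (cs.map fun c => f (some c)).sum := by
  induction cs with
  | nil => simp
  | cons c cs ih =>
    rw [List.length_cons, Finset.sum_range_succ', List.map_cons, List.sum_cons, ← ih]
    simp [add_comm]

theorem sum_activeClauses (W : ℕ) (cs : List (List Literal × ℕ∞)) (f : Option (List Literal × ℕ∞) → ℤ)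
    (F : ℕ → Prop) [DecidablePred F]
    (hf : ∀ j, j < cs.length → (if F j then (gadgetWeight W cs j : ℤ) else 0) = f cs[j]?) :
    (∑ j ∈ BuildState.activeClauses (gadgetWeight W cs) cs.length,
      if F j then (gadgetWeight W cs j : ℤ) else 0) = (cs.map fun c => f (some c)).sum := by
  rw [← sum_range_getElem?, BuildState.activeClauses, Finset.sum_filter]
  refine Finset.sum_congr rfl fun j hj => ?_
  rw [← hf j (Finset.mem_range.1 hj)]
  by_cases h0 : gadgetWeight W cs j = 0 <;> simp [h0]

/-- Every assignment satisfies `FlowHist.lower_bound` with `F` the set of its falsified clauses; the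
remaining sum over open ends is nonnegative. Equality is reached by the flow that stops at some open
end for a falsified clause and ends in a true literal for every other clause. -/
theorem simulates_gadgets {N W : ℕ} {cs : List (List Literal × ℕ∞)} {σ : BuildState}
    (h : BuildState.Complete N (gadgetWeight W cs) (cs.map Prod.fst) σ) :
    Simulates (finiteCost W cs) (energyOf σ.terms) (gadgetOffset W cs) := by
  obtain ⟨live, hist⟩ := h.hist
  set A := ((BuildState.positions (cs.map Prod.fst)).filter (gadgetWeight W cs ·.1 ≠ 0)).toFinset
  rw [List.length_map] at hist
  have hA : ∀ j l, (j, l) ∈ A ↔ gadgetWeight W cs j ≠ 0 ∧ ∃ c, cs[j]? = some c ∧ l ∈ c.1 := by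
    intro j l
    simp only [A, BuildState.mem_active_positions, List.getElem?_map, Option.map_eq_some_iff]
    refine and_congr_right fun _ => ?_
    constructor
    · rintro ⟨_, ⟨c, hc, rfl⟩, hl⟩; exact ⟨c, hc, hl⟩
    · rintro ⟨c, hc, hl⟩; exact ⟨_, ⟨c, hc, rfl⟩, hl⟩
  let F : (ℕ → Bool) → ℕ → Prop := fun β j => ∃ c, cs[j]? = some c ∧ Falsified β c.1
  classical
  have htotal : (∑ j ∈ BuildState.activeClauses (gadgetWeight W cs) cs.length,
      (gadgetWeight W cs j : ℤ)) = (cs.map fun c => if c.1 = [] then 0 else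
        (finiteWeight W c.2 : ℤ)).sum := by
    have := sum_activeClauses W cs (fun o => match o with
      | some c => if c.1 = [] then 0 else (finiteWeight W c.2 : ℤ)
      | none => 0) (fun _ => True) (fun j hj => by
        rw [List.getElem?_eq_getElem hj]
        simp only [gadgetWeight, List.getElem?_eq_getElem hj, if_true]
        split_ifs <;> simp)
    simpa using this
  have hfalse : ∀ β, (∑ j ∈ BuildState.activeClauses (gadgetWeight W cs) cs.length,
      if F β j then (gadgetWeight W cs j : ℤ) else 0) = (cs.map fun c =>
        if c.1 ≠ [] ∧ Falsified β c.1 then (finiteWeight W c.2 : ℤ) else 0).sum := by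
    intro β
    refine sum_activeClauses W cs (fun o => match o with
      | some c => if c.1 ≠ [] ∧ Falsified β c.1 then (finiteWeight W c.2 : ℤ) else 0
      | none => 0) (F β) fun j hj => ?_
    simp only [F, gadgetWeight, List.getElem?_eq_getElem hj, Option.some.injEq, exists_eq_left']
    by_cases h1 : cs[j].1 = [] <;> by_cases h2 : Falsified β cs[j].1 <;> simp [h1, h2]
  have hkey : ∀ β, finiteCost W cs β + gadgetOffset W cs =
      (cs.map fun c => if c.1 ≠ [] ∧ Falsified β c.1 then (finiteWeight W c.2 : ℤ) else 0).sum -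
        3 * (cs.map fun c => if c.1 = [] then 0 else (finiteWeight W c.2 : ℤ)).sum := by
    intro β
    unfold finiteCost gadgetOffset clauseOffset
    clear htotal hfalse hist h hA
    induction cs with
    | nil => simp
    | cons c cs ih =>
      simp only [List.map_cons, List.sum_cons]
      have : c.1 = [] → Falsified β c.1 := fun h => by simp [h, Falsified]
      have ih := ih
      by_cases h1 : c.1 = []
      · simp only [h1, if_true, ne_eq, not_true, false_and, if_false]
        rw [h1] at this
        simp only [this rfl, if_true]
        linarith
      · by_cases h2 : Falsified β c.1 <;> simp only [h1, h2, if_true, if_false, ne_eq, not_false_eq_true, and_self, and_false] <;> linarith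
  refine ⟨fun β => ?_, fun β => ?_⟩
  · have := hist.lower_bound β (F β) (by
      rintro ⟨j, l⟩ hm ⟨c, hc, hF⟩
      obtain ⟨-, c', hc', hl⟩ := (hA j l).1 hm
      rw [hc] at hc'
      cases hc'
      exact hF l hl)
    rw [htotal, hfalse] at this
    have hnn : 0 ≤ ∑ p ∈ live, (if F β p.1 then 0 else
        (gadgetWeight W cs p.1 : ℤ) * FlowHist.bitValue (β p.2)) := by
      refine Finset.sum_nonneg fun p _ => ?_
      split_ifs
      · exact le_rfl
      · refine mul_nonneg (Int.natCast_nonneg _) ?_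
        unfold FlowHist.bitValue; split_ifs <;> simp
    rw [hkey]
    linarith
  · have hlive : ∀ j ∈ BuildState.activeClauses (gadgetWeight W cs) cs.length, ∃ y, (j, y) ∈ live :=
      hist.exists_live
    choose! y hy using hlive
    obtain ⟨β', h1, -, h2⟩ := hist.exists_flow β (fun j => if F β j then some (y j) else none) (by
      intro j hj
      have hj' := BuildState.mem_activeClauses.1 hj
      by_cases hF : F β j
      · exact Or.inr ⟨y j, by simp [hF], hy j hj⟩
      · refine Or.inl ⟨by simp [hF], ?_⟩
        have : ¬ Falsified β cs[j].1 := fun h =>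
          hF ⟨_, List.getElem?_eq_getElem hj'.1, h⟩
        unfold Falsified at this
        push Not at this
        obtain ⟨l, hl, he⟩ := this
        exact ⟨l, (hA j l).2 ⟨hj'.2, _, List.getElem?_eq_getElem hj'.1, hl⟩, he⟩)
    refine ⟨β', ?_⟩
    rw [htotal] at h2
    have h3 : (∑ j ∈ BuildState.activeClauses (gadgetWeight W cs) cs.length,
        if (if F β j then some (y j) else none) = none then 0 else (gadgetWeight W cs j : ℤ)) =
        ∑ j ∈ BuildState.activeClauses (gadgetWeight W cs) cs.length,
          if F β j then (gadgetWeight W cs j : ℤ) else 0 :=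
      Finset.sum_congr rfl fun j _ => by by_cases hF : F β j <;> simp [hF]
    rw [h3, hfalse] at h2
    rw [hkey]
    linarith

/-- If the cost is infinite, some falsified clause has the weight `∞`, and it alone contributes `W`
to a sum of nonnegative numbers. -/
theorem finiteWeight_eq_top {W : ℕ} {cs : List (List Literal × ℕ∞)} {β : ℕ → Bool}
    (h : (cs.map fun c => if ∀ l ∈ c.1, β l.1 ≠ l.2 then c.2 else 0).sum = ⊤) :
    (W : ℤ) ≤ finiteCost W cs β := by
  have hnn : ∀ cs : List (List Literal × ℕ∞), 0 ≤ finiteCost W cs β := by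
    intro cs
    refine List.sum_nonneg fun z hz => ?_
    obtain ⟨c, _, rfl⟩ := List.mem_map.1 hz
    split_ifs <;> simp
  induction cs with
  | nil => simp at h
  | cons c cs ih =>
    have := hnn cs
    have e : finiteCost W (c :: cs) β =
      (if Falsified β c.1 then (finiteWeight W c.2 : ℤ) else 0) + finiteCost W cs β := rfl
    rw [e]
    rw [List.map_cons, List.sum_cons, ENat.add_eq_top] at h
    rcases h with h | h
    · split_ifs at h with hF
      · rw [if_pos (show Falsified β c.1 from hF), finiteWeight, if_pos h]
        linarith
      · simp at h
    · have := ih h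
      split_ifs
      · have := Int.natCast_nonneg (finiteWeight W c.2); linarith
      · linarith

/-- If the cost is finite, no falsified clause has the weight `∞`, so the value of `W` is irrelevant
and the cost is at most the sum of the finite weights. With `W = finiteSum cs + 1` the two cases are
separated. -/
theorem finiteWeight_ne_top {W : ℕ} {cs : List (List Literal × ℕ∞)} {β : ℕ → Bool}
    (h : (cs.map fun c => if ∀ l ∈ c.1, β l.1 ≠ l.2 then c.2 else 0).sum ≠ ⊤) :
    ENat.map (fun n : ℕ => (n : ℤ))
        (cs.map fun c => if ∀ l ∈ c.1, β l.1 ≠ l.2 then c.2 else 0).sum =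
      (finiteCost W cs β : WithTop ℤ) ∧ finiteCost W cs β ≤ finiteSum cs := by
  induction cs with
  | nil => exact ⟨rfl, by simp [finiteCost, finiteSum]⟩
  | cons c cs ih =>
    rw [List.map_cons, List.sum_cons] at h ⊢
    have h' := h
    rw [Ne, ENat.add_eq_top, not_or] at h'
    obtain ⟨h1, h2⟩ := ih h'.2
    have e : finiteCost W (c :: cs) β =
      (if Falsified β c.1 then (finiteWeight W c.2 : ℤ) else 0) + finiteCost W cs β := rfl
    have e2 : finiteSum (c :: cs) = (if c.2 = ⊤ then 0 else c.2.toNat) + finiteSum cs := rfl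
    rw [e, e2]
    by_cases hF : Falsified β c.1
    · have hF' : ∀ l ∈ c.1, β l.1 ≠ l.2 := hF
      simp only [if_pos hF'] at h' ⊢
      have h3 := h'.1
      simp only [if_pos hF, finiteWeight, if_neg h3]
      refine ⟨?_, by push_cast; linarith⟩
      obtain ⟨n, hn⟩ := ENat.ne_top_iff_exists.1 h3
      obtain ⟨n', hn'⟩ := ENat.ne_top_iff_exists.1 h'.2
      rw [← hn'] at h1 ⊢
      rw [← hn]
      rw [ENat.map_natCast] at h1
      rw [ENat.toNat_natCast, ← Nat.cast_add, ENat.map_natCast]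
      have h4 : (n' : ℤ) = finiteCost W cs β := by exact_mod_cast h1
      rw [← h4]
      push_cast
      rfl
    · have hF' : ¬ ∀ l ∈ c.1, β l.1 ≠ l.2 := hF
      simp only [if_neg hF', if_neg hF, zero_add]
      exact ⟨h1, h2.trans (by exact_mod_cast Nat.le_add_left _ _)⟩

/-- The quadratic function, written down as an instance of `Q`, represents the formula. -/
theorem exists_represents {Q : OptProblem} (T : Target Q) (φ : WCNF) {N Z : ℕ} {σ : BuildState}
    (h : BuildState.Complete N (gadgetWeight (finiteSum φ.clauses + 1) φ.clauses)
      (φ.clauses.map Prod.fst) σ)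
    (hZ : σ.next ≤ Z) :
    ∃ J : Q.Inst, Q.words J = (T.count Z σ.terms : ℤ) :: T.enc Z σ.terms ∧
      Represents maxSAT Q φ J
        (gadgetOffset (finiteSum φ.clauses + 1) φ.clauses + T.offset σ.terms)
        (gadgetOffset (finiteSum φ.clauses + 1) φ.clauses + T.offset σ.terms +
          (finiteSum φ.clauses + 1 : ℕ)) ∧
      (∀ w, 2 ≤ w → BuildState.Covered w σ → Q.tw J ≤ w ∧ Q.itw J ≤ w) ∧
      (σ.terms = [] → Q.itw J = 0) := by
  obtain ⟨live, hist⟩ := h.hist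
  obtain ⟨J, h1, ⟨f', h2, h3⟩, h4, h5⟩ := T.exists_inst Z σ.terms
    ⟨fun t ht => (hist.terms_lt t ht).1, fun t ht => (hist.terms_lt t ht).2.trans_le hZ,
      hist.terms_ne_zero, hist.terms_distinct⟩
  have hsim := (simulates_gadgets h).trans h3
  refine ⟨J, h1, represents_of_simulates hsim ?_ ?_ ?_ h2 ?_, ?_, h5⟩
  · intro β hβ
    refine (finiteWeight_ne_top ?_).1
    intro he
    exact hβ (by change ENat.map _ (φ.cost β) = ⊤; rw [ENat.map_eq_top_iff]; exact he)
  · intro β hβ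
    have : φ.cost β = ⊤ := by
      change ENat.map _ (φ.cost β) = ⊤ at hβ
      rwa [ENat.map_eq_top_iff] at hβ
    have := finiteWeight_eq_top (W := finiteSum φ.clauses + 1) this
    linarith
  · rintro ⟨β, hβ⟩
    refine ⟨β, ?_⟩
    have : φ.cost β ≠ ⊤ := fun he => hβ (by
      change ENat.map _ (φ.cost β) = ⊤; rw [ENat.map_eq_top_iff]; exact he)
    have := (finiteWeight_ne_top (W := finiteSum φ.clauses + 1) this).2
    push_cast
    linarith
  · refine ⟨0, fun β => List.sum_nonneg fun z hz => ?_⟩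
    obtain ⟨c, _, rfl⟩ := List.mem_map.1 hz
    split_ifs <;> simp
  · rintro w hw ⟨L, hL, hlt, hcov⟩
    exact h4 w hw L hL (fun B hB x hx => (hlt B hB x hx).trans_le hZ) hcov

/-! ### The construction for a given formula -/

def TreeDecomposition.nodeList {V : Type} {G : SimpleGraph V} (D : TreeDecomposition G)
    (code : V → ℤ) : List (ℕ × List ℤ) :=
  (List.finRange (D.last + 1)).map fun t => ((D.parent t : ℕ), (D.bag t).map code)

section

variable {S : List (Finset ℕ)} (D : TreeDecomposition (incidenceGraph S))

theorem incidenceCode_injective (S : List (Finset ℕ)) : Function.Injective (incidenceCode S) := by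
  rintro (x | i) (y | j) h
  · exact congrArg _ (Subtype.ext (by simpa [incidenceCode] using h))
  · exact absurd h (natCast_ne_clauseCode _ _)
  · exact absurd h.symm (natCast_ne_clauseCode _ _)
  · exact congrArg _ (Fin.ext (clauseCode_inj h))

theorem TreeDecomposition.length_nodeList : (D.nodeList (incidenceCode S)).length = D.last + 1 := by
  simp [nodeList]

theorem TreeDecomposition.getD_nodeList {t : ℕ} (ht : t < D.last + 1) :
    (D.nodeList (incidenceCode S)).getD t (0, []) =
      ((D.parent ⟨t, ht⟩ : ℕ), (D.bag ⟨t, ht⟩).map (incidenceCode S)) := by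
  rw [List.getD_eq_getElem _ _ (by rwa [D.length_nodeList])]
  simp [nodeList]

theorem TreeDecomposition.validNodes {N m : ℕ} (hN : ∀ s ∈ S, ∀ x ∈ s, x < N) (hm : S.length ≤ m) :
    ValidNodes m N D.width (D.nodeList (incidenceCode S)).length
      (fun t => ((D.nodeList (incidenceCode S)).getD t (0, [])).2)
      fun t => ((D.nodeList (incidenceCode S)).getD t (0, [])).1 := by
  rw [D.length_nodeList]
  refine ⟨fun t ht => ?_, fun t ht v hv => ?_, fun t ht v hv s hs hvs => ?_, fun t ht => ?_⟩
  · simp only [D.getD_nodeList ht]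
    exact (D.bag_nodup _).map (incidenceCode_injective S)
  · simp only [D.getD_nodeList ht] at hv
    obtain ⟨a, -, rfl⟩ := List.mem_map.1 hv
    rcases a with ⟨x, s, hs, hx⟩ | j
    · exact Or.inl ⟨by simp [incidenceCode], by simpa [incidenceCode] using hN s hs x hx⟩
    · exact Or.inr ⟨j, j.2.trans_le hm, rfl⟩
  · have hs' := hs.trans ht
    simp only [D.getD_nodeList ht] at hv ⊢
    simp only [D.getD_nodeList hs'] at hvs
    obtain ⟨a, ha, rfl⟩ := List.mem_map.1 hv
    obtain ⟨a', ha', he⟩ := List.mem_map.1 hvs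
    obtain rfl := incidenceCode_injective S he
    have h1 := D.parent_lt ⟨t, ht⟩ (fun h => by have := congrArg Fin.val h; simp at this; omega)
    have h2 := parent_mem_of_connected D.parent_root D.parent_lt (D.connected a').preconnected
      (t := ⟨t, ht⟩) (t' := ⟨s, hs'⟩) ha ha' hs
    refine ⟨h1, ?_⟩
    rw [D.getD_nodeList (D.parent ⟨t, ht⟩).2]
    exact List.mem_map_of_mem h2
  · simp only [D.getD_nodeList ht, List.length_map]
    have : (D.bag ⟨t, ht⟩).length ≤ Finset.univ.sup fun t => (D.bag t).length :=
      Finset.le_sup (f := fun t => (D.bag t).length) (Finset.mem_univ _)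
    unfold width
    omega

theorem TreeDecomposition.exists_node {j x : ℕ} (hj : j < S.length) (hx : x ∈ S[j]) :
    ∃ t < (D.nodeList (incidenceCode S)).length,
      (x : ℤ) ∈ ((D.nodeList (incidenceCode S)).getD t (0, [])).2 ∧
      clauseCode j ∈ ((D.nodeList (incidenceCode S)).getD t (0, [])).2 := by
  obtain ⟨t, h1, h2⟩ := D.covering (Sum.inl ⟨x, S[j], List.getElem_mem _, hx⟩)
    (Sum.inr ⟨j, hj⟩) ⟨by simp, Or.inl ⟨_, _, rfl, rfl, hx⟩⟩
  refine ⟨t, by rw [D.length_nodeList]; exact t.2, ?_⟩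
  rw [D.getD_nodeList t.2]
  exact ⟨List.mem_map.2 ⟨_, h1, rfl⟩, List.mem_map.2 ⟨_, h2, rfl⟩⟩

end

/-- The construction for a formula and a list of nodes. -/
def construct (N : ℕ) (cs : List (List Literal × ℕ∞)) (ns : List (ℕ × List ℤ)) : BuildState :=
  .clauses (gadgetWeight (finiteSum cs + 1) cs)
    (.nodes (gadgetWeight (finiteSum cs + 1) cs) cs.length
      (.roots (gadgetWeight (finiteSum cs + 1) cs) (.init N) cs.length) ns) (cs.map Prod.fst)

theorem exists_of_gadgetWeight_ne_zero {W : ℕ} {cs : List (List Literal × ℕ∞)} {j : ℕ}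
    (h : gadgetWeight W cs j ≠ 0) : ∃ hj : j < cs.length, cs[j].1 ≠ [] := by
  unfold gadgetWeight at h
  by_cases hj : j < cs.length
  · refine ⟨hj, fun h0 => ?_⟩
    simp [List.getElem?_eq_getElem hj, h0] at h
  · simp [List.getElem?_eq_none (not_lt.1 hj)] at h

theorem complete_of_inactive {N : ℕ} {cs : List (List Literal × ℕ∞)} (ns : List (ℕ × List ℤ))
    (h : ∀ c ∈ cs, c.1 = []) :
    BuildState.Complete N (gadgetWeight (finiteSum cs + 1) cs) (cs.map Prod.fst)
      (construct N cs ns) ∧ (construct N cs ns).terms = [] := by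
  have hg : ∀ j, gadgetWeight (finiteSum cs + 1) cs j = 0 := by
    intro j
    by_contra h0
    obtain ⟨hj, hne⟩ := exists_of_gadgetWeight_ne_zero h0
    exact hne (h _ (List.getElem_mem hj))
  obtain ⟨h1, h2⟩ := BuildState.terms_of_inactive hg cs.length N ns (cs.map Prod.fst)
  refine ⟨⟨∅, ?_⟩, h1⟩
  unfold construct
  rw [h1, h2]
  convert FlowHist.init (N := N) (g := gadgetWeight (finiteSum cs + 1) cs)
  · simp [BuildState.activeClauses, hg]
  · simp [hg]

/-- A nonempty clause gives an edge of the incidence graph, so some bag has two elements and `1 ≤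
D.width`. If all clauses are empty, no term is constructed at all, and the bound `0` holds as well.
-/
theorem complete_of_decomposition (φ : WCNF) (D : TreeDecomposition (incidenceGraph φ.scopes))
    {N : ℕ} (hN : ∀ c ∈ φ.clauses, ∀ l ∈ c.1, l.1 < N) :
    BuildState.Complete N (gadgetWeight (finiteSum φ.clauses + 1) φ.clauses)
        (φ.clauses.map Prod.fst) (construct N φ.clauses (D.nodeList (incidenceCode φ.scopes))) ∧
      ((construct N φ.clauses (D.nodeList (incidenceCode φ.scopes))).terms = [] ∨
        (1 ≤ D.width ∧ BuildState.Covered (3 * D.width)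
          (construct N φ.clauses (D.nodeList (incidenceCode φ.scopes))))) := by
  by_cases hne : ∀ c ∈ φ.clauses, c.1 = []
  · obtain ⟨h1, h2⟩ := complete_of_inactive (N := N) (D.nodeList (incidenceCode φ.scopes)) hne
    exact ⟨h1, Or.inl h2⟩
  push Not at hne
  obtain ⟨c, hc, hcne⟩ := hne
  obtain ⟨l, hl⟩ := List.exists_mem_of_ne_nil _ hcne
  obtain ⟨j, hj, rfl⟩ := List.getElem_of_mem hc
  have hlen : φ.scopes.length = (φ.clauses.map Prod.fst).length := by simp [WCNF.scopes]
  have hNs : ∀ s ∈ φ.scopes, ∀ x ∈ s, x < N := by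
    intro s hs x hx
    obtain ⟨c, hc, rfl⟩ := List.mem_map.1 hs
    obtain ⟨l, hl, rfl⟩ := List.mem_map.1 (List.mem_toFinset.1 hx)
    exact hN c hc l hl
  have hcov : ∀ q ∈ BuildState.positions (φ.clauses.map Prod.fst),
      ∃ hj : q.1 < φ.scopes.length, q.2.1 ∈ φ.scopes[q.1] := by
    intro q hq
    obtain ⟨c, hc, hl⟩ := BuildState.mem_positions.1 hq
    obtain ⟨hj, rfl⟩ := List.getElem?_eq_some_iff.1 hc
    refine ⟨by rwa [hlen], ?_⟩
    simp only [WCNF.scopes, List.getElem_map] at hl ⊢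
    exact mem_literalScope hl
  have hpos : (j, l) ∈ BuildState.positions (φ.clauses.map Prod.fst) :=
    BuildState.mem_positions.2 ⟨φ.clauses[j].1, by simp [hj], hl⟩
  have hk : 1 ≤ D.width := by
    obtain ⟨hj', hx⟩ := hcov _ hpos
    obtain ⟨t, ht, h1, h2⟩ := D.exists_node hj' hx
    have h3 := (D.validNodes hNs le_rfl).length_le t ht
    have h4 : ({((l.1 : ℕ) : ℤ), clauseCode j} : Finset ℤ) ⊆
        (((D.nodeList (incidenceCode φ.scopes)).getD t (0, [])).2).toFinset := by
      intro v hv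
      rw [List.mem_toFinset]
      simp only [Finset.mem_insert, Finset.mem_singleton] at hv
      rcases hv with rfl | rfl
      exacts [h1, h2]
    have h5 := Finset.card_le_card h4
    rw [Finset.card_pair (natCast_ne_clauseCode _ _)] at h5
    have h6 := List.toFinset_card_le ((D.nodeList (incidenceCode φ.scopes)).getD t (0, [])).2
    omega
  have := BuildState.complete_of_nodes (g := gadgetWeight (finiteSum φ.clauses + 1) φ.clauses)
    (cs := φ.clauses.map Prod.fst) (by simp; omega) hk (D.validNodes hNs hlen.le) (fun q hq => by
      obtain ⟨hj, hx⟩ := hcov q hq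
      exact D.exists_node hj hx) (fun j hj hg => by
      obtain ⟨hj', hne⟩ := exists_of_gadgetWeight_ne_zero hg
      obtain ⟨l, hl⟩ := List.exists_mem_of_ne_nil _ hne
      exact ⟨l, BuildState.mem_positions.2 ⟨φ.clauses[j].1, by simp [hj'], hl⟩⟩)
  rw [List.length_map] at this
  exact ⟨this.1, Or.inr ⟨hk, this.2⟩⟩

theorem complete_without_decomposition (φ : WCNF) {N : ℕ}
    (hN : ∀ c ∈ φ.clauses, ∀ l ∈ c.1, l.1 < N) :
    BuildState.Complete N (gadgetWeight (finiteSum φ.clauses + 1) φ.clauses)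
        (φ.clauses.map Prod.fst) (construct N φ.clauses []) ∧
      BuildState.Covered (maxSAT.tw φ + 2) (construct N φ.clauses []) := by
  obtain ⟨L, h1, h2, h3⟩ := exists_built_primal φ.scopes
  have hlt : ∀ B ∈ L, ∀ x ∈ B, x < N := by
    intro B hB x hx
    obtain ⟨s, hs, hxs⟩ := h3 B hB x hx
    obtain ⟨c, hc, rfl⟩ := List.mem_map.1 hs
    obtain ⟨l, hl, rfl⟩ := List.mem_map.1 (List.mem_toFinset.1 hxs)
    exact hN c hc l hl
  have hscope : ∀ c ∈ φ.clauses.map Prod.fst, ∃ B ∈ L, literalScope c ⊆ B := by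
    intro c hc
    obtain ⟨d, hd, rfl⟩ := List.mem_map.1 hc
    exact h2 _ (List.mem_map_of_mem hd)
  change Built (maxSAT.tw φ) L at h1
  have hlen : (φ.clauses.map Prod.fst).length = φ.clauses.length := by simp
  unfold construct BuildState.nodes
  simp only [List.zipIdx_nil, List.foldl_nil]
  rw [← hlen]
  -- For treewidth `0` the bound is `2`, and the bags with four elements of the general construction
  -- are not available.
  by_cases hk : maxSAT.tw φ = 0
  · rw [hk] at h1 ⊢
    refine BuildState.complete_of_edgeless _ h1 hlt hscope ?_ ?_
    · intro c hc
      obtain ⟨d, hd, rfl⟩ := List.mem_map.1 hc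
      exact φ.literals_nodup d hd
    · intro j hj
      obtain ⟨hj', hne⟩ := exists_of_gadgetWeight_ne_zero (BuildState.mem_activeClauses.1 hj).2
      simpa [List.getD_eq_getElem?_getD, hj'] using hne
  · exact BuildState.complete_of_primal _ (Nat.pos_of_ne_zero hk) h1 hlt hscope

/-! ### Verifying programs -/

/-- Started in `s`, the program `p` halts within `T` steps in a state with the property `Q`. -/
def Halts (B : ℤ) (p : Program) (s : MachineState) (T : ℕ) (Q : MachineState → Prop) : Prop :=
  ∃ t s', Exec B p s t s' ∧ t ≤ T ∧ Q s'

def InRange (B v : ℤ) : Prop := -B ≤ v ∧ v ≤ B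

theorem Halts.mono {B : ℤ} {p : Program} {s : MachineState} {T T' : ℕ}
    {Q Q' : MachineState → Prop} (h : Halts B p s T Q) (hT : T ≤ T') (hQ : ∀ s', Q s' → Q' s') :
    Halts B p s T' Q' := by
  obtain ⟨t, s', h1, h2, h3⟩ := h
  exact ⟨t, s', h1, h2.trans hT, hQ s' h3⟩

theorem Halts.seq {B : ℤ} {p q : Program} {s : MachineState} {T T' : ℕ}
    {Q : MachineState → Prop} (h : Halts B p s T fun s' => Halts B q s' T' Q) :
    Halts B (.seq p q) s (T + T') Q := by
  obtain ⟨t, s', h1, h2, t', s'', h3, h4, h5⟩ := h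
  exact ⟨t + t', s'', .seq h1 h3, by omega, h5⟩

/-- A loop that runs through a list. -/
theorem Halts.loop {B : ℤ} {e : Expr} {p : Program} {α β : Type} (f : β → α → β) (c : α → ℕ)
    (Rel : β → List α → MachineState → Prop)
    (hstep : ∀ x a l s, Rel x (a :: l) s →
      e.eval s ≠ 0 ∧ Halts B p s (c a) (Rel (f x a) l))
    (hexit : ∀ x s, Rel x [] s → e.eval s = 0) (l : List α) :
    ∀ (x : β) (s : MachineState), Rel x l s →
      Halts B (.loop e p) s ((l.map fun a => c a + 1).sum + 1) (Rel (l.foldl f x) []) := by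
  induction l with
  | nil => exact fun x s h => ⟨1, s, .loop_exit (hexit x s h), by simp, h⟩
  | cons a l ih =>
    intro x s h
    obtain ⟨h1, t, s', h2, h3, h4⟩ := hstep x a l s h
    obtain ⟨t', s'', h5, h6, h7⟩ := ih _ s' h4
    refine ⟨t + t' + 1, s'', .loop_step h1 h2 h5, ?_, h7⟩
    simp only [List.map_cons, List.sum_cons]
    omega

/-- A loop that runs through an enumerated list. -/
theorem Halts.loop_zipIdx {B : ℤ} {e : Expr} {p : Program} {α β : Type} (f : β → α × ℕ → β)
    (c : α → ℕ) (Rel : β → ℕ → List α → MachineState → Prop)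
    (hstep : ∀ x i a l s, Rel x i (a :: l) s →
      e.eval s ≠ 0 ∧ Halts B p s (c a) (Rel (f x (a, i)) (i + 1) l))
    (hexit : ∀ x i s, Rel x i [] s → e.eval s = 0) (l : List α) :
    ∀ (x : β) (i : ℕ) (s : MachineState), Rel x i l s →
      Halts B (.loop e p) s ((l.map fun a => c a + 1).sum + 1)
        (Rel ((l.zipIdx i).foldl f x) (i + l.length) []) := by
  induction l with
  | nil => exact fun x i s h => ⟨1, s, .loop_exit (hexit x i s h), by simp, h⟩
  | cons a l ih =>
    intro x i s h
    obtain ⟨h1, t, s', h2, h3, h4⟩ := hstep x i a l s h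
    obtain ⟨t', s'', h5, h6, h7⟩ := ih _ _ s' h4
    refine ⟨t + t' + 1, s'', .loop_step h1 h2 h5, ?_, ?_⟩
    · simp only [List.map_cons, List.sum_cons]
      omega
    · rw [List.length_cons, ← Nat.add_assoc, Nat.add_right_comm]
      exact h7

/-- The weakest precondition of a program without loops. -/
def Program.wp (B : ℤ) : Program → (MachineState → Prop) → MachineState → Prop
  | .skip, Q, s => Q s
  | .assign r e, Q, s => InRange B (e.eval s) ∧ Q (s.setReg r (e.eval s))
  | .store a i e, Q, s => InRange B (i.eval s) ∧ InRange B (e.eval s) ∧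
      Q (s.setMem a (i.eval s) (e.eval s))
  | .seq p q, Q, s => p.wp B (q.wp B Q) s
  | .branch e p q, Q, s => (e.eval s ≠ 0 → p.wp B Q s) ∧ (e.eval s = 0 → q.wp B Q s)
  | .loop _ _, _, _ => False

/-- The size bounds the running time of programs without loops. The value at a loop is immaterial,
since the weakest precondition of a loop is defined to be `False`. -/
def Program.size : Program → ℕ
  | .seq p q => p.size + q.size
  | .branch _ p q => p.size + q.size + 1
  | _ => 1

theorem Program.wp_mono {B : ℤ} {p : Program} {Q Q' : MachineState → Prop}
    (h : ∀ s, Q s → Q' s) {s : MachineState} (hp : p.wp B Q s) : p.wp B Q' s := by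
  induction p generalizing Q Q' s with
  | skip => exact h _ hp
  | assign r e => exact ⟨hp.1, h _ hp.2⟩
  | store a i e => exact ⟨hp.1, hp.2.1, h _ hp.2.2⟩
  | seq p q ihp ihq => exact ihp (fun s hs => ihq h hs) hp
  | branch e p q ihp ihq => exact ⟨fun he => ihp h (hp.1 he), fun he => ihq h (hp.2 he)⟩
  | loop e p => exact hp

theorem Program.wp.halts {B : ℤ} {p : Program} {Q : MachineState → Prop} {s : MachineState}
    (h : p.wp B Q s) : Halts B p s p.size Q := by
  induction p generalizing Q s with
  | skip => exact ⟨1, s, .skip s, le_rfl, h⟩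
  | assign r e => exact ⟨1, _, .assign r e s (abs_le.2 h.1), le_rfl, h.2⟩
  | store a i e => exact ⟨1, _, .store a i e s (abs_le.2 h.1) (abs_le.2 h.2.1), le_rfl, h.2.2⟩
  | seq p q ihp ihq => exact .seq ((ihp h).mono le_rfl fun s' h' => ihq h')
  | branch e p q ihp ihq =>
    by_cases he : e.eval s = 0
    · obtain ⟨t, s', h1, h2, h3⟩ := ihq (h.2 he)
      exact ⟨t + 1, s', .branch_else he h1, by simp only [Program.size]; omega, h3⟩
    · obtain ⟨t, s', h1, h2, h3⟩ := ihp (h.1 he)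
      exact ⟨t + 1, s', .branch_then he h1, by simp only [Program.size]; omega, h3⟩
  | loop e p => exact h.elim

def Program.block : List Program → Program
  | [] => .skip
  | p :: ps => .seq p (block ps)

@[simp] theorem wp_skip {B : ℤ} {Q : MachineState → Prop} {s : MachineState} :
    Program.skip.wp B Q s ↔ Q s := Iff.rfl

@[simp] theorem wp_block_nil {B : ℤ} {Q : MachineState → Prop} {s : MachineState} :
    (Program.block []).wp B Q s ↔ Q s := Iff.rfl

@[simp] theorem wp_block_cons {B : ℤ} {p : Program} {ps : List Program} {Q : MachineState → Prop}
    {s : MachineState} :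
    (Program.block (p :: ps)).wp B Q s ↔ p.wp B ((Program.block ps).wp B Q) s := Iff.rfl

@[simp] theorem wp_assign {B : ℤ} {r : ℕ} {e : Expr} {Q : MachineState → Prop}
    {s : MachineState} : (Program.assign r e).wp B Q s ↔
      InRange B (e.eval s) ∧ Q (s.setReg r (e.eval s)) := Iff.rfl

@[simp] theorem wp_store {B : ℤ} {a : ℕ} {i e : Expr} {Q : MachineState → Prop}
    {s : MachineState} : (Program.store a i e).wp B Q s ↔
      InRange B (i.eval s) ∧ InRange B (e.eval s) ∧ Q (s.setMem a (i.eval s) (e.eval s)) := Iff.rfl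

@[simp] theorem wp_branch {B : ℤ} {e : Expr} {p q : Program} {Q : MachineState → Prop}
    {s : MachineState} : (Program.branch e p q).wp B Q s ↔
      (e.eval s ≠ 0 → p.wp B Q s) ∧ (e.eval s = 0 → q.wp B Q s) := Iff.rfl

@[simp] theorem setReg_reg (s : MachineState) (r r' : ℕ) (v : ℤ) :
    (s.setReg r v).reg r' = if r' = r then v else s.reg r' := by
  simp [MachineState.setReg, Function.update_apply]

@[simp] theorem setReg_mem (s : MachineState) (r : ℕ) (v : ℤ) : (s.setReg r v).mem = s.mem := rfl

@[simp] theorem setMem_reg (s : MachineState) (a : ℕ) (i v : ℤ) : (s.setMem a i v).reg = s.reg :=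
  rfl

@[simp] theorem setMem_mem (s : MachineState) (a a' : ℕ) (i v : ℤ) :
    (s.setMem a i v).mem a' = if a' = a then Function.update (s.mem a) i v else s.mem a' := by
  by_cases h : a' = a
  · subst h; simp [MachineState.setMem]
  · simp [MachineState.setMem, h]

attribute [simp] Expr.eval

@[simp] theorem ite_one_zero_ne_zero (p : Prop) [Decidable p] :
    ((if p then 1 else 0 : ℤ) = 0) ↔ ¬ p := by
  split_ifs with h <;> simp [h]

/-- The words of the list `l` are in the array `f`, starting at index `p`. -/
def Seg (f : ℤ → ℤ) (p : ℕ) (l : List ℤ) : Prop :=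
  ∀ (i : ℕ) (h : i < l.length), f ((p + i : ℕ) : ℤ) = l[i]

theorem Seg.nil (f : ℤ → ℤ) (p : ℕ) : Seg f p [] := fun i h => absurd h (by simp)

theorem seg_append {f : ℤ → ℤ} {p : ℕ} {l l' : List ℤ} :
    Seg f p (l ++ l') ↔ Seg f p l ∧ Seg f (p + l.length) l' := by
  constructor
  · refine fun h => ⟨fun i hi => ?_, fun i hi => ?_⟩
    · have := h i (by rw [List.length_append]; omega)
      rwa [List.getElem_append_left hi] at this
    · have := h (l.length + i) (by rw [List.length_append]; omega)
      rw [List.getElem_append_right (by omega)] at this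
      simpa [Nat.add_assoc] using this
  · rintro ⟨h1, h2⟩ i hi
    by_cases hil : i < l.length
    · rw [List.getElem_append_left hil]; exact h1 i hil
    · rw [List.getElem_append_right (by omega)]
      rw [List.length_append] at hi
      have := h2 (i - l.length) (by omega)
      rwa [show p + l.length + (i - l.length) = p + i by omega] at this

theorem seg_singleton {f : ℤ → ℤ} {p : ℕ} {v : ℤ} : Seg f p [v] ↔ f (p : ℤ) = v := by
  constructor
  · intro h; simpa using h 0 (by simp)
  · intro h i hi
    have : i = 0 := by simpa using hi
    subst this; simpa using h

theorem seg_cons {f : ℤ → ℤ} {p : ℕ} {v : ℤ} {l : List ℤ} :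
    Seg f p (v :: l) ↔ f (p : ℤ) = v ∧ Seg f (p + 1) l := by
  rw [← List.singleton_append, seg_append, seg_singleton]; rfl

theorem Seg.update {f : ℤ → ℤ} {p : ℕ} {l : List ℤ} (h : Seg f p l) {i : ℤ} {v : ℤ}
    (hi : i < p ∨ p + l.length ≤ i) : Seg (Function.update f i v) p l := by
  intro k hk
  rw [Function.update_of_ne (by push_cast; omega)]
  exact h k hk

theorem Seg.concat {f : ℤ → ℤ} {p : ℕ} {l : List ℤ} (h : Seg f p l) {i v : ℤ}
    (hi : i = p + l.length) : Seg (Function.update f i v) p (l ++ [v]) := by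
  rw [seg_append, seg_singleton]
  refine ⟨h.update (Or.inr hi.ge), ?_⟩
  rw [hi]
  push_cast
  simp

/-- The array `f` holds the values of the function `c`. -/
def Agree (f : ℤ → ℤ) (c : ℕ → ℕ) : Prop := ∀ i : ℕ, f i = c i

theorem Agree.update {f : ℤ → ℤ} {c : ℕ → ℕ} (h : Agree f c) {i v : ℤ} {k w : ℕ} (hi : i = k)
    (hv : v = w) : Agree (Function.update f i v) (Function.update c k w) := by
  intro j
  subst hi hv
  by_cases hj : j = k
  · subst hj; simp
  · rw [Function.update_of_ne (by exact_mod_cast hj), Function.update_of_ne hj]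
    exact h j

/-- The states differ at most in the registers `R` and the arrays `A`. -/
structure Frame (R A : List ℕ) (s s' : MachineState) : Prop where
  reg : ∀ r ∉ R, s'.reg r = s.reg r
  mem : ∀ a ∉ A, s'.mem a = s.mem a

theorem Frame.refl (R A : List ℕ) (s : MachineState) : Frame R A s s :=
  ⟨fun _ _ => rfl, fun _ _ => rfl⟩

theorem Frame.trans {R A : List ℕ} {s s' s'' : MachineState} (h : Frame R A s s')
    (h' : Frame R A s' s'') : Frame R A s s'' :=
  ⟨fun r hr => (h'.reg r hr).trans (h.reg r hr), fun a ha => (h'.mem a ha).trans (h.mem a ha)⟩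

theorem Frame.mono {R A R' A' : List ℕ} {s s' : MachineState} (h : Frame R A s s')
    (hR : R ⊆ R') (hA : A ⊆ A') : Frame R' A' s s' :=
  ⟨fun r hr => h.reg r fun h => hr (hR h), fun a ha => h.mem a fun h => ha (hA h)⟩

theorem Frame.setReg {R A : List ℕ} {s s' : MachineState} (h : Frame R A s s') {r : ℕ}
    (hr : r ∈ R) (v : ℤ) : Frame R A s (s'.setReg r v) := by
  refine ⟨fun r' hr' => ?_, fun a ha => h.mem a ha⟩
  rw [setReg_reg, if_neg (fun he : r' = r => hr' (he ▸ hr))]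
  exact h.reg r' hr'

theorem Frame.setMem {R A : List ℕ} {s s' : MachineState} (h : Frame R A s s') {a : ℕ}
    (ha : a ∈ A) (i v : ℤ) : Frame R A s (s'.setMem a i v) := by
  refine ⟨fun r hr => h.reg r hr, fun a' ha' => ?_⟩
  rw [setMem_mem, if_neg (fun he : a' = a => ha' (he ▸ ha))]
  exact h.mem a' ha'

/-! ### Writing down the terms -/

/-- The words written so far: the terms `ts` in the format of the target, after three words for the
offset, the top value and the size. -/
structure OutRep {Q : OptProblem} (T : Target Q) (Z : ℕ) (θ : ℤ) (ts : List Term)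
    (s : MachineState) : Prop where
  pos : s.reg 1 = 3 + (T.enc Z ts).length
  num : s.reg 2 = ts.length
  off : s.reg 3 = θ + T.offset ts
  count : s.reg 30 = T.count Z ts
  top : s.reg 5 = Z
  words : Seg (s.mem 1) 3 (T.enc Z ts)

theorem OutRep.congr {Q : OptProblem} {T : Target Q} {Z : ℕ} {θ : ℤ} {ts : List Term}
    {s s' : MachineState} (h : OutRep T Z θ ts s) {R A : List ℕ} (hf : Frame R A s s')
    (hR : ∀ r ∈ R, r ∉ [1, 2, 3, 5, 30]) (hA : 1 ∉ A) : OutRep T Z θ ts s' := by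
  have hreg : ∀ r ∈ [1, 2, 3, 5, 30], s'.reg r = s.reg r :=
    fun r hr => hf.reg r fun hrR => hR r hrR hr
  refine ⟨?_, ?_, ?_, ?_, ?_, ?_⟩
  · rw [hreg 1 (by decide)]; exact h.pos
  · rw [hreg 2 (by decide)]; exact h.num
  · rw [hreg 3 (by decide)]; exact h.off
  · rw [hreg 30 (by decide)]; exact h.count
  · rw [hreg 5 (by decide)]; exact h.top
  · rw [hf.mem 1 hA]; exact h.words

/-- The word size suffices for writing the terms. -/
structure Fits (B : ℤ) (Z C V : ℕ) (θ : ℤ) (ts : List Term) : Prop where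
  length_le : ts.length ≤ C
  weight_le : ∀ t ∈ ts, |t.2.2| ≤ V
  lt : ∀ t ∈ ts, t.1 < Z ∧ t.2.1 < Z
  bound : 20 * ((C : ℤ) + V + Z + 1) + C * V + |θ| ≤ B

/-- A loop-free piece of program that appends the term in the registers `6`, `7`, `8` to the output.
Register `1` is the next output position, `2` the number of terms, `3` the offset, `5` the bound
`Z`, `30` the number of clauses or terms written, and `31` is scratch. The property `P` is
arbitrary, so that the specification can be used in front of any continuation. -/
structure Emitter {Q : OptProblem} (T : Target Q) where
  prog : Program
  enc_nil : ∀ Z, T.enc Z [] = []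
  count_nil : ∀ Z, T.count Z [] = 0
  offset_nil : T.offset [] = 0
  bounds : ∀ {B : ℤ} {Z C V : ℕ} {θ : ℤ} {ts : List Term}, Fits B Z C V θ ts →
    (3 + (T.enc Z ts).length : ℤ) ≤ B ∧ InRange B (θ + T.offset ts) ∧ (T.count Z ts : ℤ) ≤ B
  spec : ∀ {B : ℤ} {Z C V : ℕ} {θ : ℤ} {ts : List Term} {t : Term} {s : MachineState}
    {P : MachineState → Prop}, OutRep T Z θ ts s → s.reg 6 = t.1 → s.reg 7 = t.2.1 →
    s.reg 8 = t.2.2 → Fits B Z C V θ (ts ++ [t]) →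
    (∀ s', OutRep T Z θ (ts ++ [t]) s' → Frame [1, 2, 3, 30, 31] [1] s s' → P s') →
    prog.wp B P s

/-- Append words to the output. -/
def outs : List Expr → Program
  | [] => .skip
  | e :: es => .seq (.store 1 (.reg 1) e) (.seq (.assign 1 (.add (.reg 1) (.const 1))) (outs es))

/-- Writing a word changes register `1` and array `1` before the next expression is evaluated. Hence
each expression is required to have its value in all states that differ from `s` only there. -/
theorem wp_outs {B : ℤ} {q : ℕ} (es : List Expr) (vs : List ℤ) {s : MachineState}
    {P : MachineState → Prop} {l : List ℤ}
    (h : List.Forall₂ (fun e v => (∀ s', Frame [1] [1] s s' → e.eval s' = v) ∧ InRange B v) es vs)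
    (hpos : s.reg 1 = (q : ℤ) + l.length) (hl : Seg (s.mem 1) q l)
    (hB : (q + l.length + es.length : ℤ) ≤ B)
    (hP : ∀ s' : MachineState, s'.reg 1 = (q : ℤ) + (l ++ vs).length → Seg (s'.mem 1) q (l ++ vs) →
      Frame [1] [1] s s' → P s') : (outs es).wp B P s := by
  induction es generalizing vs s l with
  | nil =>
    obtain rfl := List.forall₂_nil_left_iff.1 h
    exact hP s (by simpa using hpos) (by simpa using hl) (.refl _ _ _)
  | cons e es ih =>
    obtain ⟨v, vs, h1, h2, rfl⟩ := List.forall₂_cons_left_iff.1 h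
    have hev := h1.1 s (.refl _ _ _)
    simp only [List.length_cons, Nat.cast_add, Nat.cast_one] at hB
    refine ⟨?_, ?_, ?_, ?_⟩
    · simp only [Expr.eval, hpos]; constructor <;> omega
    · rw [hev]; exact h1.2
    · simp only [Expr.eval, setMem_reg, hpos]; constructor <;> omega
    · simp only [Expr.eval, setMem_reg, hev, hpos]
      have hf : Frame [1] [1] s ((s.setMem 1 (q + l.length) v).setReg 1 (q + l.length + 1)) :=
        ((Frame.refl _ _ s).setMem (by decide) _ _).setReg (by decide) _
      refine ih vs (l := l ++ [v]) ?_ ?_ ?_ ?_ ?_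
      · exact h2.imp fun e v h => ⟨fun s' hs' => h.1 s' (hf.trans hs'), h.2⟩
      · simp; ring
      · simpa using hl.concat rfl
      · simp; linarith
      · intro s' h3 h4 h5
        exact hP s' (by simpa using h3) (by simpa using h4) (hf.trans h5)

theorem abs_le_of_fits {B : ℤ} {Z C V : ℕ} {θ : ℤ} {ts : List Term} (h : Fits B Z C V θ ts) :
    |satOffsets ts| ≤ ts.length * V := by
  obtain ⟨-, h1, -, -⟩ := h
  induction ts with
  | nil => simp [satOffsets]
  | cons t ts ih =>
    have h2 := ih fun u hu => h1 u (by simp [hu])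
    have h3 := h1 t (by simp)
    have h4 : |satOffset t| ≤ V := by
      unfold satOffset
      split_ifs
      · simp
      · rwa [abs_neg]
    have e : satOffsets (t :: ts) = satOffset t + satOffsets ts := by simp [satOffsets]
    rw [e, List.length_cons]
    push_cast
    have := abs_add_le (satOffset t) (satOffsets ts)
    linarith

theorem offset_bound_of_fits {B : ℤ} {Z C V : ℕ} {θ : ℤ} {ts : List Term}
    (h : Fits B Z C V θ ts) : |θ + satOffsets ts| + 20 * ((C : ℤ) + V + Z + 1) ≤ B := by
  have h1 := abs_le_of_fits h
  have h2 : (ts.length : ℤ) * V ≤ C * V :=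
    mul_le_mul_of_nonneg_right (by exact_mod_cast h.length_le) (Int.natCast_nonneg _)
  have h3 := abs_add_le θ (satOffsets ts)
  have := h.bound
  linarith

/-- The worst case is a negative product: one clause with a single literal and two with two
literals, that is `3 + 4 + 4` words including sizes and weights. -/
theorem length_satFormula_le (Z : ℕ) (ts : List Term) :
    (satFormula Z ts).length ≤ 3 * ts.length ∧
      ((satFormula Z ts).flatMap clauseWords).length ≤ 11 * ts.length := by
  induction ts using List.reverseRecOn with
  | nil => simp [satFormula]
  | append_singleton ts t ih =>
    rw [satFormula_append_singleton, List.flatMap_append]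
    simp only [List.length_append, List.length_singleton]
    have : (satClauses (Z + ts.length) t).length ≤ 3 ∧
        ((satClauses (Z + ts.length) t).flatMap clauseWords).length ≤ 11 := by
      unfold satClauses
      split_ifs <;> simp [clauseWords]
    omega

def quboEmitter : Emitter quboTarget where
  prog := .block [outs [.reg 6, .reg 7, .reg 8], .assign 30 (.add (.reg 30) (.const 1)),
    .assign 2 (.add (.reg 2) (.const 1))]
  enc_nil _ := rfl
  count_nil _ := rfl
  offset_nil := rfl
  bounds {B Z C V θ ts} h := by
    have h1 : ((quboTarget.enc Z ts).length : ℤ) = 3 * ts.length := by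
      simp [quboTarget, List.length_flatMap]; ring
    have h2 := h.bound
    have h3 := h.length_le
    have h4 : (0 : ℤ) ≤ C * V := by positivity
    have h5 := abs_nonneg θ
    rw [h1]
    refine ⟨by omega, ?_, ?_⟩
    · have := abs_le.1 (show |θ| ≤ B by omega)
      simpa [quboTarget, InRange] using this
    · simp only [quboTarget]; omega
  spec {B Z C V θ ts t s P} h h6 h7 h8 hfit hP := by
    have h1 : ((quboTarget.enc Z ts).length : ℤ) = 3 * ts.length := by
      simp [quboTarget, List.length_flatMap]; ring
    have h2 := hfit.bound
    have h3 := hfit.length_le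
    have h4 : (0 : ℤ) ≤ C * V := by positivity
    have h5 := abs_nonneg θ
    have hlt := hfit.lt t (by simp)
    have hw := abs_le.1 (hfit.weight_le t (by simp))
    simp only [List.length_append, List.length_singleton] at h3
    have henc : quboTarget.enc Z (ts ++ [t]) = quboTarget.enc Z ts ++ [(t.1 : ℤ), (t.2.1 : ℤ), t.2.2] := by
      simp [quboTarget]
    have hnum := h.num
    have hcount := h.count
    rw [wp_block_cons]
    refine wp_outs (q := 3) _ [(t.1 : ℤ), (t.2.1 : ℤ), t.2.2] ?_ h.pos h.words ?_ ?_
    · refine .cons ⟨fun s' hs' => ?_, ?_, ?_⟩ (.cons ⟨fun s' hs' => ?_, ?_, ?_⟩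
        (.cons ⟨fun s' hs' => ?_, ?_, ?_⟩ .nil))
      · rw [Expr.eval, hs'.reg 6 (by decide), h6]
      · omega
      · omega
      · rw [Expr.eval, hs'.reg 7 (by decide), h7]
      · omega
      · omega
      · rw [Expr.eval, hs'.reg 8 (by decide), h8]
      · omega
      · omega
    · rw [h1]; simp; omega
    · intro s' g1 g2 hf
      have e1 := hf.reg 30 (by decide)
      have e2 := hf.reg 2 (by decide)
      have e3 : quboTarget.count Z ts = ts.length := rfl
      simp only [wp_block_cons, wp_block_nil, wp_assign, Expr.eval, setReg_reg, e1, e2, hcount, hnum]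
      refine ⟨by rw [e3]; constructor <;> omega, by simp only [Nat.reduceEqDiff, if_false]; constructor <;> omega, hP _ ?_ ?_⟩
      · refine ⟨?_, ?_, ?_, ?_, ?_, ?_⟩
        · simpa [henc] using g1
        · simp
        · simp only [setReg_reg, hf.reg 3 (by decide)]
          exact h.off
        · simp [quboTarget]
        · simpa [hf.reg 5 (by decide)] using h.top
        · rw [henc]; exact g2
      · exact ((hf.mono (by decide) (by decide)).setReg (by decide) _).setReg (by decide) _

theorem satFormula_enc_append (Z : ℕ) (ts : List Term) (t : Term) :
    max2SATTarget.enc Z (ts ++ [t]) =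
      max2SATTarget.enc Z ts ++ (satClauses (Z + ts.length) t).flatMap clauseWords := by
  simp [max2SATTarget, satFormula_append_singleton]

/-- The last part of the program: count the clauses and the term. -/
theorem wp_satFinish {B : ℤ} {Z C V k : ℕ} {θ : ℤ} {ts : List Term} {t : Term}
    {s s' : MachineState} {P : MachineState → Prop} (h : OutRep max2SATTarget Z θ ts s)
    (hfit : Fits B Z C V θ (ts ++ [t])) (hf : Frame [1, 31] [1] s s')
    (h1 : s'.reg 1 = (3 : ℕ) + (max2SATTarget.enc Z (ts ++ [t])).length)
    (h2 : Seg (s'.mem 1) 3 (max2SATTarget.enc Z (ts ++ [t]))) {e : Expr}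
    (he : ∀ s'', s''.reg 3 = s.reg 3 → s''.reg 8 = s.reg 8 →
      e.eval s'' = θ + max2SATTarget.offset (ts ++ [t]))
    (hk : (satClauses (Z + ts.length) t).length = k)
    (hP : ∀ s', OutRep max2SATTarget Z θ (ts ++ [t]) s' → Frame [1, 2, 3, 30, 31] [1] s s' → P s') :
    (Program.block [.assign 30 (.add (.reg 30) (.const k)), .assign 3 e,
      .assign 2 (.add (.reg 2) (.const 1))]).wp B P s' := by
  have hnum := h.num
  have hcount := h.count
  have e1 := hf.reg 30 (by decide)
  have e2 := hf.reg 2 (by decide)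
  have e3 := hf.reg 3 (by decide)
  have e4 := hf.reg 8 (by decide)
  have e5 := offset_bound_of_fits hfit
  have e6 := (length_satFormula_le Z (ts ++ [t])).1
  have e7 := hfit.length_le
  have e8 : max2SATTarget.count Z (ts ++ [t]) = max2SATTarget.count Z ts + k := by
    simp [max2SATTarget, satFormula_append_singleton, hk]
  have e9 := abs_nonneg (θ + satOffsets (ts ++ [t]))
  change max2SATTarget.count Z (ts ++ [t]) ≤ _ at e6
  have e10 : (max2SATTarget.count Z (ts ++ [t]) : ℤ) = max2SATTarget.count Z ts + k := by
    rw [e8]; push_cast; rfl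
  simp only [List.length_append, List.length_singleton] at e6 e7
  simp only [wp_block_cons, wp_block_nil, wp_assign]
  rw [he _ (by simp [e3]) (by simp [e4])]
  simp only [Expr.eval, setReg_reg, e1, e2, hcount, hnum, ← e10]
  refine ⟨⟨by omega, by omega⟩, ?_, ?_, hP _ ?_ ?_⟩
  · exact abs_le.1 (show |θ + satOffsets (ts ++ [t])| ≤ B by linarith)
  · simp only [Nat.reduceEqDiff, if_false]; constructor <;> omega
  · refine ⟨?_, ?_, ?_, ?_, ?_, ?_⟩
    · simpa using h1
    · simp
    · simp
    · simp
    · simpa [hf.reg 5 (by decide)] using h.top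
    · exact h2
  · exact (((hf.mono (by decide) (by decide)).setReg (by decide) _).setReg (by decide) _).setReg
      (by decide) _

def negLit (r : ℕ) : Expr := .sub (.const (-1)) (.reg r)

def posLit (r : ℕ) : Expr := .add (.reg r) (.const 1)

def negWeight : Expr := .sub (.const 0) (.reg 8)

/-- The four branches are those of `satClauses`. The auxiliary variable is `Z` plus the number of
terms already written, kept in register `31`; it is computed even for terms that do not use it. -/
def max2SATEmitter : Emitter max2SATTarget where
  prog := .block [.assign 31 (.add (.reg 5) (.reg 2)),
    .branch (.le (.const 1) (.reg 8))
      (.branch (.eq (.reg 6) (.reg 7))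
        (.block [outs [.const 1, .reg 8, negLit 6],
          .block [.assign 30 (.add (.reg 30) (.const (1 : ℕ))), .assign 3 (.reg 3),
            .assign 2 (.add (.reg 2) (.const 1))]])
        (.block [outs [.const 2, .reg 8, negLit 6, negLit 7],
          .block [.assign 30 (.add (.reg 30) (.const (1 : ℕ))), .assign 3 (.reg 3),
            .assign 2 (.add (.reg 2) (.const 1))]]))
      (.branch (.eq (.reg 6) (.reg 7))
        (.block [outs [.const 1, negWeight, posLit 6],
          .block [.assign 30 (.add (.reg 30) (.const (1 : ℕ))), .assign 3 (.sub (.reg 3) (.reg 8)),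
            .assign 2 (.add (.reg 2) (.const 1))]])
        (.block [outs [.const 1, negWeight, posLit 31, .const 2, negWeight, negLit 31, posLit 6,
            .const 2, negWeight, negLit 31, posLit 7],
          .block [.assign 30 (.add (.reg 30) (.const (3 : ℕ))), .assign 3 (.sub (.reg 3) (.reg 8)),
            .assign 2 (.add (.reg 2) (.const 1))]]))]
  enc_nil _ := rfl
  count_nil _ := rfl
  offset_nil := rfl
  bounds {B Z C V θ ts} h := by
    have h1 := length_satFormula_le Z ts
    have h2 := offset_bound_of_fits h
    have h3 := h.length_le
    have h4 := abs_nonneg (θ + satOffsets ts)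
    change (max2SATTarget.count Z ts) ≤ _ ∧ (max2SATTarget.enc Z ts).length ≤ _ at h1
    refine ⟨by omega, ?_, by omega⟩
    exact abs_le.1 (show |θ + satOffsets ts| ≤ B by linarith)
  spec {B Z C V θ ts t s P} h h6 h7 h8 hfit hP := by
    have h2 := hfit.bound
    have h3 := hfit.length_le
    have h4 : (0 : ℤ) ≤ C * V := by positivity
    have h5 := abs_nonneg θ
    have hlt := hfit.lt t (by simp)
    have hw := abs_le.1 (hfit.weight_le t (by simp))
    have hlen := (length_satFormula_le Z ts).2
    change (max2SATTarget.enc Z ts).length ≤ _ at hlen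
    simp only [List.length_append, List.length_singleton] at h3
    have hoff : max2SATTarget.offset (ts ++ [t]) = max2SATTarget.offset ts + satOffset t :=
      satOffsets_append_singleton ts t
    have henc := satFormula_enc_append Z ts t
    have h0 := h.off
    rw [wp_block_cons, wp_assign]
    simp only [Expr.eval, h.top, h.num]
    set s₁ := s.setReg 31 ((Z : ℤ) + ts.length) with hs₁
    have hf₁ : Frame [1, 31] [1] s s₁ := (Frame.refl _ _ s).setReg (by decide) _
    have k6 : s₁.reg 6 = t.1 := by simp [hs₁, h6]
    have k7 : s₁.reg 7 = t.2.1 := by simp [hs₁, h7]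
    have k8 : s₁.reg 8 = t.2.2 := by simp [hs₁, h8]
    have k31 : s₁.reg 31 = (Z : ℤ) + ts.length := by simp [hs₁]
    have k1 : s₁.reg 1 = (3 : ℕ) + (max2SATTarget.enc Z ts).length := by simp [hs₁, h.pos]
    have e6 : ∀ s', Frame [1] [1] s₁ s' → s'.reg 6 = t.1 := fun s' hs' => by
      rw [hs'.reg 6 (by decide), k6]
    have e7 : ∀ s', Frame [1] [1] s₁ s' → s'.reg 7 = t.2.1 := fun s' hs' => by
      rw [hs'.reg 7 (by decide), k7]
    have e8 : ∀ s', Frame [1] [1] s₁ s' → s'.reg 8 = t.2.2 := fun s' hs' => by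
      rw [hs'.reg 8 (by decide), k8]
    have e31 : ∀ s', Frame [1] [1] s₁ s' → s'.reg 31 = (Z : ℤ) + ts.length := fun s' hs' => by
      rw [hs'.reg 31 (by decide), k31]
    have hw₁ : Seg (s₁.mem 1) 3 (max2SATTarget.enc Z ts) := h.words
    have hfr : ∀ s', Frame [1] [1] s₁ s' → Frame [1, 31] [1] s s' := fun s' hs' =>
      hf₁.trans (hs'.mono (by decide) (by decide))
    clear_value s₁
    refine ⟨⟨by omega, by omega⟩, ?_⟩
    simp only [wp_block_cons, wp_block_nil, wp_branch, Expr.eval, k6, k7, k8, ne_eq,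
      ite_one_zero_ne_zero, not_not]
    have hcast : ((t.1 : ℤ) = t.2.1) ↔ t.1 = t.2.1 := by exact_mod_cast Iff.rfl
    rw [hcast]
    refine ⟨fun hpos => ⟨fun heq => ?_, fun heq => ?_⟩, fun hneg => ⟨fun heq => ?_, fun heq => ?_⟩⟩
    · have hc : satClauses (Z + ts.length) t = [([(t.1, false)], t.2.2.natAbs)] := by
        unfold satClauses; rw [if_pos (by omega), if_pos heq]
      refine wp_outs (q := 3) _ ((satClauses (Z + ts.length) t).flatMap clauseWords) ?_ k1 hw₁ ?_ ?_
      · simp only [hc, clauseWords, literalWord, List.flatMap_cons, List.flatMap_nil, List.map_cons,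
          List.map_nil, List.length_cons, List.length_nil, List.append_nil, List.cons_append,
          List.nil_append, List.forall₂_cons, negLit, posLit, negWeight, Expr.eval, InRange]
        refine ⟨⟨fun s' hs' => ?_, ?_, ?_⟩, ⟨fun s' hs' => ?_, ?_, ?_⟩, ⟨fun s' hs' => ?_, ?_, ?_⟩,
          List.Forall₂.nil⟩ <;> (try simp only [e6 s' hs', e8 s' hs']) <;> (try simp [-Nat.cast_natAbs]) <;> omega
      · simp; omega
      · intro s' g1 g2 hf
        rw [← henc] at g1 g2
        refine wp_satFinish h hfit (hfr s' hf) g1 g2 (fun s'' q1 q2 => ?_) (by rw [hc]; rfl) hP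
        rw [Expr.eval, q1, h0, hoff, satOffset, if_pos (by omega), add_zero]
    · have hc : satClauses (Z + ts.length) t =
          [([(t.1, false), (t.2.1, false)], t.2.2.natAbs)] := by
        unfold satClauses; rw [if_pos (by omega), if_neg heq]
      refine wp_outs (q := 3) _ ((satClauses (Z + ts.length) t).flatMap clauseWords) ?_ k1 hw₁ ?_ ?_
      · simp only [hc, clauseWords, literalWord, List.flatMap_cons, List.flatMap_nil, List.map_cons,
          List.map_nil, List.length_cons, List.length_nil, List.append_nil, List.cons_append,
          List.nil_append, List.forall₂_cons, negLit, posLit, negWeight, Expr.eval, InRange]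
        refine ⟨⟨fun s' hs' => ?_, ?_, ?_⟩, ⟨fun s' hs' => ?_, ?_, ?_⟩, ⟨fun s' hs' => ?_, ?_, ?_⟩,
          ⟨fun s' hs' => ?_, ?_, ?_⟩, List.Forall₂.nil⟩ <;>
          (try simp only [e6 s' hs', e7 s' hs', e8 s' hs']) <;> (try simp [-Nat.cast_natAbs]) <;> omega
      · simp; omega
      · intro s' g1 g2 hf
        rw [← henc] at g1 g2
        refine wp_satFinish h hfit (hfr s' hf) g1 g2 (fun s'' q1 q2 => ?_) (by rw [hc]; rfl) hP
        rw [Expr.eval, q1, h0, hoff, satOffset, if_pos (by omega), add_zero]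
    · have hc : satClauses (Z + ts.length) t = [([(t.1, true)], t.2.2.natAbs)] := by
        unfold satClauses; rw [if_neg (by omega), if_pos heq]
      refine wp_outs (q := 3) _ ((satClauses (Z + ts.length) t).flatMap clauseWords) ?_ k1 hw₁ ?_ ?_
      · simp only [hc, clauseWords, literalWord, List.flatMap_cons, List.flatMap_nil, List.map_cons,
          List.map_nil, List.length_cons, List.length_nil, List.append_nil, List.cons_append,
          List.nil_append, List.forall₂_cons, negLit, posLit, negWeight, Expr.eval, InRange]
        refine ⟨⟨fun s' hs' => ?_, ?_, ?_⟩, ⟨fun s' hs' => ?_, ?_, ?_⟩, ⟨fun s' hs' => ?_, ?_, ?_⟩,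
          List.Forall₂.nil⟩ <;> (try simp only [e6 s' hs', e8 s' hs']) <;> (try simp [-Nat.cast_natAbs]) <;> omega
      · simp; omega
      · intro s' g1 g2 hf
        rw [← henc] at g1 g2
        refine wp_satFinish h hfit (hfr s' hf) g1 g2 (fun s'' q1 q2 => ?_) (by rw [hc]; rfl) hP
        rw [Expr.eval, Expr.eval, Expr.eval, q1, q2, h0, h8, hoff, satOffset, if_neg (by omega)]
        ring
    · have hc : satClauses (Z + ts.length) t =
          [([(Z + ts.length, true)], t.2.2.natAbs),
            ([(Z + ts.length, false), (t.1, true)], t.2.2.natAbs),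
            ([(Z + ts.length, false), (t.2.1, true)], t.2.2.natAbs)] := by
        unfold satClauses; rw [if_neg (by omega), if_neg heq]
      refine wp_outs (q := 3) _ ((satClauses (Z + ts.length) t).flatMap clauseWords) ?_ k1 hw₁ ?_ ?_
      · simp only [hc, clauseWords, literalWord, List.flatMap_cons, List.flatMap_nil, List.map_cons,
          List.map_nil, List.length_cons, List.length_nil, List.append_nil, List.cons_append,
          List.nil_append, List.forall₂_cons, negLit, posLit, negWeight, Expr.eval, InRange]
        refine ⟨⟨fun s' hs' => ?_, ?_, ?_⟩, ⟨fun s' hs' => ?_, ?_, ?_⟩, ⟨fun s' hs' => ?_, ?_, ?_⟩,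
          ⟨fun s' hs' => ?_, ?_, ?_⟩, ⟨fun s' hs' => ?_, ?_, ?_⟩, ⟨fun s' hs' => ?_, ?_, ?_⟩,
          ⟨fun s' hs' => ?_, ?_, ?_⟩, ⟨fun s' hs' => ?_, ?_, ?_⟩, ⟨fun s' hs' => ?_, ?_, ?_⟩,
          ⟨fun s' hs' => ?_, ?_, ?_⟩, ⟨fun s' hs' => ?_, ?_, ?_⟩, List.Forall₂.nil⟩ <;>
          (try simp only [e6 s' hs', e7 s' hs', e8 s' hs', e31 s' hs']) <;> (try simp [-Nat.cast_natAbs]) <;> omega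
      · simp; omega
      · intro s' g1 g2 hf
        rw [← henc] at g1 g2
        refine wp_satFinish h hfit (hfr s' hf) g1 g2 (fun s'' q1 q2 => ?_) (by rw [hc]; rfl) hP
        rw [Expr.eval, Expr.eval, Expr.eval, q1, q2, h0, h8, hoff, satOffset, if_neg (by omega)]
        ring

namespace Emitter

variable {Q : OptProblem} {T : Target Q}

/-- Write down terms that are given by expressions. -/
def emits (E : Emitter T) : List (Expr × Expr × Expr) → Program
  | [] => .skip
  | e :: es => .seq (.assign 6 e.1) (.seq (.assign 7 e.2.1) (.seq (.assign 8 e.2.2)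
      (.seq E.prog (E.emits es))))

/-- The registers that are changed by writing down terms. -/
abbrev scratch : List ℕ := [1, 2, 3, 6, 7, 8, 30, 31]

theorem wp_emits (E : Emitter T) {B : ℤ} {Z C V : ℕ} {θ : ℤ} (es : List (Expr × Expr × Expr))
    (us : List Term) {ts : List Term} {s : MachineState} {P : MachineState → Prop}
    (h : List.Forall₂ (fun e t => ∀ s', Frame scratch [1] s s' →
      e.1.eval s' = ((t : Term).1 : ℤ) ∧ e.2.1.eval s' = (t.2.1 : ℤ) ∧ e.2.2.eval s' = t.2.2) es us)
    (hout : OutRep T Z θ ts s) (hfit : Fits B Z C V θ (ts ++ us))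
    (hP : ∀ s', OutRep T Z θ (ts ++ us) s' → Frame scratch [1] s s' → P s') :
    (E.emits es).wp B P s := by
  induction es generalizing us s ts with
  | nil =>
    obtain rfl := List.forall₂_nil_left_iff.1 h
    exact hP s (by simpa using hout) (.refl _ _ _)
  | cons e es ih =>
    obtain ⟨t, us, h1, h2, rfl⟩ := List.forall₂_cons_left_iff.1 h
    have hb := hfit.bound
    have h4 : (0 : ℤ) ≤ C * V := by positivity
    have h5 := abs_nonneg θ
    have hlt := hfit.lt t (by simp)
    have hw := abs_le.1 (hfit.weight_le t (by simp))
    have e1 := (h1 s (.refl _ _ _)).1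
    have f1 : Frame scratch [1] s (s.setReg 6 t.1) := (Frame.refl _ _ s).setReg (by decide) _
    have e2 := (h1 _ f1).2.1
    have f2 := f1.setReg (r := 7) (by decide) (t.2.1 : ℤ)
    have e3 := (h1 _ f2).2.2
    have f3 := f2.setReg (r := 8) (by decide) t.2.2
    refine ⟨?_, ?_, ?_, ?_⟩
    · rw [e1]; constructor <;> omega
    · rw [e1, e2]; constructor <;> omega
    · rw [e1, e2, e3]; constructor <;> omega
    · rw [e1, e2, e3]
      refine E.spec (t := t) (hout.congr (R := [6, 7, 8]) (A := []) ?_ (by decide) (by decide))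
        (by simp) (by simp) (by simp) ⟨?_, ?_, ?_, hb⟩ fun s' o1 f4 => ?_
      · exact (((Frame.refl _ _ s).setReg (by decide) _).setReg (by decide) _).setReg (by decide) _
      · have := hfit.length_le
        simp only [List.length_append, List.length_cons, List.length_nil] at this ⊢
        omega
      · exact fun u hu => hfit.weight_le u (by simp at hu ⊢; tauto)
      · exact fun u hu => hfit.lt u (by simp at hu ⊢; tauto)
      · have f5 := f3.trans (f4.mono (by decide) (by decide))
        refine ih us (ts := ts ++ [t]) ?_ o1 (by simpa using hfit) fun s'' o2 f6 => ?_
        · exact h2.imp fun e t h s'' hs'' => h s'' (f5.trans hs'')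
        · exact hP s'' (by simpa using o2) (f5.trans f6)

end Emitter

/-! ### The steps of the construction as programs -/

/-- The machine state `s` represents the state `σ` of the construction. -/
structure BuildRep {Q : OptProblem} (T : Target Q) (inp : ℤ → ℤ) (Z : ℕ) (θ : ℤ) (g : ℕ → ℕ)
    (m W : ℕ) (σ : BuildState) (s : MachineState) : Prop where
  input : s.mem 0 = inp
  clauses : s.reg 11 = m
  top : s.reg 12 = W
  next : s.reg 4 = σ.next
  weights : Agree (s.mem 2) g
  topVar : Agree (s.mem 3) σ.topVar
  topClause : Agree (s.mem 4) σ.topClause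
  cur : Agree (s.mem 5) σ.cur
  out : OutRep T Z θ σ.terms s

theorem BuildRep.congr {Q : OptProblem} {T : Target Q} {inp : ℤ → ℤ} {Z : ℕ} {θ : ℤ} {g : ℕ → ℕ}
    {m W : ℕ} {σ : BuildState} {s s' : MachineState} (h : BuildRep T inp Z θ g m W σ s)
    {R A : List ℕ} (hf : Frame R A s s') (hR : ∀ r ∈ R, r ∉ [1, 2, 3, 4, 5, 11, 12, 30])
    (hA : ∀ a ∈ A, a ∉ [0, 1, 2, 3, 4, 5]) : BuildRep T inp Z θ g m W σ s' := by
  have hreg : ∀ r ∈ [1, 2, 3, 4, 5, 11, 12, 30], s'.reg r = s.reg r :=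
    fun r hr => hf.reg r fun hrR => hR r hrR hr
  have hmem : ∀ a ∈ [0, 1, 2, 3, 4, 5], s'.mem a = s.mem a :=
    fun a ha => hf.mem a fun haA => hA a haA ha
  refine ⟨?_, ?_, ?_, ?_, ?_, ?_, ?_, ?_, h.out.congr hf (fun r hr hm => hR r hr ?_) ?_⟩
  · rw [hmem 0 (by decide)]; exact h.input
  · rw [hreg 11 (by decide)]; exact h.clauses
  · rw [hreg 12 (by decide)]; exact h.top
  · rw [hreg 4 (by decide)]; exact h.next
  · rw [hmem 2 (by decide)]; exact h.weights
  · rw [hmem 3 (by decide)]; exact h.topVar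
  · rw [hmem 4 (by decide)]; exact h.topClause
  · rw [hmem 5 (by decide)]; exact h.cur
  · simp only [List.mem_cons, List.not_mem_nil, or_false] at hm ⊢
    omega
  · exact fun h1 => hA 1 h1 (by decide)

/-- There is room for `k` more steps of the construction. -/
structure Room (B : ℤ) (Z C G U : ℕ) (θ : ℤ) (k : ℕ) (σ : BuildState) : Prop where
  small : σ.Small G U
  next : σ.next + 2 * k ≤ Z
  length : σ.terms.length + 6 * k ≤ C
  bound : 20 * ((C : ℤ) + (2 * G : ℕ) + Z + 1) + C * (2 * G : ℕ) + |θ| + 4 * U ≤ B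

namespace Room

variable {B : ℤ} {Z C G U : ℕ} {θ : ℤ} {k k' : ℕ} {σ σ' : BuildState} {g : ℕ → ℕ}

theorem fits (h : Room B Z C G U θ k σ) : Fits B Z C (2 * G) θ σ.terms := by
  refine ⟨by have := h.length; omega, fun t ht => ?_, fun t ht => ?_, ?_⟩
  · exact_mod_cast h.small.weight_le t ht
  · have := h.small.lt_next t ht
    have := h.next
    omega
  · have := h.bound; omega

theorem of_grows (h : Room B Z C G U θ (k + 1) σ) (hg : BuildState.Grows 1 σ σ')
    (hs : σ'.Small G U) : Room B Z C G U θ k σ' :=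
  ⟨hs, by have := h.next; have := hg.next_le; omega,
    by have := h.length; have := hg.length_le; omega, h.bound⟩

theorem mono (h : Room B Z C G U θ k σ) (hk : k' ≤ k) : Room B Z C G U θ k' σ :=
  ⟨h.small, by have := h.next; omega, by have := h.length; omega, h.bound⟩

theorem rootStep (h : Room B Z C G U θ (k + 1) σ) (hg : ∀ j, g j ≤ G) (j : ℕ) :
    Room B Z C G U θ k (BuildState.rootStep g σ j) :=
  h.of_grows (BuildState.grows_rootStep g σ j) (h.small.rootStep hg j)

theorem bagStep (h : Room B Z C G U θ (k + 1) σ) (hg : ∀ j, g j ≤ G) {b : ℕ} (hb : b ≤ U) (pb : ℕ)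
    (v : ℤ) : Room B Z C G U θ k (BuildState.bagStep g b pb σ v) :=
  h.of_grows (BuildState.grows_bagStep g b pb σ v) (h.small.bagStep hg hb pb v)

theorem literalStep (h : Room B Z C G U θ (k + 1) σ) (hg : ∀ j, g j ≤ G) (j : ℕ) {l : Literal}
    (hl : l.1 ≤ σ.next) : Room B Z C G U θ k (BuildState.literalStep g j σ l) :=
  h.of_grows (BuildState.grows_literalStep g j σ l) (h.small.literalStep hg j hl)

theorem simple (h : Room B Z C G U θ k σ) : 20 * ((C : ℤ) + 2 * G + Z + 1) + 4 * U ≤ B := by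
  have := h.bound
  have h4 : (0 : ℤ) ≤ C * (2 * G : ℕ) := by positivity
  have h5 := abs_nonneg θ
  push_cast at *
  linarith

end Room

namespace Emitter

variable {Q : OptProblem} {T : Target Q} {B : ℤ} {Z C G U m W k : ℕ} {θ : ℤ} {g : ℕ → ℕ}
  {inp : ℤ → ℤ} {σ : BuildState} {s : MachineState} {P : MachineState → Prop}

abbrev rootRegs : List ℕ := [1, 2, 3, 4, 6, 7, 8, 10, 15, 30, 31]

def rootBody (E : Emitter T) : Program :=
  .block [.assign 15 (.load 2 (.reg 10)),
    .branch (.eq (.reg 15) (.const 0)) .skip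
      (.block [.store 5 (.reg 10) (.reg 4),
        E.emits [(.reg 4, .reg 4, .sub (.const 0) (.add (.reg 15) (.reg 15)))],
        .assign 4 (.add (.reg 4) (.const 1))]),
    .assign 10 (.add (.reg 10) (.const 1))]

theorem wp_rootBody (E : Emitter T) {j : ℕ} (h : BuildRep T inp Z θ g m W σ s)
    (hr : Room B Z C G U θ (k + 1) σ) (hg : ∀ j, g j ≤ G) (hj : s.reg 10 = j) (hjU : j < U)
    (hP : ∀ s' : MachineState, BuildRep T inp Z θ g m W (σ.rootStep g j) s' →
      s'.reg 10 = j + 1 → Frame rootRegs [1, 5] s s' → P s') :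
    E.rootBody.wp B P s := by
  have hsimple := hr.simple
  have hnext := hr.next
  have hgj : (g j : ℤ) ≤ G := by exact_mod_cast hg j
  have hgj0 : (0 : ℤ) ≤ g j := by positivity
  simp only [rootBody, wp_block_cons, wp_block_nil, wp_assign, wp_branch, wp_skip, Expr.eval,
    setReg_reg, setReg_mem, hj, h.weights j, if_true, ite_one_zero_ne_zero, ne_eq, not_not]
  refine ⟨⟨by omega, by omega⟩, fun h0 => ⟨?_, ?_⟩, fun h0 => ?_⟩
  · simp [hj]; constructor <;> omega
  · have h0' : g j = 0 := by exact_mod_cast h0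
    have e : σ.rootStep g j = σ := by simp [BuildState.rootStep, h0']
    refine hP _ ?_ (by simp [hj])
      (((Frame.refl _ _ s).setReg (by decide) _).setReg (by decide) _)
    rw [e]
    exact h.congr (R := [15, 10]) (A := [])
      (((Frame.refl _ _ s).setReg (by decide) _).setReg (by decide) _) (by decide) (by decide)
  · have h0' : g j ≠ 0 := by exact_mod_cast h0
    have hr' := hr.rootStep hg j
    simp only [BuildState.rootStep, if_neg h0'] at hr' hP
    simp only [wp_store, Expr.eval, setReg_reg, setReg_mem, hj, h.next, Nat.reduceEqDiff, if_false]
    refine ⟨⟨by omega, by omega⟩, ⟨by omega, by omega⟩, ?_⟩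
    refine E.wp_emits _ [(σ.next, σ.next, -(2 * g j : ℤ))] ?_
      (h.out.congr (R := [15]) (A := [5])
        (((Frame.refl _ _ s).setReg (by decide) _).setMem (by decide) _ _) (by decide) (by decide))
      hr'.fits fun s₁ o1 f1 => ?_
    · refine .cons (fun s' hs' => ?_) .nil
      have r4 := hs'.reg 4 (by decide)
      have r15 := hs'.reg 15 (by decide)
      simp [h.next] at r4 r15
      refine ⟨by simp [r4], by simp [r4], by simp [r15]; ring⟩
    · have r4 := f1.reg 4 (by decide)
      have r10 := f1.reg 10 (by decide)
      have r11 := f1.reg 11 (by decide)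
      have r12 := f1.reg 12 (by decide)
      have m0 := f1.mem 0 (by decide)
      have m2 := f1.mem 2 (by decide)
      have m3 := f1.mem 3 (by decide)
      have m4 := f1.mem 4 (by decide)
      have m5 := f1.mem 5 (by decide)
      simp [h.next, hj, h.clauses, h.top] at r4 r10 r11 r12 m0 m2 m3 m4 m5
      simp only [wp_assign, wp_block_cons, wp_block_nil, Expr.eval, setReg_reg, r4, r10]
      refine ⟨⟨by omega, by omega⟩, ⟨?_, ?_⟩, hP _ ⟨?_, ?_, ?_, ?_, ?_, ?_, ?_, ?_, ?_⟩ ?_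
        (((Frame.trans (((Frame.refl _ _ s).setReg (by decide) _).setMem (by decide) _ _)
          (f1.mono (by decide) (by decide))).setReg (by decide) _).setReg (by decide) _)⟩
      · simp; omega
      · simp; omega
      · simp [m0, h.input]
      · simp [r11]
      · simp [r12]
      · simp
      · simpa [m2] using h.weights
      · simpa [m3] using h.topVar
      · simpa [m4] using h.topClause
      · simp only [setReg_mem, m5]
        exact h.cur.update rfl rfl
      · exact o1.congr (R := [4, 10]) (A := [])
          (((Frame.refl _ _ _).setReg (by decide) _).setReg (by decide) _) (by decide) (by decide)
      · simp

end Emitter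

namespace BuildRep

variable {Q : OptProblem} {T : Target Q} {Z m W : ℕ} {θ : ℤ} {g : ℕ → ℕ}
  {inp : ℤ → ℤ} {σ : BuildState} {s : MachineState}

theorem setReg (h : BuildRep T inp Z θ g m W σ s) {r : ℕ}
    (hr : r ∉ [1, 2, 3, 4, 5, 11, 12, 30]) (v : ℤ) :
    BuildRep T inp Z θ g m W σ (s.setReg r v) :=
  h.congr (R := [r]) (A := []) ((Frame.refl _ _ s).setReg (by simp) v) (by simpa using hr)
    (by simp)

theorem setNext (h : BuildRep T inp Z θ g m W σ s) {v : ℤ} {n : ℕ} (hv : v = n) :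
    BuildRep T inp Z θ g m W { σ with next := n } (s.setReg 4 v) :=
  ⟨h.input, h.clauses, h.top, by simpa using hv, h.weights, h.topVar, h.topClause, h.cur,
    h.out.congr (R := [4]) (A := []) ((Frame.refl _ _ s).setReg (by decide) v) (by decide)
      (by decide)⟩

theorem setTopVar (h : BuildRep T inp Z θ g m W σ s) {i v : ℤ} {x b : ℕ} (hi : i = x)
    (hv : v = b) : BuildRep T inp Z θ g m W { σ with topVar := Function.update σ.topVar x b }
      (s.setMem 3 i v) :=
  ⟨h.input, h.clauses, h.top, h.next, h.weights, h.topVar.update hi hv, h.topClause, h.cur,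
    h.out.congr (R := []) (A := [3]) ((Frame.refl _ _ s).setMem (by decide) i v) (by decide)
      (by decide)⟩

theorem setTopClause (h : BuildRep T inp Z θ g m W σ s) {i v : ℤ} {x b : ℕ} (hi : i = x)
    (hv : v = b) :
    BuildRep T inp Z θ g m W { σ with topClause := Function.update σ.topClause x b }
      (s.setMem 4 i v) :=
  ⟨h.input, h.clauses, h.top, h.next, h.weights, h.topVar, h.topClause.update hi hv, h.cur,
    h.out.congr (R := []) (A := [4]) ((Frame.refl _ _ s).setMem (by decide) i v) (by decide)
      (by decide)⟩

theorem setCur (h : BuildRep T inp Z θ g m W σ s) {i v : ℤ} {x b : ℕ} (hi : i = x)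
    (hv : v = b) : BuildRep T inp Z θ g m W { σ with cur := Function.update σ.cur x b }
      (s.setMem 5 i v) :=
  ⟨h.input, h.clauses, h.top, h.next, h.weights, h.topVar, h.topClause, h.cur.update hi hv,
    h.out.congr (R := []) (A := [5]) ((Frame.refl _ _ s).setMem (by decide) i v) (by decide)
      (by decide)⟩

theorem emitted (h : BuildRep T inp Z θ g m W σ s) {s' : MachineState} {ts : List Term}
    (hf : Frame Emitter.scratch [1] s s') (ho : OutRep T Z θ ts s') :
    BuildRep T inp Z θ g m W { σ with terms := ts } s' := by
  refine ⟨?_, ?_, ?_, ?_, ?_, ?_, ?_, ?_, ho⟩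
  · rw [hf.mem 0 (by decide)]; exact h.input
  · rw [hf.reg 11 (by decide)]; exact h.clauses
  · rw [hf.reg 12 (by decide)]; exact h.top
  · rw [hf.reg 4 (by decide)]; exact h.next
  · rw [hf.mem 2 (by decide)]; exact h.weights
  · rw [hf.mem 3 (by decide)]; exact h.topVar
  · rw [hf.mem 4 (by decide)]; exact h.topClause
  · rw [hf.mem 5 (by decide)]; exact h.cur

end BuildRep

/-- The terms of a triangle with apex in register `18`, the fresh variable in register `4`, its
coefficient in register `26` and the weight in register `15`. -/
def triangleExprs : List (Expr × Expr × Expr) :=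
  [(.reg 4, .reg 4, .reg 26),
    (.add (.reg 4) (.const 1), .add (.reg 4) (.const 1), .add (.reg 15) (.reg 15)),
    (.reg 18, .reg 4, .sub (.const 0) (.add (.reg 15) (.reg 15))),
    (.reg 18, .add (.reg 4) (.const 1), .sub (.const 0) (.add (.reg 15) (.reg 15))),
    (.reg 4, .add (.reg 4) (.const 1), .add (.reg 15) (.reg 15))]

theorem forall₂_triangleExprs {s : MachineState} {y n : ℕ} {c w : ℤ} (hy : s.reg 18 = y)
    (hn : s.reg 4 = n) (hc : s.reg 26 = c) (hw : s.reg 15 = w) :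
    List.Forall₂ (fun e t => ∀ s', Frame Emitter.scratch [1] s s' →
      e.1.eval s' = ((t : Term).1 : ℤ) ∧ e.2.1.eval s' = (t.2.1 : ℤ) ∧ e.2.2.eval s' = t.2.2)
      triangleExprs (triangle y n c w) := by
  have key : ∀ s', Frame Emitter.scratch [1] s s' → s'.reg 18 = y ∧ s'.reg 4 = n ∧ s'.reg 26 = c ∧
      s'.reg 15 = w := fun s' hs' => by
    rw [hs'.reg 18 (by decide), hs'.reg 4 (by decide), hs'.reg 26 (by decide),
      hs'.reg 15 (by decide)]
    exact ⟨hy, hn, hc, hw⟩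
  unfold triangleExprs triangle
  refine .cons (fun s' hs' => ?_) (.cons (fun s' hs' => ?_) (.cons (fun s' hs' => ?_)
    (.cons (fun s' hs' => ?_) (.cons (fun s' hs' => ?_) .nil)))) <;>
  · obtain ⟨h1, h2, h3, h4⟩ := key s' hs'
    simp [h1, h2, h3, h4]
    try ring

namespace Emitter

variable {Q : OptProblem} {T : Target Q} {B : ℤ} {Z C G U m W k : ℕ} {θ : ℤ} {g : ℕ → ℕ}
  {inp : ℤ → ℤ} {σ : BuildState} {s : MachineState} {P : MachineState → Prop}

/-- The arrays `2`, `3`, `4`, `5` hold the weights, the top nodes of the variables, those of the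
clauses, and the open ends. Register `24` is the element of the bag, and the registers `16` and `22`
are the first slots of the node and of its parent. -/
def bagCore (E : Emitter T) : Program :=
  .branch (.le (.const 0) (.reg 24))
    (.branch (.eq (.load 3 (.reg 24)) (.const 0)) (.store 3 (.reg 24) (.reg 16)) .skip)
    (.block [.assign 10 (.sub (.const (-1)) (.reg 24)), .assign 15 (.load 2 (.reg 10)),
      .branch (.eq (.reg 15) (.const 0)) .skip
        (.branch (.eq (.load 4 (.reg 10)) (.const 0))
          (.block [.store 4 (.reg 10) (.reg 16),
            .store 5 (.add (.reg 16) (.reg 10)) (.load 5 (.reg 10))])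
          (.block [.assign 18 (.load 5 (.add (.reg 22) (.reg 10))),
            .assign 26 (.add (.reg 15) (.reg 15)), E.emits triangleExprs,
            .store 5 (.add (.reg 16) (.reg 10)) (.reg 4),
            .store 5 (.add (.reg 22) (.reg 10)) (.add (.reg 4) (.const 1)),
            .assign 4 (.add (.reg 4) (.const 2))]))])

abbrev bagRegs : List ℕ := [1, 2, 3, 4, 6, 7, 8, 10, 15, 18, 26, 30, 31]

theorem wp_bagCore (E : Emitter T) {b pb : ℕ} {v : ℤ} (h : BuildRep T inp Z θ g m W σ s)
    (hr : Room B Z C G U θ (k + 1) σ) (hg : ∀ j, g j ≤ G) (hgm : ∀ j, g j ≠ 0 → j < U)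
    (hv : InRange (B - 1) v) (h24 : s.reg 24 = v) (h16 : s.reg 16 = b) (h22 : s.reg 22 = pb)
    (hb : b ≤ U) (hpb : pb ≤ U)
    (hP : ∀ s' : MachineState, BuildRep T inp Z θ g m W (σ.bagStep g b pb v) s' →
      Frame bagRegs [1, 3, 4, 5] s s' → P s') : E.bagCore.wp B P s := by
  have hsimple := hr.simple
  have hnext := hr.next
  have hr' := hr.bagStep hg hb pb v
  obtain ⟨hv1, hv2⟩ := hv
  unfold BuildState.bagStep at hr' hP
  simp only [bagCore, wp_branch, Expr.eval, h24, ite_one_zero_ne_zero, ne_eq, not_not]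
  refine ⟨fun h0 => ?_, fun h0 => ?_⟩
  · rw [if_pos h0] at hP
    obtain ⟨x, rfl⟩ := Int.eq_ofNat_of_zero_le h0
    rw [Int.toNat_natCast] at hP
    rw [h.topVar x]
    refine ⟨fun h1 => ?_, fun h1 => ?_⟩
    · rw [if_pos (by exact_mod_cast h1)] at hP
      simp only [wp_store, Expr.eval, h24, h16]
      exact ⟨⟨by omega, by omega⟩, ⟨by omega, by omega⟩, hP _ (h.setTopVar rfl rfl)
        ((Frame.refl _ _ s).setMem (by decide) _ _)⟩
    · rw [if_neg (by exact_mod_cast h1)] at hP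
      exact hP _ h (.refl _ _ _)
  · rw [if_neg h0] at hP hr'
    obtain ⟨j, hj⟩ := Int.eq_ofNat_of_zero_le (show 0 ≤ -1 - v by omega)
    have hjn : (-1 - v).toNat = j := by omega
    rw [hjn] at hP hr'
    have hgj : (g j : ℤ) ≤ G := by exact_mod_cast hg j
    have f1 : Frame bagRegs [1, 3, 4, 5] s ((s.setReg 10 j).setReg 15 (g j)) :=
      ((Frame.refl _ _ s).setReg (by decide) _).setReg (by decide) _
    have h1 : BuildRep T inp Z θ g m W σ ((s.setReg 10 j).setReg 15 (g j)) :=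
      (h.setReg (by decide) _).setReg (by decide) _
    simp only [wp_block_cons, wp_block_nil, wp_assign, wp_branch, Expr.eval, setReg_reg, setReg_mem,
      h24, hj, h.weights j, if_true, ite_one_zero_ne_zero, ne_eq, not_not]
    refine ⟨⟨by omega, by omega⟩, ⟨by omega, by omega⟩, fun h2 => ?_, fun h2 => ⟨?_, ?_⟩⟩
    · rw [if_pos (by exact_mod_cast h2)] at hP
      exact hP _ h1 f1
    all_goals
      have hg0 : g j ≠ 0 := by exact_mod_cast h2
      have hjU := hgm j hg0
      rw [if_neg hg0] at hP hr'
      simp only [Nat.reduceEqDiff, if_false, if_true, h.topClause j]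
      intro h3
    · rw [if_pos (by exact_mod_cast h3)] at hP
      simp only [wp_block_cons, wp_block_nil, wp_store, Expr.eval, setReg_reg, setReg_mem,
        setMem_reg, setMem_mem, Nat.reduceEqDiff, if_false, if_true, h16, h.cur j]
      have hc := hr.small.cur_le j
      refine ⟨⟨by omega, by omega⟩, ⟨by omega, by omega⟩, ⟨by omega, by omega⟩,
        ⟨by omega, by omega⟩, hP _ ?_ ((f1.setMem (by decide) _ _).setMem (by decide) _ _)⟩
      exact (h1.setTopClause rfl rfl).setCur (by push_cast; rfl) rfl
    · rw [if_neg (by exact_mod_cast h3)] at hP hr'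
      have hc := hr.small.cur_le (pb + j)
      have hcur : s.mem 5 ((pb : ℤ) + j) = σ.cur (pb + j) := by exact_mod_cast h.cur (pb + j)
      simp only [wp_block_cons, wp_block_nil, wp_assign, Expr.eval, setReg_reg, setReg_mem,
        Nat.reduceEqDiff, if_false, if_true, h22, hcur]
      refine ⟨⟨by omega, by omega⟩, ⟨by omega, by omega⟩, ?_⟩
      refine E.wp_emits _ (triangle (σ.cur (pb + j)) σ.next (2 * g j) (g j)) ?_
        ((h1.setReg (by decide) _).setReg (by decide) _).out hr'.fits fun s₁ o1 f2 => ?_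
      · refine forall₂_triangleExprs ?_ ?_ ?_ ?_ <;> simp [h.next]
        ring
      · have h4 := ((h1.setReg (r := 18) (by decide) (σ.cur (pb + j))).setReg (r := 26) (by decide)
          (g j + g j)).emitted f2 o1
        have f3 : Frame bagRegs [1, 3, 4, 5] s s₁ :=
          ((f1.setReg (by decide) _).setReg (by decide) _).trans (f2.mono (by decide) (by decide))
        have r10 := f2.reg 10 (by decide)
        have r16 := f2.reg 16 (by decide)
        have r22 := f2.reg 22 (by decide)
        have r4 := h4.next
        simp [h16, h22] at r10 r16 r22 r4
        simp only [wp_block_cons, wp_block_nil, wp_assign, wp_store, Expr.eval, setMem_reg, r4, r10,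
          r16, r22]
        refine ⟨⟨by omega, by omega⟩, ⟨by omega, by omega⟩, ⟨by omega, by omega⟩,
          ⟨by omega, by omega⟩, ⟨by omega, by omega⟩, hP _ ?_ ?_⟩
        · exact ((h4.setCur (by push_cast; rfl) rfl).setCur (by push_cast; rfl)
            (by push_cast; rfl)).setNext (by push_cast; rfl)
        · exact ((f3.setMem (by decide) _ _).setMem (by decide) _ _).setReg (by decide) _

/-- Register `10` is the clause, `15` its weight and `19` the word of the literal. From these come
the variable in `14`, the linear coefficient of the fresh variable in `26`, the coefficient of its
product with the variable in `25`, the slot in `17` and the open end in `18`. -/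
def literalCore (E : Emitter T) : Program :=
  .branch (.eq (.reg 15) (.const 0)) .skip
    (.block [
      .branch (.le (.const 1) (.reg 19))
        (.block [.assign 14 (.sub (.reg 19) (.const 1)), .assign 26 (.add (.reg 15) (.reg 15)),
          .assign 25 (.sub (.const 0) (.reg 15))])
        (.block [.assign 14 (.sub (.const (-1)) (.reg 19)), .assign 26 (.reg 15),
          .assign 25 (.reg 15)]),
      .branch (.le (.load 3 (.reg 14)) (.load 4 (.reg 10)))
        (.assign 17 (.add (.load 4 (.reg 10)) (.reg 10)))
        (.assign 17 (.add (.load 3 (.reg 14)) (.reg 10))),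
      .assign 18 (.load 5 (.reg 17)),
      E.emits (triangleExprs ++ [(.reg 14, .reg 4, .reg 25)]),
      .store 5 (.reg 17) (.add (.reg 4) (.const 1)),
      .assign 4 (.add (.reg 4) (.const 2))])

abbrev literalRegs : List ℕ := [1, 2, 3, 4, 6, 7, 8, 14, 17, 18, 25, 26, 30, 31]

theorem wp_literalCore (E : Emitter T) {j : ℕ} {l : Literal} (h : BuildRep T inp Z θ g m W σ s)
    (hr : Room B Z C G U θ (k + 1) σ) (hg : ∀ j, g j ≤ G) (hjU : j < U)
    (hl : l.1 ≤ σ.next) (h10 : s.reg 10 = j) (h15 : s.reg 15 = g j)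
    (h19 : s.reg 19 = literalWord l)
    (hP : ∀ s' : MachineState, BuildRep T inp Z θ g m W (σ.literalStep g j l) s' →
      Frame literalRegs [1, 5] s s' → P s') : E.literalCore.wp B P s := by
  have hsimple := hr.simple
  have hnext := hr.next
  have hr' := hr.literalStep hg j hl
  have hgj : (g j : ℤ) ≤ G := by exact_mod_cast hg j
  unfold BuildState.literalStep at hr' hP
  simp only [literalCore, wp_branch, wp_skip, Expr.eval, h15, ite_one_zero_ne_zero, ne_eq, not_not]
  refine ⟨fun h0 => ?_, fun h0 => ?_⟩
  · rw [if_pos (by exact_mod_cast h0)] at hP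
    exact hP _ h (.refl _ _ _)
  rw [if_neg (by exact_mod_cast h0)] at hP hr'
  rw [wp_block_cons]
  set c : ℤ := if l.2 then 2 * g j else g j with hc
  set d : ℤ := if l.2 then -(g j : ℤ) else g j with hd
  set s₁ := ((s.setReg 14 l.1).setReg 26 c).setReg 25 d with hs₁
  have f1 : Frame literalRegs [1, 5] s s₁ :=
    (((Frame.refl _ _ s).setReg (by decide) _).setReg (by decide) _).setReg (by decide) _
  have h1 : BuildRep T inp Z θ g m W σ s₁ :=
    ((h.setReg (by decide) _).setReg (by decide) _).setReg (by decide) _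
  -- Both signs lead to the state `s₁`, whose entries depend on the sign by `c` and `d`; the
  -- remaining program is then treated once for both.
  refine Program.wp_mono (Q := fun s' => s' = s₁) ?_ ?_
  swap
  · obtain ⟨x, b⟩ := l
    simp only at hl
    cases b
    · simp only [wp_branch, Expr.eval, h19, literalWord, ite_one_zero_ne_zero, ne_eq, not_not,
        wp_block_cons, wp_block_nil, wp_assign, setReg_reg, Nat.reduceEqDiff, if_false, h15]
      refine ⟨fun h => ?_, fun _ => ⟨?_, ?_, ?_, ?_⟩⟩
      · simp at h; omega
      · constructor <;> (try simp only [Bool.false_eq_true, if_false, if_true]) <;> omega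
      · constructor <;> (try simp only [Bool.false_eq_true, if_false, if_true]) <;> omega
      · constructor <;> (try simp only [Bool.false_eq_true, if_false, if_true]) <;> omega
      · rw [hs₁, hc, hd]
        simp
    · simp only [wp_branch, Expr.eval, h19, literalWord, ite_one_zero_ne_zero, ne_eq, not_not,
        wp_block_cons, wp_block_nil, wp_assign, setReg_reg, Nat.reduceEqDiff, if_false, h15]
      refine ⟨fun _ => ⟨?_, ?_, ?_, ?_⟩, fun h => ?_⟩
      · constructor <;> (try simp only [Bool.false_eq_true, if_false, if_true]) <;> omega
      · constructor <;> (try simp only [Bool.false_eq_true, if_false, if_true]) <;> omega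
      · constructor <;> (try simp only [Bool.false_eq_true, if_false, if_true]) <;> omega
      · rw [hs₁, hc, hd]
        simp [two_mul]
      · exact absurd (show (1 : ℤ) ≤ if True then (x : ℤ) + 1 else _ by simp) h
  · rintro s' rfl
    have r10 : s₁.reg 10 = j := by simp [hs₁, h10]
    have r14 : s₁.reg 14 = l.1 := by simp [hs₁]
    have r15 : s₁.reg 15 = g j := by simp [hs₁, h15]
    have r25 : s₁.reg 25 = d := by simp [hs₁]
    have r26 : s₁.reg 26 = c := by simp [hs₁]
    clear_value s₁
    set q := σ.literalSlot j l with hq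
    have hslot : q ≤ 2 * U := by
      have h2 := hr.small.topVar_le l.1
      have h3 := hr.small.topClause_le j
      rw [hq]; unfold BuildState.literalSlot
      omega
    rw [wp_block_cons]
    refine Program.wp_mono (Q := fun s' => s' = s₁.setReg 17 q) ?_ ?_
    swap
    · simp only [wp_branch, wp_assign, Expr.eval, r10, r14, h1.topVar l.1, h1.topClause j,
        ite_one_zero_ne_zero, ne_eq, not_not]
      refine ⟨fun h2 => ?_, fun h2 => ?_⟩
      · have : (σ.topClause j : ℤ) + j = q := by
          rw [hq]; unfold BuildState.literalSlot
          rw [max_eq_right (by exact_mod_cast h2)]; push_cast; rfl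
        rw [this]
        exact ⟨⟨by omega, by omega⟩, rfl⟩
      · have : (σ.topVar l.1 : ℤ) + j = q := by
          rw [hq]; unfold BuildState.literalSlot
          rw [max_eq_left (by omega)]; push_cast; rfl
        rw [this]
        exact ⟨⟨by omega, by omega⟩, rfl⟩
    · rintro s' rfl
      have hcq := hr.small.cur_le q
      simp only [wp_block_cons, wp_block_nil, wp_assign, Expr.eval, setReg_reg, setReg_mem, if_true,
        h1.cur q]
      refine ⟨⟨by omega, by omega⟩, ?_⟩
      have h2 := (h1.setReg (r := 17) (by decide) q).setReg (r := 18) (by decide) (σ.cur q)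
      have f2 : Frame literalRegs [1, 5] s ((s₁.setReg 17 q).setReg 18 (σ.cur q)) :=
        (f1.setReg (by decide) _).setReg (by decide) _
      refine E.wp_emits _ (literalTerms (σ.cur q) σ.next (g j) l) ?_ h2.out hr'.fits
        fun s₂ o1 f3 => ?_
      · refine List.rel_append (forall₂_triangleExprs ?_ ?_ ?_ ?_) (.cons (fun s' hs' => ?_) .nil)
        · simp
        · simp [h1.next]
        · simpa [r26] using hc
        · simp [r15]
        · have k14 := hs'.reg 14 (by decide)
          have k4 := hs'.reg 4 (by decide)
          have k25 := hs'.reg 25 (by decide)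
          simp only [Expr.eval, k14, k4, k25]
          simpa [r14, r25, h1.next] using hd
      · have h3 := h2.emitted f3 o1
        have r17 := f3.reg 17 (by decide)
        have r4 := h3.next
        simp at r17 r4
        simp only [wp_store, wp_assign, wp_block_cons, wp_block_nil, Expr.eval, setMem_reg, r4, r17]
        refine ⟨⟨by omega, by omega⟩, ⟨by omega, by omega⟩, ⟨by omega, by omega⟩, hP _ ?_ ?_⟩
        · exact (h3.setCur rfl (by push_cast; rfl)).setNext (by push_cast; rfl)
        · exact ((f2.trans (f3.mono (by decide) (by decide))).setMem (by decide) _ _).setReg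
            (by decide) _

end Emitter

/-! ### Reading the input -/

theorem Program.wp.seq_halts {B : ℤ} {p q : Program} {s : MachineState} {T : ℕ}
    {Q : MachineState → Prop} (h : p.wp B (fun s' => Halts B q s' T Q) s) :
    Halts B (.seq p q) s (p.size + T) Q :=
  .seq h.halts

/-- The registers `R` and the input are unchanged. -/
structure Keeps (R : List ℕ) (s s' : MachineState) : Prop where
  reg : ∀ r ∈ R, s'.reg r = s.reg r
  input : s'.mem 0 = s.mem 0

theorem Frame.keeps {R R' A : List ℕ} {s s' : MachineState} (h : Frame R A s s')
    (hR : ∀ r ∈ R', r ∉ R) (hA : 0 ∉ A) : Keeps R' s s' :=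
  ⟨fun r hr => h.reg r (hR r hr), h.mem 0 hA⟩

/-- Process the words from the position in register `9` on; their number is in register `13`. -/
def readWords (core : Program) : Program :=
  .loop (.le (.const 1) (.reg 13))
    (.seq core (.seq (.assign 9 (.add (.reg 9) (.const 1)))
      (.assign 13 (.sub (.reg 13) (.const 1)))))

theorem halts_readWords {B : ℤ} {core : Program} {β γ : Type} (word : γ → ℤ) (f : β → γ → β)
    (R : List ℕ) (hR9 : 9 ∉ R) (hR13 : 13 ∉ R) (inp : ℤ → ℤ)
    (Rel : β → List γ → MachineState → Prop)
    (hset : ∀ x l s v, Rel x l s → Rel x l (s.setReg 9 v) ∧ Rel x l (s.setReg 13 v))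
    (hcore : ∀ (x : β) (e : γ) (l : List γ) (s : MachineState), Rel x (e :: l) s → s.mem 0 = inp →
      inp (s.reg 9) = word e →
      core.wp B (fun s' => Rel (f x e) l s' ∧ Keeps (9 :: 13 :: R) s s') s)
    (l : List γ) {x : β} {s : MachineState} {p : ℕ} (h : Rel x l s) (hin : s.mem 0 = inp)
    (h9 : s.reg 9 = p) (h13 : s.reg 13 = l.length) (hl : Seg inp p (l.map word))
    (hB : (p + l.length : ℤ) ≤ B) :
    Halts B (readWords core) s ((core.size + 3) * l.length + 1) fun s' =>
      Rel (l.foldl f x) [] s' ∧ s'.reg 9 = p + l.length ∧ Keeps R s s' := by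
  have := Halts.loop (B := B) (e := .le (.const 1) (.reg 13))
    (p := .seq core (.seq (.assign 9 (.add (.reg 9) (.const 1)))
      (.assign 13 (.sub (.reg 13) (.const 1))))) f (fun _ => core.size + 2)
    (fun x' l' s' => Rel x' l' s' ∧ Keeps R s s' ∧ s'.reg 13 = l'.length ∧
      ∃ p' : ℕ, s'.reg 9 = p' ∧ Seg inp p' (l'.map word) ∧ p' + l'.length = p + l.length)
    ?_ ?_ l x s ⟨h, ⟨fun _ _ => rfl, rfl⟩, h13, p, h9, hl, rfl⟩
  · refine this.mono (by simp; ring_nf; rfl) fun s' hs' => ?_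
    obtain ⟨h1, h2, -, p', h3, -, h4⟩ := hs'
    refine ⟨h1, ?_, h2⟩
    rw [h3]
    simp only [List.length_nil] at h4
    omega
  · rintro x' e l' s' ⟨h1, h2, h3, p', h4, h5, h6⟩
    rw [List.length_cons] at h3 h6
    rw [List.map_cons, seg_cons] at h5
    refine ⟨?_, ?_⟩
    · simp [h3]
    refine Halts.mono (T := core.size + (1 + 1)) ?_ (by omega) fun _ h => h
    refine Program.wp.seq_halts (Program.wp_mono ?_ (hcore x' e l' s' h1 (h2.input.trans hin)
      (by rw [h4]; exact h5.1)))
    rintro s'' ⟨g1, g2⟩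
    have g9 := g2.reg 9 (by simp)
    have g13 := g2.reg 13 (by simp)
    have := Program.wp.halts (B := B) (p := .seq (.assign 9 (.add (.reg 9) (.const 1)))
      (.assign 13 (.sub (.reg 13) (.const 1)))) (s := s'') (Q := fun s' => Rel (f x' e) l' s' ∧
      Keeps R s s' ∧ s'.reg 13 = l'.length ∧
      ∃ p' : ℕ, s'.reg 9 = p' ∧ Seg inp p' (l'.map word) ∧ p' + l'.length = p + l.length)
      (by
        refine ⟨?_, ?_, ?_⟩
        · simp only [Expr.eval, g9, h4]; constructor <;> omega
        · simp only [Expr.eval, setReg_reg, g13, h3]; constructor <;> simp <;> omega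
        · refine ⟨(hset _ _ _ _ (hset _ _ _ _ g1).1).2, ⟨fun r hr => ?_, ?_⟩, ?_, p' + 1, ?_, h5.2,
            by omega⟩
          · have e9 : r ≠ 9 := fun h => hR9 (h ▸ hr)
            have e13 : r ≠ 13 := fun h => hR13 (h ▸ hr)
            simp only [setReg_reg, if_neg e9, if_neg e13]
            rw [g2.reg r (by simp [hr]), h2.reg r hr]
          · simp only [setReg_mem]
            rw [g2.input, h2.input]
          · simp [g13, h3]
          · simp [g9, h4])
    exact this
  · rintro x' s' ⟨-, -, h3, -⟩
    simp [h3]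

/-- Process blocks of words; register `q` counts the blocks, register `t` holds their number. -/
def readBlocks (q t : ℕ) (header core : Program) : Program :=
  .loop (.le (.add (.reg q) (.const 1)) (.reg t))
    (.seq header (.seq (readWords core) (.assign q (.add (.reg q) (.const 1)))))

/-- A block of words: two words and a list of further words. -/
def blockWords {α γ : Type} (h₁ h₂ : α → ℤ) (elems : α → List γ) (word : γ → ℤ) (a : α) : List ℤ :=
  h₁ a :: h₂ a :: (elems a).map word

/-- Clauses, nodes and quadratic terms all have the form of two words followed by a list of words,
and this rule covers every pass over them. `Rel` is the invariant between blocks and `Rel'` the one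
inside a block. The linear time bound comes from charging all steps of a block to its words. -/
theorem halts_readBlocks {B : ℤ} {q t : ℕ} {header core : Program} {β α γ : Type} (h₁ h₂ : α → ℤ)
    (elems : α → List γ) (word : γ → ℤ) (f₀ : β → α × ℕ → β) (f : α × ℕ → β → γ → β)
    (hq : q ≠ 9 ∧ q ≠ 13 ∧ q ≠ t) (ht : t ≠ 9 ∧ t ≠ 13) (inp : ℤ → ℤ)
    (Rel : β → ℕ → List α → MachineState → Prop)
    (Rel' : α × ℕ → List α → β → List γ → MachineState → Prop)
    (hset : ∀ a as x l s v, Rel' a as x l s →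
      Rel' a as x l (s.setReg 9 v) ∧ Rel' a as x l (s.setReg 13 v))
    (hheader : ∀ (x : β) (i : ℕ) (a : α) (as : List α) (s : MachineState) (p : ℕ),
      Rel x i (a :: as) s → s.mem 0 = inp → s.reg 9 = p → inp p = h₁ a → inp (p + 1 : ℕ) = h₂ a →
      s.reg q = i → (p + 2 + (elems a).length : ℤ) ≤ B → (i + 1 : ℤ) ≤ B →
      header.wp B (fun s' => Rel' (a, i) as (f₀ x (a, i)) (elems a) s' ∧ s'.reg 9 = p + 2 ∧
        s'.reg 13 = (elems a).length ∧ Keeps [q, t] s s') s)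
    (hcore : ∀ (a : α × ℕ) (as : List α) (x : β) (e : γ) (l : List γ) (s : MachineState),
      Rel' a as x (e :: l) s → s.mem 0 = inp → inp (s.reg 9) = word e → s.reg q = a.2 →
      core.wp B (fun s' => Rel' a as (f a x e) l s' ∧ Keeps [9, 13, q, t] s s') s)
    (hend : ∀ (a : α × ℕ) (as : List α) (x : β) (s : MachineState), Rel' a as x [] s →
      Rel x (a.2 + 1) as (s.setReg q (a.2 + 1)))
    (l : List α) {x : β} {i : ℕ} {s : MachineState} {p : ℕ} (h : Rel x i l s)
    (hin : s.mem 0 = inp) (h9 : s.reg 9 = p) (hqi : s.reg q = i) (hti : s.reg t = (i + l.length : ℕ))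
    (hl : Seg inp p (l.flatMap (blockWords h₁ h₂ elems word)))
    (hB : (p + (l.flatMap (blockWords h₁ h₂ elems word)).length : ℤ) ≤ B)
    (hiB : (i + l.length : ℤ) ≤ B) :
    Halts B (readBlocks q t header core) s
      ((header.size + core.size + 3) * (l.flatMap (blockWords h₁ h₂ elems word)).length + 1)
      fun s' => Rel ((l.zipIdx i).foldl (fun x a => (elems a.1).foldl (f a) (f₀ x a)) x)
        (i + l.length) [] s' ∧
        s'.reg 9 = p + (l.flatMap (blockWords h₁ h₂ elems word)).length ∧
        s'.mem 0 = inp := by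
  have := Halts.loop_zipIdx (B := B) (e := .le (.add (.reg q) (.const 1)) (.reg t))
    (p := .seq header (.seq (readWords core) (.assign q (.add (.reg q) (.const 1)))))
    (fun x a => (elems a.1).foldl (f a) (f₀ x a))
    (fun a => header.size + ((core.size + 3) * (elems a).length + 1 + 1))
    (fun x' i' l' s' => Rel x' i' l' s' ∧ s'.mem 0 = inp ∧ s'.reg q = i' ∧
      s'.reg t = (i' + l'.length : ℕ) ∧ i' + l'.length = i + l.length ∧
      ∃ p' : ℕ, s'.reg 9 = p' ∧ Seg inp p' (l'.flatMap (blockWords h₁ h₂ elems word)) ∧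
        p' + (l'.flatMap (blockWords h₁ h₂ elems word)).length =
          p + (l.flatMap (blockWords h₁ h₂ elems word)).length)
    ?_ ?_ l x i s ⟨h, hin, hqi, hti, rfl, p, h9, hl, rfl⟩
  · refine this.mono (Nat.add_le_add_right ?_ 1) fun s' hs' => ?_
    -- The two leading words of a block pay for the header, the counter and the loop tests, even if
    -- the list of elements is empty.
    · rw [List.length_flatMap, ← List.sum_map_mul_left]
      refine List.sum_le_sum fun a _ => ?_
      simp only [blockWords, List.length_cons, List.length_map]
      nlinarith [Nat.zero_le (header.size * (elems a).length), Nat.zero_le core.size,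
        Nat.zero_le header.size]
    · obtain ⟨h1, h2, -, -, -, p', h3, -, h4⟩ := hs'
      refine ⟨h1, ?_, h2⟩
      rw [h3]
      simp only [List.flatMap_nil, List.length_nil] at h4
      omega
  · rintro x' i' a l' s' ⟨h1, h2, h3, h4, h5, p', h6, h7, h8⟩
    rw [List.flatMap_cons, seg_append] at h7
    rw [List.flatMap_cons, List.length_append] at h8
    rw [List.length_cons] at h4 h5
    obtain ⟨h7, h7'⟩ := h7
    have hlen : (blockWords h₁ h₂ elems word a).length = 2 + (elems a).length := by
      simp [blockWords]; omega
    rw [hlen] at h7' h8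
    unfold blockWords at h7
    rw [seg_cons, seg_cons] at h7
    refine ⟨?_, ?_⟩
    · simp [h3, h4]
    refine Program.wp.seq_halts (Program.wp_mono ?_ (hheader x' i' a l' s' p' h1 h2 h6 h7.1 h7.2.1 h3
      (by omega) (by omega)))
    rintro s₁ ⟨g1, g2, g3, g4⟩
    have k2 : s₁.mem 0 = inp := g4.input.trans h2
    have := halts_readWords (B := B) (core := core) word (f (a, i')) [q, t]
      (by simp; omega) (by simp; omega) inp
      (fun x l s => Rel' (a, i') l' x l s ∧ s.reg q = i') (fun x l s v hr =>
        ⟨⟨(hset _ _ _ _ _ v hr.1).1, by rw [setReg_reg, if_neg hq.1]; exact hr.2⟩,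
          (hset _ _ _ _ _ v hr.1).2, by rw [setReg_reg, if_neg hq.2.1]; exact hr.2⟩)
      (fun x e l s hr hm hw => Program.wp_mono (fun s' hs' => ⟨⟨hs'.1, by
        rw [hs'.2.reg q (by simp)]; exact hr.2⟩, hs'.2⟩) (hcore (a, i') l' x e l s hr.1 hm hw hr.2))
      (elems a) (s := s₁) (p := p' + 2) ⟨g1, (g4.reg q (by simp)).trans h3⟩ k2
      (by rw [g2]; push_cast; rfl) g3 h7.2.2 (by push_cast; omega)
    refine Halts.seq (this.mono le_rfl ?_)
    rintro s₂ ⟨⟨f1, f2⟩, f3, f4⟩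
    have := Program.wp.halts (B := B) (p := .assign q (.add (.reg q) (.const 1))) (s := s₂)
      (Q := fun s' => Rel ((elems a).foldl (f (a, i')) (f₀ x' (a, i'))) (i' + 1) l' s' ∧
        s'.mem 0 = inp ∧ s'.reg q = (i' + 1 : ℕ) ∧
        s'.reg t = (i' + 1 + l'.length : ℕ) ∧ i' + 1 + l'.length = i + l.length ∧
        ∃ p' : ℕ, s'.reg 9 = p' ∧ Seg inp p' (l'.flatMap (blockWords h₁ h₂ elems word)) ∧
          p' + (l'.flatMap (blockWords h₁ h₂ elems word)).length =
            p + (l.flatMap (blockWords h₁ h₂ elems word)).length) (by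
        simp only [wp_assign, Expr.eval, f2]
        refine ⟨⟨by omega, by omega⟩, hend (a, i') l' _ s₂ f1, ?_, ?_, ?_, by omega,
          p' + (2 + (elems a).length), ?_, h7', by omega⟩
        · rw [setReg_mem, f4.input, k2]
        · simp
        · rw [setReg_reg, if_neg hq.2.2.symm, f4.reg t (by simp), g4.reg t (by simp), h4]
          push_cast; ring
        · rw [setReg_reg, if_neg hq.1.symm, f3]; push_cast; ring)
    exact this
  · rintro x' i' s' ⟨-, -, h3, h4, -⟩
    simp [h3, h4]

/-! ### The formula as a sequence of words -/

abbrev inputBlocks (cs : List (List Literal × ℕ∞)) : List ℤ :=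
  cs.flatMap (blockWords (fun c => (c.1.length : ℤ)) (fun c => weightWord c.2) Prod.fst literalWord)

theorem weightWord_eq (a : ℕ∞) : weightWord a = if a = ⊤ then -1 else (a.toNat : ℤ) := by
  cases a <;> rfl

theorem finiteSum_append (cs ds : List (List Literal × ℕ∞)) :
    finiteSum (cs ++ ds) = finiteSum cs + finiteSum ds := by simp [finiteSum]

theorem finiteSum_singleton (c : List Literal × ℕ∞) :
    finiteSum [c] = if c.2 = ⊤ then 0 else c.2.toNat := by simp [finiteSum]

theorem gadgetWeight_concat (W : ℕ) (cs : List (List Literal × ℕ∞)) (c : List Literal × ℕ∞) :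
    gadgetWeight W (cs ++ [c]) = Function.update (gadgetWeight W cs) cs.length
      (if c.1 = [] then 0 else finiteWeight W c.2) := by
  funext j
  unfold gadgetWeight
  rcases lt_trichotomy j cs.length with h | rfl | h
  · rw [Function.update_of_ne h.ne, List.getElem?_append_left h]
  · simp
  · rw [Function.update_of_ne h.ne', List.getElem?_eq_none (by simp; omega),
      List.getElem?_eq_none (by omega)]

theorem finiteWeight_le {cs : List (List Literal × ℕ∞)} {c : List Literal × ℕ∞} (hc : c ∈ cs) :
    finiteWeight (finiteSum cs + 1) c.2 ≤ finiteSum cs + 1 := by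
  obtain ⟨l, l', rfl⟩ := List.append_of_mem hc
  unfold finiteWeight
  split_ifs with h
  · exact le_rfl
  · rw [finiteSum_append, ← List.singleton_append, finiteSum_append, finiteSum_singleton, if_neg h]
    omega

theorem gadgetWeight_le (cs : List (List Literal × ℕ∞)) (j : ℕ) :
    gadgetWeight (finiteSum cs + 1) cs j ≤ finiteSum cs + 1 := by
  unfold gadgetWeight
  by_cases hj : j < cs.length
  · rw [List.getElem?_eq_getElem hj]
    simp only
    split_ifs
    · omega
    · exact finiteWeight_le (List.getElem_mem hj)
  · simp [List.getElem?_eq_none (not_lt.1 hj)]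

theorem gadgetOffset_bounds (cs pre suf : List (List Literal × ℕ∞)) (h : pre ++ suf = cs) :
    -(3 * (finiteSum cs + 1 : ℕ) * pre.length : ℤ) ≤ gadgetOffset (finiteSum cs + 1) pre ∧
      gadgetOffset (finiteSum cs + 1) pre ≤ 0 := by
  have key : ∀ l : List (List Literal × ℕ∞), (∀ c ∈ l, c ∈ cs) →
      -(3 * (finiteSum cs + 1 : ℕ) * l.length : ℤ) ≤ gadgetOffset (finiteSum cs + 1) l ∧
      gadgetOffset (finiteSum cs + 1) l ≤ 0 := by
    intro l hl
    induction l with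
    | nil => simp [gadgetOffset]
    | cons c l ih =>
      have h1 := ih fun c hc => hl c (by simp [hc])
      have h2 : gadgetOffset (finiteSum cs + 1) (c :: l) = clauseOffset (finiteSum cs + 1) c +
        gadgetOffset (finiteSum cs + 1) l := by simp [gadgetOffset]
      have h3 : (finiteWeight (finiteSum cs + 1) c.2 : ℤ) ≤ (finiteSum cs + 1 : ℕ) := by
        exact_mod_cast finiteWeight_le (hl c (by simp))
      have h4 : (0 : ℤ) ≤ finiteWeight (finiteSum cs + 1) c.2 := by positivity
      rw [h2, List.length_cons]
      unfold clauseOffset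
      push_cast at *
      split_ifs <;> constructor <;> linarith [h1.1, h1.2]
  exact key pre fun c hc => h ▸ List.mem_append_left _ hc

/-! ### The phases of the program -/

def scanHeader : Program :=
  .block [.assign 13 (.load 0 (.reg 9)), .assign 19 (.load 0 (.add (.reg 9) (.const 1))),
    .branch (.le (.const 0) (.reg 19)) (.assign 12 (.add (.reg 12) (.reg 19))) .skip,
    .assign 9 (.add (.reg 9) (.const 2))]

/-- The word of a literal of `x` has the absolute value `x + 1`. The maximum of these is therefore a
strict upper bound for the variables, and the first fresh variable. -/
def scanLiteral : Program :=
  .block [.assign 19 (.load 0 (.reg 9)),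
    .branch (.le (.const 0) (.reg 19)) .skip (.assign 19 (.sub (.const 0) (.reg 19))),
    .branch (.le (.add (.reg 4) (.const 1)) (.reg 19)) (.assign 4 (.reg 19)) .skip]

abbrev scanRegs : List ℕ := [4, 9, 10, 12, 13, 19]

theorem abs_literalWord (l : Literal) :
    (if 0 ≤ literalWord l then literalWord l else 0 - literalWord l) = l.1 + 1 := by
  unfold literalWord
  split_ifs <;> omega

theorem halts_scan {B M : ℤ} {cs : List (List Literal × ℕ∞)} {inp : ℤ → ℤ} {s : MachineState} {p : ℕ}
    (hinp : ∀ i, InRange M (inp i)) (hM : M + 1 ≤ B) (hM0 : 0 ≤ M) (hS : (finiteSum cs : ℤ) ≤ B)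
    (hin : s.mem 0 = inp) (h9 : s.reg 9 = p) (h10 : s.reg 10 = 0) (h11 : s.reg 11 = cs.length)
    (h4 : s.reg 4 = 0) (h12 : s.reg 12 = 0) (hcs : Seg inp p (inputBlocks cs))
    (hB : (p + (inputBlocks cs).length : ℤ) ≤ B) (hm : (cs.length : ℤ) ≤ B) :
    Halts B (readBlocks 10 11 scanHeader scanLiteral) s
      ((scanHeader.size + scanLiteral.size + 3) * (inputBlocks cs).length + 1) fun s' =>
      (∃ N : ℕ, s'.reg 4 = N ∧ (N : ℤ) ≤ M ∧ ∀ c ∈ cs, ∀ l ∈ c.1, l.1 < N) ∧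
        s'.reg 12 = finiteSum cs ∧ s'.reg 9 = p + (inputBlocks cs).length ∧
        Frame scanRegs [] s s' := by
  have := halts_readBlocks (B := B) (q := 10) (t := 11) (header := scanHeader) (core := scanLiteral)
    (fun c : List Literal × ℕ∞ => (c.1.length : ℤ)) (fun c => weightWord c.2) Prod.fst literalWord
    (fun pre a => pre ++ [a.1]) (fun _ x _ => x) (by decide) (by decide) inp
    (fun pre _ suf s' => pre ++ suf = cs ∧ (∃ N : ℕ, s'.reg 4 = N ∧ (N : ℤ) ≤ M ∧
      ∀ c ∈ pre, ∀ l ∈ c.1, l.1 < N) ∧ s'.reg 12 = finiteSum pre ∧ Frame scanRegs [] s s')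
    (fun _ suf pre es s' => pre ++ suf = cs ∧ (∃ N : ℕ, s'.reg 4 = N ∧ (N : ℤ) ≤ M ∧
      ∀ c ∈ pre, ∀ l ∈ c.1, l.1 < N ∨ l ∈ es) ∧ s'.reg 12 = finiteSum pre ∧ Frame scanRegs [] s s')
    ?_ ?_ ?_ ?_ cs (x := []) (i := 0) (p := p) (s := s)
    ⟨rfl, ⟨0, by simpa using h4, by simpa using hM0, by simp⟩, by simpa [finiteSum] using h12, .refl _ _ _⟩ hin h9
    (by simpa using h10) (by simpa using h11) hcs hB (by simpa using hm)
  · refine this.mono le_rfl fun s' ⟨⟨h0, h1, h2, h3⟩, h4, _⟩ => ?_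
    rw [List.append_nil] at h0
    rw [h0] at h1 h2
    exact ⟨h1, h2, h4, h3⟩
  · rintro a suf pre es s' v ⟨h1, ⟨N, h2, h2', h2''⟩, h3, h4⟩
    exact ⟨⟨h1, ⟨N, by simpa using h2, h2', h2''⟩, by simpa using h3, h4.setReg (by decide) _⟩,
      ⟨h1, ⟨N, by simpa using h2, h2', h2''⟩, by simpa using h3, h4.setReg (by decide) _⟩⟩
  · rintro pre i c suf s' p' ⟨h1, ⟨N, h2, h2', h2''⟩, h3, h4⟩ hm0 k9 w1 w2 k10 hb1 hb2
    have hw := hinp (p' + 1 : ℕ)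
    rw [w2] at hw
    have hw2 : inp ((p' : ℤ) + 1) = weightWord c.2 := by rw [← w2]; push_cast; rfl
    have hsum : finiteSum (pre ++ [c]) ≤ finiteSum cs := by
      rw [← h1, show pre ++ c :: suf = (pre ++ [c]) ++ suf by simp, finiteSum_append _ suf]; omega
    have hsum' := finiteSum_append pre [c]
    rw [finiteSum_singleton] at hsum'
    simp only [scanHeader, wp_block_cons, wp_block_nil, wp_assign, wp_branch, wp_skip, Expr.eval,
      setReg_reg, setReg_mem, hm0, k9, w1, hw2, h3, Nat.reduceEqDiff, if_false, if_true,
      ite_one_zero_ne_zero, ne_eq, not_not]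
    rw [weightWord_eq] at hw ⊢
    refine ⟨⟨by omega, by omega⟩, ⟨by have := hw.1; omega, by have := hw.2; omega⟩, fun h0 => ?_, fun h0 => ?_⟩
    · have htop : c.2 ≠ ⊤ := fun h => by simp [h] at h0
      rw [if_neg htop] at hsum' ⊢
      refine ⟨⟨by omega, by omega⟩, ⟨by omega, by omega⟩, ⟨by simpa using h1, ⟨N, by simpa using h2, h2', ?_⟩, ?_, ?_⟩, ?_, ?_, ?_⟩
      · intro d hd l hl
        rcases List.mem_append.1 hd with hd | hd
        · exact Or.inl (h2'' d hd l hl)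
        · rw [List.mem_singleton.1 hd] at hl; exact Or.inr hl
      · omega
      · exact (((h4.setReg (by decide) _).setReg (by decide) _).setReg (by decide) _).setReg (by decide) _
      · simp
      · simp
      · exact ⟨by simp, by simp⟩
    · have htop : c.2 = ⊤ := by by_contra h; simp [h] at h0
      rw [if_pos htop] at hsum' ⊢
      refine ⟨⟨by omega, by omega⟩, ⟨by simpa using h1, ⟨N, by simpa using h2, h2', ?_⟩, ?_, ?_⟩, ?_, ?_, ?_⟩
      · intro d hd l hl
        rcases List.mem_append.1 hd with hd | hd
        · exact Or.inl (h2'' d hd l hl)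
        · rw [List.mem_singleton.1 hd] at hl; exact Or.inr hl
      · omega
      · exact ((h4.setReg (by decide) _).setReg (by decide) _).setReg (by decide) _
      · simp
      · simp
      · exact ⟨by simp, by simp⟩
  · rintro a suf pre l es s' ⟨h1, ⟨N, h2, h2', h2''⟩, h3, h4⟩ hm0 w k10
    have hw := hinp (s'.reg 9)
    rw [w] at hw
    have habs := abs_literalWord l
    have hl0 : (0 : ℤ) ≤ l.1 := by positivity
    have hmax : ∀ N' : ℕ, N ≤ N' → l.1 < N' → ∀ c ∈ pre, ∀ l' ∈ c.1, l'.1 < N' ∨ l' ∈ es := by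
      intro N' hN hl c hc l' hl'
      rcases h2'' c hc l' hl' with h | h
      · exact Or.inl (by omega)
      · rcases List.mem_cons.1 h with rfl | h
        · exact Or.inl hl
        · exact Or.inr h
    have hr : literalWord l ≤ B ∧ - B ≤ literalWord l := ⟨by have := hw.2; omega, by have := hw.1; omega⟩
    obtain ⟨hw1, hw2⟩ := hw
    simp only [scanLiteral, wp_block_cons, wp_block_nil, wp_assign, wp_branch, wp_skip, Expr.eval,
      setReg_reg, setReg_mem, hm0, w, h2, Nat.reduceEqDiff, if_false, if_true,
      ite_one_zero_ne_zero, ne_eq, not_not]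
    refine ⟨⟨by omega, by omega⟩, fun h0 => ⟨fun h5 => ⟨⟨by omega, by omega⟩, ?_⟩, fun h5 => ?_⟩,
      fun h0 => ⟨⟨by omega, by omega⟩, fun h5 => ⟨⟨by omega, by omega⟩, ?_⟩, fun h5 => ?_⟩⟩
    · rw [if_pos h0] at habs
      exact ⟨⟨h1, ⟨l.1 + 1, by simp [habs], by push_cast; omega, hmax _ (by omega) (by omega)⟩, by simpa using h3,
        (h4.setReg (by decide) _).setReg (by decide) _⟩, by simp, by simp⟩
    · rw [if_pos h0] at habs
      exact ⟨⟨h1, ⟨N, by simp [h2], h2', hmax _ (by omega) (by omega)⟩, by simpa using h3,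
        h4.setReg (by decide) _⟩, by simp, by simp⟩
    · rw [if_neg h0] at habs
      exact ⟨⟨h1, ⟨l.1 + 1, by simpa using habs, by push_cast; omega, hmax _ (by omega) (by omega)⟩, by simpa using h3,
        ((h4.setReg (by decide) _).setReg (by decide) _).setReg (by decide) _⟩, by simp, by simp⟩
    · rw [if_neg h0] at habs
      exact ⟨⟨h1, ⟨N, by simp [h2], h2', hmax _ (by omega) (by omega)⟩, by simpa using h3,
        (h4.setReg (by decide) _).setReg (by decide) _⟩, by simp, by simp⟩
  · rintro a suf pre s' ⟨h1, ⟨N, h2, h2', h2''⟩, h3, h4⟩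
    exact ⟨h1, ⟨N, by simpa using h2, h2', fun c hc l hl => by simpa using h2'' c hc l hl⟩,
      by simpa using h3, h4.setReg (by decide) _⟩

/-- The weight `∞` is recognized by its negative word. Triple weights are formed by addition, as the
machine does not multiply. Everything happens at the header of a clause; its literals are merely
passed over. -/
def weightHeader : Program :=
  .block [.assign 13 (.load 0 (.reg 9)), .assign 15 (.load 0 (.add (.reg 9) (.const 1))),
    .branch (.le (.const 0) (.reg 15)) .skip (.assign 15 (.reg 12)),
    .branch (.eq (.reg 13) (.const 0))
      (.block [.assign 3 (.sub (.reg 3) (.reg 15)), .store 2 (.reg 10) (.const 0)])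
      (.block [.assign 3 (.sub (.reg 3) (.add (.reg 15) (.add (.reg 15) (.reg 15)))),
        .store 2 (.reg 10) (.reg 15)]),
    .assign 9 (.add (.reg 9) (.const 2))]

abbrev weightRegs : List ℕ := [3, 9, 10, 13, 15]

theorem halts_weights {B M : ℤ} {cs : List (List Literal × ℕ∞)} {inp : ℤ → ℤ} {s : MachineState}
    {p : ℕ} (hinp : ∀ i, InRange M (inp i)) (hM : M + 1 ≤ B)
    (hS : (3 * (finiteSum cs + 1 : ℕ) * cs.length : ℤ) + (finiteSum cs + 1 : ℕ) ≤ B)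
    (hin : s.mem 0 = inp) (h9 : s.reg 9 = p) (h10 : s.reg 10 = 0) (h11 : s.reg 11 = cs.length)
    (h3 : s.reg 3 = 0) (h12 : s.reg 12 = (finiteSum cs + 1 : ℕ)) (h2 : s.mem 2 = fun _ => 0)
    (hcs : Seg inp p (inputBlocks cs)) (hB : (p + (inputBlocks cs).length : ℤ) ≤ B)
    (hm : (cs.length : ℤ) ≤ B) :
    Halts B (readBlocks 10 11 weightHeader .skip) s
      ((weightHeader.size + Program.skip.size + 3) * (inputBlocks cs).length + 1) fun s' =>
      s'.reg 3 = gadgetOffset (finiteSum cs + 1) cs ∧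
        Agree (s'.mem 2) (gadgetWeight (finiteSum cs + 1) cs) ∧
        s'.reg 9 = p + (inputBlocks cs).length ∧ Frame weightRegs [2] s s' := by
  set W := finiteSum cs + 1 with hW
  have := halts_readBlocks (B := B) (q := 10) (t := 11) (header := weightHeader) (core := .skip)
    (fun c : List Literal × ℕ∞ => (c.1.length : ℤ)) (fun c => weightWord c.2) Prod.fst literalWord
    (fun pre a => pre ++ [a.1]) (fun _ x _ => x) (by decide) (by decide) inp
    (fun pre i suf s' => pre ++ suf = cs ∧ pre.length = i ∧ s'.reg 3 = gadgetOffset W pre ∧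
      Agree (s'.mem 2) (gadgetWeight W pre) ∧ Frame weightRegs [2] s s')
    (fun a suf pre es s' => pre ++ suf = cs ∧ pre.length = a.2 + 1 ∧ s'.reg 3 = gadgetOffset W pre ∧
      Agree (s'.mem 2) (gadgetWeight W pre) ∧ Frame weightRegs [2] s s')
    ?_ ?_ ?_ ?_ cs (x := []) (i := 0) (p := p) (s := s)
    ⟨rfl, rfl, by simpa [gadgetOffset] using h3, by rw [h2]; intro j; simp [gadgetWeight],
      .refl _ _ _⟩ hin h9
    (by simpa using h10) (by simpa using h11) hcs hB (by simpa using hm)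
  · refine this.mono le_rfl fun s' ⟨⟨h0, _, h1, h2, h3⟩, h4, _⟩ => ?_
    rw [List.append_nil] at h0
    rw [h0] at h1 h2
    exact ⟨h1, h2, h4, h3⟩
  · rintro a suf pre es s' v ⟨h1, h2, h3, h4, h5⟩
    exact ⟨⟨h1, h2, by simpa using h3, h4, h5.setReg (by decide) _⟩,
      ⟨h1, h2, by simpa using h3, h4, h5.setReg (by decide) _⟩⟩
  · rintro pre i c suf s' p' ⟨h1, h2, h3, h4, h5⟩ hm0 k9 w1 w2 k10 hb1 hb2
    have hw := hinp (p' + 1 : ℕ)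
    rw [w2] at hw
    have hw2 : inp ((p' : ℤ) + 1) = weightWord c.2 := by rw [← w2]; push_cast; rfl
    have k12 : s'.reg 12 = W := (h5.reg 12 (by decide)).trans h12
    have hfw : finiteWeight W c.2 ≤ W := finiteWeight_le (by rw [← h1]; simp)
    have hfw' : (finiteWeight W c.2 : ℤ) = if 0 ≤ weightWord c.2 then weightWord c.2 else W := by
      rw [weightWord_eq]
      unfold finiteWeight
      by_cases h : c.2 = ⊤ <;> simp [h]
    have hg := gadgetWeight_concat W pre c
    have hoff : gadgetOffset W (pre ++ [c]) = gadgetOffset W pre + clauseOffset W c := by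
      simp [gadgetOffset]
    have hb := gadgetOffset_bounds cs (pre ++ [c]) suf (by simpa using h1)
    have hlen : ((pre ++ [c]).length : ℤ) ≤ cs.length := by
      have := congrArg List.length h1
      simp only [List.length_append, List.length_cons, List.length_nil] at this ⊢
      omega
    have hmul : (3 * W * (pre ++ [c]).length : ℤ) ≤ 3 * W * cs.length :=
      mul_le_mul_of_nonneg_left hlen (by positivity)
    rw [← hW, hoff] at hb
    rw [hoff, hg, h2]
    obtain ⟨hw1, hw3⟩ := hw
    have hlen0 : ((c.1.length : ℤ) = 0) ↔ c.1 = [] := by simp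
    -- The rest of the header depends on the weight only through its finite replacement in register
    -- `15`, so both cases of the test for `∞` are completed by the same argument.
    have finish : ∀ (s'' : MachineState), s''.reg 9 = p' → s''.reg 13 = c.1.length →
        s''.reg 10 = i → s''.reg 11 = s'.reg 11 → s''.mem 0 = s'.mem 0 → s''.reg 15 = finiteWeight W c.2 →
        s''.reg 3 = gadgetOffset W pre → s''.mem 2 = s'.mem 2 → Frame weightRegs [2] s s'' →
        (Program.block [.branch (.eq (.reg 13) (.const 0))
      (.block [.assign 3 (.sub (.reg 3) (.reg 15)), .store 2 (.reg 10) (.const 0)])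
      (.block [.assign 3 (.sub (.reg 3) (.add (.reg 15) (.add (.reg 15) (.reg 15)))),
        .store 2 (.reg 10) (.reg 15)]),
    .assign 9 (.add (.reg 9) (.const 2))]).wp B (fun s' => ((pre ++ [c] ++ suf = cs ∧ (pre ++ [c]).length = i + 1 ∧ s'.reg 3 = gadgetOffset W pre + clauseOffset W c ∧
      Agree (s'.mem 2) (Function.update (gadgetWeight W pre) i (if c.1 = [] then 0 else finiteWeight W c.2)) ∧ Frame weightRegs [2] s s') ∧ s'.reg 9 = p' + 2 ∧
        s'.reg 13 = c.1.length ∧ (∀ r ∈ [10, 11], s'.reg r = s''.reg r) ∧ s'.mem 0 = s''.mem 0)) s'' := by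
      intro s'' q9 q13 q10 q11 q0 q15 q3 q2 qf
      have q4 : Agree (s''.mem 2) (gadgetWeight W pre) := by rw [q2]; exact h4
      simp only [wp_block_cons, wp_block_nil, wp_assign, wp_store, wp_branch, wp_skip, Expr.eval,
        setReg_reg, setReg_mem, setMem_reg, q9, q10, q13, q15, q3, Nat.reduceEqDiff, if_false, if_true,
        ite_one_zero_ne_zero, ne_eq, not_not, hlen0]
      unfold clauseOffset at hb ⊢
      refine ⟨fun h0 => ?_, fun h0 => ?_⟩
      · rw [if_pos h0] at hb ⊢
        refine ⟨⟨by omega, by omega⟩, ⟨by omega, by omega⟩, ⟨by omega, by omega⟩, ⟨by omega, by omega⟩,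
          ⟨by simpa using h1, by simpa using h2, ?_, ?_, ?_⟩, ?_, ?_, ?_, ?_⟩
        · ring
        · simp only [setReg_mem, setMem_mem, if_true, if_pos h0]
          exact q4.update rfl rfl
        · exact ((qf.setReg (by decide) _).setMem (by decide) _ _).setReg (by decide) _
        · simp
        · simp [q13]
        · simp
        · simp
      · rw [if_neg h0] at hb ⊢
        refine ⟨⟨by omega, by omega⟩, ⟨by omega, by omega⟩, ⟨by omega, by omega⟩, ⟨by omega, by omega⟩,
          ⟨by simpa using h1, by simpa using h2, ?_, ?_, ?_⟩, ?_, ?_, ?_, ?_⟩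
        · ring
        · simp only [setReg_mem, setMem_mem, if_true, if_neg h0]
          exact q4.update rfl rfl
        · exact ((qf.setReg (by decide) _).setMem (by decide) _ _).setReg (by decide) _
        · simp
        · simp [q13]
        · simp
        · simp
    unfold weightHeader
    rw [wp_block_cons, wp_assign, wp_block_cons, wp_assign, wp_block_cons, wp_branch]
    simp only [Expr.eval, setReg_reg, setReg_mem, hm0, k9, w1, hw2, k12, wp_assign, wp_skip,
      Nat.reduceEqDiff, if_false, if_true, ite_one_zero_ne_zero, ne_eq, not_not]
    refine ⟨⟨by omega, by omega⟩, ⟨by omega, by omega⟩, fun h0 => ?_, fun h0 => ⟨⟨by omega, by omega⟩, ?_⟩⟩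
    · rw [if_pos h0] at hfw'
      refine Program.wp_mono ?_ (finish _ ?_ ?_ ?_ ?_ ?_ ?_ ?_ ?_ ?_)
      · rintro t ⟨t1, t2, t3, t4, t5⟩
        exact ⟨t1, t2, t3, fun r hr => (t4 r hr).trans (by revert r; simp), t5⟩
      all_goals first | exact (h5.setReg (by decide) _).setReg (by decide) _ | simp [k9, k10, h3, hfw']
    · rw [if_neg h0] at hfw'
      refine Program.wp_mono ?_ (finish _ ?_ ?_ ?_ ?_ ?_ ?_ ?_ ?_ ?_)
      · rintro t ⟨t1, t2, t3, t4, t5⟩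
        exact ⟨t1, t2, t3, fun r hr => (t4 r hr).trans (by revert r; simp), t5⟩
      all_goals first | exact ((h5.setReg (by decide) _).setReg (by decide) _).setReg (by decide) _ | simp [k9, k10, h3, hfw']
  · rintro a suf pre l es s' ⟨h1, h2, h3, h4, h5⟩ hm0 w k10
    exact ⟨⟨h1, h2, h3, h4, h5⟩, fun _ _ => rfl, rfl⟩
  · rintro a suf pre s' ⟨h1, h2, h3, h4, h5⟩
    exact ⟨h1, h2, by simpa using h3, h4, h5.setReg (by decide) _⟩

abbrev nodeBlocks (ns : List (ℕ × List ℤ)) : List ℤ :=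
  ns.flatMap (blockWords (fun n => (n.1 : ℤ)) (fun n => (n.2.length : ℤ)) Prod.snd id)

theorem foldl_zipIdx_map {α β γ : Type} (f : β → α × ℕ → β) (h : γ → α) (l : List γ) (x : β) (i : ℕ) :
    ((l.map h).zipIdx i).foldl f x = (l.zipIdx i).foldl (fun x a => f x (h a.1, a.2)) x := by
  induction l generalizing x i with
  | nil => rfl
  | cons a l ih => simp only [List.map_cons, List.zipIdx_cons, List.foldl_cons, ih]

namespace Emitter

variable {Q : OptProblem} {T : Target Q} {B : ℤ} {Z C G U m W k : ℕ} {θ : ℤ} {g : ℕ → ℕ}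
  {inp : ℤ → ℤ} {σ : BuildState} {s : MachineState}

theorem halts_roots (E : Emitter T) (h : BuildRep T inp Z θ g m W σ s)
    (hr : Room B Z C G U θ (m + k) σ) (hg : ∀ j, g j ≤ G) (h10 : s.reg 10 = 0) (hmU : m ≤ U) :
    Halts B (.loop (.le (.add (.reg 10) (.const 1)) (.reg 11)) E.rootBody) s
      ((E.rootBody.size + 1) * m + 1) fun s' => BuildRep T inp Z θ g m W (σ.roots g m) s' ∧
        Room B Z C G U θ k (σ.roots g m) ∧ Frame rootRegs [1, 5] s s' := by
  have := Halts.loop (B := B) (e := .le (.add (.reg 10) (.const 1)) (.reg 11)) (p := E.rootBody)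
    (BuildState.rootStep g) (fun _ => E.rootBody.size)
    (fun σ l s' => BuildRep T inp Z θ g m W σ s' ∧ Room B Z C G U θ (l.length + k) σ ∧
      Frame rootRegs [1, 5] s s' ∧ ∃ j, j + l.length = m ∧ l = List.range' j l.length ∧
        s'.reg 10 = j) ?_ ?_ (List.range' 0 m) σ s
      ⟨h, by simpa using hr, .refl _ _ _, 0, by simp, by simp, by simpa using h10⟩
  · refine this.mono (by simp; ring_nf; rfl) ?_
    rintro s' ⟨h1, h2, h3, -⟩
    rw [← List.range_eq_range'] at h1 h2
    exact ⟨h1, by simpa [BuildState.roots] using h2, h3⟩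
  · rintro σ a l s' ⟨h1, h2, h3, j, h4, h5, h6⟩
    rw [List.length_cons] at h4 h5
    rw [List.length_cons, Nat.add_right_comm] at h2
    rw [List.range'_succ, List.cons.injEq] at h5
    obtain ⟨rfl, h5⟩ := h5
    refine ⟨by simp [h6, h1.clauses]; omega, Program.wp.halts (E.wp_rootBody h1 h2 hg h6 (by omega) ?_)⟩
    intro s'' f1 f2 f3
    exact ⟨f1, h2.rootStep hg _, h3.trans f3, a + 1, by omega, h5, by rw [f2]; push_cast; rfl⟩
  · rintro σ s' ⟨h1, h2, h3, j, h4, h5, h6⟩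
    simp [h6, h1.clauses]
    simp at h4
    omega

/-- The base of the node grows by `m` from node to node, which avoids a multiplication, and array
`6` keeps the bases for later use as those of parents. The base is stored before the parent's is
loaded: the root is its own parent. -/
def nodeHeader : Program :=
  .block [.assign 16 (.add (.reg 16) (.reg 11)), .store 6 (.reg 21) (.reg 16),
    .assign 22 (.load 6 (.load 0 (.reg 9))), .assign 13 (.load 0 (.add (.reg 9) (.const 1))),
    .assign 9 (.add (.reg 9) (.const 2))]

def nodeCore (E : Emitter T) : Program := .seq (.assign 24 (.load 0 (.reg 9))) E.bagCore

theorem halts_nodes (E : Emitter T) {M : ℤ} {ns : List (ℕ × List ℤ)} {p : ℕ}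
    (h : BuildRep T inp Z θ g m W σ s)
    (hr : Room B Z C G U θ ((ns.map fun n => n.2.length).sum + k) σ) (hg : ∀ j, g j ≤ G)
    (hgm : ∀ j, g j ≠ 0 → j < U) (hinp : ∀ i, InRange M (inp i)) (hM : M + 1 ≤ B)
    (hU : m * ns.length ≤ U) (hpar : ∀ i (hi : i < ns.length), ns[i].1 ≤ i)
    (h9 : s.reg 9 = p) (h16 : s.reg 16 = 0) (h20 : s.reg 20 = ns.length) (h21 : s.reg 21 = 0)
    (hns : Seg inp p (nodeBlocks ns)) (hB : (p + (nodeBlocks ns).length : ℤ) ≤ B)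
    (hlen : (ns.length : ℤ) ≤ B) :
    Halts B (readBlocks 21 20 nodeHeader E.nodeCore) s
      ((nodeHeader.size + E.nodeCore.size + 3) * (nodeBlocks ns).length + 1) fun s' =>
      BuildRep T inp Z θ g m W (σ.nodes g m ns) s' ∧ Room B Z C G U θ k (σ.nodes g m ns) := by
  have hU' : ∀ i < ns.length, m * (i + 1) ≤ U := fun i hi =>
    (Nat.mul_le_mul_left _ (by omega)).trans hU
  have := halts_readBlocks (B := B) (q := 21) (t := 20) (header := nodeHeader) (core := E.nodeCore)
    (fun n : ℕ × List ℤ => (n.1 : ℤ)) (fun n => (n.2.length : ℤ)) Prod.snd id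
    (fun σ _ => σ) (fun a σ v => σ.bagStep g (m * (a.2 + 1)) (m * (a.1.1 + 1)) v)
    (by decide) (by decide) inp
    (fun σ i l s' => BuildRep T inp Z θ g m W σ s' ∧
      Room B Z C G U θ ((l.map fun n => n.2.length).sum + k) σ ∧ l = ns.drop i ∧ i ≤ ns.length ∧
      s'.reg 16 = (m * i : ℕ) ∧ ∀ t < i, s'.mem 6 t = (m * (t + 1) : ℕ))
    (fun a l σ vs s' => BuildRep T inp Z θ g m W σ s' ∧
      Room B Z C G U θ (vs.length + ((l.map fun n => n.2.length).sum + k)) σ ∧ l = ns.drop (a.2 + 1) ∧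
      a.2 < ns.length ∧ a.1.1 < ns.length ∧
      s'.reg 16 = (m * (a.2 + 1) : ℕ) ∧ s'.reg 22 = (m * (a.1.1 + 1) : ℕ) ∧
      ∀ t < a.2 + 1, s'.mem 6 t = (m * (t + 1) : ℕ))
    ?_ ?_ ?_ ?_ ns (x := σ) (i := 0) (p := p) (s := s)
    ⟨h, hr, rfl, Nat.zero_le _, by simpa using h16, by simp⟩ h.input h9
    (by simpa using h21) (by simpa using h20) hns hB (by simpa using hlen)
  · refine this.mono le_rfl ?_
    rintro s' ⟨⟨h1, h2, -⟩, -⟩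
    have e : σ.nodes g m ns = (ns.zipIdx 0).foldl
      (fun x a => a.1.2.foldl (fun σ v => σ.bagStep g (m * (a.2 + 1)) (m * (a.1.1 + 1)) v) x) σ := rfl
    rw [e]
    exact ⟨h1, by simpa using h2⟩
  · rintro a l σ vs s' v ⟨h1, h2, h3, h4, h5, h6, h7, h8⟩
    exact ⟨⟨h1.setReg (by decide) _, h2, h3, h4, h5, by simpa using h6, by simpa using h7, h8⟩,
      ⟨h1.setReg (by decide) _, h2, h3, h4, h5, by simpa using h6, by simpa using h7, h8⟩⟩
  · rintro σ i a l s' p' ⟨h1, h2, h3, h4, h5, h6⟩ hm0 k9 w1 w2 k21 hb1 hb2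
    have hi : i < ns.length := by
      by_contra hc
      rw [List.drop_eq_nil_of_le (by omega)] at h3
      simp at h3
    rw [List.drop_eq_getElem_cons hi, List.cons.injEq] at h3
    obtain ⟨rfl, rfl⟩ := h3
    have hp := hpar i hi
    have hbase := hU' i hi
    have hbase' := hU' ns[i].1 (by omega)
    have hs := hr.simple
    have hmi : (m * i : ℕ) + (m : ℤ) = (m * (i + 1) : ℕ) := by push_cast; ring
    have hw2 : inp ((p' : ℤ) + 1) = ns[i].2.length := by rw [← w2]; push_cast; rfl
    -- The parent is either an earlier node, whose base is already in the array, or the node itself.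
    have h22 : Function.update (s'.mem 6) (i : ℤ) ((m * (i + 1) : ℕ) : ℤ) (ns[i].1 : ℤ) =
        (m * (ns[i].1 + 1) : ℕ) := by
      rcases hp.lt_or_eq with hlt | heq
      · rw [Function.update_of_ne (by exact_mod_cast hlt.ne)]; exact h6 _ hlt
      · rw [heq]; simp
    simp only [nodeHeader, wp_block_cons, wp_block_nil, wp_assign, wp_store, Expr.eval,
      setReg_reg, setReg_mem, setMem_reg, setMem_mem, hm0, k9, w1, hw2, h5, k21, h1.clauses, hmi,
      h22, Nat.reduceEqDiff, if_false, if_true, OfNat.zero_ne_ofNat]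
    refine ⟨⟨by omega, by omega⟩, ⟨by omega, by omega⟩, ⟨by omega, by omega⟩, ⟨by omega, by omega⟩,
      ⟨by omega, by omega⟩, ⟨by omega, by omega⟩, ⟨?_, ?_, ?_, hi, by omega, ?_, ?_, ?_⟩, ?_, ?_, ?_⟩
    · exact h1.congr (R := [9, 13, 16, 22]) (A := [6])
        ((((((Frame.refl _ _ s').setReg (by decide) _).setMem (by decide) _ _).setReg (by decide) _
          ).setReg (by decide) _).setReg (by decide) _) (by decide) (by decide)
    · refine h2.mono ?_
      simp only [List.map_cons, List.sum_cons]
      omega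
    · trivial
    · simp
    · simp
    · intro t ht
      rcases (Nat.lt_succ_iff.1 ht).lt_or_eq with hlt | rfl
      · rw [Function.update_of_ne (by exact_mod_cast hlt.ne)]; exact h6 _ hlt
      · simp
    · simp
    · simp
    · exact ⟨by simp, by simp⟩
  · rintro a l σ v vs s' ⟨h1, h2, h3, h4, h5, h6, h7, h8⟩ hm0 w k21
    obtain ⟨hw1, hw2⟩ := hinp (s'.reg 9)
    have hs := hr.simple
    have hr2 : Room B Z C G U θ ((vs.length + ((l.map fun n => n.2.length).sum + k)) + 1) σ := by
      refine h2.mono ?_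
      simp only [List.length_cons]; omega
    rw [w] at hw1 hw2
    simp only [id] at w hw1 hw2
    refine ⟨?_, ?_⟩
    · simp only [Expr.eval, hm0, w]; constructor <;> omega
    simp only [Expr.eval, hm0, w]
    refine E.wp_bagCore (h1.setReg (by decide) v) hr2 hg hgm (v := v) ⟨by omega, by omega⟩ (by simp)
      (b := m * (a.2 + 1)) (pb := m * (a.1.1 + 1)) (by simpa using h6) (by simpa using h7)
      (hU' _ h4) (hU' _ h5) fun s'' f1 f2 => ⟨⟨f1, hr2.bagStep hg (hU' _ h4) _ _, h3, h4, h5, ?_, ?_, ?_⟩, ?_⟩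
    · rw [f2.reg 16 (by decide)]; simpa using h6
    · rw [f2.reg 22 (by decide)]; simpa using h7
    · rw [f2.mem 6 (by decide)]; exact h8
    · have := f2.keeps (R' := [9, 13, 21, 20]) (by decide) (by decide)
      exact ⟨fun r hr => (this.reg r hr).trans (by revert r; simp), this.input⟩
  · rintro a l σ s' ⟨h1, h2, h3, h4, h5, h6, h7, h8⟩
    exact ⟨h1.setReg (by decide) _, by simpa using h2, h3, by omega, by simpa using h6, h8⟩

def literalHeader : Program :=
  .block [.assign 13 (.load 0 (.reg 9)), .assign 15 (.load 2 (.reg 10)),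
    .assign 9 (.add (.reg 9) (.const 2))]

def literalBody (E : Emitter T) : Program := .seq (.assign 19 (.load 0 (.reg 9))) E.literalCore

theorem halts_literals (E : Emitter T) {M : ℤ} {cs : List (List Literal × ℕ∞)} {p N : ℕ}
    (h : BuildRep T inp Z θ g cs.length W σ s)
    (hr : Room B Z C G U θ ((cs.map fun c => c.1.length).sum + k) σ) (hg : ∀ j, g j ≤ G)
    (hinp : ∀ i, InRange M (inp i)) (hM : M + 1 ≤ B) (hU : cs.length ≤ U)
    (hN : ∀ c ∈ cs, ∀ l ∈ c.1, l.1 < N) (hσ : N ≤ σ.next) (h9 : s.reg 9 = p) (h10 : s.reg 10 = 0)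
    (hcs : Seg inp p (inputBlocks cs)) (hB : (p + (inputBlocks cs).length : ℤ) ≤ B) :
    Halts B (readBlocks 10 11 literalHeader E.literalBody) s
      ((literalHeader.size + E.literalBody.size + 3) * (inputBlocks cs).length + 1) fun s' =>
      BuildRep T inp Z θ g cs.length W (σ.clauses g (cs.map Prod.fst)) s' ∧
        Room B Z C G U θ k (σ.clauses g (cs.map Prod.fst)) := by
  have hs := hr.simple
  have := halts_readBlocks (B := B) (q := 10) (t := 11) (header := literalHeader)
    (core := E.literalBody)
    (fun c : List Literal × ℕ∞ => (c.1.length : ℤ)) (fun c => weightWord c.2) Prod.fst literalWord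
    (fun σ _ => σ) (fun a σ l => σ.literalStep g a.2 l) (by decide) (by decide) inp
    (fun σ i l s' => BuildRep T inp Z θ g cs.length W σ s' ∧
      Room B Z C G U θ ((l.map fun c => c.1.length).sum + k) σ ∧ N ≤ σ.next ∧
      (∀ c ∈ l, ∀ l ∈ c.1, l.1 < N) ∧ i + l.length = cs.length)
    (fun a l σ es s' => BuildRep T inp Z θ g cs.length W σ s' ∧
      Room B Z C G U θ (es.length + ((l.map fun c => c.1.length).sum + k)) σ ∧ N ≤ σ.next ∧
      (∀ c ∈ l, ∀ l ∈ c.1, l.1 < N) ∧ a.2 + 1 + l.length = cs.length ∧ s'.reg 15 = g a.2 ∧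
      ∀ l ∈ es, l.1 < N)
    ?_ ?_ ?_ ?_ cs (x := σ) (i := 0) (p := p) (s := s)
    ⟨h, hr, hσ, hN, by simp⟩ h.input h9
    (by simpa using h10) (by simpa using h.clauses) hcs hB (by push_cast; omega)
  · refine this.mono le_rfl ?_
    rintro s' ⟨⟨h1, h2, -⟩, -⟩
    have e : σ.clauses g (cs.map Prod.fst) = (cs.zipIdx 0).foldl
      (fun x a => a.1.1.foldl (fun σ l => σ.literalStep g a.2 l) x) σ := by
      unfold BuildState.clauses
      rw [foldl_zipIdx_map]
      rfl
    rw [e]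
    exact ⟨h1, by simpa using h2⟩
  · rintro a l σ vs s' v ⟨h1, h2, h3, h4, h5, h6, h7⟩
    exact ⟨⟨h1.setReg (by decide) _, h2, h3, h4, h5, by simpa using h6, h7⟩,
      ⟨h1.setReg (by decide) _, h2, h3, h4, h5, by simpa using h6, h7⟩⟩
  · rintro σ i c l s' p' ⟨h1, h2, h3, h4, h5⟩ hm0 k9 w1 w2 k10 hb1 hb2
    have hgi : (g i : ℤ) ≤ G := by exact_mod_cast hg i
    have hw := h1.weights i
    simp only [literalHeader, wp_block_cons, wp_block_nil, wp_assign, Expr.eval,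
      setReg_reg, setReg_mem, hm0, k9, w1, k10, hw, Nat.reduceEqDiff, if_false, if_true]
    refine ⟨⟨by omega, by omega⟩, ⟨by omega, by omega⟩, ⟨by omega, by omega⟩,
      ⟨?_, ?_, h3, fun c' hc' => h4 c' (by simp [hc']), ?_, ?_, h4 c (by simp)⟩, ?_, ?_, ?_⟩
    · exact ((h1.setReg (by decide) _).setReg (by decide) _).setReg (by decide) _
    · refine h2.mono ?_
      simp only [List.map_cons, List.sum_cons]
      omega
    · simp only [List.length_cons] at h5 ⊢; omega
    · simp
    · simp
    · simp
    · exact ⟨by simp, by simp⟩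
  · rintro a l σ e es s' ⟨h1, h2, h3, h4, h5, h6, h7⟩ hm0 w k10
    obtain ⟨hw1, hw2⟩ := hinp (s'.reg 9)
    have hr2 : Room B Z C G U θ ((es.length + ((l.map fun n => n.1.length).sum + k)) + 1) σ := by
      refine h2.mono ?_
      simp only [List.length_cons]; omega
    rw [w] at hw1 hw2
    have hlt := h7 e (by simp)
    refine ⟨?_, ?_⟩
    · simp only [Expr.eval, hm0, w]; constructor <;> omega
    simp only [Expr.eval, hm0, w]
    refine E.wp_literalCore (h1.setReg (by decide) _) hr2 hg (j := a.2) (l := e) (by omega) (by omega)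
      (by simpa using k10) (by simpa using h6) (by simp) fun s'' f1 f2 =>
      ⟨⟨f1, hr2.literalStep hg _ (by omega), ?_, h4, h5, ?_, fun l hl => h7 l (by simp [hl])⟩, ?_⟩
    · exact h3.trans (BuildState.grows_literalStep g a.2 σ e).le_next
    · rw [f2.reg 15 (by decide)]; simpa using h6
    · have := f2.keeps (R' := [9, 13, 10, 11]) (by decide) (by decide)
      exact ⟨fun r hr => (this.reg r hr).trans (by revert r; simp), this.input⟩
  · rintro a l σ s' ⟨h1, h2, h3, h4, h5, h6, h7⟩
    exact ⟨h1.setReg (by decide) _, by simpa using h2, h3, h4, h5⟩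

end Emitter

/-! ### Complete runs on an input -/

theorem natAbs_le_maxAbs {l : List ℤ} {v : ℤ} (h : v ∈ l) : v.natAbs ≤ maxAbs l := by
  unfold maxAbs
  induction l with
  | nil => simp at h
  | cons a l ih =>
    simp only [List.map_cons, List.foldr_cons]
    rcases List.mem_cons.1 h with rfl | h
    · exact le_max_left _ _
    · exact (ih h).trans (le_max_right _ _)

theorem inRange_input (input : List ℤ) (i : ℤ) :
    InRange (maxAbs input) ((initialState input).mem 0 i) := by
  simp only [initialState]
  split_ifs
  · by_cases h : i.toNat < input.length
    · rw [List.getD_eq_getElem _ _ h]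
      have := natAbs_le_maxAbs (List.getElem_mem h)
      constructor <;> omega
    · rw [List.getD_eq_default _ _ (not_lt.1 h)]
      constructor <;> omega
  · constructor <;> omega

theorem seg_input (input : List ℤ) : Seg ((initialState input).mem 0) 0 input := by
  intro i hi
  simp [initialState, hi]

theorem input_of_length_le (input : List ℤ) {i : ℕ} (h : input.length ≤ i) :
    (initialState input).mem 0 i = 0 := by
  simp [initialState, h]

theorem finiteSum_le {cs : List (List Literal × ℕ∞)} {M : ℕ}
    (h : ∀ c ∈ cs, (weightWord c.2).natAbs ≤ M) : finiteSum cs ≤ cs.length * M := by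
  induction cs with
  | nil => simp [finiteSum]
  | cons c cs ih =>
    have h1 := ih fun c hc => h c (by simp [hc])
    have h2 := h c (by simp)
    rw [← List.singleton_append, finiteSum_append, finiteSum_singleton, List.length_append,
      Nat.add_mul]
    rw [weightWord_eq] at h2
    split_ifs at h2 ⊢ <;> simp at h2 ⊢ <;> omega

theorem length_inputBlocks (cs : List (List Literal × ℕ∞)) :
    (inputBlocks cs).length = 2 * cs.length + (cs.map fun c => c.1.length).sum := by
  induction cs with
  | nil => simp
  | cons c cs ih =>
    rw [inputBlocks, List.flatMap_cons, List.length_append, ih]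
    simp [blockWords]; omega

theorem length_nodeBlocks (ns : List (ℕ × List ℤ)) :
    (nodeBlocks ns).length = 2 * ns.length + (ns.map fun n => n.2.length).sum := by
  induction ns with
  | nil => simp
  | cons c cs ih =>
    rw [nodeBlocks, List.flatMap_cons, List.length_append, ih]
    simp [blockWords]; omega

namespace Emitter

variable {Q : OptProblem} {T : Target Q}

def enterScan : Program := .block [.assign 11 (.load 0 (.const 0)), .assign 9 (.const 1)]

/-- Terms are written as soon as they are constructed, so the range of the auxiliary variables of
their clauses must be fixed in advance. It starts at `N + 2 * n`, since there are at most `n` steps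
with at most two fresh variables each. -/
def enterWeights : Program :=
  .block [.assign 12 (.add (.reg 12) (.const 1)), .assign 5 (.add (.reg 4) (.add (.reg 0) (.reg 0))),
    .assign 9 (.const 1), .assign 10 (.const 0)]

/-- The output starts at position `3`: the offset, the top value and the size are known only at the
end and are written last. -/
def enterRoots : Program := .block [.assign 1 (.const 3), .assign 10 (.const 0)]

def enterNodes : Program :=
  .block [.assign 20 (.load 0 (.reg 9)), .assign 9 (.add (.reg 9) (.const 1)),
    .assign 16 (.const 0), .assign 21 (.const 0)]

def enterLiterals : Program := .block [.assign 9 (.const 1), .assign 10 (.const 0)]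

def writeHeader : Program :=
  .block [.store 1 (.const 0) (.reg 3), .store 1 (.const 1) (.add (.reg 3) (.reg 12)),
    .store 1 (.const 2) (.reg 30)]

/-- The reduction of `MaxSAT`. -/
def reduction (E : Emitter T) : Program :=
  .seq (.seq enterScan (readBlocks 10 11 scanHeader scanLiteral)) <|
  .seq enterWeights <| .seq (readBlocks 10 11 weightHeader .skip) <|
  .seq enterRoots <| .seq (.loop (.le (.add (.reg 10) (.const 1)) (.reg 11)) E.rootBody) <|
  .seq enterNodes <| .seq (readBlocks 21 20 nodeHeader E.nodeCore) <|
  .seq enterLiterals <| .seq (readBlocks 10 11 literalHeader E.literalBody) writeHeader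

def reductionTime (E : Emitter T) : ℕ :=
  enterScan.size + enterWeights.size + enterRoots.size + enterNodes.size + enterLiterals.size +
    writeHeader.size + 5 + (scanHeader.size + scanLiteral.size + 3) +
    (weightHeader.size + Program.skip.size + 3) + (E.rootBody.size + 1) +
    (nodeHeader.size + E.nodeCore.size + 3) + (literalHeader.size + E.literalBody.size + 3)

theorem OutRep.hasOutput {Z C V : ℕ} {θ h B : ℤ} {ts : List Term} {s : MachineState}
    (E : Emitter T) (ho : OutRep T Z θ ts s) (hh : s.reg 12 = h)
    (hfit : Fits B Z C V θ ts) (hfit' : Fits B Z C V (θ + h) ts) :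
    writeHeader.wp B (fun s' => s'.HasOutput
      ((θ + T.offset ts) :: (θ + T.offset ts + h) :: (T.count Z ts : ℤ) :: T.enc Z ts)) s := by
  obtain ⟨h1, h2, h3⟩ := E.bounds hfit
  obtain ⟨-, h4, -⟩ := E.bounds hfit'
  simp only [writeHeader, wp_block_cons, wp_block_nil, wp_store, Expr.eval, setMem_reg, ho.off, hh,
    ho.count]
  obtain ⟨h2, h2'⟩ := h2
  obtain ⟨h4, h4'⟩ := h4
  refine ⟨⟨by omega, by omega⟩, ⟨by omega, by omega⟩, ⟨by omega, by omega⟩, ⟨by omega, by omega⟩,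
    ⟨by omega, by omega⟩, ⟨by omega, by omega⟩, ?_, fun i hi => ?_⟩
  · simp only [setMem_reg, ho.pos, List.length_cons]; push_cast; ring
  · have hw := ho.words
    simp only [setMem_mem, if_true]
    match i with
    | 0 => simp
    | 1 => simp
    | 2 => simp
    | i + 3 =>
      rw [Function.update_of_ne (by push_cast; omega), Function.update_of_ne (by push_cast; omega),
        Function.update_of_ne (by push_cast; omega)]
      have := hw i (by simpa using hi)
      rw [Nat.add_comm] at this
      simpa using this

-- With `D = n + M + 2`, the sum of the weights is at most `n * M`, whence `W ≤ D ^ 2`, and offsets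
-- are of the order `n * W ≤ D ^ 3`. Slots are of the order `(n + 1) ^ 2`. So a constant multiple of
-- `D ^ 3` bounds all words. The time is a sum of linear bounds, one for each pass.
set_option maxHeartbeats 1000000 in
theorem halts_reduction (E : Emitter T) {cs : List (List Literal × ℕ∞)} {ns : List (ℕ × List ℤ)}
    {input : List ℤ} {B : ℤ} (hcs : Seg ((initialState input).mem 0) 0 ((cs.length : ℤ) :: inputBlocks cs))
    (hns : Seg ((initialState input).mem 0) (1 + (inputBlocks cs).length)
      ((ns.length : ℤ) :: nodeBlocks ns))
    (hlen : 1 + (inputBlocks cs).length + (nodeBlocks ns).length ≤ input.length)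
    (hweight : ∀ c ∈ cs, (weightWord c.2).natAbs ≤ maxAbs input)
    (hpar : ∀ i (hi : i < ns.length), ns[i].1 ≤ i)
    (hB : ((300 * (input.length + maxAbs input + 2) ^ 3 : ℕ) : ℤ) ≤ B) :
    ∃ N : ℕ, (∀ c ∈ cs, ∀ l ∈ c.1, l.1 < N) ∧ ∃ Z : ℕ, (construct N cs ns).next ≤ Z ∧
      Halts B E.reduction (initialState input) (E.reductionTime * (input.length + 1)) fun s' =>
        s'.HasOutput ((gadgetOffset (finiteSum cs + 1) cs + T.offset (construct N cs ns).terms) ::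
          (gadgetOffset (finiteSum cs + 1) cs + T.offset (construct N cs ns).terms +
            (finiteSum cs + 1 : ℕ)) ::
          (T.count Z (construct N cs ns).terms : ℤ) :: T.enc Z (construct N cs ns).terms) := by
  set n := input.length
  set M := maxAbs input
  set m := cs.length with hm
  set W := finiteSum cs + 1 with hW
  set D := n + M + 2 with hD
  set g := gadgetWeight W cs with hg
  set inp := (initialState input).mem 0 with hinp
  set k₁ := (cs.map fun c => c.1.length).sum with hk₁
  set k₂ := (ns.map fun c => c.2.length).sum with hk₂
  have hL₁ : (inputBlocks cs).length = 2 * m + k₁ := length_inputBlocks cs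
  have hL₂ : (nodeBlocks ns).length = 2 * ns.length + k₂ := length_nodeBlocks ns
  have hS : finiteSum cs ≤ m * M := finiteSum_le hweight
  have hin : ∀ i, InRange (M : ℤ) (inp i) := inRange_input input
  have hgW : ∀ j, g j ≤ W := gadgetWeight_le cs
  have hgm : ∀ j, g j ≠ 0 → j < m := fun j hj => (exists_of_gadgetWeight_ne_zero hj).1
  have hmn : m ≤ n := by omega
  have hmU : m ≤ (n + 1) * (n + 1) :=
    (show m ≤ n + 1 by omega).trans (Nat.le_mul_of_pos_left _ n.succ_pos)
  obtain ⟨hB1, hB2, hB3, hB4, hB5, hB6⟩ : D ≤ D ^ 3 ∧ W ≤ D ^ 3 ∧ m * W ≤ D ^ 3 ∧ n * W ≤ D ^ 3 ∧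
      (n + 1) * (n + 1) ≤ D ^ 3 ∧ 1 ≤ D ^ 3 := by
    have h1 : 1 ≤ D := by omega
    have hW2 : W ≤ D ^ 2 := by
      have := Nat.mul_le_mul hmn (le_refl M)
      rw [hW, hD, pow_two]; nlinarith
    have hnW : n * W ≤ D ^ 3 := by
      rw [pow_succ']; exact Nat.mul_le_mul (by omega) hW2
    refine ⟨Nat.le_self_pow (by decide) D, hW2.trans (Nat.pow_le_pow_right h1 (by decide)),
      (Nat.mul_le_mul_right W hmn).trans hnW, hnW, ?_, Nat.one_le_pow _ _ h1⟩
    refine le_trans ?_ (Nat.pow_le_pow_right h1 (show 2 ≤ 3 by decide))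
    rw [pow_two]; exact Nat.mul_le_mul (by omega) (by omega)
  set D3 := D ^ 3
  rw [seg_cons] at hcs hns
  obtain ⟨hcs0, hcs⟩ := hcs
  obtain ⟨hns0, hns⟩ := hns
  have hfirst : Halts B (.seq enterScan (readBlocks 10 11 scanHeader scanLiteral)) (initialState input)
      (enterScan.size + ((scanHeader.size + scanLiteral.size + 3) * (inputBlocks cs).length + 1))
      fun s' => (∃ N : ℕ, s'.reg 4 = N ∧ (N : ℤ) ≤ M ∧ ∀ c ∈ cs, ∀ l ∈ c.1, l.1 < N) ∧
        s'.reg 12 = finiteSum cs ∧ s'.reg 11 = m ∧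
        Frame [4, 9, 10, 11, 12, 13, 19] [] (initialState input) s' := by
    refine Program.wp.seq_halts ?_
    have h0 : (initialState input).mem 0 0 = m := by exact_mod_cast hcs0
    simp only [enterScan, wp_block_cons, wp_block_nil, wp_assign, Expr.eval, setReg_mem, h0]
    refine ⟨⟨by omega, by omega⟩, ⟨by omega, by omega⟩, ?_⟩
    have f1 : Frame [4, 9, 10, 11, 12, 13, 19] [] (initialState input)
        (((initialState input).setReg 11 m).setReg 9 1) :=
      ((Frame.refl _ _ _).setReg (by decide) _).setReg (by decide) _
    refine (halts_scan (B := B) (M := M) (inp := inp) (p := 1)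
      (s := ((initialState input).setReg 11 m).setReg 9 1) hin (by omega) (by omega) (by omega) rfl
      (by simp) (by simp [initialState]) (by simp [hm]) (by simp [initialState])
      (by simp [initialState]) hcs (by omega) (by omega)).mono le_rfl ?_
    rintro s' ⟨h1, h2, -, h3⟩
    exact ⟨h1, h2, by rw [h3.reg 11 (by decide)]; simp, f1.trans (h3.mono (by decide) (by decide))⟩
  obtain ⟨t₁, s₁, hexec, ht₁, ⟨N, h4, hNM, hN⟩, h12, h11, f1⟩ := hfirst
  refine ⟨N, hN, N + 2 * n, ?_, ?_⟩
  · have h1 := (BuildState.grows_roots g (.init N) m).next_le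
    have h2 := (BuildState.grows_nodes g m (.roots g (.init N) m) ns).next_le
    have h3 := (BuildState.grows_clauses g (.nodes g m (.roots g (.init N) m) ns)
      (cs.map Prod.fst)).next_le
    rw [List.map_map] at h3
    change _ ≤ _ + 2 * k₁ at h3
    change _ ≤ _ + 2 * k₂ at h2
    change _ ≤ N + 2 * m at h1
    change (BuildState.clauses g (.nodes g m (.roots g (.init N) m) ns) (cs.map Prod.fst)).next ≤ _
    omega
  have hoff := gadgetOffset_bounds cs cs [] (by simp)
  rw [← hW, ← hm] at hoff
  have hmW : (3 * (W : ℤ) * m) = 3 * (m * W : ℕ) := by push_cast; ring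
  rw [hmW] at hoff
  set θ := gadgetOffset W cs with hθ
  -- There is one step for each clause, each element of a bag and each literal. Each of them is
  -- responsible for a different word of the input, so there are at most `n` steps and at most `6 *
  -- n` terms.
  have hroom : Room B (N + 2 * n) (6 * n) W ((n + 1) * (n + 1)) θ (m + (k₂ + (k₁ + 0))) (.init N) := by
    refine ⟨BuildState.small_init _ _ _, ?_, ?_, ?_⟩
    · simp only [BuildState.init]; omega
    · simp only [BuildState.init, List.length_nil]; omega
    · have : ((6 * n : ℕ) : ℤ) * (2 * W : ℕ) = 12 * (n * W : ℕ) := by push_cast; ring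
      rw [this, abs_of_nonpos hoff.2]
      omega
  have htime : t₁ + (enterWeights.size +
      (((weightHeader.size + Program.skip.size + 3) * (inputBlocks cs).length + 1) +
      (enterRoots.size + (((E.rootBody.size + 1) * m + 1) + (enterNodes.size +
      (((nodeHeader.size + E.nodeCore.size + 3) * (nodeBlocks ns).length + 1) + (enterLiterals.size +
      (((literalHeader.size + E.literalBody.size + 3) * (inputBlocks cs).length + 1) +
      writeHeader.size))))))))  ≤ E.reductionTime * (n + 1) := by
    have hp : ∀ a b c : ℕ, b ≤ n → c ≤ 1 → a * b + c ≤ (a + c) * (n + 1) := by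
      intro a b c hb hc
      have h1 := Nat.mul_le_mul_left a hb
      have h2 := Nat.zero_le (c * n)
      have h3 : (a + c) * (n + 1) = a * n + a + c * n + c := by ring
      omega
    have q1 := hp (scanHeader.size + scanLiteral.size + 3) _ 1 (show (inputBlocks cs).length ≤ n by omega) le_rfl
    have q2 := hp (weightHeader.size + Program.skip.size + 3) _ 1 (show (inputBlocks cs).length ≤ n by omega) le_rfl
    have q3 := hp (E.rootBody.size + 1) _ 1 hmn le_rfl
    have q4 := hp (nodeHeader.size + E.nodeCore.size + 3) _ 1 (show (nodeBlocks ns).length ≤ n by omega) le_rfl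
    have q5 := hp (literalHeader.size + E.literalBody.size + 3) _ 1 (show (inputBlocks cs).length ≤ n by omega) le_rfl
    have q6 : enterScan.size + enterWeights.size + enterRoots.size + enterNodes.size +
      enterLiterals.size + writeHeader.size ≤ (enterScan.size + enterWeights.size + enterRoots.size +
        enterNodes.size + enterLiterals.size + writeHeader.size) * (n + 1) :=
      Nat.le_mul_of_pos_right _ (by omega)
    have e : E.reductionTime * (n + 1) = (enterScan.size + enterWeights.size + enterRoots.size +
        enterNodes.size + enterLiterals.size + writeHeader.size) * (n + 1) +
        (scanHeader.size + scanLiteral.size + 3 + 1) * (n + 1) +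
        (weightHeader.size + Program.skip.size + 3 + 1) * (n + 1) +
        (E.rootBody.size + 1 + 1) * (n + 1) + (nodeHeader.size + E.nodeCore.size + 3 + 1) * (n + 1) +
        (literalHeader.size + E.literalBody.size + 3 + 1) * (n + 1) := by
      unfold reductionTime; ring
    omega
  refine Halts.mono ?_ htime fun _ h => h
  refine Halts.seq ⟨t₁, s₁, hexec, le_rfl, ?_⟩
  refine Program.wp.seq_halts ?_
  have h0 : s₁.reg 0 = n := by rw [f1.reg 0 (by decide)]; simp [initialState, n]
  simp only [enterWeights, wp_block_cons, wp_block_nil, wp_assign, Expr.eval, setReg_reg, h12, h4, h0,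
    Nat.reduceEqDiff, if_false, if_true, OfNat.zero_ne_ofNat, OfNat.ofNat_ne_zero]
  refine ⟨⟨by omega, by omega⟩, ⟨by omega, by omega⟩, ⟨by omega, by omega⟩, ⟨by omega, by omega⟩, ?_⟩
  have hreg : ∀ r ∉ [0, 4, 9, 10, 11, 12, 13, 19], s₁.reg r = 0 := by
    intro r hr
    simp only [List.mem_cons, not_or] at hr
    rw [f1.reg r (by simp only [List.mem_cons, not_or]; tauto)]
    simp [initialState, hr.1]
  have hmem : ∀ a ≠ 0, s₁.mem a = fun _ => 0 := by
    intro a ha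
    rw [f1.mem a (by simp)]
    funext i
    simp [initialState, ha]
  refine Halts.seq ((halts_weights (B := B) (M := M) (inp := inp) (p := 1)
    (s := (((s₁.setReg 12 _).setReg 5 _).setReg 9 _).setReg 10 _) hin (by omega) ?_
    (f1.mem 0 (by simp)) (by simp) (by simp) (by simp [h11, hm]) (by simp [hreg])
    (by simp) (by simp [hmem]) hcs (by omega) (by omega)).mono le_rfl ?_)
  · rw [← hW, ← hm, hmW]; omega
  rintro s₂ ⟨o1, o2, o3, f2⟩
  rw [← hW] at o1 o2
  refine Program.wp.seq_halts ?_
  simp only [enterRoots, wp_block_cons, wp_block_nil, wp_assign, Expr.eval]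
  refine ⟨⟨by omega, by omega⟩, ⟨by omega, by omega⟩, ?_⟩
  have hrep : BuildRep T inp (N + 2 * n) θ g m W (.init N) ((s₂.setReg 1 3).setReg 10 0) := by
    have r2 := f2.reg 2 (by decide)
    have r4 := f2.reg 4 (by decide)
    have r5 := f2.reg 5 (by decide)
    have r11 := f2.reg 11 (by decide)
    have r12 := f2.reg 12 (by decide)
    have r30 := f2.reg 30 (by decide)
    have m0 := f2.mem 0 (by decide)
    have m3 := f2.mem 3 (by decide)
    have m4 := f2.mem 4 (by decide)
    have m5 := f2.mem 5 (by decide)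
    simp [hreg, hmem, h4, h11] at r2 r4 r5 r11 r12 r30 m0 m3 m4 m5
    refine ⟨?_, ?_, ?_, ?_, o2, ?_, ?_, ?_, ?_, ?_, ?_, ?_, ?_, ?_⟩
    · simp only [setReg_mem, m0]; exact f1.mem 0 (by simp)
    · simp [r11]
    · simp [r12, hW]
    · simp [r4, BuildState.init]
    · simp [m3, BuildState.init, Agree]
    · simp [m4, BuildState.init, Agree]
    · simp [m5, BuildState.init, Agree]
    · simp [BuildState.init, E.enc_nil]
    · simp [BuildState.init, r2]
    · simp [BuildState.init, E.offset_nil, o1, hθ]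
    · simp [BuildState.init, E.count_nil, r30]
    · simp [r5]; ring
    · simp only [BuildState.init, E.enc_nil]; exact .nil _ _
  refine Halts.seq ((E.halts_roots hrep hroom hgW (by simp) hmU).mono le_rfl ?_)
  rintro s₃ ⟨b1, b2, f3⟩
  refine Program.wp.seq_halts ?_
  have r9 : s₃.reg 9 = (1 + (inputBlocks cs).length : ℕ) := by
    rw [f3.reg 9 (by decide)]; simp [o3]
  simp only [enterNodes, wp_block_cons, wp_block_nil, wp_assign, Expr.eval, setReg_reg, setReg_mem, r9,
    b1.input, hns0, Nat.reduceEqDiff, if_false, if_true]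
  refine ⟨⟨by omega, by omega⟩, ⟨by omega, by omega⟩, ⟨by omega, by omega⟩, ⟨by omega, by omega⟩, ?_⟩
  refine Halts.seq ((E.halts_nodes (M := M) (ns := ns) (p := 1 + (inputBlocks cs).length + 1)
    ((((b1.setReg (by decide) _).setReg (by decide) _).setReg (by decide) _).setReg (by decide) _)
    b2 hgW (fun j hj => ?_) hin (by omega) ?_ hpar (by simp) (by simp) (by simp) (by simp) hns
    (by push_cast; omega) (by omega)).mono le_rfl ?_)
  · exact (hgm j hj).trans_le hmU
  · exact Nat.mul_le_mul (by omega) (by omega)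
  rintro s₄ ⟨d1, d2⟩
  refine Program.wp.seq_halts ?_
  simp only [enterLiterals, wp_block_cons, wp_block_nil, wp_assign, Expr.eval]
  refine ⟨⟨by omega, by omega⟩, ⟨by omega, by omega⟩, ?_⟩
  refine Halts.seq ((E.halts_literals (M := M) (cs := cs) (p := 1) (N := N)
    ((d1.setReg (by decide) _).setReg (by decide) _) d2 hgW hin (by omega) hmU hN ?_
    (by simp) (by simp) hcs (by omega)).mono le_rfl ?_)
  · exact (BuildState.grows_roots g (.init N) m).le_next.trans
      (BuildState.grows_nodes g m (.roots g (.init N) m) ns).le_next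
  rintro s₅ ⟨e1, e2⟩
  refine (Program.wp.halts (OutRep.hasOutput E e1.out e1.top e2.fits ?_))
  have hf := e2.fits
  refine ⟨hf.length_le, hf.weight_le, hf.lt, ?_⟩
  have : ((6 * n : ℕ) : ℤ) * (2 * W : ℕ) = 12 * (n * W : ℕ) := by push_cast; ring
  rw [this]
  have habs : |θ + W| ≤ 3 * (m * W : ℕ) + W := by rw [abs_le]; constructor <;> omega
  omega

end Emitter

/-! ### The reductions from MaxSAT -/

/-- The constant is absorbed by the exponent: `300 ≤ 2 ^ 9 ≤ D ^ 9`. -/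
theorem pow_bound {D K : ℕ} (hD : 2 ≤ D) (hK : 12 ≤ K) : 300 * D ^ 3 ≤ D ^ K := by
  calc 300 * D ^ 3 ≤ 2 ^ 9 * D ^ 3 := Nat.mul_le_mul_right _ (by decide)
    _ ≤ D ^ 9 * D ^ 3 := Nat.mul_le_mul_right _ (Nat.pow_le_pow_left hD 9)
    _ = D ^ 12 := by rw [← pow_add]
    _ ≤ D ^ K := Nat.pow_le_pow_right (by omega) hK

theorem Halts.runsLinear {p : Program} {A K : ℕ} {input output : List ℤ}
    (h : Halts (((input.length + maxAbs input + 2) ^ K : ℕ) : ℤ) p (initialState input)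
      (A * (input.length + 1)) fun s => s.HasOutput output) (hA : A ≤ K) :
    RunsLinear p K input output := by
  obtain ⟨t, s, h1, h2, h3⟩ := h
  exact ⟨t, s, h1, h2.trans (Nat.mul_le_mul_right _ hA), h3⟩

theorem WCNF.words_eq (φ : WCNF) : φ.words = (φ.clauses.length : ℤ) :: inputBlocks φ.clauses := rfl

theorem TreeDecomposition.words_eq {V : Type} {G : SimpleGraph V} (D : TreeDecomposition G)
    (code : V → ℤ) :
    D.words code = ((D.nodeList code).length : ℤ) :: nodeBlocks (D.nodeList code) := by
  unfold words nodeList nodeBlocks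
  rw [List.flatMap_map]
  simp [blockWords]

theorem TreeDecomposition.nodeList_le {V : Type} {G : SimpleGraph V} (D : TreeDecomposition G)
    (code : V → ℤ) (i : ℕ) (hi : i < (D.nodeList code).length) : (D.nodeList code)[i].1 ≤ i := by
  have hi' : i < D.last + 1 := by simpa [nodeList] using hi
  have : (D.nodeList code)[i].1 = D.parent ⟨i, hi'⟩ := by simp [nodeList]
  rw [this]
  by_cases h : (⟨i, hi'⟩ : Fin (D.last + 1)) = 0
  · rw [h, D.parent_root]; simp
  · exact (D.parent_lt _ h).le

theorem weightWord_mem {cs : List (List Literal × ℕ∞)} {c : List Literal × ℕ∞} (h : c ∈ cs) :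
    weightWord c.2 ∈ inputBlocks cs :=
  List.mem_flatMap.2 ⟨c, h, by simp [blockWords]⟩

namespace Emitter

variable {Q : OptProblem} {T : Target Q}

/-- The constant of the reduction. -/
def reductionConst (E : Emitter T) : ℕ := E.reductionTime + 12

/-- The same program serves both reductions. Without nodes every open end stays in the slot of its
clause, and the decomposition of the primal graph is needed only in the proof of the bound. -/
theorem linReducesTw (E : Emitter T) : LinReducesTw (fun k => k + 2) maxSAT Q := by
  refine ⟨E.reduction, E.reductionConst, fun φ => ?_⟩
  obtain ⟨φ, rfl⟩ : ∃ φ' : WCNF, φ' = φ := ⟨φ, rfl⟩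
  have hw : maxSAT.words φ = (φ.clauses.length : ℤ) :: inputBlocks φ.clauses := φ.words_eq
  obtain ⟨N, hN, Z, hZ, hrun⟩ := E.halts_reduction (cs := φ.clauses) (ns := [])
    (input := maxSAT.words φ)
    (B := (((maxSAT.words φ).length + maxAbs (maxSAT.words φ) + 2) ^ E.reductionConst : ℕ)) (by rw [← hw]; exact seg_input _) (by
      rw [seg_cons]
      refine ⟨?_, .nil _ _⟩
      -- The word after the formula is beyond the input and thus `0`, which is read as an empty list
      -- of nodes.
      rw [input_of_length_le]
      · rfl
      · rw [hw, List.length_cons]; omega) (by rw [hw]; simp; omega)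
    (fun c hc => natAbs_le_maxAbs (by rw [hw]; exact List.mem_cons_of_mem _ (weightWord_mem hc)))
    (by simp) (Int.ofNat_le.2 (pow_bound (by omega) (by unfold reductionConst; omega)))
  obtain ⟨h1, h2⟩ := complete_without_decomposition φ hN
  obtain ⟨J, h3, h4, h5, -⟩ := exists_represents T φ h1 hZ
  refine ⟨J, _, _, Halts.runsLinear (A := E.reductionTime) ?_ (by unfold reductionConst; omega),
    h4, (h5 _ (by omega) h2).1⟩
  rw [h3]
  exact hrun

theorem linReducesItw (E : Emitter T) : LinReducesItw (fun k => 3 * k) maxSAT Q := by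
  refine ⟨E.reduction, E.reductionConst, fun φ D => ?_⟩
  obtain ⟨φ, rfl⟩ : ∃ φ' : WCNF, φ' = φ := ⟨φ, rfl⟩
  change TreeDecomposition (incidenceGraph φ.scopes) at D
  set code := incidenceCode φ.scopes
  set input := maxSAT.words φ ++ D.words code with hinput
  have hw : input = (φ.clauses.length : ℤ) :: inputBlocks φ.clauses ++
      ((D.nodeList code).length : ℤ) :: nodeBlocks (D.nodeList code) := by
    rw [hinput, D.words_eq]; rfl
  have hseg := seg_input input
  nth_rewrite 2 [hw] at hseg
  rw [seg_append] at hseg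
  obtain ⟨N, hN, Z, hZ, hrun⟩ := E.halts_reduction (cs := φ.clauses) (ns := D.nodeList code)
    (input := input) (B := ((input.length + maxAbs input + 2) ^ E.reductionConst : ℕ)) hseg.1 (by
      have := hseg.2
      rwa [List.length_cons, Nat.zero_add, Nat.add_comm] at this) (by rw [hw]; simp; omega)
    (fun c hc => natAbs_le_maxAbs (by
      rw [hw]
      exact List.mem_append_left _ (List.mem_cons_of_mem _ (weightWord_mem hc))))
    (D.nodeList_le code) (Int.ofNat_le.2 (pow_bound (by omega) (by unfold reductionConst; omega)))
  obtain ⟨h1, h2⟩ := complete_of_decomposition φ D hN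
  obtain ⟨J, h3, h4, h5, h6⟩ := exists_represents T φ h1 hZ
  refine ⟨J, _, _, Halts.runsLinear (A := E.reductionTime) ?_ (by unfold reductionConst; omega),
    h4, ?_⟩
  · rw [h3]
    exact hrun
  · rcases h2 with h2 | ⟨h2, h2'⟩
    · rw [h6 h2]; exact Nat.zero_le _
    · exact (h5 _ (by omega) h2').2

end Emitter

/-! ### Transforming a Hamiltonian -/

abbrev termBlocks (ts : List Term) : List ℤ :=
  ts.flatMap (blockWords (fun t => (t.1 : ℤ)) (fun t => (t.2.1 : ℤ)) (fun t => [t.2.2]) id)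

theorem length_termBlocks (ts : List Term) : (termBlocks ts).length = 3 * ts.length := by
  induction ts with
  | nil => simp
  | cons t ts ih =>
    rw [termBlocks, List.flatMap_cons, List.length_append, ih]
    simp [blockWords]; omega

theorem QUBO.words_eq (H : QUBO) : H.words = (H.terms.length : ℤ) :: termBlocks H.terms := rfl

theorem Fits.of_prefix {B : ℤ} {Z C V : ℕ} {θ : ℤ} {ts us : List Term}
    (h : Fits B Z C V θ (ts ++ us)) : Fits B Z C V θ ts := by
  refine ⟨?_, fun t ht => h.weight_le t (by simp [ht]), fun t ht => h.lt t (by simp [ht]), h.bound⟩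
  have := h.length_le
  rw [List.length_append] at this
  omega

/-- The second index of a term is at least the first, so it alone determines the bound `Z`. Register
`13` announces the single further word of the block, the weight. -/
def termScanHeader : Program :=
  .block [.assign 13 (.const 1), .assign 7 (.load 0 (.add (.reg 9) (.const 1))),
    .branch (.le (.reg 5) (.reg 7)) (.assign 5 (.add (.reg 7) (.const 1))) .skip,
    .assign 9 (.add (.reg 9) (.const 2))]

abbrev termScanRegs : List ℕ := [5, 7, 9, 10, 13]

theorem halts_termScan {B : ℤ} {M : ℕ} {ts : List Term} {inp : ℤ → ℤ} {s : MachineState} {p : ℕ}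
    (hinp : ∀ i, InRange M (inp i)) (hM : (M + 1 : ℤ) ≤ B)
    (hupper : ∀ t ∈ ts, t.1 ≤ t.2.1)
    (hin : s.mem 0 = inp) (h9 : s.reg 9 = p) (h10 : s.reg 10 = 0) (h11 : s.reg 11 = ts.length)
    (h5 : s.reg 5 = 0) (hts : Seg inp p (termBlocks ts))
    (hB : (p + (termBlocks ts).length : ℤ) ≤ B) (hm : (ts.length : ℤ) ≤ B) :
    Halts B (readBlocks 10 11 termScanHeader .skip) s
      ((termScanHeader.size + Program.skip.size + 3) * (termBlocks ts).length + 1) fun s' =>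
      (∃ Z : ℕ, s'.reg 5 = Z ∧ Z ≤ M + 1 ∧ ∀ t ∈ ts, t.1 < Z ∧ t.2.1 < Z) ∧
        Frame termScanRegs [] s s' := by
  have := halts_readBlocks (B := B) (q := 10) (t := 11) (header := termScanHeader) (core := .skip)
    (fun t : Term => (t.1 : ℤ)) (fun t => (t.2.1 : ℤ)) (fun t => [t.2.2]) id
    (fun pre a => pre ++ [a.1]) (fun _ x _ => x) (by decide) (by decide) inp
    (fun pre _ suf s' => pre ++ suf = ts ∧ (∃ Z : ℕ, s'.reg 5 = Z ∧ Z ≤ M + 1 ∧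
      ∀ t ∈ pre, t.1 < Z ∧ t.2.1 < Z) ∧ Frame termScanRegs [] s s')
    (fun _ suf pre _ s' => pre ++ suf = ts ∧ (∃ Z : ℕ, s'.reg 5 = Z ∧ Z ≤ M + 1 ∧
      ∀ t ∈ pre, t.1 < Z ∧ t.2.1 < Z) ∧ Frame termScanRegs [] s s')
    ?_ ?_ ?_ ?_ ts (x := []) (i := 0) (p := p) (s := s)
    ⟨rfl, ⟨0, by simpa using h5, by simp, by simp⟩, .refl _ _ _⟩ hin h9
    (by simpa using h10) (by simpa using h11) hts hB (by simpa using hm)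
  · refine this.mono le_rfl fun s' ⟨⟨h0, h1, h2⟩, _⟩ => ?_
    rw [List.append_nil] at h0
    rw [h0] at h1
    exact ⟨h1, h2⟩
  · rintro a suf pre es s' v ⟨h1, ⟨Z, h2, h2', h2''⟩, h4⟩
    exact ⟨⟨h1, ⟨Z, by simpa using h2, h2', h2''⟩, h4.setReg (by decide) _⟩,
      ⟨h1, ⟨Z, by simpa using h2, h2', h2''⟩, h4.setReg (by decide) _⟩⟩
  · rintro pre i t suf s' p' ⟨h1, ⟨Z, h2, h2', h2''⟩, h4⟩ hm0 k9 w1 w2 k10 hb1 hb2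
    have hw := hinp (p' + 1 : ℕ)
    rw [w2] at hw
    obtain ⟨-, hw⟩ := hw
    have hw2 : inp ((p' : ℤ) + 1) = t.2.1 := by rw [← w2]; push_cast; rfl
    have hup := hupper t (by rw [← h1]; simp)
    have hpre : ∀ Z' : ℕ, Z ≤ Z' → t.2.1 < Z' → ∀ u ∈ pre ++ [t], u.1 < Z' ∧ u.2.1 < Z' := by
      intro Z' hZ ht u hu
      rcases List.mem_append.1 hu with hu | hu
      · have := h2'' u hu; omega
      · rw [List.mem_singleton.1 hu]; omega
    simp only [termScanHeader, wp_block_cons, wp_block_nil, wp_assign, wp_branch, wp_skip, Expr.eval,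
      setReg_reg, setReg_mem, hm0, k9, hw2, h2, Nat.reduceEqDiff, if_false, if_true,
      ite_one_zero_ne_zero, ne_eq, not_not]
    refine ⟨⟨by omega, by omega⟩, ⟨by omega, by omega⟩, fun h0 => ⟨⟨by omega, by omega⟩,
      ⟨by omega, by omega⟩, ⟨by simpa using h1, ⟨t.2.1 + 1, by simp, by omega,
        hpre _ (by omega) (by omega)⟩, ?_⟩, ?_, ?_, ?_⟩, fun h0 => ⟨⟨by omega, by omega⟩,
        ⟨by simpa using h1, ⟨Z, by simp [h2], by omega, hpre _ (by omega) (by omega)⟩, ?_⟩, ?_, ?_, ?_⟩⟩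
    · exact (((h4.setReg (by decide) _).setReg (by decide) _).setReg (by decide) _).setReg (by decide) _
    · simp
    · simp
    · exact ⟨by simp, by simp⟩
    · exact ((h4.setReg (by decide) _).setReg (by decide) _).setReg (by decide) _
    · simp
    · simp
    · exact ⟨by simp, by simp⟩
  · rintro a suf pre l es s' h hm0 w k10
    exact ⟨h, fun _ _ => rfl, rfl⟩
  · rintro a suf pre s' ⟨h1, ⟨Z, h2, h2', h2''⟩, h4⟩
    exact ⟨h1, ⟨Z, by simpa using h2, h2', h2''⟩, h4.setReg (by decide) _⟩

def termHeader : Program :=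
  .block [.assign 13 (.const 1), .assign 6 (.load 0 (.reg 9)),
    .assign 7 (.load 0 (.add (.reg 9) (.const 1))), .assign 9 (.add (.reg 9) (.const 2))]

namespace Emitter

variable {Q : OptProblem} {T : Target Q}

def termCore (E : Emitter T) : Program := .seq (.assign 8 (.load 0 (.reg 9))) E.prog

theorem halts_terms (E : Emitter T) {B : ℤ} {M Z C V : ℕ} {θ : ℤ} {ts : List Term} {inp : ℤ → ℤ}
    {s : MachineState} {p : ℕ} (hinp : ∀ i, InRange M (inp i)) (hM : (M + 1 : ℤ) ≤ B)
    (ho : OutRep T Z θ [] s) (hfit : Fits B Z C V θ ts)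
    (hin : s.mem 0 = inp) (h9 : s.reg 9 = p) (h10 : s.reg 10 = 0) (h11 : s.reg 11 = ts.length)
    (hts : Seg inp p (termBlocks ts))
    (hB : (p + (termBlocks ts).length : ℤ) ≤ B) (hm : (ts.length : ℤ) ≤ B) :
    Halts B (readBlocks 10 11 termHeader E.termCore) s
      ((termHeader.size + E.termCore.size + 3) * (termBlocks ts).length + 1) fun s' =>
      OutRep T Z θ ts s' ∧ s'.reg 12 = s.reg 12 := by
  have := halts_readBlocks (B := B) (q := 10) (t := 11) (header := termHeader) (core := E.termCore)
    (fun t : Term => (t.1 : ℤ)) (fun t => (t.2.1 : ℤ)) (fun t => [t.2.2]) id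
    (fun pre _ => pre) (fun a x w => x ++ [((a.1.1, a.1.2.1, w) : Term)]) (by decide) (by decide) inp
    (fun pre _ suf s' => pre ++ suf = ts ∧ OutRep T Z θ pre s' ∧ s'.reg 12 = s.reg 12)
    (fun a suf pre es s' => (pre ++ es.map (fun w => (a.1.1, a.1.2.1, w))) ++ suf = ts ∧
      OutRep T Z θ pre s' ∧ s'.reg 12 = s.reg 12 ∧ s'.reg 6 = a.1.1 ∧ s'.reg 7 = a.1.2.1)
    ?_ ?_ ?_ ?_ ts (x := []) (i := 0) (p := p) (s := s)
    ⟨rfl, ho, rfl⟩ hin h9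
    (by simpa using h10) (by simpa using h11) hts hB (by simpa using hm)
  · refine this.mono le_rfl fun s' ⟨⟨h0, h1, h2⟩, _⟩ => ?_
    rw [List.append_nil] at h0
    rw [h0] at h1
    exact ⟨h1, h2⟩
  · rintro a suf pre es s' v ⟨h1, h2, h3, h4, h5⟩
    exact ⟨⟨h1, h2.congr (R := [9]) (A := []) ((Frame.refl _ _ _).setReg (by decide) _) (by decide)
        (by decide), by simpa using h3, by simpa using h4, by simpa using h5⟩,
      ⟨h1, h2.congr (R := [13]) (A := []) ((Frame.refl _ _ _).setReg (by decide) _) (by decide)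
        (by decide), by simpa using h3, by simpa using h4, by simpa using h5⟩⟩
  · rintro pre i t suf s' p' ⟨h1, h2, h3⟩ hm0 k9 w1 w2 k10 hb1 hb2
    have hw := hinp (p' + 1 : ℕ)
    have hw' := hinp p'
    rw [w2] at hw
    rw [w1] at hw'
    obtain ⟨-, hw⟩ := hw
    obtain ⟨-, hw'⟩ := hw'
    have hw2 : inp ((p' : ℤ) + 1) = t.2.1 := by rw [← w2]; push_cast; rfl
    simp only [termHeader, wp_block_cons, wp_block_nil, wp_assign, Expr.eval,
      setReg_reg, setReg_mem, hm0, k9, w1, hw2, Nat.reduceEqDiff, if_false, if_true]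
    refine ⟨⟨by omega, by omega⟩, ⟨by omega, by omega⟩, ⟨by omega, by omega⟩,
      ⟨by omega, by omega⟩, ⟨by simpa using h1, ?_, by simpa using h3, by simp, by simp⟩, ?_, ?_, ?_⟩
    · exact h2.congr (R := [13, 6, 7, 9]) (A := []) (((((Frame.refl _ _ _).setReg (by decide) _).setReg
        (by decide) _).setReg (by decide) _).setReg (by decide) _) (by decide) (by decide)
    · simp
    · simp
    · exact ⟨by simp, by simp⟩
  · rintro a suf pre w es s' ⟨h1, h2, h3, h4, h5⟩ hm0 hw k10
    obtain ⟨hw1, hw2⟩ := hinp (s'.reg 9)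
    simp only [id] at hw
    rw [hw] at hw1 hw2
    refine ⟨?_, ?_⟩
    · simp only [Expr.eval, hm0, hw]; constructor <;> omega
    simp only [Expr.eval, hm0, hw]
    refine E.spec (t := (a.1.1, a.1.2.1, w)) (h2.congr (R := [8]) (A := [])
      ((Frame.refl _ _ _).setReg (by decide) _) (by decide) (by decide)) (by simpa using h4)
      (by simpa using h5) (by simp) (Fits.of_prefix (us := es.map (fun w => (a.1.1, a.1.2.1, w)) ++ suf)
        (by rw [← h1] at hfit; simpa using hfit)) fun s'' f1 f2 => ⟨⟨by simpa using h1, f1, ?_, ?_, ?_⟩, ?_⟩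
    · rw [f2.reg 12 (by decide)]; simpa using h3
    · rw [f2.reg 6 (by decide)]; simpa using h4
    · rw [f2.reg 7 (by decide)]; simpa using h5
    · have := f2.keeps (R' := [9, 13, 10, 11]) (by decide) (by decide)
      exact ⟨fun r hr => (this.reg r hr).trans (by revert r; simp), this.input⟩
  · rintro a suf pre s' ⟨h1, h2, h3, -⟩
    exact ⟨by simpa using h1, h2.congr (R := [10]) (A := []) ((Frame.refl _ _ _).setReg (by decide) _)
      (by decide) (by decide), by simpa using h3⟩

/-- Register `12` is the distance of the top value from the offset. The value `1` suffices, as the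
minimum of a Hamiltonian is at most `0`. -/
def enterTerms : Program :=
  .block [.assign 1 (.const 3), .assign 9 (.const 1), .assign 10 (.const 0), .assign 12 (.const 1)]

/-- The reduction of `QUBO`. -/
def rewriting (E : Emitter T) : Program :=
  .seq (.seq enterScan (readBlocks 10 11 termScanHeader .skip)) <| .seq enterTerms <|
    .seq (readBlocks 10 11 termHeader E.termCore) writeHeader

def rewritingTime (E : Emitter T) : ℕ :=
  enterScan.size + enterTerms.size + writeHeader.size + 2 +
    (termScanHeader.size + Program.skip.size + 3) + (termHeader.size + E.termCore.size + 3)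

theorem halts_rewriting (E : Emitter T) {ts : List Term} {input : List ℤ} {B : ℤ}
    (hts : Seg ((initialState input).mem 0) 0 ((ts.length : ℤ) :: termBlocks ts))
    (hlen : 1 + (termBlocks ts).length ≤ input.length) (hupper : ∀ t ∈ ts, t.1 ≤ t.2.1)
    (hweight : ∀ t ∈ ts, t.2.2.natAbs ≤ maxAbs input)
    (hB : ((300 * (input.length + maxAbs input + 2) ^ 3 : ℕ) : ℤ) ≤ B) :
    ∃ Z : ℕ, (∀ t ∈ ts, t.1 < Z ∧ t.2.1 < Z) ∧
      Halts B E.rewriting (initialState input) (E.rewritingTime * (input.length + 1)) fun s' =>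
        s'.HasOutput ((0 + T.offset ts) :: (0 + T.offset ts + 1) ::
          (T.count Z ts : ℤ) :: T.enc Z ts) := by
  set n := input.length
  set M := maxAbs input
  set D := n + M + 2 with hD
  set inp := (initialState input).mem 0 with hinp
  have hL : (termBlocks ts).length = 3 * ts.length := length_termBlocks ts
  have hin : ∀ i, InRange (M : ℤ) (inp i) := inRange_input input
  obtain ⟨hB1, hB2⟩ : D ≤ D ^ 3 ∧ n * M ≤ D ^ 3 := by
    have h1 : 1 ≤ D := by omega
    refine ⟨Nat.le_self_pow (by decide) D, le_trans ?_ (Nat.pow_le_pow_right h1 (show 2 ≤ 3 by decide))⟩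
    rw [pow_two]; exact Nat.mul_le_mul (by omega) (by omega)
  set D3 := D ^ 3
  rw [seg_cons] at hts
  obtain ⟨hts0, hts⟩ := hts
  have hfirst : Halts B (.seq enterScan (readBlocks 10 11 termScanHeader .skip)) (initialState input)
      (enterScan.size + ((termScanHeader.size + Program.skip.size + 3) * (termBlocks ts).length + 1))
      fun s' => (∃ Z : ℕ, s'.reg 5 = Z ∧ Z ≤ M + 1 ∧ ∀ t ∈ ts, t.1 < Z ∧ t.2.1 < Z) ∧
        s'.reg 11 = ts.length ∧ Frame [5, 7, 9, 10, 11, 13] [] (initialState input) s' := by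
    refine Program.wp.seq_halts ?_
    have h0 : (initialState input).mem 0 0 = ts.length := by exact_mod_cast hts0
    simp only [enterScan, wp_block_cons, wp_block_nil, wp_assign, Expr.eval, setReg_mem, h0]
    refine ⟨⟨by omega, by omega⟩, ⟨by omega, by omega⟩, ?_⟩
    have f1 : Frame [5, 7, 9, 10, 11, 13] [] (initialState input)
        (((initialState input).setReg 11 ts.length).setReg 9 1) :=
      ((Frame.refl _ _ _).setReg (by decide) _).setReg (by decide) _
    refine (halts_termScan (B := B) (M := M) (inp := inp) (p := 1)
      (s := ((initialState input).setReg 11 ts.length).setReg 9 1) hin (by omega) hupper rfl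
      (by simp) (by simp [initialState]) (by simp) (by simp [initialState])
      hts (by omega) (by omega)).mono le_rfl ?_
    rintro s' ⟨h1, h3⟩
    exact ⟨h1, by rw [h3.reg 11 (by decide)]; simp, f1.trans (h3.mono (by decide) (by decide))⟩
  obtain ⟨t₁, s₁, hexec, ht₁, ⟨Z, h5, hZM, hZ⟩, h11, f1⟩ := hfirst
  refine ⟨Z, hZ, ?_⟩
  have hfit : ∀ θ : ℤ, |θ| ≤ 1 → Fits B Z n M θ ts := by
    intro θ hθ
    refine ⟨by omega, fun t ht => ?_, hZ, ?_⟩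
    · have := hweight t ht
      rw [Int.abs_eq_natAbs]; exact_mod_cast this
    · have : (n : ℤ) * M = (n * M : ℕ) := by push_cast; ring
      rw [this]; omega
  have htime : t₁ + (enterTerms.size +
      (((termHeader.size + E.termCore.size + 3) * (termBlocks ts).length + 1) +
      writeHeader.size)) ≤ E.rewritingTime * (n + 1) := by
    have hp : ∀ a b c : ℕ, b ≤ n → c ≤ 1 → a * b + c ≤ (a + c) * (n + 1) := by
      intro a b c hb hc
      have h1 := Nat.mul_le_mul_left a hb
      have h2 := Nat.zero_le (c * n)
      have h3 : (a + c) * (n + 1) = a * n + a + c * n + c := by ring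
      omega
    have q1 := hp (termScanHeader.size + Program.skip.size + 3) _ 1 (show (termBlocks ts).length ≤ n by omega) le_rfl
    have q2 := hp (termHeader.size + E.termCore.size + 3) _ 1 (show (termBlocks ts).length ≤ n by omega) le_rfl
    have q3 : enterScan.size + enterTerms.size + writeHeader.size ≤
      (enterScan.size + enterTerms.size + writeHeader.size) * (n + 1) :=
      Nat.le_mul_of_pos_right _ (by omega)
    have e : E.rewritingTime * (n + 1) = (enterScan.size + enterTerms.size + writeHeader.size) * (n + 1) +
        (termScanHeader.size + Program.skip.size + 3 + 1) * (n + 1) +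
        (termHeader.size + E.termCore.size + 3 + 1) * (n + 1) := by
      unfold rewritingTime; ring
    omega
  refine Halts.mono ?_ htime fun _ h => h
  refine Halts.seq ⟨t₁, s₁, hexec, le_rfl, ?_⟩
  refine Program.wp.seq_halts ?_
  simp only [enterTerms, wp_block_cons, wp_block_nil, wp_assign, Expr.eval]
  refine ⟨⟨by omega, by omega⟩, ⟨by omega, by omega⟩, ⟨by omega, by omega⟩, ⟨by omega, by omega⟩, ?_⟩
  have hreg : ∀ r ∉ [0, 5, 7, 9, 10, 11, 13], s₁.reg r = 0 := by
    intro r hr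
    simp only [List.mem_cons, not_or] at hr
    rw [f1.reg r (by simp only [List.mem_cons, not_or]; tauto)]
    simp [initialState, hr.1]
  refine Halts.seq ((E.halts_terms (M := M) (Z := Z) (θ := 0) (p := 1)
    (s := (((s₁.setReg 1 _).setReg 9 _).setReg 10 _).setReg 12 _) hin (by omega)
    ⟨?_, ?_, ?_, ?_, ?_, ?_⟩ (hfit 0 (by simp)) (f1.mem 0 (by simp)) (by simp) (by simp)
    (by simp [h11]) hts (by omega) (by omega)).mono le_rfl ?_)
  · simp [E.enc_nil]
  · simp [hreg]
  · simp [E.offset_nil, hreg]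
  · simp [E.count_nil, hreg]
  · simp [h5]
  · rw [E.enc_nil]; exact .nil _ _
  rintro s₂ ⟨o1, o2⟩
  exact Program.wp.halts (OutRep.hasOutput E o1 (by rw [o2]; simp) (hfit 0 (by simp))
    (hfit (0 + 1) (by simp)))

end Emitter

/-! ### The reductions -/

theorem exists_le_energyOf (ts : List Term) : ∃ c, ∀ β, c ≤ energyOf ts β := by
  induction ts with
  | nil => exact ⟨0, fun β => by simp [energyOf]⟩
  | cons t ts ih =>
    obtain ⟨c, hc⟩ := ih
    refine ⟨-|t.2.2| + c, fun β => ?_⟩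
    have h1 := hc β
    have h2 := neg_abs_le t.2.2
    have h3 := abs_nonneg t.2.2
    have e : energyOf (t :: ts) β = (if β t.1 ∧ β t.2.1 then t.2.2 else 0) + energyOf ts β := by
      simp [energyOf]
    rw [e]
    split_ifs <;> linarith

/-- All values are finite, so the top value only has to exceed the optimum. The zero assignment has
the value `0`, hence one more than the offset is enough. -/
theorem QUBO.exists_represents {Q : OptProblem} (T : Target Q) (H : QUBO) {Z : ℕ}
    (hZ : ∀ t ∈ H.terms, t.1 < Z ∧ t.2.1 < Z) :
    ∃ J : Q.Inst, Q.words J = (T.count Z H.terms : ℤ) :: T.enc Z H.terms ∧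
      Represents qubo Q H J (T.offset H.terms) (T.offset H.terms + 1) ∧
      (∀ w, 2 ≤ w → ∀ L, Built w L → (∀ B ∈ L, ∀ x ∈ B, ∃ s ∈ H.scopes, x ∈ s) →
        (∀ s ∈ H.scopes, ∃ B ∈ L, s ⊆ B) → Q.tw J ≤ w ∧ Q.itw J ≤ w) ∧
      (H.terms = [] → Q.itw J = 0) := by
  obtain ⟨J, h1, ⟨f', h2, h3⟩, h4, h5⟩ := T.exists_inst Z H.terms
    ⟨H.upper, fun t ht => (hZ t ht).2, H.nonzero, H.terms_distinct⟩
  refine ⟨J, h1, represents_of_simulates h3 (fun β _ => rfl) (fun β hβ => ?_) (fun _ => ?_) h2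
    (exists_le_energyOf _), fun w hw L hL hocc hcov => h4 w hw L hL ?_ ?_, h5⟩
  · exact absurd hβ (WithTop.coe_ne_top)
  · refine ⟨fun _ => false, ?_⟩
    have : energyOf H.terms (fun _ => false) = 0 := by
      unfold energyOf
      refine List.sum_eq_zero fun z hz => ?_
      obtain ⟨t, -, rfl⟩ := List.mem_map.1 hz
      simp
    rw [this]
    omega
  · intro B hB x hx
    obtain ⟨s, hs, hxs⟩ := hocc B hB x hx
    obtain ⟨t, ht, rfl⟩ := List.mem_map.1 hs
    have := hZ t ht
    simp only [Finset.mem_insert, Finset.mem_singleton] at hxs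
    rcases hxs with rfl | rfl <;> omega
  · intro t ht
    obtain ⟨B, hB, hs⟩ := hcov {t.1, t.2.1} (List.mem_map.2 ⟨t, ht, rfl⟩)
    exact ⟨B, hB, hs (by simp), hs (by simp)⟩

theorem TreeDecomposition.one_le_width {V : Type} {G : SimpleGraph V} (D : TreeDecomposition G)
    {u v : V} (h : G.Adj u v) : 1 ≤ D.width := by
  classical
  obtain ⟨t, hu, hv⟩ := D.covering u v h
  have h1 : ({u, v} : Finset V) ⊆ (D.bag t).toFinset := by
    intro x hx
    rw [List.mem_toFinset]
    simp only [Finset.mem_insert, Finset.mem_singleton] at hx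
    rcases hx with rfl | rfl
    exacts [hu, hv]
  have h2 := Finset.card_le_card h1
  rw [Finset.card_pair h.ne] at h2
  have h3 := List.toFinset_card_le (D.bag t)
  have h4 : (D.bag t).length ≤ Finset.univ.sup fun t => (D.bag t).length :=
    Finset.le_sup (f := fun t => (D.bag t).length) (Finset.mem_univ _)
  unfold width
  omega

namespace Emitter

variable {Q : OptProblem} {T : Target Q}

/-- The constant of the reduction of `QUBO`. -/
def rewritingConst (E : Emitter T) : ℕ := E.rewritingTime + 12

theorem exists_rewriting (E : Emitter T) (H : QUBO) (rest : List ℤ) :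
    ∃ (J : Q.Inst) (θ h : ℤ),
      RunsLinear E.rewriting E.rewritingConst (H.words ++ rest) (θ :: h :: Q.words J) ∧
      Represents qubo Q H J θ h ∧
      (∀ w, 2 ≤ w → ∀ L, Built w L → (∀ B ∈ L, ∀ x ∈ B, ∃ s ∈ H.scopes, x ∈ s) →
        (∀ s ∈ H.scopes, ∃ B ∈ L, s ⊆ B) → Q.tw J ≤ w ∧ Q.itw J ≤ w) ∧
      (H.terms = [] → Q.itw J = 0) := by
  set input := H.words ++ rest with hinput
  have hw : input = (H.terms.length : ℤ) :: termBlocks H.terms ++ rest := by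
    rw [hinput, H.words_eq]
  have hseg := seg_input input
  nth_rewrite 2 [hw] at hseg
  rw [seg_append] at hseg
  obtain ⟨Z, hZ, hrun⟩ := E.halts_rewriting (ts := H.terms) (input := input)
    (B := ((input.length + maxAbs input + 2) ^ E.rewritingConst : ℕ)) hseg.1
    (by rw [hw]; simp; omega) H.upper
    (fun t ht => natAbs_le_maxAbs (by
      rw [hw]
      exact List.mem_append_left _ (List.mem_cons_of_mem _
        (List.mem_flatMap.2 ⟨t, ht, by simp [blockWords]⟩))))
    (Int.ofNat_le.2 (pow_bound (by omega) (by unfold rewritingConst; omega)))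
  obtain ⟨J, h1, h2, h3⟩ := H.exists_represents T hZ
  refine ⟨J, _, _, Halts.runsLinear (A := E.rewritingTime) ?_ (by unfold rewritingConst; omega),
    h2, h3⟩
  rw [h1]
  simpa only [zero_add] using hrun

theorem linReducesTw_qubo (E : Emitter T) : LinReducesTw (fun k => k + 2) qubo Q := by
  refine ⟨E.rewriting, E.rewritingConst, fun H => ?_⟩
  obtain ⟨J, θ, h, h1, h2, h3, -⟩ := E.exists_rewriting H []
  rw [List.append_nil] at h1
  obtain ⟨L, hL, hcov, hocc⟩ := exists_built_primal (QUBO.scopes H)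
  exact ⟨J, θ, h, h1, h2, (h3 _ (by omega) L (hL.mono (Nat.le_add_right _ 2)) hocc hcov).1⟩

/-- The given decomposition is contracted to one that has both variables of every term in a bag,
without increasing the width. A single term already forces `1 ≤ D.width`, so `3 * D.width` leaves
room for the bags with three elements. Without terms the new instance is empty. -/
theorem linReducesItw_qubo (E : Emitter T) : LinReducesItw (fun k => 3 * k) qubo Q := by
  refine ⟨E.rewriting, E.rewritingConst, fun H D => ?_⟩
  obtain ⟨J, θ, h, h1, h2, h3, h4⟩ := E.exists_rewriting H (D.words (incidenceCode (qubo.scopes H)))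
  refine ⟨J, θ, h, h1, h2, ?_⟩
  by_cases hne : QUBO.terms H = []
  · rw [h4 hne]; exact Nat.zero_le _
  change TreeDecomposition (incidenceGraph (QUBO.scopes H)) at D
  obtain ⟨t, ht⟩ := List.exists_mem_of_ne_nil _ hne
  have hs : ({t.1, t.2.1} : Finset ℕ) ∈ QUBO.scopes H := List.mem_map.2 ⟨t, ht, rfl⟩
  obtain ⟨j, hj⟩ := List.mem_iff_get.1 hs
  have hk : 1 ≤ D.width := D.one_le_width (u := Sum.inl ⟨t.1, _, hs, by simp⟩) (v := Sum.inr j)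
    ⟨by simp, Or.inl ⟨_, j, rfl, rfl, by rw [hj]; simp⟩⟩
  obtain ⟨L, hL, hcov, hocc⟩ := exists_built_contract (S := QUBO.scopes H)
    (fun s hs => by
      obtain ⟨t, -, rfl⟩ := List.mem_map.1 hs
      simp)
    (fun s hs => by
      obtain ⟨t, -, rfl⟩ := List.mem_map.1 hs
      exact Finset.card_le_two) D
  exact (h3 (3 * D.width) (by omega) L (hL.mono (by omega)) hocc hcov).2

end Emitter

theorem LinReducesTw.restrict {g : ℕ → ℕ} {Q : OptProblem} (h : LinReducesTw g maxSAT Q) :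
    LinReducesTw g max2SAT Q := by
  obtain ⟨p, K, h⟩ := h
  refine ⟨p, K, fun φ => ?_⟩
  obtain ⟨J, θ, t, h1, h2, h3⟩ := h φ.1
  exact ⟨J, θ, t, h1, ⟨h2.optimum, h2.solution⟩, h3⟩

theorem LinReducesItw.restrict {g : ℕ → ℕ} {Q : OptProblem} (h : LinReducesItw g maxSAT Q) :
    LinReducesItw g max2SAT Q := by
  obtain ⟨p, K, h⟩ := h
  refine ⟨p, K, fun φ D => ?_⟩
  obtain ⟨J, θ, t, h1, h2, h3⟩ := h φ.1 D
  exact ⟨J, θ, t, h1, ⟨h2.optimum, h2.solution⟩, h3⟩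

theorem LinReducesTw.relax {g : ℕ → ℕ} {P : OptProblem} (h : LinReducesTw g P max2SAT) :
    LinReducesTw g P maxSAT := by
  obtain ⟨p, K, h⟩ := h
  refine ⟨p, K, fun I => ?_⟩
  obtain ⟨J, θ, t, h1, h2, h3⟩ := h I
  exact ⟨J.1, θ, t, h1, ⟨h2.optimum, h2.solution⟩, h3⟩

theorem LinReducesItw.relax {g : ℕ → ℕ} {P : OptProblem} (h : LinReducesItw g P max2SAT) :
    LinReducesItw g P maxSAT := by
  obtain ⟨p, K, h⟩ := h
  refine ⟨p, K, fun I D => ?_⟩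
  obtain ⟨J, θ, t, h1, h2, h3⟩ := h I D
  exact ⟨J.1, θ, t, h1, ⟨h2.optimum, h2.solution⟩, h3⟩

theorem theorem1 :
    (LinEquivTw (fun k => k + 2) maxSAT max2SAT ∧
      LinEquivTw (fun k => k + 2) max2SAT qubo ∧
      LinEquivTw (fun k => k + 2) maxSAT qubo) ∧
    (LinEquivItw (fun k => 3 * k) maxSAT max2SAT ∧
      LinEquivItw (fun k => 3 * k) max2SAT qubo ∧
      LinEquivItw (fun k => 3 * k) maxSAT qubo) := by
  have h1 := max2SATEmitter.linReducesTw
  have h2 := quboEmitter.linReducesTw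
  have h3 := max2SATEmitter.linReducesTw_qubo
  have h4 := max2SATEmitter.linReducesItw
  have h5 := quboEmitter.linReducesItw
  have h6 := max2SATEmitter.linReducesItw_qubo
  -- A `Max2SAT` instance is a `MaxSAT` instance with the same words. So the reduction from `MaxSAT`
  -- to `Max2SAT`, restricted at its source and relaxed at its target, is also one in the opposite
  -- direction.
  exact ⟨⟨⟨h1, h1.restrict.relax⟩, ⟨h2.restrict, h3⟩, ⟨h2, h3.relax⟩⟩,
    ⟨⟨h4, h4.restrict.relax⟩, ⟨h5.restrict, h6⟩, ⟨h5, h6.relax⟩⟩⟩
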